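/- Let $D<0$ be a fundamental discriminant, $E=\mathbb{Q}(\sqrt D)$, $\mathcal O_E=\mathbb Z\oplus\mathbb Z\omega$ with $\omega=\sqrt D/2$ if $D\equiv 0\pmod 4$ and $\omega=(\sqrt D-1)/2$ if $D\equiv 1\pmod 4$, $h_D$ the class number of $E$, $w_D=\#\mathcal O_E^\times$, and $\widehat{\mathrm{Cl}_D}$ the group of characters of $\mathrm{Cl}_D=\mathbb A_{E,\mathrm{fin}}^\times/E^\times\widehat{\mathcal O}_E^\times$, on which $\mathrm{Gal}(E/\mathbb Q)$ acts by $\chi\mapsto\chi^\sigma$, $\chi^\sigma(t)=\chi(\bar t)$. Let $V_1$ be the space of trace-zero matrices $X\in M_2(\mathbb Q)$ with the quadratic form $Q_1(X)=-2\det X$, whose bilinear form $Q_1(X,Y)$ satisfies $Q_1(X,X)=Q_1(X)$. Let $\xi_D=\begin{pmatrix}0&1\\D/4&0\end{pmatrix}$ if $D\equiv0\pmod 4$ and $\xi_D=\begin{pmatrix}1/2&1\\(D-1)/4&-1/2\end{pmatrix}$ if $D\equiv1\pmod 4$, and let $G\cong \mathrm O(2)$ be the stabilizer of $\xi_D$ in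 $\mathrm O(Q_1)$. For a prime $p$ let $L_p=\{X\in M_2(\mathbb Z_p):\operatorname{tr}X=0,\ Q_1(X,\xi_D)=0\}$, let $L_p^*$ be its dual lattice in $\xi_D^\perp$, $K_p=\{h\in G(\mathbb Q_p): hL_p=L_p\}$, $K_p^*=\{h\in K_p:(h-1)L_p^*\subset L_p\}$ and $K^*=\prod_pK_p^*$. Let $\iota:E\to M_2(\mathbb Q)$ be given by $[\tau,\tau\omega]=[1,\omega]\,{}^t\iota(\tau)$, and let $s(g)X=gXg^{-1}$ for $g\in \mathrm{GL}_2$. Then $s\circ\iota$ embeds $E^\times/\mathbb Q^\times$ in $G(\mathbb Q)$. Let $\tilde\sigma\in G(\mathbb Q)$ be the involution $X\mapsto -\iota_\sigma X\iota_\sigma^{-1}$, where $\iota_\sigma\in\mathrm{GL}_2(\mathbb Q)$ is the matrix with $[1,\bar\omega]=[1,\omega]\,{}^t\iota_\sigma$. It satisfies $\tilde\sigma\, s(\iota(t))\,\tilde\sigma=s(\iota(\bar t))$. Put $\Sigma=\prod_p\{1,\tilde\sigma_p\}\subset G(\mathbb A_{\mathrm{fin}})$. Let $\mathcal V$ be the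 space of smooth functions on $G(\mathbb A)$ that are left $G(\mathbb Q)$-invariant and right $G(\mathbb R)$-invariant, with $G(\mathbb A_{\mathrm{fin}})$ acting by right translation, and let $\mathcal V(K^*)$ be its subspace of $K^*$-fixed vectors. Give $G(\mathbb A)$ the product of the Haar probability measure on $G(\mathbb R)$ and the Haar measure on $G(\mathbb A_{\mathrm{fin}})$ with $\mathrm{vol}(K^*)=1$; let $\langle\cdot,\cdot\rangle$ and $\|\cdot\|$ be the inner product and norm of $L^2(G(\mathbb Q)\backslash G(\mathbb A))$. Let $\mathcal H$ be the Hecke algebra of compactly supported functions on $G(\mathbb A_{\mathrm{fin}})$ that are bi-invariant under $K^*$. For an irreducible $G(\mathbb A_{\mathrm{fin}})$-submodule $\mathcal U\subset\mathcal V$ with nonzero $K^*$-fixed vectors, let $L_{\mathrm{fin}}(s,\mathcal U)$ be its standard $L$-function, the Euler product $\prod_pL_p(s,\mathcal U)$ ($\operatorname{Re}s>1$), and its meromorphic continuation, with local factors as follows. * If $L_p$ has a basis $e,e'$ with $Q_1(e)=Q_1(e')=0$ and $Q_1(e,e')=1$, then $L_p(s,\mathcal U)=\big((1-zp^{-s})(1-z^{-1}p^{-s})\big)^{-1}$.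 Here $z\in\mathbb C^\times$ is the Satake parameter: the characteristic function of $K_p^*gK_p^*$, with $ge=pe$ and $ge'=p^{-1}e'$, acts on $\mathcal U^{K^*}$ by $z+z^{-1}$. * Otherwise $G(\mathbb Q_p)$ is anisotropic. If $K_p=K_p^*$, then $L_p(s,\mathcal U)=(1-p^{-2s})^{-1}$. If $K_p\neq K_p^*$, then $K_p/K_p^*$ has order two and $L_p(s,\mathcal U)=(1-\rho p^{-s})^{-1}$, where the nontrivial element of $K_p/K_p^*$ acts on $\mathcal U^{K^*}$ by $\rho$. For $\chi\in\widehat{\mathrm{Cl}_D}$ let $L_{\mathrm{fin}}(s,\mathcal{AI}(\chi))$ be the degree two Hecke $L$-function of the automorphic induction of $\chi$. Its local factor at $p$ is $\prod_{\mathfrak P\mid p}(1-\chi(\mathfrak P)N(\mathfrak P)^{-s})^{-1}$, where $\mathfrak P$ runs over the prime ideals of $\mathcal O_E$ above $p$. **Lemma.** Every element of $G(\mathbb A_{\mathrm{fin}})$ has the form $s(\iota(t))\tau$ with $t\in\mathbb A_{E,\mathrm{fin}}^\times$ and $\tau\in\Sigma$. For every $\chi\in\widehat{\mathrm{Cl}_D}$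 the formula $$f_\chi\big(s(\iota(t))\tau\big)=\tfrac12\{\chi(t)+\chi(\bar t)\}$$ gives a well-defined function on $G(\mathbb A_{\mathrm{fin}})$, viewed on $G(\mathbb A)$ through the finite component. Moreover: 1. $f_\chi\in\mathcal V(K^*)$, and $f_\chi$ is a joint eigenfunction of $\mathcal H$. 2. $f_\chi$ depends only on the class of $\chi$ in $\widehat{\mathrm{Cl}_D}/\mathrm{Gal}(E/\mathbb Q)$. The functions $f_\chi$, with $\chi$ running over these classes, form an orthogonal basis of $\mathcal V(K^*)$, and $$\|f_\chi\|^2=\frac{h_D}{2w_D}\{1+\delta(\chi^2=\mathbf 1)\}.$$ 3. Let $\mathcal U_\chi$ be the $G(\mathbb A_{\mathrm{fin}})$-submodule generated by $f_\chi$. Then $\mathcal U_\chi$ is irreducible, and its space of $K^*$-fixed vectors is $\mathbb Cf_\chi$. 4. $\chi\mapsto\mathcal U_\chi$ induces a bijection from $\widehat{\mathrm{Cl}_D}/\mathrm{Gal}(E/\mathbb Q)$ onto the set of irreducible $G(\mathbb A_{\mathrm{fin}})$-submodules of $\mathcal V$ with nonzero $K^*$-fixed vectors. 5. $L_{\mathrm{fin}}(s,\mathcal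 U_\chi)=L_{\mathrm{fin}}(s,\mathcal{AI}(\chi))$. More precisely, the local factors agree at every prime, and the Euler product converges for $\operatorname{Re}s>1$. 6. $L_{\mathrm{fin}}(s,\mathcal U_{\mathbf 1})=\zeta(s)L_{\mathrm{fin}}(s,\eta_D)$, where $\eta_D$ is the quadratic Dirichlet character modulo $|D|$ attached to $E/\mathbb Q$, i.e. $\eta_D(p)$ is the Kronecker symbol $\left(\frac Dp\right)$ for every prime $p$. -/

import Mathlib

open MeasureTheory IsDedekindDomain IsDedekindDomain.HeightOneSpectrum
open scoped Matrix ComplexConjugate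

noncomputable section

namespace OTwo

/-! ### The discriminant and the ring of integers -/

/-- `D` is a fundamental discriminant. -/
def IsFundDisc (D : ℤ) : Prop :=
  D ≠ 1 ∧ ((D % 4 = 1 ∧ Squarefree D) ∨
    (∃ m : ℤ, D = 4 * m ∧ Squarefree m ∧ (m % 4 = 2 ∨ m % 4 = 3)))

/-- `ω = √D / 2` (`D ≡ 0 mod 4`) or `ω = (√D - 1) / 2` (`D ≡ 1 mod 4`) is a root of
`ω ^ 2 = cA D + cB D * ω`; this is the constant coefficient. -/
def cA (D : ℤ) : ℤ := if D % 4 = 0 then D / 4 else (D - 1) / 4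

/-- The coefficient of `ω` in `ω ^ 2 = cA D + cB D * ω`. -/
def cB (D : ℤ) : ℤ := if D % 4 = 0 then 0 else -1

/-- `R ⊗ ℤ[ω] = R ⊕ R ω`. -/
abbrev QA (D : ℤ) (R : Type) [CommRing R] : Type :=
  QuadraticAlgebra R ((cA D : ℤ) : R) ((cB D : ℤ) : R)

/-- The ring of integers `ℤ ⊕ ℤ ω` of `E = ℚ(√D)`. -/
abbrev OE (D : ℤ) : Type := QA D ℤ

theorem cB_sq_add (D : ℤ) (h : D % 4 = 0 ∨ D % 4 = 1) : cB D ^ 2 + 4 * cA D = D := by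
  unfold cA cB
  split_ifs <;> omega

theorem IsFundDisc.mod_four {D : ℤ} (h : IsFundDisc D) : D % 4 = 0 ∨ D % 4 = 1 := by
  rcases h.2 with h | ⟨m, h, -⟩ <;> omega

theorem isDomain_OE {D : ℤ} (h : IsFundDisc D) (hneg : D < 0) : IsDomain (OE D) := by
  have hD := cB_sq_add D h.mod_four
  have key : ∀ z : OE D, QuadraticAlgebra.norm z = 0 → z = 0 := by
    intro z hz
    rw [QuadraticAlgebra.norm_def] at hz
    simp only [Int.cast_id] at hz
    have h4 : (2 * z.re + cB D * z.im) ^ 2 + (-D) * z.im ^ 2 = 0 := by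
      linear_combination 4 * hz + z.im ^ 2 * hD
    have him : z.im = 0 := by
      by_contra hne
      have : 0 < z.im ^ 2 := by positivity
      nlinarith [sq_nonneg (2 * z.re + cB D * z.im)]
    have hre : z.re = 0 := by
      rw [him] at h4
      simp at h4
      exact h4
    ext <;> simp [him, hre]
  have : NoZeroDivisors (OE D) := ⟨by
    intro x y hxy
    have : QuadraticAlgebra.norm x * QuadraticAlgebra.norm y = 0 := by
      rw [← map_mul, hxy, QuadraticAlgebra.norm_zero]
    rcases mul_eq_zero.1 this with hx | hy
    · exact Or.inl (key x hx)
    · exact Or.inr (key y hy)⟩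
  exact NoZeroDivisors.to_isDomain _

/-- The class number `h_D` of `ℚ(√D)`: the number of ideal classes of `OE D`. -/
def classNo {D : ℤ} (h : IsFundDisc D) (hneg : D < 0) : ℕ :=
  haveI := isDomain_OE h hneg
  Nat.card (ClassGroup (OE D))

/-- `w_D`, the number of units (= roots of unity) of `OE D`. -/
def unitNo (D : ℤ) : ℕ := Nat.card (OE D)ˣ

/-! ### Finite adeles -/

/-- The finite adeles of `ℚ`. -/
abbrev Af : Type := FiniteAdeleRing ℤ ℚ

/-- The finite places of `ℚ`. -/
abbrev Pl : Type := HeightOneSpectrum ℤ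

/-- The completion of `ℚ` at a finite place. -/
abbrev Qv (v : Pl) : Type := v.adicCompletion ℚ

/-- The prime number of a finite place. -/
def resChar (v : Pl) : ℕ := Ideal.absNorm v.asIdeal

/-- The projection of the finite adeles onto the component at `v`. -/
def evalAt (v : Pl) : Af →ₐ[ℚ] Qv v where
  toFun x := x v
  map_one' := rfl
  map_mul' _ _ := rfl
  map_zero' := rfl
  map_add' _ _ := rfl
  commutes' _ := rfl

/-- The finite adeles of `E`. -/
abbrev AE (D : ℤ) : Type := QA D Af

/-- Membership in the maximal compact subring `Ẑ ⊕ Ẑ ω` of the finite adeles of `E`. -/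
def IsIntAE {D : ℤ} (z : AE D) : Prop :=
  ∀ v : Pl, z.re v ∈ v.adicCompletionIntegers ℚ ∧ z.im v ∈ v.adicCompletionIntegers ℚ

/-- Membership in `E` for a finite adele of `E`. -/
def IsPrincipalAE {D : ℤ} (z : AE D) : Prop :=
  ∃ x y : ℚ, z.re = algebraMap ℚ Af x ∧ z.im = algebraMap ℚ Af y

/-- Complex conjugation on the finite ideles of `E`. -/
def conjIdele (D : ℤ) : (AE D)ˣ →* (AE D)ˣ :=
  Units.map (starRingEnd (AE D) : AE D →* AE D)

/-- The subgroup of the finite ideles of `E` generated by the principal ideles and by the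
integral ideles with integral inverse. -/
def princSub (D : ℤ) : Subgroup (AE D)ˣ :=
  Subgroup.closure ({t | IsPrincipalAE (t : AE D)} ∪
    {t | IsIntAE (t : AE D) ∧ IsIntAE ((t⁻¹ : (AE D)ˣ) : AE D)})

/-- The class group of `E` as the quotient of the finite ideles of `E`. -/
abbrev ClD (D : ℤ) : Type := (AE D)ˣ ⧸ princSub D

theorem isPrincipalAE_star {D : ℤ} {z : AE D} (h : IsPrincipalAE z) :
    IsPrincipalAE (star z) := by
  obtain ⟨x, y, hx, hy⟩ := h
  refine ⟨x + (cB D : ℚ) * y, -y, ?_, ?_⟩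
  · simp [hx, hy]
  · simp [hy]

theorem isIntAE_star {D : ℤ} {z : AE D} (h : IsIntAE z) : IsIntAE (star z) := by
  intro v
  have e1 : (star z).re v = z.re v + ((cB D : ℤ) : Qv v) * z.im v := by
    have : (star z).re = z.re + ((cB D : ℤ) : Af) * z.im := by simp
    rw [this]
    have h' : evalAt v (z.re + ((cB D : ℤ) : Af) * z.im) =
        evalAt v z.re + ((cB D : ℤ) : Qv v) * evalAt v z.im := by
      rw [map_add, map_mul, map_intCast]
    exact h'
  have e2 : (star z).im v = - z.im v := by
    have : (star z).im = - z.im := by simp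
    rw [this]
    rfl
  rw [e1, e2]
  exact ⟨add_mem (h v).1 (mul_mem (intCast_mem _ _) (h v).2), neg_mem (h v).2⟩

theorem princSub_le (D : ℤ) : princSub D ≤ (princSub D).comap (conjIdele D) := by
  unfold princSub
  rw [Subgroup.closure_le]
  rintro t (ht | ht)
  · exact Subgroup.subset_closure (Or.inl (isPrincipalAE_star ht))
  · refine Subgroup.subset_closure (Or.inr ⟨isIntAE_star ht.1, ?_⟩)
    rw [← map_inv]
    exact isIntAE_star ht.2

/-- The action of the nontrivial element of `Gal(E/ℚ)` on the class group. -/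
def conjCl (D : ℤ) : ClD D →* ClD D :=
  QuotientGroup.map _ _ (conjIdele D) (princSub_le D)

/-- The characters of the class group. -/
abbrev ClDual (D : ℤ) : Type := ClD D →* ℂˣ

theorem conjCl_conjCl (D : ℤ) (c : ClD D) : conjCl D (conjCl D c) = c := by
  induction c using QuotientGroup.induction_on with
  | H t =>
    have : conjIdele D (conjIdele D t) = t := by
      ext1
      exact star_star (t : AE D)
    change ((conjIdele D (conjIdele D t) : (AE D)ˣ) : ClD D) = _
    rw [this]

/-- Galois equivalence of class group characters. -/
def galSetoid (D : ℤ) : Setoid (ClDual D) where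
  r χ ψ := ψ = χ ∨ ψ = χ.comp (conjCl D)
  iseqv :=
    { refl := fun _ => Or.inl rfl
      symm := by
        rintro χ ψ (rfl | rfl)
        · exact Or.inl rfl
        · refine Or.inr ?_
          ext c
          simp [conjCl_conjCl]
      trans := by
        rintro χ ψ η (rfl | rfl) (rfl | rfl)
        · exact Or.inl rfl
        · exact Or.inr rfl
        · exact Or.inr rfl
        · refine Or.inl ?_
          ext c
          simp [conjCl_conjCl] }

/-- The Galois equivalence classes of class group characters. -/
abbrev ClDualGal (D : ℤ) : Type := Quotient (galSetoid D)

/-! ### The orthogonal group -/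

section group

variable {R : Type} [CommRing R]

/-- The bilinear form of `Q₁(X) = -2 det X = 2 x ^ 2 + 2 y z` on the trace zero matrices
`X = [x, y; z, -x]`, written in the coordinates `(y, x, z)`. -/
def bil (u w : Fin 3 → R) : R := u 0 * w 2 + 2 * (u 1 * w 1) + u 2 * w 0

/-- The vector `ξ_D = [0, 1; D / 4, 0]` or `[1 / 2, 1; (D - 1) / 4, -1 / 2]`, in the coordinates
`(y, x, z)`. -/
def xiQ (D : ℤ) : Fin 3 → ℚ := ![1, -(cB D : ℚ) / 2, (cA D : ℚ)]

/-- `ξ_D` over a `ℚ`-algebra. -/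
def xi (D : ℤ) (R : Type) [CommRing R] [Algebra ℚ R] : Fin 3 → R :=
  fun i => algebraMap ℚ R (xiQ D i)

/-- The stabilizer of `ξ_D` in `O(Q₁)(R)`, as a subgroup of `GL₃(R)`. -/
def stabXi (D : ℤ) (R : Type) [CommRing R] [Algebra ℚ R] : Subgroup (GL (Fin 3) R) where
  carrier := {g | (∀ u w : Fin 3 → R, bil (g.1 *ᵥ u) (g.1 *ᵥ w) = bil u w) ∧
    g.1 *ᵥ xi D R = xi D R}
  one_mem' := by simp
  mul_mem' := by
    rintro g h ⟨hg, hg'⟩ ⟨hh, hh'⟩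
    refine ⟨fun u w => ?_, ?_⟩
    · simp only [Units.val_mul, ← Matrix.mulVec_mulVec, hg, hh]
    · simp only [Units.val_mul, ← Matrix.mulVec_mulVec, hg', hh']
  inv_mem' := by
    rintro g ⟨hg, hg'⟩
    have e : ∀ u : Fin 3 → R, g.1 *ᵥ ((g⁻¹).1 *ᵥ u) = u := fun u => by
      rw [Matrix.mulVec_mulVec, ← Units.val_mul, mul_inv_cancel, Units.val_one,
        Matrix.one_mulVec]
    have e' : ∀ u : Fin 3 → R, (g⁻¹).1 *ᵥ (g.1 *ᵥ u) = u := fun u => by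
      rw [Matrix.mulVec_mulVec, ← Units.val_mul, inv_mul_cancel, Units.val_one,
        Matrix.one_mulVec]
    refine ⟨fun u w => ?_, ?_⟩
    · rw [← hg, e, e]
    · conv_lhs => rw [← hg', e']

/-- The group `G(R)` of `R`-points of the stabilizer of `ξ_D` in `O(Q₁)`. -/
def GD (D : ℤ) (R : Type) [CommRing R] [Algebra ℚ R] : Type := ↥(stabXi D R)

variable {D : ℤ} [Algebra ℚ R]

instance : Group (GD D R) := inferInstanceAs (Group ↥(stabXi D R))

instance [TopologicalSpace R] : TopologicalSpace (GD D R) :=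
  inferInstanceAs (TopologicalSpace ↥(stabXi D R))

instance [TopologicalSpace R] [IsTopologicalRing R] : IsTopologicalGroup (GD D R) :=
  inferInstanceAs (IsTopologicalGroup ↥(stabXi D R))

instance [TopologicalSpace R] : MeasurableSpace (GD D R) := borel _

instance [TopologicalSpace R] : BorelSpace (GD D R) := ⟨rfl⟩

/-- The matrix of an element of `G(R)`. -/
def GD.mat (g : GD D R) : Matrix (Fin 3) (Fin 3) R := (Subtype.val g).1

theorem map_mulVec_aux {S : Type} [CommRing S] (φ : R →+* S) (g : GL (Fin 3) R)
    (hg : ∀ u w : Fin 3 → R, bil (g.1 *ᵥ u) (g.1 *ᵥ w) = bil u w) (u w : Fin 3 → S) :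
    bil ((Matrix.GeneralLinearGroup.map φ g).1 *ᵥ u)
      ((Matrix.GeneralLinearGroup.map φ g).1 *ᵥ w) = bil u w := by
  have h := fun i j : Fin 3 => congrArg φ (hg (Pi.single i 1) (Pi.single j 1))
  have h2 : φ 2 = 2 := map_ofNat φ 2
  have h00 := h 0 0
  have h01 := h 0 1
  have h02 := h 0 2
  have h11 := h 1 1
  have h12 := h 1 2
  have h22 := h 2 2
  simp [bil, h2] at h00 h01 h02 h11 h12 h22
  simp only [bil, Matrix.mulVec, dotProduct, Fin.sum_univ_three,
    Matrix.GeneralLinearGroup.map_apply]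
  linear_combination u 0 * w 0 * h00 + (u 0 * w 1 + u 1 * w 0) * h01 +
    (u 0 * w 2 + u 2 * w 0) * h02 + u 1 * w 1 * h11 + (u 1 * w 2 + u 2 * w 1) * h12 +
    u 2 * w 2 * h22

/-- Functoriality of `G(R)` in the `ℚ`-algebra `R`. -/
def GD.map {S : Type} [CommRing S] [Algebra ℚ S] (φ : R →ₐ[ℚ] S) : GD D R →* GD D S :=
  ((Matrix.GeneralLinearGroup.map (φ : R →+* S)).comp (stabXi D R).subtype).codRestrict
    (stabXi D S) (by
      rintro ⟨g, hg, hg'⟩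
      refine ⟨map_mulVec_aux (φ : R →+* S) g hg, ?_⟩
      funext i
      have := congrArg φ (congrFun hg' i)
      simpa [xi, Matrix.mulVec, dotProduct, Fin.sum_univ_three] using this)

end group

/-- `G(𝔸) = G(ℝ) × G(𝔸_fin)`. -/
abbrev GA (D : ℤ) : Type := GD D ℝ × GD D Af

/-- The image of `G(ℚ)` in `G(𝔸)` under the diagonal embedding. -/
def ratPts (D : ℤ) : Subgroup (GA D) :=
  (MonoidHom.prod (GD.map (Algebra.ofId ℚ ℝ)) (GD.map (Algebra.ofId ℚ Af)) :
    GD D ℚ →* GA D).range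

/-- The component at `v` of an element of `G(𝔸_fin)`. -/
def GD.at {D : ℤ} (h : GD D Af) (v : Pl) : GD D (Qv v) := GD.map (evalAt v) h

/-! ### Lattices and open compact subgroups -/

/-- The local lattice `L_v^ξ`: the integral vectors orthogonal to `ξ_D`. -/
def latXi (D : ℤ) (v : Pl) : Set (Fin 3 → Qv v) :=
  {u | (∀ i, u i ∈ v.adicCompletionIntegers ℚ) ∧ bil u (xi D (Qv v)) = 0}

/-- The dual of `L_v^ξ` in the orthogonal complement of `ξ_D`. -/
def latXiDual (D : ℤ) (v : Pl) : Set (Fin 3 → Qv v) :=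
  {u | bil u (xi D (Qv v)) = 0 ∧ ∀ w ∈ latXi D v, bil u w ∈ v.adicCompletionIntegers ℚ}

/-- `K_v^ξ`, the stabilizer of the lattice `L_v^ξ` in `G(ℚ_v)`. -/
def locK (D : ℤ) (v : Pl) : Set (GD D (Qv v)) :=
  {h | (h.mat *ᵥ ·) '' latXi D v = latXi D v}

/-- `K_v^{ξ*}`, the subgroup of `K_v^ξ` acting trivially on the discriminant group. -/
def locKs (D : ℤ) (v : Pl) : Set (GD D (Qv v)) :=
  {h | h ∈ locK D v ∧ ∀ u ∈ latXiDual D v, h.mat *ᵥ u - u ∈ latXi D v}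

/-- `K_fin^{ξ*} = ∏ K_v^{ξ*}`. -/
def finKs (D : ℤ) : Set (GD D Af) := {h | ∀ v, h.at v ∈ locKs D v}

/-! ### The torus and the functions `f_χ` -/

/-- The embedding `ι` given by `[τ, τω] = [1, ω] ᵗι(τ)`. -/
def iota (D : ℤ) (R : Type) [CommRing R] : QA D R →+* Matrix (Fin 2) (Fin 2) R where
  toFun z := !![z.re, z.im; (cA D : R) * z.im, z.re + (cB D : R) * z.im]
  map_one' := by
    ext i j
    fin_cases i <;> fin_cases j <;>
      simp [QuadraticAlgebra.re_one, QuadraticAlgebra.im_one]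
  map_mul' z w := by
    ext i j
    fin_cases i <;> fin_cases j <;> simp [Matrix.mul_apply, Fin.sum_univ_two] <;> ring
  map_zero' := by
    ext i j
    fin_cases i <;> fin_cases j <;> simp
  map_add' z w := by
    ext i j
    fin_cases i <;> fin_cases j <;> simp <;> ring

/-- The matrix in the coordinates `(y, x, z)` of the conjugation `X ↦ g X g⁻¹` on trace zero
matrices. -/
def ssMat {R : Type} [CommRing R] (g : GL (Fin 2) R) : Matrix (Fin 3) (Fin 3) R :=
  ((Matrix.GeneralLinearGroup.det g)⁻¹ : Rˣ).val •
    !![g.1 0 0 ^ 2, -2 * g.1 0 0 * g.1 0 1, -g.1 0 1 ^ 2;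
      -g.1 0 0 * g.1 1 0, g.1 0 0 * g.1 1 1 + g.1 0 1 * g.1 1 0, g.1 0 1 * g.1 1 1;
      -g.1 1 0 ^ 2, 2 * g.1 1 1 * g.1 1 0, g.1 1 1 ^ 2]

/-- `s(ι(t))` for a finite idele `t` of `E`. -/
def torusMat {D : ℤ} (t : (AE D)ˣ) : Matrix (Fin 3) (Fin 3) Af :=
  ssMat (Units.map (iota D Af : AE D →* Matrix (Fin 2) (Fin 2) Af) t)

/-- The matrix of the involution `σ̃ : X ↦ -c X c⁻¹` with `c = [1, 0; cB D, -1]`, the matrix of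
the Galois conjugation of `E` in the basis `1, ω`. -/
def sigmaMat (D : ℤ) (R : Type) [CommRing R] : Matrix (Fin 3) (Fin 3) R :=
  !![1, 0, 0; -(cB D : R), -1, 0; -(cB D : R) ^ 2, -2 * (cB D : R), 1]

/-- `Σ = ∏_v {1, σ̃_v}` inside `G(𝔸_fin)`. -/
def sigmaGrp (D : ℤ) : Set (GD D Af) :=
  {τ | ∀ v, (τ.at v).mat = 1 ∨ (τ.at v).mat = sigmaMat D (Qv v)}

/-- `h = s(ι(t)) τ` for some `τ ∈ Σ`. -/
def HasTorusPart {D : ℤ} (h : GD D Af) (t : (AE D)ˣ) : Prop :=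
  ∃ τ ∈ sigmaGrp D, h.mat = torusMat t * τ.mat

/-- The value of a class group character on a finite idele. -/
def chi {D : ℤ} (χ : ClDual D) (t : (AE D)ˣ) : ℂ := (χ (t : ClD D) : ℂˣ).val

open Classical in
/-- The function `f_χ`: `f_χ(s(ι(t)) τ) = (χ(t) + χ(t̄)) / 2`, viewed on `G(𝔸)` through the
finite component. -/
def fChi {D : ℤ} (χ : ClDual D) : GA D → ℂ := fun h =>
  if H : ∃ t, HasTorusPart h.2 t then
    (1 / 2 : ℂ) * (chi χ H.choose + chi χ (conjIdele D H.choose))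
  else 0

/-! ### Automorphic functions -/

/-- Right translation by an element of `G(𝔸_fin)`. -/
def rTrans {D : ℤ} (g : GD D Af) : (GA D → ℂ) →ₗ[ℂ] (GA D → ℂ) :=
  LinearMap.funLeft ℂ ℂ (fun h : GA D => h * ((1 : GD D ℝ), g))

/-- The space `V(ξ_D)` of smooth functions on `G(𝔸)` which are left invariant under `G(ℚ)` and
right invariant under `G(ℝ)`; smoothness in the finite variable means right invariance under
some open subgroup. -/
def autV (D : ℤ) : Submodule ℂ (GA D → ℂ) where
  carrier := {f | (∀ δ ∈ ratPts D, ∀ h, f (δ * h) = f h) ∧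
    (∀ (u : GD D ℝ) (h : GA D), f (h * (u, 1)) = f h) ∧
    ∃ U : Subgroup (GD D Af), IsOpen (U : Set (GD D Af)) ∧ ∀ k ∈ U, rTrans k f = f}
  zero_mem' := ⟨by simp, by simp, ⊤, isOpen_univ, by simp⟩
  add_mem' := by
    rintro f g ⟨h1, h2, U, hU, h3⟩ ⟨h1', h2', U', hU', h3'⟩
    refine ⟨fun δ hδ h => ?_, fun u h => ?_, U ⊓ U', hU.inter hU', fun k hk => ?_⟩
    · simp [h1 δ hδ, h1' δ hδ]
    · simp [h2, h2']
    · rw [map_add, h3 k hk.1, h3' k hk.2]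
  smul_mem' := by
    rintro c f ⟨h1, h2, U, hU, h3⟩
    refine ⟨fun δ hδ h => ?_, fun u h => ?_, U, hU, fun k hk => ?_⟩
    · simp [h1 δ hδ]
    · simp [h2]
    · rw [map_smul, h3 k hk]

/-- The `K_fin^{ξ*}`-fixed vectors of a space of functions. -/
def fixK {D : ℤ} (W : Submodule ℂ (GA D → ℂ)) : Submodule ℂ (GA D → ℂ) where
  carrier := {f | f ∈ W ∧ ∀ k ∈ finKs D, rTrans k f = f}
  zero_mem' := ⟨W.zero_mem, by simp⟩
  add_mem' := fun ⟨h1, h2⟩ ⟨h1', h2'⟩ =>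
    ⟨W.add_mem h1 h1', fun k hk => by rw [map_add, h2 k hk, h2' k hk]⟩
  smul_mem' := fun c _ ⟨h1, h2⟩ =>
    ⟨W.smul_mem c h1, fun k hk => by rw [map_smul, h2 k hk]⟩

/-- `W` is a `G(𝔸_fin)`-submodule. -/
def IsStable {D : ℤ} (W : Submodule ℂ (GA D → ℂ)) : Prop :=
  ∀ g : GD D Af, ∀ f ∈ W, rTrans g f ∈ W

/-- `W` is an irreducible `G(𝔸_fin)`-module. -/
def IsIrred {D : ℤ} (W : Submodule ℂ (GA D → ℂ)) : Prop :=
  IsStable W ∧ W ≠ ⊥ ∧ ∀ W' : Submodule ℂ (GA D → ℂ), IsStable W' → W' ≤ W → W' = ⊥ ∨ W' = W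

/-- `U_χ`, the `G(𝔸_fin)`-submodule generated by `f_χ`. -/
def genU {D : ℤ} (χ : ClDual D) : Submodule ℂ (GA D → ℂ) :=
  Submodule.span ℂ (Set.range fun g : GD D Af => rTrans g (fChi χ))

/-- The irreducible `G(𝔸_fin)`-submodules of `V(ξ_D)` with nonzero `K_fin^{ξ*}`-fixed vectors. -/
def SphIrred (D : ℤ) : Type :=
  {W : Submodule ℂ (GA D → ℂ) // W ≤ autV D ∧ IsIrred W ∧ fixK W ≠ ⊥}

/-- The Hecke algebra of compactly supported functions on `G(𝔸_fin)` which are bi-invariant under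
`K_fin^{ξ*}`, as a set of functions. -/
def heckeSet (D : ℤ) : Set (GD D Af → ℂ) :=
  {φ | HasCompactSupport φ ∧ ∀ k ∈ finKs D, ∀ k' ∈ finKs D, ∀ g, φ (k * g * k') = φ g}

/-- The action of a Hecke function on a function on `G(𝔸)`. -/
def heckeAct {D : ℤ} (μ : Measure (GD D Af)) (φ : GD D Af → ℂ) (f : GA D → ℂ) : GA D → ℂ :=
  fun h => ∫ g, φ g * f (h * ((1 : GD D ℝ), g)) ∂μ

/-! ### The standard `L`-function of an irreducible submodule -/

/-- The component of `g` at every place other than `v` is trivial, i.e. `g` lies in `G(ℚ_v)`. -/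
def SuppAt {D : ℤ} (v : Pl) (g : GD D Af) : Prop := ∀ w, w ≠ v → g.at w = 1

/-- A Witt basis `e, e'` of a hyperbolic plane in `L_v^ξ`. -/
def IsHypPair (D : ℤ) (v : Pl) (e e' : Fin 3 → Qv v) : Prop :=
  e ∈ latXi D v ∧ e' ∈ latXi D v ∧ bil e e = 0 ∧ bil e' e' = 0 ∧ bil e e' = 1

/-- `G` has Witt index one at `v`. -/
def IsWittOne (D : ℤ) (v : Pl) : Prop := ∃ e e', IsHypPair D v e e'

/-- `g ∈ G(ℚ_v)` acts as `diag(p, p⁻¹)` on a Witt basis of `L_v^ξ`. -/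
def IsTorusGen {D : ℤ} (v : Pl) (g : GD D Af) : Prop :=
  SuppAt v g ∧ ∃ e e', IsHypPair D v e e' ∧ (g.at v).mat *ᵥ e = (resChar v : Qv v) • e ∧
    (g.at v).mat *ᵥ e' = (resChar v : Qv v)⁻¹ • e'

/-- `z` is the Satake parameter of `W` at a place of Witt index one: the characteristic function
of `K_v^{ξ*} g K_v^{ξ*} = g K_v^{ξ*} ⊔ g⁻¹ K_v^{ξ*}`, with `g = diag(p, p⁻¹)`, which generates the
Hecke algebra of `G(ℚ_v)`, acts on the spherical vectors by `z + z⁻¹`. -/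
def IsSatake {D : ℤ} (W : Submodule ℂ (GA D → ℂ)) (v : Pl) (z : ℂ) : Prop :=
  z ≠ 0 ∧ ∀ f ∈ fixK W, ∀ g, IsTorusGen v g → rTrans g f + rTrans g⁻¹ f = (z + z⁻¹) • f

/-- `ρ` is the value on the nontrivial class of the character by which `K_v^ξ / K_v^{ξ*}` (of order
two) acts on the spherical vectors of `W`. -/
def IsSatakeSign {D : ℤ} (W : Submodule ℂ (GA D → ℂ)) (v : Pl) (ρ : ℂ) : Prop :=
  ∀ f ∈ fixK W, ∀ k, SuppAt v k → k.at v ∈ locK D v → k.at v ∉ locKs D v → rTrans k f = ρ • f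

open Classical in
/-- The local factor at `v` of the standard `L`-function of `W` in terms of the Satake parameter.
If the Witt index at `v` is one, it is `((1 - z p⁻ˢ)(1 - z⁻¹ p⁻ˢ))⁻¹`.  If `G` is anisotropic at
`v`, it is `(1 - p⁻²ˢ)⁻¹` when `K_v^ξ = K_v^{ξ*}`, and `(1 - ρ p⁻ˢ)⁻¹` otherwise. -/
def locL {D : ℤ} (W : Submodule ℂ (GA D → ℂ)) (v : Pl) (s : ℂ) : ℂ :=
  if IsWittOne D v then
    if H : ∃ z, IsSatake W v z then
      ((1 - H.choose * (resChar v : ℂ) ^ (-s)) * (1 - H.choose⁻¹ * (resChar v : ℂ) ^ (-s)))⁻¹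
    else 0
  else if locK D v = locKs D v then (1 - (resChar v : ℂ) ^ (-2 * s))⁻¹
  else if H : ∃ ρ, IsSatakeSign W v ρ then (1 - H.choose * (resChar v : ℂ) ^ (-s))⁻¹
  else 0

/-! ### The `L`-function of the automorphic induction -/

/-- The inclusion of `OE D` in the finite adeles of `E`. -/
def toAE {D : ℤ} (x : OE D) : AE D := ⟨(x.re : Af), (x.im : Af)⟩

/-- `t` is an integral finite idele of `E` with associated ideal `P`. -/
def IsIdeleOf {D : ℤ} (t : (AE D)ˣ) (P : Ideal (OE D)) : Prop :=
  IsIntAE (t : AE D) ∧ ∀ x : OE D, x ∈ P ↔ IsIntAE (((t⁻¹ : (AE D)ˣ) : AE D) * toAE x)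

open Classical in
/-- The value `χ(P)` of a class group character on an ideal. -/
def chiIdeal {D : ℤ} (χ : ClDual D) (P : Ideal (OE D)) : ℂ :=
  if H : ∃ t, IsIdeleOf t P then chi χ H.choose else 0

/-- The local factor at `v` of the `L`-function of the automorphic induction of `χ` to `GL₂`: the
product of `(1 - χ(P) N(P)⁻ˢ)⁻¹` over the prime ideals `P` of `OE D` above `v`. -/
def locAI {D : ℤ} (χ : ClDual D) (v : Pl) (s : ℂ) : ℂ :=
  ∏ᶠ (P : Ideal (OE D)) (_ : P.IsPrime ∧ P.comap (Int.castRingHom (OE D)) = v.asIdeal),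
    (1 - chiIdeal χ P * (Nat.card (OE D ⧸ P) : ℂ) ^ (-s))⁻¹

/-- The Euler product with given local factors. -/
def eulerProd (F : Pl → ℂ → ℂ) (s : ℂ) : ℂ := ∏' v, F v s

/-- `L` is the `L`-function with the given local factors: a meromorphic function on `ℂ` which is
equal to the convergent Euler product on `Re s > 1`. -/
def IsLFunction (F : Pl → ℂ → ℂ) (L : ℂ → ℂ) : Prop :=
  MeromorphicOn L Set.univ ∧ ∀ s : ℂ, 1 < s.re → HasProd (fun v => F v s) (L s)

/-- The Kronecker symbol `(D / p)` at a prime `p`. -/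
def kronAtPrime (D : ℤ) (p : ℕ) : ℤ :=
  if p = 2 then (if D % 2 = 0 then 0 else if D % 8 = 1 then 1 else -1) else jacobiSym D p

end OTwo

end

open OTwo

noncomputable section

namespace OTwo

set_option linter.unusedSectionVars false
set_option linter.unnecessarySeqFocus false
set_option linter.unusedSimpArgs false

open scoped QuadraticAlgebra

/-! The whole statement becomes finite Fourier analysis on the class group once the double coset
space is identified. The plane `ξ_D^⊥` is `E` itself with the form `tr(z w̄)`: `vec` is the
identification. In these coordinates `s(ι(t))` is multiplication by `t̄/t` and `σ̃` is `z ↦ -z̄`. An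
isometry is determined by the images of `1` and `√D`, so Hilbert 90 gives `G = T ⊔ T σ̃` over any
field (`GD.exists_tor`), where `T` is the torus `E^×/ℚ^×`. The lattice `L_p` is `O_p`, its dual is
`O_p/√D`, and an integral form of Hilbert 90 shows that `K_p^*` consists of the units of `O_p` and
their products with `σ̃` (`mem_locKs_iff`).

Every `h` in `G(𝔸_fin)` therefore has a torus part `t`, unique up to a scalar at each place. Since
`ℚ` has class number one, local scalars do not matter in `Cl_D`, and `cls h` is well defined. Right
translation by `K^*` does not change it. Left translation by `G(ℚ)` changes it at most by Galois
conjugation, which is inversion because `t t̄` is a scalar. Conversely these moves identify all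
elements with classes `c` and `c⁻¹`. Hence `𝒱(K^*)` is the space of even functions on `Cl_D`, and
`f_χ` is the even part of `χ`. Basis and orthogonality follow from the orthogonality of characters.
For the norm one unfolds the indicator function of `G(ℝ) × tK^*`; the multiplicity `w_D/2` is the
number of units modulo `±1`, so integration over the quotient is `w_D⁻¹ ∑_c`.

The torus is commutative, so torus translates of `f_χ`, and hence Hecke translates, stay
combinations of `χ` and `χ⁻¹` along the torus. An even combination of these is a multiple of `f_χ`.
This gives the Hecke eigenproperty and the line of fixed vectors (`fixK_genU`). For irreducibility,
write a vector `w` of a submodule as an operator applied to `f_χ`, apply the adjoint operator to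
`w`, and average over `K^*`: the value at `1` is a sum of squares and does not vanish, so the
submodule contains `f_χ`.

The local factors are computed from an element `ω - r` whose norm has valuation one at `p`. It
represents the prime ideal `(p, ω - r)`, and modulo scalars and integral units it generates the
local torus. The Witt index and `K_p/K_p^*` distinguish split, ramified and inert primes. For `χ =
1` these three cases match the Kronecker symbol.

The deep part is that every irreducible submodule with fixed vectors is some `𝒰_χ`. If `ψ ≠ χ, χ⁻¹`,
one needs a prime `P` with `χ(P) + χ(P)⁻¹ ≠ ψ(P) + ψ(P)⁻¹`, which means that `α = χψ⁻¹` and `β = χψ`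
are both nontrivial at `P` (`exists_prime_ev_ne_one`). Ideal class zeta sums agree near `s = 1` up
to a bounded error, so `L(s, ψ)` stays bounded for `ψ ≠ 1`, while the zeta sum is unbounded. This
gives one-sided bounds for prime sums, without nonvanishing at `s = 1`. If `α² ≠ 1` or `β² ≠ 1`, a
positive combination of three such bounds gives a contradiction. If both are quadratic, they are
genus characters and depend only on the norm. Dirichlet's theorem and a pigeonhole argument for norm
forms then yield a third prime at which both are nontrivial. Commuting operators with separated
eigenvalues finally isolate one `f_χ` in the submodule. -/

/-- `D` is a negative fundamental discriminant. -/
class ImagDisc (D : ℤ) : Prop where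
  isFundDisc : IsFundDisc D
  neg : D < 0

theorem ImagDisc.ne_zero (D : ℤ) [h : ImagDisc D] : D ≠ 0 := h.neg.ne

theorem cB_sq (D : ℤ) [h : ImagDisc D] : cB D ^ 2 + 4 * cA D = D :=
  cB_sq_add D h.isFundDisc.mod_four

theorem cB_sq_cast (D : ℤ) [ImagDisc D] (R : Type) [CommRing R] :
    (cB D : R) ^ 2 + 4 * (cA D : R) = (D : R) := by
  have := congrArg (Int.cast : ℤ → R) (cB_sq D)
  push_cast at this
  exact this

/-! ### The plane orthogonal to `ξ_D` as a quadratic algebra, the torus and the reflection -/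

section generic

variable {R : Type} [CommRing R] {D : ℤ}

open QuadraticAlgebra

/-- The square root `2 ω - cB D` of `D`. -/
def sqD (D : ℤ) (R : Type) [CommRing R] : QA D R := ⟨-(cB D : R), 2⟩

/-- The identification of `R ⊕ R ω` with the orthogonal complement of `ξ_D`. -/
def vec (z : QA D R) : Fin 3 → R := ![z.im, z.re, (cB D : R) * z.re - (cA D : R) * z.im]

theorem vec_injective : Function.Injective (vec : QA D R → Fin 3 → R) := by
  intro z w h
  ext
  · exact congrFun h 1
  · exact congrFun h 0

theorem vec_add (z w : QA D R) : vec (z + w) = vec z + vec w := by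
  funext i
  fin_cases i <;> simp [vec] <;> ring

theorem vec_neg (z : QA D R) : vec (-z) = - vec z := by
  funext i
  fin_cases i <;> simp [vec]; ring

theorem vec_sub (z w : QA D R) : vec (z - w) = vec z - vec w := by
  rw [sub_eq_add_neg, vec_add, vec_neg, sub_eq_add_neg]

theorem vec_smul (c : R) (z : QA D R) : vec (c • z) = c • vec z := by
  funext i
  fin_cases i <;> simp [vec]; ring

theorem vec_zero : vec (0 : QA D R) = 0 := by
  simpa using vec_smul (0 : R) (0 : QA D R)

theorem bil_vec (z w : QA D R) : bil (vec z) (vec w) = (z * star w).trace := by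
  simp [bil, vec, QuadraticAlgebra.trace_def]
  ring

theorem star_sqD (D : ℤ) (R : Type) [CommRing R] : star (sqD D R) = - sqD D R := by
  ext <;> simp [sqD]; ring

theorem sqD_mul_self (D : ℤ) [ImagDisc D] (R : Type) [CommRing R] :
    sqD D R * sqD D R = ⟨(D : R), 0⟩ := by
  have := cB_sq_cast D R
  ext
  · simp [sqD]; linear_combination this
  · simp [sqD]; ring

theorem sub_star_eq (z : QA D R) : z - star z = z.im • sqD D R := by
  ext <;> simp [sqD] <;> ring

/-- This is the displacement of `z` under `σ̃`. It is a scalar, and is integral as soon as `√D z`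
is, which makes `σ̃` trivial on the discriminant group. -/
theorem neg_star_sub_eq (z : QA D R) : -star z - z = ⟨-(sqD D R * z).im, 0⟩ := by
  ext
  · simp [sqD]; ring
  · simp

/-- The pairing is the standard symplectic pairing of `w` with `√D z`, so the dual of `ℤ ⊕ ℤω` is
its multiple by `1/√D`. -/
theorem bil_vec_eq (z w : QA D R) : bil (vec z) (vec w) =
    w.re * (sqD D R * z).im - w.im * (sqD D R * z).re := by
  simp [bil, vec, sqD]
  ring

theorem mul_star_eq (z : QA D R) : z * star z = ⟨z.norm, 0⟩ :=
  (algebraMap_norm_eq_mul_star z).symm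

/-- Functoriality of `R ⊕ R ω`. -/
def qmap {S : Type} [CommRing S] (φ : R →+* S) : QA D R →+* QA D S where
  toFun z := ⟨φ z.re, φ z.im⟩
  map_one' := by ext <;> simp
  map_mul' z w := by ext <;> simp
  map_zero' := by ext <;> simp
  map_add' z w := by ext <;> simp

@[simp] theorem qmap_re {S : Type} [CommRing S] (φ : R →+* S) (z : QA D R) :
    (qmap φ z).re = φ z.re := rfl

@[simp] theorem qmap_im {S : Type} [CommRing S] (φ : R →+* S) (z : QA D R) :
    (qmap φ z).im = φ z.im := rfl

theorem qmap_star {S : Type} [CommRing S] (φ : R →+* S) (z : QA D R) :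
    qmap φ (star z) = star (qmap φ z) := by
  ext <;> simp

theorem qmap_norm {S : Type} [CommRing S] (φ : R →+* S) (z : QA D R) :
    (qmap φ z).norm = φ z.norm := by
  simp [QuadraticAlgebra.norm_def]

/-- Conjugation on the units of `R ⊕ R ω`. -/
def conjU : (QA D R)ˣ →* (QA D R)ˣ := Units.map (starRingEnd (QA D R) : QA D R →* QA D R)

@[simp] theorem conjU_val (t : (QA D R)ˣ) : (conjU t : QA D R) = star (t : QA D R) := rfl

variable [Algebra ℚ R]

theorem algebraMap_half_mul_two (R : Type) [CommRing R] [Algebra ℚ R] :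
    algebraMap ℚ R (1 / 2) * (2 : R) = 1 := by
  have : (2 : R) = algebraMap ℚ R 2 := (map_ofNat _ 2).symm
  rw [this, ← map_mul]
  norm_num

theorem two_algebraMap_half : (2 : R) * algebraMap ℚ R (-(cB D : ℚ) / 2) = -(cB D : R) := by
  have : (2 : R) = algebraMap ℚ R 2 := (map_ofNat _ 2).symm
  rw [this, ← map_mul]
  rw [show (2 : ℚ) * (-(cB D : ℚ) / 2) = -(cB D : ℚ) by ring]
  simp

/-- The first coordinate of `ξ_D` is `1`, so orthogonality solves for the third coordinate of `u` in
terms of the other two. -/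
theorem perp_iff [ImagDisc D] (u : Fin 3 → R) :
    bil u (xi D R) = 0 ↔ ∃ z : QA D R, u = vec z := by
  constructor
  · intro h
    refine ⟨⟨u 1, u 0⟩, ?_⟩
    have h2 : (2 : R) * algebraMap ℚ R (-(cB D : ℚ) / 2) = -(cB D : R) := two_algebraMap_half
    funext i
    fin_cases i
    · simp [vec]
    · simp [vec]
    · simp only [bil, xi, xiQ, Matrix.cons_val, map_intCast, map_one] at h
      simp [vec]
      linear_combination h - u 1 * h2
  · rintro ⟨z, rfl⟩
    have h2 : (2 : R) * algebraMap ℚ R (-(cB D : ℚ) / 2) = -(cB D : R) := two_algebraMap_half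
    simp only [bil, vec, xi, xiQ, Matrix.cons_val, map_intCast, map_one]
    linear_combination z.re * h2

/-- The combination `2ξ_D - 2 vec ω + cB · vec 1` is `D` times the last basis vector. As `D` is
invertible in a `ℚ`-algebra, these three vectors span. -/
theorem mat_ext [ImagDisc D] {A B : Matrix (Fin 3) (Fin 3) R}
    (h0 : A *ᵥ xi D R = B *ᵥ xi D R) (h : ∀ z : QA D R, A *ᵥ vec z = B *ᵥ vec z) : A = B := by
  have h1 := h (1 : QA D R)
  have h2 := h ⟨0, 1⟩
  have key : ∀ i, A i 2 = B i 2 := by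
    intro i
    have e0 := congrFun h0 i
    have e1 := congrFun h1 i
    have e2 := congrFun h2 i
    simp only [Matrix.mulVec, dotProduct, Fin.sum_univ_three, vec, xi, xiQ, Matrix.cons_val,
      QuadraticAlgebra.re_one, QuadraticAlgebra.im_one, map_one, map_intCast] at e0 e1 e2
    have h2 : (2 : R) * algebraMap ℚ R (-(cB D : ℚ) / 2) = -(cB D : R) := two_algebraMap_half
    have hD := cB_sq_cast D R
    have hu : (algebraMap ℚ R (1 / D)) * (D : R) = 1 := by
      have : ((D : R)) = algebraMap ℚ R D := by simp
      have hD0 : (D : ℚ) ≠ 0 := by exact_mod_cast ImagDisc.ne_zero D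
      rw [this, ← map_mul, one_div, inv_mul_cancel₀ hD0, map_one]
    have h3 : (D : R) * (A i 2 - B i 2) = 0 := by
      linear_combination (B i 2 - A i 2) * hD + 2 * e0 - 2 * e2 + (cB D : R) * e1
        - (A i 1 - B i 1) * h2
    have h4 : A i 2 - B i 2 = 0 := by
      linear_combination (algebraMap ℚ R (1 / D)) * h3 - (A i 2 - B i 2) * hu
    exact sub_eq_zero.1 h4
  ext i j
  have e1 := congrFun h1 i
  have e2 := congrFun h2 i
  simp only [Matrix.mulVec, dotProduct, Fin.sum_univ_three, vec, Matrix.cons_val,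
      QuadraticAlgebra.re_one, QuadraticAlgebra.im_one] at e1 e2
  fin_cases j
  · simp only [Fin.zero_eta]
    linear_combination e2 + (cA D : R) * key i
  · simp only [Fin.mk_one]
    linear_combination e1 - (cB D : R) * key i
  · exact key i

theorem GD.ext {g h : GD D R} (e : g.mat = h.mat) : g = h :=
  Subtype.ext (Units.ext e)

@[simp] theorem GD.mat_mul (g h : GD D R) : (g * h).mat = g.mat * h.mat := rfl

@[simp] theorem GD.mat_one : (1 : GD D R).mat = 1 := rfl

theorem GD.mat_xi (g : GD D R) : g.mat *ᵥ xi D R = xi D R := g.2.2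

theorem GD.bil_mat (g : GD D R) (u w : Fin 3 → R) : bil (g.mat *ᵥ u) (g.mat *ᵥ w) = bil u w :=
  g.2.1 u w

theorem GD.ext_vec [ImagDisc D] {g h : GD D R} (e : ∀ z : QA D R, g.mat *ᵥ vec z = h.mat *ᵥ vec z) :
    g = h :=
  GD.ext (mat_ext (by rw [g.mat_xi, h.mat_xi]) e)

theorem GD.mul_vec (g h : GD D R) (u : Fin 3 → R) :
    (g * h).mat *ᵥ u = g.mat *ᵥ (h.mat *ᵥ u) := by
  rw [GD.mat_mul, Matrix.mulVec_mulVec]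

theorem GD.inv_mul_vec (g : GD D R) (u : Fin 3 → R) : g⁻¹.mat *ᵥ (g.mat *ᵥ u) = u := by
  rw [← GD.mul_vec, inv_mul_cancel, GD.mat_one, Matrix.one_mulVec]

theorem GD.exists_vec [ImagDisc D] (g : GD D R) (z : QA D R) : ∃ w : QA D R, g.mat *ᵥ vec z = vec w := by
  rw [← perp_iff]
  conv_lhs => rw [← g.mat_xi]
  rw [g.bil_mat]
  exact (perp_iff _).2 ⟨z, rfl⟩

/-- The map `s` as a homomorphism to matrices. -/
def ssHom : GL (Fin 2) R →* Matrix (Fin 3) (Fin 3) R where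
  toFun := ssMat
  map_one' := by
    ext i j
    fin_cases i <;> fin_cases j <;> simp [ssMat]
  map_mul' g h := by
    have e : ssMat (g * h) = ((Matrix.GeneralLinearGroup.det g)⁻¹ : Rˣ).val •
      ((Matrix.GeneralLinearGroup.det h)⁻¹ : Rˣ).val • !![(g * h).1 0 0 ^ 2,
        -2 * (g * h).1 0 0 * (g * h).1 0 1, -(g * h).1 0 1 ^ 2;
      -(g * h).1 0 0 * (g * h).1 1 0, (g * h).1 0 0 * (g * h).1 1 1 + (g * h).1 0 1 * (g * h).1 1 0,
        (g * h).1 0 1 * (g * h).1 1 1;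
      -(g * h).1 1 0 ^ 2, 2 * (g * h).1 1 1 * (g * h).1 1 0, (g * h).1 1 1 ^ 2] := by
      rw [ssMat, map_mul, mul_inv, Units.val_mul, mul_smul]
    rw [e, ssMat, ssMat, Matrix.smul_mul, Matrix.mul_smul]
    congr 2
    ext i j
    fin_cases i <;> fin_cases j <;>
      simp [Matrix.mul_apply, Fin.sum_univ_three, Fin.sum_univ_two] <;> ring

theorem GL_det_inv (g : GL (Fin 2) R) :
    ((Matrix.GeneralLinearGroup.det g)⁻¹ : Rˣ).val * (g.1 0 0 * g.1 1 1 - g.1 0 1 * g.1 1 0) = 1 := by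
  rw [← Matrix.det_fin_two, ← Matrix.GeneralLinearGroup.val_det_apply, Units.inv_mul]

theorem bil_ssMat (g : GL (Fin 2) R) (u w : Fin 3 → R) :
    bil (ssMat g *ᵥ u) (ssMat g *ᵥ w) = bil u w := by
  have h := GL_det_inv g
  simp only [ssMat, Matrix.smul_mulVec]
  generalize ((Matrix.GeneralLinearGroup.det g)⁻¹ : Rˣ).val = c at *
  simp only [bil, Matrix.mulVec, dotProduct, Fin.sum_univ_three, Pi.smul_apply, smul_eq_mul,
    Matrix.of_apply, Matrix.cons_val]
  linear_combination (u 0 * w 2 + 2 * (u 1 * w 1) + u 2 * w 0) *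
    (c * (g.1 0 0 * g.1 1 1 - g.1 0 1 * g.1 1 0) + 1) * h

/-- `ι` on units. -/
def iotaU (t : (QA D R)ˣ) : GL (Fin 2) R :=
  Units.map (iota D R : QA D R →* Matrix (Fin 2) (Fin 2) R) t

theorem iotaU_val (t : (QA D R)ˣ) : (iotaU t).1 = iota D R t := rfl

/-- Since `2 ξ_D = ι(√D)`, the matrices orthogonal to `ξ_D` anticommute with `ι(√D)`. Conjugation by
`ι(t)` on them is thus multiplication by a ratio of `t` and its conjugate, which is `t̄/t` in the
coordinates `vec`. -/
theorem ssMat_iotaU_vec (t : (QA D R)ˣ) (z : QA D R) :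
    ssMat (iotaU t) *ᵥ vec z = vec (star (t : QA D R) * ((t⁻¹ : (QA D R)ˣ) : QA D R) * z) := by
  have h := GL_det_inv (iotaU t)
  have hn : ((Matrix.GeneralLinearGroup.det (iotaU t))⁻¹ : Rˣ).val * (t : QA D R).norm = 1 := by
    rw [← h, QuadraticAlgebra.norm_def, iotaU_val]
    simp [iota]
    ring
  have hi : ((t⁻¹ : (QA D R)ˣ) : QA D R) =
      ((Matrix.GeneralLinearGroup.det (iotaU t))⁻¹ : Rˣ).val • star (t : QA D R) := by
    rw [Units.inv_eq_of_mul_eq_one_right]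
    rw [mul_smul_comm, mul_star_eq]
    ext
    · simpa using hn
    · simp
  rw [hi]
  simp only [ssMat, Matrix.smul_mulVec, iotaU_val]
  generalize ((Matrix.GeneralLinearGroup.det (iotaU t))⁻¹ : Rˣ).val = c at *
  rw [mul_smul_comm, smul_mul_assoc, vec_smul]
  congr 1
  funext i
  fin_cases i
  all_goals
    simp [Matrix.mulVec, dotProduct, Fin.sum_univ_three, vec, iota]
    ring

theorem ssMat_iotaU_xi (t : (QA D R)ˣ) : ssMat (iotaU t) *ᵥ xi D R = xi D R := by
  have h := GL_det_inv (iotaU t)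
  have h2 : (2 : R) * algebraMap ℚ R (-(cB D : ℚ) / 2) = -(cB D : R) := two_algebraMap_half
  simp only [ssMat, Matrix.smul_mulVec, iotaU_val] at *
  generalize ((Matrix.GeneralLinearGroup.det (iotaU t))⁻¹ : Rˣ).val = c at *
  simp [iota] at h
  funext i
  have h2' : (2 : R) * algebraMap ℚ R (xiQ D 1) = -(cB D : R) := h2
  generalize hx : algebraMap ℚ R (xiQ D 1) = x at *
  have hx0 : algebraMap ℚ R (xiQ D 0) = 1 := by simp [xiQ]
  have hx2 : algebraMap ℚ R (xiQ D 2) = (cA D : R) := by simp [xiQ]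
  fin_cases i
  all_goals
    simp [Matrix.mulVec, dotProduct, Fin.sum_univ_three, iota, xi, hx, hx0, hx2]
  · linear_combination h - c * (t : QA D R).re * (t : QA D R).im * h2'
  · linear_combination x * h + c * (cA D : R) * (t : QA D R).im ^ 2 * h2'
  · linear_combination (cA D : R) * h + c * (cA D : R) * (t : QA D R).im *
      ((t : QA D R).re + (cB D : R) * (t : QA D R).im) * h2'

/-- The embedding `t ↦ s(ι(t))` of the torus in `G(R)`. -/
def tor : (QA D R)ˣ →* GD D R :=
  ((MonoidHom.toHomUnits (ssHom (R := R))).comp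
    (Units.map (iota D R : QA D R →* Matrix (Fin 2) (Fin 2) R))).codRestrict (stabXi D R)
    fun t => ⟨fun u w => bil_ssMat (iotaU t) u w, ssMat_iotaU_xi t⟩

theorem tor_mat (t : (QA D R)ˣ) : (tor t).mat = ssMat (iotaU t) := rfl

theorem tor_vec (t : (QA D R)ˣ) (z : QA D R) :
    (tor t).mat *ᵥ vec z = vec (star (t : QA D R) * ((t⁻¹ : (QA D R)ˣ) : QA D R) * z) :=
  ssMat_iotaU_vec t z

theorem sigmaMat_vec (z : QA D R) : sigmaMat D R *ᵥ vec z = vec (-star z) := by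
  funext i
  fin_cases i <;>
    simp [Matrix.mulVec, dotProduct, Fin.sum_univ_three, vec, sigmaMat] <;> ring

theorem sigmaMat_xi (D : ℤ) (R : Type) [CommRing R] [Algebra ℚ R] :
    sigmaMat D R *ᵥ xi D R = xi D R := by
  have h2 : (2 : R) * algebraMap ℚ R (xiQ D 1) = -(cB D : R) := two_algebraMap_half
  have hx0 : algebraMap ℚ R (xiQ D 0) = 1 := by simp [xiQ]
  have hx2 : algebraMap ℚ R (xiQ D 2) = (cA D : R) := by simp [xiQ]
  generalize hx : algebraMap ℚ R (xiQ D 1) = x at *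
  funext i
  fin_cases i
  all_goals simp [Matrix.mulVec, dotProduct, Fin.sum_univ_three, sigmaMat, xi, hx, hx0, hx2]
  · linear_combination -h2
  · linear_combination -(cB D : R) * h2

theorem sigmaMat_sq (D : ℤ) (R : Type) [CommRing R] : sigmaMat D R * sigmaMat D R = 1 := by
  ext i j
  fin_cases i <;> fin_cases j <;>
    simp [Matrix.mul_apply, Fin.sum_univ_three, sigmaMat] <;> ring

theorem bil_sigmaMat (u w : Fin 3 → R) : bil (sigmaMat D R *ᵥ u) (sigmaMat D R *ᵥ w) = bil u w := by
  simp [bil, Matrix.mulVec, dotProduct, Fin.sum_univ_three, sigmaMat]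
  ring

/-- The involution `σ̃` in `G(R)`. -/
def sig (D : ℤ) (R : Type) [CommRing R] [Algebra ℚ R] : GD D R :=
  ⟨⟨sigmaMat D R, sigmaMat D R, sigmaMat_sq D R, sigmaMat_sq D R⟩, bil_sigmaMat, sigmaMat_xi D R⟩

@[simp] theorem sig_mat : (sig D R).mat = sigmaMat D R := rfl

theorem sig_vec (z : QA D R) : (sig D R).mat *ᵥ vec z = vec (-star z) := sigmaMat_vec z

theorem sig_mul_sig : sig D R * sig D R = 1 := GD.ext (sigmaMat_sq D R)

theorem sig_mul_tor [ImagDisc D] (t : (QA D R)ˣ) : sig D R * tor t = tor (conjU t) * sig D R := by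
  refine GD.ext_vec fun z => ?_
  rw [GD.mul_vec, GD.mul_vec, tor_vec, sig_vec, sig_vec, tor_vec]
  congr 1
  simp [← map_inv, mul_comm]

theorem tor_eq_one_iff [ImagDisc D] (t : (QA D R)ˣ) : tor t = 1 ↔ (t : QA D R).im = 0 := by
  have key : tor t = 1 ↔ star (t : QA D R) = t := by
    constructor
    · intro h
      have := tor_vec t (1 : QA D R)
      rw [h, GD.mat_one, Matrix.one_mulVec, mul_one] at this
      have h1 := vec_injective this
      have h2 := congrArg (· * (t : QA D R)) h1
      simpa [mul_assoc] using h2.symm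
    · intro h
      refine GD.ext_vec fun z => ?_
      rw [tor_vec, h, Units.mul_inv, one_mul, GD.mat_one, Matrix.one_mulVec]
  rw [key]
  have hu := algebraMap_half_mul_two R
  constructor
  · intro h
    have h1 : -(t : QA D R).im = (t : QA D R).im := by
      conv_rhs => rw [← h]
      simp
    linear_combination (-(algebraMap ℚ R (1 / 2))) * h1 - (t : QA D R).im * hu
  · intro h
    ext <;> simp [h]

theorem tor_ne_sig [ImagDisc D] [Nontrivial R] (t : (QA D R)ˣ) : tor t ≠ sig D R := by
  intro h
  have hu := algebraMap_half_mul_two R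
  have h1 := tor_vec t (1 : QA D R)
  rw [h, sig_vec] at h1
  have h2 := vec_injective h1
  rw [mul_one, star_one] at h2
  have h3 := tor_vec t ⟨0, 1⟩
  rw [h, sig_vec, ← h2] at h3
  have h4 := congrArg QuadraticAlgebra.im (vec_injective h3)
  simp at h4
  have h5 : (1 : R) = 0 := by
    linear_combination (-(hu : _)) + (algebraMap ℚ R (1 / 2)) * h4
  exact one_ne_zero h5

theorem GD.map_mat {S : Type} [CommRing S] [Algebra ℚ S] (φ : R →ₐ[ℚ] S) (g : GD D R) :
    (GD.map φ g).mat = g.mat.map φ := rfl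

theorem GD.map_tor {S : Type} [CommRing S] [Algebra ℚ S] (φ : R →ₐ[ℚ] S) (t : (QA D R)ˣ) :
    GD.map φ (tor t) = tor (Units.map ((qmap (φ : R →+* S) : QA D R →+* QA D S) : QA D R →* QA D S) t) := by
  refine GD.ext ?_
  rw [GD.map_mat, tor_mat, tor_mat, ssMat, ssMat]
  have : (φ (((Matrix.GeneralLinearGroup.det (iotaU t))⁻¹ : Rˣ) : R)) =
    (((Matrix.GeneralLinearGroup.det
      (iotaU (Units.map ((qmap (φ : R →+* S) : QA D R →+* QA D S) : QA D R →* QA D S) t)))⁻¹ : Sˣ) : S) := by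
    have : Matrix.GeneralLinearGroup.det
      (iotaU (Units.map ((qmap (φ : R →+* S) : QA D R →+* QA D S) : QA D R →* QA D S) t)) =
      Units.map (φ : R →* S) (Matrix.GeneralLinearGroup.det (iotaU t)) := by
      ext1
      simp [Matrix.det_fin_two, iotaU_val, iota]
    rw [this, ← map_inv]
    rfl
  ext i j
  rw [Matrix.map_apply, Matrix.smul_apply, Matrix.smul_apply, smul_eq_mul, smul_eq_mul, map_mul,
    this]
  congr 1
  fin_cases i <;> fin_cases j <;> simp [iotaU_val, iota, map_ofNat φ 2]

theorem GD.map_sig {S : Type} [CommRing S] [Algebra ℚ S] (φ : R →ₐ[ℚ] S) :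
    GD.map φ (sig D R) = sig D S := by
  refine GD.ext ?_
  rw [GD.map_mat, sig_mat, sig_mat]
  ext i j
  fin_cases i <;> fin_cases j <;> simp [sigmaMat, map_ofNat φ 2]

end generic

/-! ### Hilbert 90 and the structure of `G` over a field -/

section field

variable {K : Type} [Field K] {D : ℤ}

theorem isUnit_of_norm_ne_zero {z : QA D K} (h : z.norm ≠ 0) : ∃ t : (QA D K)ˣ, (t : QA D K) = z :=
  QuadraticAlgebra.isUnit_iff_norm_isUnit.2 (isUnit_iff_ne_zero.2 h)

theorem norm_ne_zero_of_unit (t : (QA D K)ˣ) : (t : QA D K).norm ≠ 0 :=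
  (QuadraticAlgebra.isUnit_iff_norm_isUnit.1 t.isUnit).ne_zero

theorem unit_inv_eq (t : (QA D K)ˣ) : ((t⁻¹ : (QA D K)ˣ) : QA D K) =
    ((t : QA D K).norm)⁻¹ • star (t : QA D K) := by
  rw [Units.inv_eq_of_mul_eq_one_right]
  rw [mul_smul_comm, mul_star_eq]
  ext
  · exact inv_mul_cancel₀ (norm_ne_zero_of_unit t)
  · exact mul_zero _

variable [ImagDisc D]

theorem disc_cast_ne_zero (D : ℤ) [ImagDisc D] (K : Type) [Field K] [Algebra ℚ K] :
    (D : K) ≠ 0 := by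
  have : CharZero K := algebraRat.charZero K
  exact_mod_cast ImagDisc.ne_zero D

/-- One has `N(1 + √D w) = 1 + D (Im w - N w)`. The parametrization `1 + √D w` is chosen because `w`
is integral for the elements that occur in `K_v^*`. -/
theorem im_eq_norm_of_norm_eq_one [Algebra ℚ K] {w : QA D K}
    (h : (1 + sqD D K * w).norm = 1) : w.im = w.norm := by
  have hD := cB_sq_cast D K
  have hD0 : (D : K) ≠ 0 := disc_cast_ne_zero D K
  apply mul_left_cancel₀ hD0
  rw [QuadraticAlgebra.norm_def] at h ⊢
  simp [sqD] at h
  linear_combination h + (w.im - (w.re * w.re + (cB D : K) * w.re * w.im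
    - (cA D : K) * w.im * w.im)) * (-hD)

/-- A solution of Hilbert 90: `√D w w̄ = √D Im w = w - w̄`, so `t = w̄` satisfies `t̄ = (1 + √D w)
t`. -/
theorem star_star_eq_mul {w : QA D K} (h : w.im = w.norm) :
    star (star w) = (1 + sqD D K * w) * star w := by
  have e1 := mul_star_eq w
  have e2 := sub_star_eq w
  rw [star_star, add_mul, one_mul, mul_assoc, e1, ← h]
  have : sqD D K * (⟨w.im, 0⟩ : QA D K) = w.im • sqD D K := by
    ext <;> simp [mul_comm]
  rw [this, ← e2]
  ring

/-- A second solution of the same equation, needed because it is an integral unit exactly where the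
solution `w̄` may fail to be one. -/
theorem star_one_sub_eq_mul {w : QA D K} (h : w.im = w.norm) :
    star (1 - star w * (⟨0, 1⟩ : QA D K)) =
      (1 + sqD D K * w) * (1 - star w * (⟨0, 1⟩ : QA D K)) := by
  have e1 := mul_star_eq w
  have e2 := sub_star_eq w
  have e3 : sqD D K = (⟨0, 1⟩ : QA D K) - star (⟨0, 1⟩ : QA D K) := by
    rw [sub_star_eq, one_smul]
  have e4 : sqD D K * (⟨w.im, 0⟩ : QA D K) = w.im • sqD D K := by
    ext <;> simp [mul_comm]
  have e5 : sqD D K * (w * star w) = w - star w := by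
    rw [e1, ← h, e4, e2]
  have e6 : star (1 - star w * (⟨0, 1⟩ : QA D K)) = 1 - w * star (⟨0, 1⟩ : QA D K) := by
    rw [star_sub, star_one, star_mul, star_star, mul_comm]
  rw [e6]
  generalize (⟨0, 1⟩ : QA D K) = o at *
  linear_combination o * e5 - w * e3

/-- Hilbert 90. The solution `t = w̄` is invertible unless `N w = 0`; then `Im w = 0` as well, which
forces `w = 0` and `u = 1`. No assumption that the algebra is a field is needed. -/
theorem exists_tor_of_mul [Algebra ℚ K] {u : QA D K} (h : u.norm = 1) :
    ∃ t : (QA D K)ˣ, ∀ z, (tor t).mat *ᵥ vec z = vec (u * z) := by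
  have hD0 : (D : K) ≠ 0 := disc_cast_ne_zero D K
  have hs := sqD_mul_self D K
  obtain ⟨w, rfl⟩ : ∃ w, u = 1 + sqD D K * w := by
    refine ⟨(D : K)⁻¹ • (sqD D K * (u - 1)), ?_⟩
    rw [mul_smul_comm, ← mul_assoc, hs]
    ext <;> simp [hD0]
  have hw := im_eq_norm_of_norm_eq_one h
  by_cases hn : w.norm = 0
  · have him : w.im = 0 := by rw [hw, hn]
    have hre : w.re = 0 := by
      rw [QuadraticAlgebra.norm_def, him] at hn
      simpa using hn
    refine ⟨1, fun z => ?_⟩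
    have : w = 0 := by ext <;> simp [him, hre]
    rw [this]
    simp
  · obtain ⟨t, ht⟩ := isUnit_of_norm_ne_zero (z := star w) (by rwa [QuadraticAlgebra.norm_star])
    refine ⟨t, fun z => ?_⟩
    rw [tor_vec]
    congr 2
    rw [ht, star_star_eq_mul hw, ← ht, mul_assoc, Units.mul_inv, mul_one]

theorem GD.vec_of_one_of_sqD [Algebra ℚ K] (g : GD D K) {u s : QA D K}
    (h1 : g.mat *ᵥ vec (1 : QA D K) = vec u) (h2 : g.mat *ᵥ vec (sqD D K) = vec s) (z : QA D K) :
    g.mat *ᵥ vec z = vec ((z.re + (cB D : K) * z.im / 2) • u + (z.im / 2) • s) := by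
  have : CharZero K := algebraRat.charZero K
  have : z = (z.re + (cB D : K) * z.im / 2) • (1 : QA D K) + (z.im / 2) • sqD D K := by
    ext
    · simp [sqD]; ring
    · simp [sqD]
  conv_lhs => rw [this]
  rw [vec_add, vec_smul, vec_smul, Matrix.mulVec_add, Matrix.mulVec_smul, Matrix.mulVec_smul, h1, h2,
    vec_add, vec_smul, vec_smul]

/-- Over a field every element of `G` is in the torus or in the coset of `σ̃`. -/
theorem GD.exists_tor [Algebra ℚ K] (g : GD D K) :
    ∃ t : (QA D K)ˣ, g = tor t ∨ g = tor t * sig D K := by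
  have hD0 : (D : K) ≠ 0 := disc_cast_ne_zero D K
  have hD := cB_sq_cast D K
  have : CharZero K := algebraRat.charZero K
  obtain ⟨u, hu⟩ := g.exists_vec (1 : QA D K)
  obtain ⟨s, hs⟩ := g.exists_vec (sqD D K)
  have b1 := g.bil_mat (vec (1 : QA D K)) (vec (1 : QA D K))
  have b2 := g.bil_mat (vec (1 : QA D K)) (vec (sqD D K))
  have b3 := g.bil_mat (vec (sqD D K)) (vec (sqD D K))
  rw [hu, bil_vec, bil_vec] at b1
  rw [hu, hs, bil_vec, bil_vec] at b2
  rw [hs, bil_vec, bil_vec] at b3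
  rw [mul_star_eq, mul_star_eq] at b1 b3
  have hsn : (sqD D K).norm = -(D : K) := by
    rw [QuadraticAlgebra.norm_def]; simp [sqD]; linear_combination -hD
  simp [QuadraticAlgebra.trace_def, hsn] at b1 b3
  -- The images `u` of `1` and `s` of `√D` are orthogonal, so `ū s` has trace zero and is a multiple
  -- of `√D`.
  have htr : (star u * s).trace = 0 := by
    rw [← QuadraticAlgebra.trace_star, star_mul, star_star, mul_comm, b2, one_mul, star_sqD]
    simp [QuadraticAlgebra.trace_def, sqD]
    ring
  have hus : star u * s = ((star u * s).im / 2) • sqD D K := by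
    rw [QuadraticAlgebra.trace_def] at htr
    ext
    · simp only [sqD, QuadraticAlgebra.re_smul, smul_eq_mul]; linear_combination htr / 2
    · simp [sqD]
  generalize (star u * s).im / 2 = c at hus
  have hsc : s = c • (u * sqD D K) := by
    rw [← mul_smul_comm, ← hus, ← mul_assoc, mul_star_eq, b1]
    ext <;> simp
  -- Comparing norms leaves only the orientation `c = ±1`.
  have hc : c ^ 2 = 1 := by
    have h4 : s.norm = c ^ 2 * (sqD D K).norm := by
      rw [hsc]
      have : c • (u * sqD D K) = algebraMap K (QA D K) c * (u * sqD D K) := by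
        rw [Algebra.smul_def]
      rw [this, map_mul, map_mul, b1, QuadraticAlgebra.norm_algebraMap, one_mul]
    rw [hsn] at h4
    have : (D : K) * (c ^ 2 - 1) = 0 := by linear_combination h4 - b3 / 2
    rcases mul_eq_zero.1 this with h | h
    · exact absurd h hD0
    · exact sub_eq_zero.1 h
  have hv := GD.vec_of_one_of_sqD g hu hs
  have hz : ∀ z : QA D K, star z =
      (z.re + (cB D : K) * z.im / 2) • (1 : QA D K) - (z.im / 2) • sqD D K := by
    intro z
    ext
    · simp [sqD]; ring
    · simp [sqD]
  have hz' : ∀ z : QA D K, z =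
      (z.re + (cB D : K) * z.im / 2) • (1 : QA D K) + (z.im / 2) • sqD D K := by
    intro z
    ext
    · simp [sqD]; ring
    · simp [sqD]
  rcases sq_eq_one_iff.1 hc with rfl | rfl
  · obtain ⟨t, ht⟩ := exists_tor_of_mul (D := D) (u := u) b1
    refine ⟨t, Or.inl (GD.ext_vec fun z => ?_)⟩
    rw [ht, hv, hsc, one_smul]
    congr 1
    conv_rhs => rw [hz' z]
    rw [mul_add, mul_smul_comm, mul_smul_comm, mul_one]
  -- Here `g` is `z ↦ u z̄ = (-u)(-z̄)`, the composite of a torus element with `σ̃`.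
  · obtain ⟨t, ht⟩ := exists_tor_of_mul (D := D) (u := -u) (by rw [QuadraticAlgebra.norm_neg, b1])
    refine ⟨t, Or.inr (GD.ext_vec fun z => ?_)⟩
    rw [GD.mul_vec, sig_vec, ht, hv, hsc, neg_one_smul]
    congr 1
    rw [neg_mul_neg, hz z, mul_sub, mul_smul_comm, mul_smul_comm, mul_one, smul_neg, sub_eq_add_neg]

end field

/-! ### Completions of `ℚ`: valuations, residues and Hensel's lemma -/

section places

/-- The valuation on the completion at a finite place. -/
abbrev vl (v : Pl) : Valuation (Qv v) (WithZero (Multiplicative ℤ)) := Valued.v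

theorem mem_O_iff {v : Pl} {x : Qv v} : x ∈ v.adicCompletionIntegers ℚ ↔ vl v x ≤ 1 :=
  mem_adicCompletionIntegers ℤ ℚ v

open Rat.HeightOneSpectrum in
theorem asIdeal_eq_span_primesEquiv (v : Pl) :
    v.asIdeal = Ideal.span {(((primesEquiv v : Nat.Primes) : ℕ) : ℤ)} := by
  have h := span_natGenerator v
  have h2 : Ideal.map (Rat.IsIntegralClosure.intEquiv ℤ) v.asIdeal = v.asIdeal := by
    ext x
    rw [Ideal.mem_map_of_equiv]
    constructor
    · rintro ⟨y, hy, rfl⟩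
      have : Rat.IsIntegralClosure.intEquiv ℤ y = y := by
        conv_lhs => rw [← Int.cast_id (n := y)]
        rw [map_intCast, Int.cast_id]
      rwa [this]
    · intro hx
      refine ⟨x, hx, ?_⟩
      conv_lhs => rw [← Int.cast_id (n := x)]
      rw [map_intCast, Int.cast_id]
  exact h2.symm.trans h.symm

open Rat.HeightOneSpectrum in
theorem primesEquiv_eq_resChar (v : Pl) : ((primesEquiv v : Nat.Primes) : ℕ) = resChar v := by
  rw [resChar, asIdeal_eq_span_primesEquiv, Ideal.absNorm_span_singleton]
  simp

theorem resChar_prime (v : Pl) : (resChar v).Prime := by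
  rw [← primesEquiv_eq_resChar]
  exact (Rat.HeightOneSpectrum.primesEquiv v).2

theorem asIdeal_eq_span (v : Pl) : v.asIdeal = Ideal.span {(resChar v : ℤ)} := by
  rw [asIdeal_eq_span_primesEquiv, primesEquiv_eq_resChar]

theorem resChar_injective : Function.Injective resChar := fun v w h =>
  HeightOneSpectrum.ext (by rw [asIdeal_eq_span v, asIdeal_eq_span w, h])

theorem exists_place {p : ℕ} (hp : p.Prime) : ∃ v : Pl, resChar v = p :=
  ⟨Rat.HeightOneSpectrum.primesEquiv.symm (show Nat.Primes from ⟨p, hp⟩),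
    (primesEquiv_eq_resChar _).symm.trans (congrArg Subtype.val (Equiv.apply_symm_apply _ _))⟩

theorem vl_ratCast (v : Pl) (x : ℚ) : vl v (algebraMap ℚ (Qv v) x) = v.valuation ℚ x :=
  valuedAdicCompletion_eq_valuation' v x

theorem vl_intCast (v : Pl) (n : ℤ) : vl v (n : Qv v) = v.intValuation n := by
  have := vl_ratCast v (n : ℚ)
  rw [map_intCast] at this
  rw [this]
  exact valuation_of_algebraMap v n

theorem vl_intCast_le (v : Pl) (n : ℤ) : vl v (n : Qv v) ≤ 1 := by
  rw [vl_intCast]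
  exact intValuation_le_one v n

theorem vl_intCast_lt_iff (v : Pl) (n : ℤ) : vl v (n : Qv v) < 1 ↔ (resChar v : ℤ) ∣ n := by
  rw [vl_intCast, intValuation_lt_one_iff_dvd, asIdeal_eq_span, Ideal.dvd_span_singleton,
    Ideal.mem_span_singleton]

theorem vl_intCast_eq_one (v : Pl) {n : ℤ} (h : ¬ (resChar v : ℤ) ∣ n) : vl v (n : Qv v) = 1 :=
  le_antisymm (vl_intCast_le v n) (not_lt.1 (mt (vl_intCast_lt_iff v n).1 h))

theorem vl_resChar (v : Pl) : vl v (resChar v : Qv v) = WithZero.exp (-1) := by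
  have := vl_intCast v (resChar v)
  rw [Int.cast_natCast] at this
  rw [this]
  exact intValuation_singleton v (by exact_mod_cast (resChar_prime v).ne_zero) (asIdeal_eq_span v)

theorem resChar_ne_zero (v : Pl) : (resChar v : Qv v) ≠ 0 := by
  have : CharZero (Qv v) := algebraRat.charZero _
  exact_mod_cast (resChar_prime v).ne_zero

theorem vl_intCast_eq_exp (v : Pl) {n : ℤ} (h : (resChar v : ℤ) ∣ n)
    (h' : ¬ (resChar v : ℤ) ^ 2 ∣ n) : vl v (n : Qv v) = WithZero.exp (-1) := by
  obtain ⟨m, rfl⟩ := h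
  have hm : ¬ (resChar v : ℤ) ∣ m := fun ⟨k, hk⟩ => h' ⟨k, by rw [hk]; ring⟩
  push_cast
  rw [map_mul, vl_intCast_eq_one v hm, vl_resChar, mul_one]

theorem exists_vl_eq_exp {v : Pl} {x : Qv v} (hx : x ≠ 0) : ∃ n : ℤ, vl v x = WithZero.exp n :=
  ⟨WithZero.log (vl v x), (WithZero.exp_log ((vl v).ne_zero_iff.2 hx)).symm⟩

theorem vl_zpow_resChar (v : Pl) (n : ℤ) :
    vl v ((resChar v : Qv v) ^ n) = WithZero.exp (-n) := by
  rw [map_zpow₀, vl_resChar, ← WithZero.exp_zsmul]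
  simp

theorem vl_lt_one_iff {v : Pl} (x : Qv v) : vl v x < 1 ↔ vl v x ≤ WithZero.exp (-1) := by
  by_cases hx : x = 0
  · simp [hx]
  obtain ⟨n, hn⟩ := exists_vl_eq_exp hx
  rw [hn, ← WithZero.exp_zero, WithZero.exp_lt_exp, WithZero.exp_le_exp]
  omega

theorem vl_lt_one_iff_div {v : Pl} (x : Qv v) : vl v x < 1 ↔ vl v (x / (resChar v : Qv v)) ≤ 1 := by
  rw [vl_lt_one_iff, map_div₀, vl_resChar, div_le_iff₀ (by simp), one_mul]

open Rat.HeightOneSpectrum in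
theorem norm_padicEquiv_le_one_iff {v : Pl} (x : Qv v) :
    ‖adicCompletion.padicEquiv v x‖ ≤ 1 ↔ vl v x ≤ 1 := by
  have h := adicCompletion.padicEquiv_bijOn v
  constructor
  · intro hx
    obtain ⟨y, hy, hxy⟩ := h.surjOn hx
    rw [← (adicCompletion.padicEquiv v).injective hxy]
    exact mem_O_iff.1 hy
  · intro hx
    exact h.mapsTo (mem_O_iff.2 hx)

open Rat.HeightOneSpectrum in
theorem norm_padicEquiv_lt_one_iff {v : Pl} (x : Qv v) :
    ‖adicCompletion.padicEquiv v x‖ < 1 ↔ vl v x < 1 := by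
  by_cases hx : x = 0
  · simp [hx]
  have h := norm_padicEquiv_le_one_iff x⁻¹
  have hx' : adicCompletion.padicEquiv v x ≠ 0 := by simpa using hx
  have h3 : 0 < ‖adicCompletion.padicEquiv v x‖ := norm_pos_iff.2 hx'
  have h4 : 0 < vl v x := (vl v).pos_iff.2 hx
  rw [map_inv₀, norm_inv, map_inv₀, inv_le_one₀ h3, inv_le_one₀ h4] at h
  exact not_iff_not.1 (by rw [not_lt, not_lt, h])

-- The residue field at `v` is the prime field; the integer is the standard residue of the
-- corresponding `p`-adic integer.
open Rat.HeightOneSpectrum in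
theorem exists_int_sub_lt {v : Pl} {x : Qv v} (hx : vl v x ≤ 1) :
    ∃ n : ℤ, vl v (x - n) < 1 := by
  have : Fact (Nat.Prime (primesEquiv v : Nat.Primes)) := ⟨(primesEquiv v).2⟩
  let y : ℤ_[(primesEquiv v : Nat.Primes)] :=
    ⟨adicCompletion.padicEquiv v x, (norm_padicEquiv_le_one_iff x).2 hx⟩
  refine ⟨(y.zmodRepr : ℕ), ?_⟩
  have h := PadicInt.norm_sub_zmodRepr_lt_one y
  rw [PadicInt.norm_def, PadicInt.coe_sub, PadicInt.coe_natCast] at h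
  rw [← norm_padicEquiv_lt_one_iff, map_sub, map_intCast, Int.cast_natCast]
  exact h

-- Hensel's lemma for `X² - bX - a`, transported from `ℤ_p`: the derivative at `r` is a unit.
open Rat.HeightOneSpectrum in
theorem exists_root_of_simple {v : Pl} (a b r : ℤ) (h : (resChar v : ℤ) ∣ r ^ 2 - b * r - a)
    (h' : ¬ (resChar v : ℤ) ∣ 2 * r - b) :
    ∃ ρ : Qv v, ρ ^ 2 - b * ρ - a = 0 ∧ vl v ρ ≤ 1 ∧ vl v (ρ - r) < 1 := by
  have : Fact (Nat.Prime (primesEquiv v : Nat.Primes)) := ⟨(primesEquiv v).2⟩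
  let F : Polynomial ℤ := Polynomial.X ^ 2 - Polynomial.C b * Polynomial.X - Polynomial.C a
  have hF : ∀ y : ℤ_[(primesEquiv v : Nat.Primes)],
      Polynomial.aeval y F = y ^ 2 - b * y - a := by
    intro y; simp [F]
  have hF' : ∀ y : ℤ_[(primesEquiv v : Nat.Primes)],
      Polynomial.aeval y (Polynomial.derivative F) = 2 * y - b := by
    intro y; simp [F, Polynomial.derivative_pow, map_ofNat]
  rw [← primesEquiv_eq_resChar] at h h'
  have h1 : ‖Polynomial.aeval (r : ℤ_[(primesEquiv v : Nat.Primes)]) F‖ < 1 := by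
    rw [hF]
    have := (PadicInt.norm_int_lt_one_iff_dvd (p := (primesEquiv v : Nat.Primes)) _).2 h
    push_cast at this
    exact this
  have h2 : ‖Polynomial.aeval (r : ℤ_[(primesEquiv v : Nat.Primes)]) (Polynomial.derivative F)‖ = 1 := by
    rw [hF']
    have := mt (PadicInt.norm_int_lt_one_iff_dvd (p := (primesEquiv v : Nat.Primes)) _).1 h'
    push_cast at this
    exact le_antisymm (PadicInt.norm_le_one _) (not_lt.1 this)
  obtain ⟨z, hz, hz', -⟩ := hensels_lemma (F := F) (a := (r : ℤ_[(primesEquiv v : Nat.Primes)]))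
    (by rw [h2, one_pow]; exact h1)
  rw [hF] at hz
  rw [h2] at hz'
  refine ⟨(adicCompletion.padicEquiv v).symm z, ?_, ?_, ?_⟩
  · apply (adicCompletion.padicEquiv v).injective
    have := congrArg (fun y : ℤ_[(primesEquiv v : Nat.Primes)] =>
      (y : ℚ_[(primesEquiv v : Nat.Primes)])) hz
    simpa using this
  · rw [← norm_padicEquiv_le_one_iff]
    simpa using z.2
  · rw [← norm_padicEquiv_lt_one_iff]
    rw [PadicInt.norm_def, PadicInt.coe_sub, PadicInt.coe_intCast] at hz'
    simpa using hz'

end places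

/-! ### The local lattice, its dual and the groups `K_v` and `K_v^*` -/

section localIntegral

variable {D : ℤ} {v : Pl}

/-- Membership in `ℤ_v ⊕ ℤ_v ω`. -/
def IntL (z : QA D (Qv v)) : Prop := vl v z.re ≤ 1 ∧ vl v z.im ≤ 1

theorem vl_add_le {x y : Qv v} (hx : vl v x ≤ 1) (hy : vl v y ≤ 1) : vl v (x + y) ≤ 1 :=
  (vl v).map_add_le hx hy

theorem vl_sub_le {x y : Qv v} (hx : vl v x ≤ 1) (hy : vl v y ≤ 1) : vl v (x - y) ≤ 1 :=
  (vl v).map_sub_le hx hy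

theorem vl_mul_le {x y : Qv v} (hx : vl v x ≤ 1) (hy : vl v y ≤ 1) : vl v (x * y) ≤ 1 := by
  rw [map_mul]; exact mul_le_one' hx hy

theorem IntL.add {z w : QA D (Qv v)} (hz : IntL z) (hw : IntL w) : IntL (z + w) :=
  ⟨vl_add_le hz.1 hw.1, vl_add_le hz.2 hw.2⟩

theorem IntL.neg {z : QA D (Qv v)} (hz : IntL z) : IntL (-z) := by
  refine ⟨?_, ?_⟩ <;> simp [Valuation.map_neg, hz.1, hz.2]

theorem IntL.sub {z w : QA D (Qv v)} (hz : IntL z) (hw : IntL w) : IntL (z - w) := by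
  rw [sub_eq_add_neg]; exact hz.add hw.neg

theorem IntL.mul {z w : QA D (Qv v)} (hz : IntL z) (hw : IntL w) : IntL (z * w) := by
  refine ⟨?_, ?_⟩
  · rw [QuadraticAlgebra.re_mul]
    exact vl_add_le (vl_mul_le hz.1 hw.1)
      (vl_mul_le (vl_mul_le (vl_intCast_le v _) hz.2) hw.2)
  · rw [QuadraticAlgebra.im_mul]
    exact vl_add_le (vl_add_le (vl_mul_le hz.1 hw.2) (vl_mul_le hz.2 hw.1))
      (vl_mul_le (vl_mul_le (vl_intCast_le v _) hz.2) hw.2)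

theorem IntL.smul {c : Qv v} {z : QA D (Qv v)} (hc : vl v c ≤ 1) (hz : IntL z) : IntL (c • z) :=
  ⟨vl_mul_le hc hz.1, vl_mul_le hc hz.2⟩

theorem IntL.star {z : QA D (Qv v)} (hz : IntL z) : IntL (star z) := by
  refine ⟨?_, ?_⟩
  · simp only [QuadraticAlgebra.re_star]
    exact vl_add_le hz.1 (vl_mul_le (vl_intCast_le v _) hz.2)
  · simp [Valuation.map_neg, hz.2]

theorem intL_one : IntL (1 : QA D (Qv v)) := by simp [IntL]

theorem intL_sqD : IntL (sqD D (Qv v)) := by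
  refine ⟨?_, ?_⟩
  · simp [sqD, Valuation.map_neg, vl_intCast_le]
  · have := vl_intCast_le v 2
    simpa [sqD] using this

theorem IntL.norm_le {z : QA D (Qv v)} (hz : IntL z) : vl v z.norm ≤ 1 := by
  have := (hz.mul hz.star).1
  rwa [mul_star_eq] at this

/-- The units of `ℤ_v ⊕ ℤ_v ω`. -/
def intUnits (D : ℤ) (v : Pl) : Subgroup (QA D (Qv v))ˣ where
  carrier := {t | IntL (t : QA D (Qv v)) ∧ IntL ((t⁻¹ : (QA D (Qv v))ˣ) : QA D (Qv v))}
  one_mem' := by simp [intL_one]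
  mul_mem' := fun h h' => ⟨h.1.mul h'.1, by rw [mul_inv]; exact h.2.mul h'.2⟩
  inv_mem' := fun h => ⟨h.2, by rw [inv_inv]; exact h.1⟩

theorem mem_intUnits_iff (t : (QA D (Qv v))ˣ) :
    t ∈ intUnits D v ↔ IntL (t : QA D (Qv v)) ∧ vl v (t : QA D (Qv v)).norm = 1 := by
  constructor
  · rintro ⟨h, h'⟩
    refine ⟨h, le_antisymm h.norm_le ?_⟩
    have h1 := h'.norm_le
    have h2 : vl v (t : QA D (Qv v)).norm *
        vl v ((t⁻¹ : (QA D (Qv v))ˣ) : QA D (Qv v)).norm = 1 := by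
      rw [← map_mul, ← map_mul, Units.mul_inv]
      simp
    calc 1 = _ := h2.symm
      _ ≤ vl v (t : QA D (Qv v)).norm * 1 := mul_le_mul_right h1 _
      _ = _ := mul_one _
  · rintro ⟨h, h'⟩
    refine ⟨h, ?_⟩
    rw [unit_inv_eq]
    exact IntL.smul (by rw [map_inv₀, h', inv_one]) h.star

theorem conjU_mem_intUnits {t : (QA D (Qv v))ˣ} (h : t ∈ intUnits D v) : conjU t ∈ intUnits D v :=
  ⟨h.1.star, by rw [← map_inv]; exact h.2.star⟩

variable [ImagDisc D]

/-- Integral Hilbert 90. If `N w` is a unit, take `w̄`. Otherwise `Im w = N w` is in the maximal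
ideal, hence so is `Re w`, and `1 - w̄ ω` has norm congruent to `1`. -/
theorem exists_intUnit {w : QA D (Qv v)} (hw : IntL w) {t : (QA D (Qv v))ˣ}
    (h : star (t : QA D (Qv v)) = (1 + sqD D (Qv v) * w) * t) :
    ∃ s ∈ intUnits D v, tor s = tor t := by
  have hn : (1 + sqD D (Qv v) * w).norm = 1 := by
    have := congrArg QuadraticAlgebra.norm h
    rw [QuadraticAlgebra.norm_star, map_mul] at this
    exact (mul_eq_right₀ (norm_ne_zero_of_unit t)).1 this.symm
  have him := im_eq_norm_of_norm_eq_one hn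
  suffices H : ∃ s ∈ intUnits D v,
      star (s : QA D (Qv v)) = (1 + sqD D (Qv v) * w) * s by
    obtain ⟨s, hs, hs'⟩ := H
    refine ⟨s, hs, GD.ext_vec fun z => ?_⟩
    rw [tor_vec, tor_vec, h, hs', mul_assoc _ (s : QA D (Qv v)), Units.mul_inv, mul_assoc _ (t : QA D (Qv v)),
      Units.mul_inv]
  by_cases hw1 : vl v w.norm = 1
  · obtain ⟨s, hs⟩ := isUnit_of_norm_ne_zero (z := star w) (by
      rw [QuadraticAlgebra.norm_star]
      intro h0
      simp [h0] at hw1)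
    refine ⟨s, (mem_intUnits_iff s).2 ?_, ?_⟩
    · rw [hs, QuadraticAlgebra.norm_star]
      exact ⟨hw.star, hw1⟩
    · rw [hs, star_star_eq_mul him]
  · have hlt : vl v w.norm < 1 := lt_of_le_of_ne hw.norm_le hw1
    have him' : vl v w.im < 1 := by rw [him]; exact hlt
    have hre : vl v w.re < 1 := by
      have e : w.re ^ 2 = w.im * (1 - (cB D : Qv v) * w.re + (cA D : Qv v) * w.im) := by
        have := him
        rw [QuadraticAlgebra.norm_def] at this
        linear_combination -this
      have h1 : vl v (1 - (cB D : Qv v) * w.re + (cA D : Qv v) * w.im) ≤ 1 :=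
        vl_add_le (vl_sub_le (by simp) (vl_mul_le (vl_intCast_le v _) hw.1))
          (vl_mul_le (vl_intCast_le v _) hw.2)
      have h2 : vl v w.re ^ 2 < 1 := by
        rw [← map_pow, e, map_mul]
        exact mul_lt_one_of_lt_of_le him' h1
      exact (pow_lt_one_iff (two_ne_zero)).1 h2
    have hint : IntL (1 - star w * (⟨0, 1⟩ : QA D (Qv v))) :=
      intL_one.sub (hw.star.mul ⟨by simp, by simp⟩)
    have hnorm : vl v (1 - star w * (⟨0, 1⟩ : QA D (Qv v))).norm = 1 := by
      have e : (1 - star w * (⟨0, 1⟩ : QA D (Qv v))).norm = 1 +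
          (w.im * (2 * (cA D : Qv v)) - (cB D : Qv v) * w.re - (cA D : Qv v) * w.norm) := by
        rw [QuadraticAlgebra.norm_def, QuadraticAlgebra.norm_def]
        simp
        ring
      have h1 : vl v (w.im * (2 * (cA D : Qv v)) - (cB D : Qv v) * w.re - (cA D : Qv v) * w.norm) < 1 := by
        refine (vl v).map_sub_lt ((vl v).map_sub_lt ?_ ?_) ?_
        · rw [map_mul]
          exact mul_lt_one_of_lt_of_le him' (vl_mul_le (by simpa using vl_intCast_le v 2) (vl_intCast_le v _))
        · rw [map_mul, mul_comm]
          exact mul_lt_one_of_lt_of_le hre (vl_intCast_le v _)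
        · rw [map_mul, mul_comm]
          exact mul_lt_one_of_lt_of_le hlt (vl_intCast_le v _)
      rw [e]
      exact (vl v).map_one_add_of_lt h1
    obtain ⟨s, hs⟩ := isUnit_of_norm_ne_zero (z := 1 - star w * (⟨0, 1⟩ : QA D (Qv v))) (by
      intro h0
      simp [h0] at hnorm)
    refine ⟨s, (mem_intUnits_iff s).2 ?_, ?_⟩
    · rw [hs]
      exact ⟨hint, hnorm⟩
    · rw [hs, star_one_sub_eq_mul him]

theorem mem_latXi_iff (u : Fin 3 → Qv v) :
    u ∈ latXi D v ↔ ∃ z : QA D (Qv v), IntL z ∧ u = vec z := by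
  constructor
  · rintro ⟨h, h'⟩
    obtain ⟨z, rfl⟩ := (perp_iff u).1 h'
    exact ⟨z, ⟨mem_O_iff.1 (h 1), mem_O_iff.1 (h 0)⟩, rfl⟩
  · rintro ⟨z, hz, rfl⟩
    refine ⟨fun i => mem_O_iff.2 ?_, (perp_iff _).2 ⟨z, rfl⟩⟩
    fin_cases i
    · exact hz.2
    · exact hz.1
    · exact vl_sub_le (vl_mul_le (vl_intCast_le v _) hz.1) (vl_mul_le (vl_intCast_le v _) hz.2)

theorem vec_mem_latXi {z : QA D (Qv v)} : vec z ∈ latXi D v ↔ IntL z :=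
  (mem_latXi_iff _).trans ⟨fun ⟨_, hw, e⟩ => vec_injective e ▸ hw, fun h => ⟨z, h, rfl⟩⟩

/-- By `bil_vec_eq` the coordinates of `√D z` are, up to sign, the pairings of `z` with `ω` and `1`,
so these two test vectors suffice. -/
theorem mem_latXiDual_iff (u : Fin 3 → Qv v) :
    u ∈ latXiDual D v ↔ ∃ z : QA D (Qv v), IntL (sqD D (Qv v) * z) ∧ u = vec z := by
  have e : ∀ z w : QA D (Qv v), bil (vec z) (vec w) =
      w.re * (sqD D (Qv v) * z).im - w.im * (sqD D (Qv v) * z).re := bil_vec_eq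
  constructor
  · rintro ⟨h, h'⟩
    obtain ⟨z, rfl⟩ := (perp_iff u).1 h
    refine ⟨z, ⟨?_, ?_⟩, rfl⟩
    · have := mem_O_iff.1 (h' (vec (⟨0, 1⟩ : QA D (Qv v))) (vec_mem_latXi.2 ⟨by simp, by simp⟩))
      rw [e, ← Valuation.map_neg] at this
      simpa using this
    · have := mem_O_iff.1 (h' (vec (⟨1, 0⟩ : QA D (Qv v))) (vec_mem_latXi.2 ⟨by simp, by simp⟩))
      rw [e] at this
      simpa using this
  · rintro ⟨z, hz, rfl⟩
    refine ⟨(perp_iff _).2 ⟨z, rfl⟩, fun w hw => ?_⟩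
    obtain ⟨w, hw', rfl⟩ := (mem_latXi_iff w).1 hw
    rw [mem_O_iff, e]
    exact vl_sub_le (vl_mul_le hw'.1 hz.2) (vl_mul_le hw'.2 hz.1)

theorem mem_locK_iff (h : GD D (Qv v)) : h ∈ locK D v ↔
    (∀ u ∈ latXi D v, h.mat *ᵥ u ∈ latXi D v) ∧ ∀ u ∈ latXi D v, h⁻¹.mat *ᵥ u ∈ latXi D v := by
  constructor
  · intro e
    have e' : (h.mat *ᵥ ·) '' latXi D v = latXi D v := e
    refine ⟨fun u hu => ?_, fun u hu => ?_⟩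
    · rw [← e']; exact ⟨u, hu, rfl⟩
    · rw [← e'] at hu
      obtain ⟨w, hw, rfl⟩ := hu
      rw [h.inv_mul_vec]
      exact hw
  · rintro ⟨h1, h2⟩
    refine Set.Subset.antisymm ?_ fun u hu => ⟨_, h2 u hu, ?_⟩
    · rintro _ ⟨u, hu, rfl⟩
      exact h1 u hu
    · have := h⁻¹.inv_mul_vec u
      rwa [inv_inv] at this

/-- `K_v^ξ` as a subgroup. -/
def locKGrp (D : ℤ) [ImagDisc D] (v : Pl) : Subgroup (GD D (Qv v)) where
  carrier := locK D v
  one_mem' := by simp [mem_locK_iff]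
  mul_mem' := by
    intro g h hg hh
    rw [mem_locK_iff] at *
    refine ⟨fun u hu => ?_, fun u hu => ?_⟩
    · rw [GD.mul_vec]; exact hg.1 _ (hh.1 u hu)
    · rw [mul_inv_rev, GD.mul_vec]; exact hh.2 _ (hg.2 u hu)
  inv_mem' := by
    intro g hg
    rw [mem_locK_iff] at *
    exact ⟨hg.2, by rw [inv_inv]; exact hg.1⟩

theorem latXi_add {u w : Fin 3 → Qv v} (hu : u ∈ latXi D v) (hw : w ∈ latXi D v) :
    u + w ∈ latXi D v := by
  obtain ⟨z, hz, rfl⟩ := (mem_latXi_iff _).1 hu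
  obtain ⟨z', hz', rfl⟩ := (mem_latXi_iff _).1 hw
  rw [← vec_add, vec_mem_latXi]
  exact hz.add hz'

theorem latXi_neg {u : Fin 3 → Qv v} (hu : u ∈ latXi D v) : -u ∈ latXi D v := by
  obtain ⟨z, hz, rfl⟩ := (mem_latXi_iff _).1 hu
  rw [← vec_neg, vec_mem_latXi]
  exact hz.neg

/-- `K_v^{ξ*}` as a subgroup. -/
def locKsGrp (D : ℤ) [ImagDisc D] (v : Pl) : Subgroup (GD D (Qv v)) where
  carrier := locKs D v
  one_mem' := ⟨(locKGrp D v).one_mem, fun u _ => by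
    simpa [vec_zero] using (vec_mem_latXi (D := D) (z := 0)).2 (by simp [IntL])⟩
  mul_mem' := by
    rintro g h ⟨hg, hg'⟩ ⟨hh, hh'⟩
    refine ⟨(locKGrp D v).mul_mem hg hh, fun u hu => ?_⟩
    rw [GD.mul_vec]
    have e : g.mat *ᵥ (h.mat *ᵥ u) - u = g.mat *ᵥ (h.mat *ᵥ u - u) + (g.mat *ᵥ u - u) := by
      rw [Matrix.mulVec_sub]; abel
    rw [e]
    exact latXi_add (((mem_locK_iff g).1 hg).1 _ (hh' u hu)) (hg' u hu)
  inv_mem' := by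
    rintro g ⟨hg, hg'⟩
    refine ⟨(locKGrp D v).inv_mem hg, fun u hu => ?_⟩
    have e : g⁻¹.mat *ᵥ u - u = -(g⁻¹.mat *ᵥ (g.mat *ᵥ u - u)) := by
      rw [Matrix.mulVec_sub, GD.inv_mul_vec]; abel
    rw [e]
    exact latXi_neg (((mem_locK_iff g).1 hg).2 _ (hg' u hu))

theorem tor_mem_locK {t : (QA D (Qv v))ˣ}
    (h : IntL (star (t : QA D (Qv v)) * ((t⁻¹ : (QA D (Qv v))ˣ) : QA D (Qv v)))) :
    tor t ∈ locK D v := by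
  rw [mem_locK_iff]
  refine ⟨fun u hu => ?_, fun u hu => ?_⟩
  · obtain ⟨z, hz, rfl⟩ := (mem_latXi_iff _).1 hu
    rw [tor_vec, vec_mem_latXi]
    exact h.mul hz
  · obtain ⟨z, hz, rfl⟩ := (mem_latXi_iff _).1 hu
    rw [← map_inv, tor_vec, vec_mem_latXi, inv_inv]
    refine IntL.mul ?_ hz
    have := h.star
    rwa [star_mul, star_star, mul_comm, mul_comm, ] at this

/-- On the dual lattice `s̄/s - 1 = -Im(s) √D/s`, and the factor `√D` carries the dual lattice back
into the lattice. -/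
theorem tor_mem_locKs {s : (QA D (Qv v))ˣ} (hs : s ∈ intUnits D v) : tor s ∈ locKs D v := by
  refine ⟨tor_mem_locK (hs.1.star.mul hs.2), fun u hu => ?_⟩
  obtain ⟨z, hz, rfl⟩ := (mem_latXiDual_iff _).1 hu
  rw [tor_vec, ← vec_sub, vec_mem_latXi]
  have e := sub_star_eq (s : QA D (Qv v))
  have e2 : star (s : QA D (Qv v)) * ((s⁻¹ : (QA D (Qv v))ˣ) : QA D (Qv v)) * z - z =
      (-(s : QA D (Qv v)).im) • (((s⁻¹ : (QA D (Qv v))ˣ) : QA D (Qv v)) * (sqD D (Qv v) * z)) := by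
    have e3 : star (s : QA D (Qv v)) = s - (s : QA D (Qv v)).im • sqD D (Qv v) := by
      rw [← e]; ring
    rw [e3, sub_mul, Units.mul_inv, sub_mul, one_mul, neg_smul, smul_mul_assoc, smul_mul_assoc,
      sub_sub_cancel_left, mul_left_comm, mul_assoc]
  rw [e2]
  exact IntL.smul (by rw [Valuation.map_neg]; exact hs.1.2) (hs.2.mul hz)

theorem sig_mem_locKs : sig D (Qv v) ∈ locKs D v := by
  have h1 : ∀ u ∈ latXi D v, (sig D (Qv v)).mat *ᵥ u ∈ latXi D v := by
    intro u hu
    obtain ⟨z, hz, rfl⟩ := (mem_latXi_iff _).1 hu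
    rw [sig_vec, vec_mem_latXi]
    exact hz.star.neg
  have hi : (sig D (Qv v))⁻¹ = sig D (Qv v) := inv_eq_of_mul_eq_one_left sig_mul_sig
  refine ⟨(mem_locK_iff _).2 ⟨h1, by rw [hi]; exact h1⟩, fun u hu => ?_⟩
  obtain ⟨z, hz, rfl⟩ := (mem_latXiDual_iff _).1 hu
  rw [sig_vec, ← vec_sub, vec_mem_latXi]
  rw [neg_star_sub_eq]
  exact ⟨by rw [Valuation.map_neg]; exact hz.2, by simp⟩

/-- Triviality on the discriminant group turns `t̄/t` into `1 + √D w` with `w` integral. Integral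
Hilbert 90 then replaces `t` by a unit with the same image. -/
theorem mem_locKs_iff (h : GD D (Qv v)) :
    h ∈ locKs D v ↔ ∃ s ∈ intUnits D v, h = tor s ∨ h = tor s * sig D (Qv v) := by
  constructor
  · intro hh
    have key : ∀ t : (QA D (Qv v))ˣ, tor t ∈ locKs D v → ∃ s ∈ intUnits D v, tor s = tor t := by
      intro t ht
      have hD0 : (D : Qv v) ≠ 0 := disc_cast_ne_zero D _
      have hs := sqD_mul_self D (Qv v)
      have hz : sqD D (Qv v) * ((D : Qv v)⁻¹ • sqD D (Qv v)) = 1 := by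
        rw [mul_smul_comm, hs]
        ext <;> simp [hD0]
      -- The test vector is `1/√D`, written as `D⁻¹ √D`; its displacement `(t̄/t - 1)/√D` is the
      -- integral element `w`.
      have h1 := ht.2 (vec ((D : Qv v)⁻¹ • sqD D (Qv v)))
        ((mem_latXiDual_iff _).2 ⟨_, by rw [hz]; exact intL_one, rfl⟩)
      rw [tor_vec, ← vec_sub, vec_mem_latXi] at h1
      refine exists_intUnit h1 ?_
      rw [mul_sub, mul_left_comm, hz, mul_one, add_sub_cancel, mul_assoc, Units.inv_mul, mul_one]
    obtain ⟨t, rfl | rfl⟩ := h.exists_tor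
    · obtain ⟨s, hs, e⟩ := key t hh
      exact ⟨s, hs, Or.inl e.symm⟩
    · obtain ⟨s, hs, e⟩ := key t (by
        have := (locKsGrp D v).mul_mem hh sig_mem_locKs
        rwa [mul_assoc, sig_mul_sig, mul_one] at this)
      exact ⟨s, hs, Or.inr (by rw [e])⟩
  · rintro ⟨s, hs, rfl | rfl⟩
    · exact tor_mem_locKs hs
    · exact (locKsGrp D v).mul_mem (tor_mem_locKs hs) sig_mem_locKs

end localIntegral

/-! ### Roots modulo `p` of the minimal polynomial of `ω` -/

section rootForm

/-- The value at `r` of the minimal polynomial of `ω`. -/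
def nf (D r : ℤ) : ℤ := r ^ 2 - cB D * r - cA D

theorem four_mul_nf (D r : ℤ) [ImagDisc D] : 4 * nf D r = (2 * r - cB D) ^ 2 - D := by
  rw [nf]
  linear_combination -cB_sq D

theorem nf_pos (D r : ℤ) [h : ImagDisc D] : 0 < nf D r := by
  have := four_mul_nf D r
  have := h.neg
  nlinarith [sq_nonneg (2 * r - cB D)]

theorem nf_add (D r k : ℤ) : nf D (r + k) = nf D r + k * (2 * r - cB D) + k ^ 2 := by
  rw [nf, nf]; ring

theorem nf_conj (D r : ℤ) : nf D (cB D - r) = nf D r := by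
  rw [nf, nf]; ring

/-- A fundamental discriminant is not divisible by the square of an odd prime. -/
theorem not_sq_dvd_disc (D : ℤ) [h : ImagDisc D] {p : ℕ} (hp : p.Prime) (h2 : p ≠ 2) :
    ¬ (p : ℤ) ^ 2 ∣ D := by
  intro hd
  have hu : ¬ IsUnit (p : ℤ) := (Nat.prime_iff_prime_int.1 hp).not_isUnit
  rcases h.isFundDisc.2 with ⟨-, hs⟩ | ⟨m, hm, hs, -⟩
  · exact hu (hs p (by rwa [← sq]))
  · refine hu (hs p ?_)
    rw [← sq]
    have hc : IsCoprime ((p : ℤ) ^ 2) 4 := by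
      have : Nat.Coprime p 2 := (Nat.coprime_primes hp Nat.prime_two).2 h2
      have h3 : IsCoprime (p : ℤ) 2 := by exact_mod_cast Nat.isCoprime_iff_coprime.2 this
      have := h3.pow (m := 2) (n := 2)
      norm_num at this ⊢
      exact this
    rw [hm] at hd
    exact hc.dvd_of_dvd_mul_left hd

/-- This is the maximality of `ℤ[ω]` at `p`, seen at a double root. For odd `p` the square of `p`
would divide `D = (2r - cB)² - 4 nf`. For `p = 2` the value is `r² - m` with `m ≡ 2, 3 mod 4`, which
is never divisible by `4`. -/
theorem not_sq_dvd_nf (D r : ℤ) [h : ImagDisc D] {p : ℕ} (hp : p.Prime)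
    (h1 : (p : ℤ) ∣ 2 * r - cB D) : ¬ (p : ℤ) ^ 2 ∣ nf D r := by
  intro h2
  by_cases hp2 : p = 2
  · subst hp2
    have hb : cB D = 0 := by
      unfold cB at *
      split_ifs at * with h4
      · rfl
      · exfalso
        rw [Nat.cast_ofNat] at h1
        omega
    have hD4 : D % 4 = 0 := by
      unfold cB at hb
      split_ifs at hb with h4
      exact h4
    rcases h.isFundDisc.2 with ⟨h5, -⟩ | ⟨m, hm, -, hm4⟩
    · omega
    · have ha : cA D = m := by
        rw [cA, if_pos hD4]; omega
      rw [nf, hb, ha] at h2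
      norm_num at h2
      have : r ^ 2 % 4 = 0 ∨ r ^ 2 % 4 = 1 := by
        rcases Int.even_or_odd' r with ⟨k, rfl | rfl⟩
        · left; ring_nf; omega
        · right; ring_nf; omega
      omega
  · refine not_sq_dvd_disc D hp hp2 ?_
    have := four_mul_nf D r
    have e : D = (2 * r - cB D) ^ 2 - 4 * nf D r := by linear_combination this
    rw [e]
    exact dvd_sub (pow_dvd_pow_of_dvd h1 2) (h2.mul_left 4)

/-- `r` is a root modulo `p` but not modulo `p ^ 2` of the minimal polynomial of `ω`. -/
def IsRootAt (D : ℤ) (v : Pl) (r : ℤ) : Prop :=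
  (resChar v : ℤ) ∣ nf D r ∧ ¬ (resChar v : ℤ) ^ 2 ∣ nf D r

theorem IsRootAt.conj {D r : ℤ} {v : Pl} (h : IsRootAt D v r) : IsRootAt D v (cB D - r) := by
  rw [IsRootAt, nf_conj]; exact h

/-- If `p²` divides the value, the root is simple by `not_sq_dvd_nf`, and the shift by `p` changes
the value by `p (2r - cB)` modulo `p²`. Valuation exactly one makes `ω - r` a local generator of a
prime ideal. -/
theorem exists_isRootAt {D : ℤ} [ImagDisc D] {v : Pl} {r : ℤ} (h : (resChar v : ℤ) ∣ nf D r) :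
    ∃ k : ℤ, IsRootAt D v (r + k * resChar v) := by
  by_cases h2 : (resChar v : ℤ) ^ 2 ∣ nf D r
  · have h1 : ¬ (resChar v : ℤ) ∣ 2 * r - cB D := fun h1 =>
      not_sq_dvd_nf D r (resChar_prime v) h1 h2
    have hp0 : (resChar v : ℤ) ≠ 0 := by exact_mod_cast (resChar_prime v).ne_zero
    refine ⟨1, ?_, ?_⟩
    · rw [one_mul, nf_add]
      exact dvd_add (dvd_add h (dvd_mul_right _ _)) (dvd_pow_self _ two_ne_zero)
    · rw [one_mul, nf_add]
      intro h3
      have h4 : (resChar v : ℤ) ^ 2 ∣ resChar v * (2 * r - cB D) := by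
        have := dvd_sub (dvd_sub h3 (dvd_refl _)) h2
        ring_nf at this ⊢
        exact this
      rw [sq] at h4
      exact h1 (Int.dvd_of_mul_dvd_mul_left hp0 h4)
  · exact ⟨0, by rw [zero_mul, add_zero]; exact ⟨h, h2⟩⟩

end rootForm

/-! ### The elements `ω - r` and the scalars -/

section piElem

/-- The element `ω - r`. -/
def piE (D r : ℤ) (R : Type) [CommRing R] : QA D R := ⟨-(r : R), 1⟩

variable {R : Type} [CommRing R] {D r : ℤ}

theorem norm_piE : (piE D r R).norm = (nf D r : R) := by
  rw [QuadraticAlgebra.norm_def]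
  simp [piE, nf]
  ring

theorem star_piE : star (piE D r R) = -piE D (cB D - r) R := by
  ext
  · simp [piE]; ring
  · simp [piE]

theorem mul_star_piE (z : QA D R) : z * star (piE D r R) =
    ⟨((cB D : R) - r) * (z.re + r * z.im) + z.im * (nf D r : R), -(z.re + r * z.im)⟩ := by
  ext
  · simp [piE, nf]; ring
  · simp [piE]; ring

theorem mul_piE (z : QA D R) : z * piE D r R =
    ⟨-(r : R) * (z.re + ((cB D : R) - r) * z.im) - z.im * (nf D r : R),
      z.re + ((cB D : R) - r) * z.im⟩ := by
  ext
  · simp [piE, nf]; ring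
  · simp [piE]; ring

/-- Modulo `nf D r` the norm is the product of the evaluations at the two roots `r` and `cB - r`;
this drives the descent on the valuation of the norm. -/
theorem norm_eq_root (z : QA D R) (r : ℤ) : z.norm =
    (z.re + r * z.im) * (z.re + ((cB D : R) - r) * z.im) + z.im ^ 2 * (nf D r : R) := by
  rw [QuadraticAlgebra.norm_def]
  simp [nf]
  ring

theorem nf_cast_ne_zero (D r : ℤ) [ImagDisc D] (K : Type) [Field K] [Algebra ℚ K] :
    (nf D r : K) ≠ 0 := by
  have : CharZero K := algebraRat.charZero K
  exact_mod_cast (nf_pos D r).ne'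

theorem exists_piU (D r : ℤ) [ImagDisc D] (K : Type) [Field K] [Algebra ℚ K] :
    ∃ t : (QA D K)ˣ, (t : QA D K) = piE D r K :=
  isUnit_of_norm_ne_zero (by rw [norm_piE]; exact nf_cast_ne_zero D r K)

theorem star_piE_mul_self : star (piE D r R) * star (piE D r R) =
    -(((2 * r - cB D : ℤ) : R) • star (piE D r R)) - (nf D r : R) • 1 := by
  ext <;> simp [piE, nf] <;> ring

/-- The unit `ω - r`. -/
def piU (D r : ℤ) [ImagDisc D] (K : Type) [Field K] [Algebra ℚ K] : (QA D K)ˣ :=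
  (exists_piU D r K).choose

theorem piU_val (D r : ℤ) [ImagDisc D] (K : Type) [Field K] [Algebra ℚ K] :
    (piU D r K : QA D K) = piE D r K :=
  (exists_piU D r K).choose_spec

/-- The scalar units. -/
def scal {R : Type} [CommRing R] {D : ℤ} : Rˣ →* (QA D R)ˣ :=
  Units.map (algebraMap R (QA D R) : R →* QA D R)

theorem scal_val (q : Rˣ) : ((scal q : (QA D R)ˣ) : QA D R) = ⟨q, 0⟩ := rfl

theorem scal_mul_val (q : Rˣ) (t : (QA D R)ˣ) : ((scal q * t : (QA D R)ˣ) : QA D R) =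
    (q : R) • (t : QA D R) := by
  rw [Units.val_mul, scal_val]
  ext <;> simp

theorem tor_scal [ImagDisc D] [Algebra ℚ R] (q : Rˣ) : tor (scal q : (QA D R)ˣ) = 1 := by
  rw [tor_eq_one_iff]
  rfl

theorem exists_scal_of_tor_eq_one [ImagDisc D] {K : Type} [Field K] [Algebra ℚ K] {t : (QA D K)ˣ}
    (h : tor t = 1) : ∃ q : Kˣ, t = scal q := by
  rw [tor_eq_one_iff] at h
  have hn := norm_ne_zero_of_unit t
  rw [QuadraticAlgebra.norm_def, h] at hn
  have hre : (t : QA D K).re ≠ 0 := by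
    intro h0
    simp [h0] at hn
  refine ⟨Units.mk0 _ hre, ?_⟩
  ext
  · rfl
  · exact h

theorem norm_smul_qa (c : R) (z : QA D R) : (c • z).norm = c ^ 2 * z.norm := by
  rw [QuadraticAlgebra.norm_def, QuadraticAlgebra.norm_def]
  simp
  ring

theorem mul_conjU (t : (QA D R)ˣ) : ((t * conjU t : (QA D R)ˣ) : QA D R) =
    ⟨(t : QA D R).norm, 0⟩ := by
  rw [Units.val_mul, conjU_val, mul_star_eq]

end piElem

/-! ### The local torus modulo scalars and integral units -/

section decomposition

variable {D : ℤ} {v : Pl}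

/-- The products of a scalar and an integral unit. -/
def scalInt (D : ℤ) (v : Pl) : Subgroup (QA D (Qv v))ˣ :=
  (scal : (Qv v)ˣ →* (QA D (Qv v))ˣ).range ⊔ intUnits D v

theorem mem_scalInt {t : (QA D (Qv v))ˣ} :
    t ∈ scalInt D v ↔ ∃ q : (Qv v)ˣ, ∃ s ∈ intUnits D v, scal q * s = t := by
  rw [scalInt, Subgroup.mem_sup]
  constructor
  · rintro ⟨_, ⟨q, rfl⟩, s, hs, h⟩
    exact ⟨q, s, hs, h⟩
  · rintro ⟨q, s, hs, h⟩
    exact ⟨_, ⟨q, rfl⟩, s, hs, h⟩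

theorem scal_mem_scalInt (q : (Qv v)ˣ) : (scal q : (QA D (Qv v))ˣ) ∈ scalInt D v :=
  Subgroup.mem_sup_left ⟨q, rfl⟩

theorem intUnits_le_scalInt : intUnits D v ≤ scalInt D v := le_sup_right

theorem scal_mul_mem_scalInt_iff (q : (Qv v)ˣ) (t : (QA D (Qv v))ˣ) :
    scal q * t ∈ scalInt D v ↔ t ∈ scalInt D v :=
  Subgroup.mul_mem_cancel_left _ (scal_mem_scalInt q)

variable (v) in
/-- The prime at `v` as a unit of the completion. -/
def resU : (Qv v)ˣ := Units.mk0 (resChar v : Qv v) (resChar_ne_zero v)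

theorem vl_pos {x : Qv v} (hx : x ≠ 0) : 0 < vl v x := (vl v).pos_iff.2 hx

/-- Every unit is a scalar multiple of a primitive integral element. -/
theorem exists_primitive (t : (QA D (Qv v))ˣ) : ∃ q : (Qv v)ˣ,
    IntL ((scal q * t : (QA D (Qv v))ˣ) : QA D (Qv v)) ∧
    (vl v ((scal q * t : (QA D (Qv v))ˣ) : QA D (Qv v)).re = 1 ∨
      vl v ((scal q * t : (QA D (Qv v))ˣ) : QA D (Qv v)).im = 1) := by
  have hn := norm_ne_zero_of_unit t
  have key : ∀ x : Qv v, x ≠ 0 → vl v (t : QA D (Qv v)).re ≤ vl v x →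
      vl v (t : QA D (Qv v)).im ≤ vl v x →
      (x = (t : QA D (Qv v)).re ∨ x = (t : QA D (Qv v)).im) → ∃ q : (Qv v)ˣ,
    IntL ((scal q * t : (QA D (Qv v))ˣ) : QA D (Qv v)) ∧
    (vl v ((scal q * t : (QA D (Qv v))ˣ) : QA D (Qv v)).re = 1 ∨
      vl v ((scal q * t : (QA D (Qv v))ˣ) : QA D (Qv v)).im = 1) := by
    intro x hx h1 h2 h3
    have e : ∀ y : Qv v, vl v y ≤ vl v x → vl v (x⁻¹ * y) ≤ 1 := by
      intro y hy
      rw [map_mul, map_inv₀, inv_mul_le_iff₀ (vl_pos hx), mul_one]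
      exact hy
    refine ⟨(Units.mk0 x hx)⁻¹, ?_⟩
    rw [scal_mul_val, Units.val_inv_eq_inv_val, Units.val_mk0]
    refine ⟨⟨e _ h1, e _ h2⟩, ?_⟩
    rcases h3 with h3 | h3
    · left
      rw [QuadraticAlgebra.re_smul, ← h3, smul_eq_mul, inv_mul_cancel₀ hx, map_one]
    · right
      rw [QuadraticAlgebra.im_smul, ← h3, smul_eq_mul, inv_mul_cancel₀ hx, map_one]
  rcases le_total (vl v (t : QA D (Qv v)).re) (vl v (t : QA D (Qv v)).im) with h | h
  · refine key _ (fun h0 => hn ?_) h le_rfl (Or.inr rfl)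
    rw [h0, map_zero, le_zero_iff, map_eq_zero] at h
    rw [QuadraticAlgebra.norm_def, h, h0]; ring
  · refine key _ (fun h0 => hn ?_) le_rfl h (Or.inl rfl)
    rw [h0, map_zero, le_zero_iff, map_eq_zero] at h
    rw [QuadraticAlgebra.norm_def, h, h0]; ring

theorem vl_nf (D : ℤ) {v : Pl} {r : ℤ} (h : IsRootAt D v r) :
    vl v (nf D r : Qv v) = WithZero.exp (-1) := vl_intCast_eq_exp v h.1 h.2

theorem vl_inv_nf_mul_le {r : ℤ} (h : IsRootAt D v r) {x : Qv v} (hx : vl v x < 1) :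
    vl v ((nf D r : Qv v)⁻¹ * x) ≤ 1 := by
  rw [map_mul, map_inv₀, vl_nf D h, ← WithZero.exp_neg, neg_neg]
  rw [vl_lt_one_iff] at hx
  calc _ ≤ WithZero.exp (1 : ℤ) * WithZero.exp (-1 : ℤ) := by gcongr
    _ = 1 := by rw [← WithZero.exp_add]; simp

variable [ImagDisc D]

theorem piU_inv (r : ℤ) : (((piU D r (Qv v))⁻¹ : (QA D (Qv v))ˣ) : QA D (Qv v)) =
    (nf D r : Qv v)⁻¹ • star (piE D r (Qv v)) := by
  rw [unit_inv_eq, piU_val, norm_piE]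

theorem conjU_piU_inv (r : ℤ) : (((conjU (piU D r (Qv v)))⁻¹ : (QA D (Qv v))ˣ) : QA D (Qv v)) =
    (nf D r : Qv v)⁻¹ • piE D r (Qv v) := by
  rw [unit_inv_eq, conjU_val, QuadraticAlgebra.norm_star, star_star, piU_val, norm_piE]

theorem scal_mul_piU_inv_eq (r : ℤ) (t : (QA D (Qv v))ˣ) :
    t * (conjU (piU D r (Qv v)))⁻¹ * (piU D r (Qv v))⁻¹ ∈ scalInt D v ↔ t ∈ scalInt D v := by
  have : t * (conjU (piU D r (Qv v)))⁻¹ * (piU D r (Qv v))⁻¹ =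
      scal (Units.mk0 _ (nf_cast_ne_zero D r (Qv v)))⁻¹ * t := by
    rw [mul_assoc, ← mul_inv, mul_comm (conjU _), mul_comm t]
    congr 1
    rw [map_inv]
    congr 1
    ext1
    rw [mul_conjU, piU_val, norm_piE]
    rfl
  rw [this, scal_mul_mem_scalInt_iff]

/-- Descent on the valuation of the norm: an integral element of nonunit norm can be divided by `ω -
r` or by its conjugate, which lowers the valuation by one. -/
theorem exists_mul_zpow_of_intL {r : ℤ} (hr : IsRootAt D v r) (n : ℕ) (t : (QA D (Qv v))ˣ)
    (ht : IntL (t : QA D (Qv v))) (hn : vl v (t : QA D (Qv v)).norm = WithZero.exp (-(n : ℤ))) :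
    ∃ k : ℤ, t * piU D r (Qv v) ^ k ∈ scalInt D v := by
  induction n generalizing t with
  | zero =>
    refine ⟨0, ?_⟩
    rw [zpow_zero, mul_one]
    exact intUnits_le_scalInt ((mem_intUnits_iff t).2 ⟨ht, by simpa using hn⟩)
  | succ n ih =>
    have hnf := vl_nf D hr
    have hnf1 : vl v (nf D r : Qv v) < 1 := (vl_intCast_lt_iff v _).2 hr.1
    have hlt : vl v (t : QA D (Qv v)).norm < 1 := by
      rw [hn, ← WithZero.exp_zero, WithZero.exp_lt_exp]
      push_cast; omega
    have hprod : vl v (((t : QA D (Qv v)).re + r * (t : QA D (Qv v)).im) *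
        ((t : QA D (Qv v)).re + ((cB D : Qv v) - r) * (t : QA D (Qv v)).im)) < 1 := by
      have e : ((t : QA D (Qv v)).re + r * (t : QA D (Qv v)).im) *
        ((t : QA D (Qv v)).re + ((cB D : Qv v) - r) * (t : QA D (Qv v)).im) =
          (t : QA D (Qv v)).norm - (t : QA D (Qv v)).im ^ 2 * (nf D r : Qv v) := by
        rw [norm_eq_root _ r]; ring
      rw [e]
      refine (vl v).map_sub_lt hlt ?_
      rw [map_mul, mul_comm]
      refine mul_lt_one_of_lt_of_le hnf1 ?_
      rw [map_pow]
      exact pow_le_one' ht.2 2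
    have hbr : vl v ((cB D : Qv v) - r) ≤ 1 := vl_sub_le (vl_intCast_le v _) (vl_intCast_le v _)
    have himnf : vl v ((t : QA D (Qv v)).im * (nf D r : Qv v)) < 1 := by
      rw [map_mul, mul_comm]
      exact mul_lt_one_of_lt_of_le hnf1 ht.2
    have hnval : ∀ z : QA D (Qv v), vl v z.norm = WithZero.exp (-1) →
        vl v ((nf D r : Qv v)⁻¹ • ((t : QA D (Qv v)) * z)).norm = WithZero.exp (-(n : ℤ)) := by
      intro z hz
      rw [norm_smul_qa, map_mul, map_mul, map_mul, map_pow, map_inv₀, hnf, hn, hz,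
        ← WithZero.exp_neg, ← WithZero.exp_nsmul, ← WithZero.exp_add, ← WithZero.exp_add]
      congr 1
      push_cast
      ring
    -- The product of the two evaluations is a nonunit, so one factor is; this factor is what must
    -- vanish modulo `p` for the division to stay integral.
    have hcase : vl v ((t : QA D (Qv v)).re + r * (t : QA D (Qv v)).im) < 1 ∨
        vl v ((t : QA D (Qv v)).re + ((cB D : Qv v) - r) * (t : QA D (Qv v)).im) < 1 := by
      by_contra! hc
      rw [map_mul] at hprod
      exact absurd hprod (not_lt.2 (one_le_mul hc.1 hc.2))
    rcases hcase with h | h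
    · obtain ⟨k, hk⟩ := ih (t * (piU D r (Qv v))⁻¹) (by
        rw [Units.val_mul, piU_inv, mul_smul_comm, mul_star_piE]
        refine ⟨vl_inv_nf_mul_le hr ((vl v).map_add_lt ?_ himnf), vl_inv_nf_mul_le hr ?_⟩
        · rw [map_mul, mul_comm]
          exact mul_lt_one_of_lt_of_le h hbr
        · rwa [Valuation.map_neg]) (by
        rw [Units.val_mul, piU_inv, mul_smul_comm]
        exact hnval _ (by rw [QuadraticAlgebra.norm_star, norm_piE, hnf]))
      refine ⟨-1 + k, ?_⟩
      rwa [zpow_add, zpow_neg_one, ← mul_assoc]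
    · obtain ⟨k, hk⟩ := ih (t * (conjU (piU D r (Qv v)))⁻¹) (by
        rw [Units.val_mul, conjU_piU_inv, mul_smul_comm, mul_piE]
        refine ⟨vl_inv_nf_mul_le hr ((vl v).map_sub_lt ?_ himnf), vl_inv_nf_mul_le hr h⟩
        rw [map_mul, mul_comm]
        refine mul_lt_one_of_lt_of_le h ?_
        rw [Valuation.map_neg]
        exact vl_intCast_le v _) (by
        rw [Units.val_mul, conjU_piU_inv, mul_smul_comm]
        exact hnval _ (by rw [norm_piE, hnf]))
      -- The product `π π̄` is a scalar, so dividing by `π̄` amounts to multiplying by `π`.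
      refine ⟨k + 1, ?_⟩
      rw [← scal_mul_piU_inv_eq r] 
      convert hk using 1
      rw [zpow_add_one, ← mul_assoc, mul_right_comm (t * _), mul_inv_cancel_right, mul_right_comm]

theorem exists_mul_zpow_mem {r : ℤ} (hr : IsRootAt D v r) (t : (QA D (Qv v))ˣ) :
    ∃ k : ℤ, t * piU D r (Qv v) ^ k ∈ scalInt D v := by
  obtain ⟨q, hq, -⟩ := exists_primitive t
  obtain ⟨n, hn⟩ := exists_vl_eq_exp (norm_ne_zero_of_unit (scal q * t))
  have hn0 : n ≤ 0 := by
    have := hq.norm_le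
    rwa [hn, ← WithZero.exp_zero, WithZero.exp_le_exp] at this
  obtain ⟨k, hk⟩ := exists_mul_zpow_of_intL hr n.natAbs _ hq (by
    rw [hn]; congr 1; omega)
  refine ⟨k, ?_⟩
  rwa [mul_assoc, scal_mul_mem_scalInt_iff] at hk

/-- A primitive element has unit norm. If its `ω`-coordinate is a unit, the norm is a unit square
times a value of `nf` modulo `p`, which is nonzero. Otherwise the norm is congruent to the square of
the unit real coordinate. -/
theorem mem_scalInt_of_inert (h : ∀ r : ℤ, ¬ (resChar v : ℤ) ∣ nf D r) (t : (QA D (Qv v))ˣ) :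
    t ∈ scalInt D v := by
  obtain ⟨q, hq, hp⟩ := exists_primitive t
  rw [← scal_mul_mem_scalInt_iff q]
  generalize scal q * t = s at *
  refine intUnits_le_scalInt ((mem_intUnits_iff s).2 ⟨hq, ?_⟩)
  by_cases him : vl v (s : QA D (Qv v)).im = 1
  · have him0 : (s : QA D (Qv v)).im ≠ 0 := by
      intro h0; simp [h0] at him
    obtain ⟨r, hr⟩ := exists_int_sub_lt (x := -(s : QA D (Qv v)).re / (s : QA D (Qv v)).im) (by
      rw [map_div₀, him, div_one, Valuation.map_neg]; exact hq.1)
    generalize hρ : -(s : QA D (Qv v)).re / (s : QA D (Qv v)).im = ρ at hr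
    have hre : (s : QA D (Qv v)).re = -ρ * (s : QA D (Qv v)).im := by
      rw [← hρ]; field_simp
    have hρ1 : vl v ρ ≤ 1 := by
      rw [← hρ, map_div₀, him, div_one, Valuation.map_neg]; exact hq.1
    have e : (s : QA D (Qv v)).norm = (s : QA D (Qv v)).im ^ 2 *
        ((nf D r : Qv v) + (ρ - r) * (ρ + r - (cB D : Qv v))) := by
      rw [QuadraticAlgebra.norm_def, hre]
      simp only [nf]; push_cast; ring
    have h1 : vl v ((ρ - r) * (ρ + r - (cB D : Qv v))) < 1 := by
      rw [map_mul]
      exact mul_lt_one_of_lt_of_le hr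
        (vl_sub_le (vl_add_le hρ1 (vl_intCast_le v _)) (vl_intCast_le v _))
    rw [e, map_mul, map_pow, him, one_pow, one_mul]
    rw [(vl v).map_add_eq_of_lt_left (by rw [vl_intCast_eq_one v (h r)]; exact h1), vl_intCast_eq_one v (h r)]
  · have him1 : vl v (s : QA D (Qv v)).im < 1 := lt_of_le_of_ne hq.2 him
    have hre := hp.resolve_right him
    have e : (s : QA D (Qv v)).norm = (s : QA D (Qv v)).re ^ 2 +
        (s : QA D (Qv v)).im * ((cB D : Qv v) * (s : QA D (Qv v)).re - (cA D : Qv v) * (s : QA D (Qv v)).im) := by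
      rw [QuadraticAlgebra.norm_def]; ring
    have h1 : vl v ((s : QA D (Qv v)).im * ((cB D : Qv v) * (s : QA D (Qv v)).re -
        (cA D : Qv v) * (s : QA D (Qv v)).im)) < 1 := by
      rw [map_mul]
      exact mul_lt_one_of_lt_of_le him1
        (vl_sub_le (vl_mul_le (vl_intCast_le v _) hq.1) (vl_mul_le (vl_intCast_le v _) hq.2))
    rw [e, (vl v).map_add_eq_of_lt_left (by rw [map_pow, hre, one_pow]; exact h1), map_pow, hre, one_pow]

/-- The kernel of the torus map consists of the scalars and the torus is disjoint from the coset of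
`σ̃`, so `mem_locKs_iff` can be pulled back to `t`. -/
theorem tor_mem_locKs_iff (t : (QA D (Qv v))ˣ) : tor t ∈ locKs D v ↔ t ∈ scalInt D v := by
  rw [mem_locKs_iff, mem_scalInt]
  constructor
  · rintro ⟨s, hs, h | h⟩
    · have : tor (t * s⁻¹) = 1 := by rw [map_mul, map_inv, h, mul_inv_cancel]
      obtain ⟨q, hq⟩ := exists_scal_of_tor_eq_one this
      exact ⟨q, s, hs, by rw [← hq, inv_mul_cancel_right]⟩
    · exfalso
      refine tor_ne_sig (s⁻¹ * t) ?_
      rw [map_mul, h, map_inv, inv_mul_cancel_left]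
  · rintro ⟨q, s, hs, rfl⟩
    exact ⟨s, hs, Or.inl (by rw [map_mul, tor_scal, one_mul])⟩

theorem tor_mul_sig_mem_locKs_iff (t : (QA D (Qv v))ˣ) :
    tor t * sig D (Qv v) ∈ locKs D v ↔ t ∈ scalInt D v := by
  rw [← tor_mem_locKs_iff]
  exact Subgroup.mul_mem_cancel_right (locKsGrp D v) sig_mem_locKs

theorem locK_eq_locKs_of_inert (h : ∀ r : ℤ, ¬ (resChar v : ℤ) ∣ nf D r) :
    locK D v = locKs D v := by
  refine Set.Subset.antisymm (fun g _ => ?_) fun g hg => hg.1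
  obtain ⟨t, rfl | rfl⟩ := g.exists_tor
  · exact (tor_mem_locKs_iff t).2 (mem_scalInt_of_inert h t)
  · exact (tor_mul_sig_mem_locKs_iff t).2 (mem_scalInt_of_inert h t)

/-! ### Ramified places: the group `K_v / K_v^*` of order two -/

section ramified

variable {r : ℤ} (hr : IsRootAt D v r) (hram : (resChar v : ℤ) ∣ 2 * r - cB D)
include hr

/-- The norm of a scalar times a unit has even valuation, whereas `N(ω - r)` has valuation one. -/
theorem piU_not_mem_scalInt : piU D r (Qv v) ∉ scalInt D v := by
  rw [mem_scalInt]
  rintro ⟨q, s, hs, h⟩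
  have h1 := congrArg (fun t : (QA D (Qv v))ˣ => vl v (t : QA D (Qv v)).norm) h
  rw [scal_mul_val, norm_smul_qa, map_mul, ((mem_intUnits_iff s).1 hs).2, mul_one, piU_val, norm_piE,
    vl_nf D hr] at h1
  obtain ⟨n, hn⟩ := exists_vl_eq_exp q.ne_zero
  rw [map_pow, hn, ← WithZero.exp_nsmul] at h1
  have := WithZero.exp_injective h1
  simp at this
  omega

include hram

/-- One has `π̄/π = π̄²/N(π)` and `π̄² = -(2r - cB) π̄ - N(π)`. Ramification makes the coefficient
`2r - cB` divisible by `p`, hence by `N(π)`. -/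
theorem intL_conj_div_piU : IntL (star (piU D r (Qv v) : QA D (Qv v)) *
    (((piU D r (Qv v))⁻¹ : (QA D (Qv v))ˣ) : QA D (Qv v))) := by
  obtain ⟨c, hc⟩ := hram
  have h1 : vl v ((nf D r : Qv v)⁻¹ * ((2 * r - cB D : ℤ) : Qv v)) ≤ 1 :=
    vl_inv_nf_mul_le hr ((vl_intCast_lt_iff v _).2 ⟨c, hc⟩)
  have hnf := nf_cast_ne_zero D r (Qv v)
  have e : star (piU D r (Qv v) : QA D (Qv v)) *
    (((piU D r (Qv v))⁻¹ : (QA D (Qv v))ˣ) : QA D (Qv v)) =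
    -(((nf D r : Qv v)⁻¹ * ((2 * r - cB D : ℤ) : Qv v)) • star (piE D r (Qv v))) - 1 := by
    rw [piU_inv, piU_val, mul_smul_comm, mul_smul]
    rw [star_piE_mul_self, smul_sub, smul_neg, smul_smul _ _ (1 : QA D (Qv v)), inv_mul_cancel₀ hnf, one_smul]
  rw [e]
  refine ((IntL.smul h1 (IntL.star ?_)).neg).sub intL_one
  exact ⟨by simpa [piE, Valuation.map_neg] using vl_intCast_le v r, by simp [piE]⟩

theorem tor_piU_mem_locK : tor (piU D r (Qv v)) ∈ locK D v :=
  tor_mem_locK (intL_conj_div_piU hr hram)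

/-- Write `π² = N(π) · π/π̄`; the second factor is a unit by `intL_conj_div_piU`. -/
theorem piU_sq_mem_scalInt : piU D r (Qv v) ^ 2 ∈ scalInt D v := by
  have h := intL_conj_div_piU hr hram
  have h2 : conjU (piU D r (Qv v)) * (piU D r (Qv v))⁻¹ ∈ intUnits D v := by
    refine ⟨h, ?_⟩
    have := h.star
    rw [mul_inv, inv_inv, Units.val_mul, ← map_inv, conjU_val]
    rwa [star_mul, star_star] at this
  have h3 : scal (Units.mk0 _ (nf_cast_ne_zero D r (Qv v))) =
      piU D r (Qv v) * conjU (piU D r (Qv v)) := by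
    ext1
    rw [mul_conjU, piU_val, norm_piE]
    rfl
  have h4 : piU D r (Qv v) ^ 2 = scal (Units.mk0 _ (nf_cast_ne_zero D r (Qv v))) *
      (conjU (piU D r (Qv v)) * (piU D r (Qv v))⁻¹)⁻¹ := by
    rw [h3, mul_inv, inv_inv, sq, mul_comm (conjU (piU D r (Qv v)))⁻¹, mul_assoc, mul_left_comm (conjU _),
      mul_inv_cancel, mul_one]
  rw [h4, scal_mul_mem_scalInt_iff]
  exact intUnits_le_scalInt (inv_mem h2)

/-- Some power of `π` brings `t` into the subgroup. As `π²` already lies in it, the exponent must be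
odd and can be taken to be one. -/
theorem mul_piU_mem_scalInt_of_not_mem {t : (QA D (Qv v))ˣ} (ht : t ∉ scalInt D v) :
    t * piU D r (Qv v) ∈ scalInt D v := by
  obtain ⟨k, hk⟩ := exists_mul_zpow_mem hr t
  have h2 := piU_sq_mem_scalInt hr hram
  rcases Int.even_or_odd' k with ⟨m, rfl | rfl⟩
  · rw [zpow_mul, zpow_ofNat] at hk
    exact absurd ((Subgroup.mul_mem_cancel_right _ (zpow_mem h2 m)).1 hk) ht
  · rw [zpow_add_one, zpow_mul, zpow_ofNat, mul_left_comm] at hk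
    exact (Subgroup.mul_mem_cancel_left _ (zpow_mem h2 m)).1 hk

theorem locK_ne_locKs_of_ramified : locK D v ≠ locKs D v := by
  intro h
  have := tor_piU_mem_locK hr hram
  rw [h, tor_mem_locKs_iff] at this
  exact piU_not_mem_scalInt hr this

end ramified

end decomposition

/-! ### Split places: isotropic lines, hyperbolic pairs and the Satake generator -/

section split

/-- The homomorphism `ω ↦ ρ` attached to a root `ρ` of the minimal polynomial of `ω`. -/
def evalRoot {D : ℤ} {R : Type} [CommRing R] (ρ : R) (h : ρ ^ 2 - cB D * ρ - cA D = 0) :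
    QA D R →+* R where
  toFun z := z.re + z.im * ρ
  map_one' := by simp
  map_mul' z w := by
    simp
    linear_combination (-(z.im * w.im)) * h
  map_zero' := by simp
  map_add' z w := by simp; ring

variable {R : Type} [CommRing R] {D : ℤ}

theorem evalRoot_apply {ρ : R} (h : ρ ^ 2 - cB D * ρ - cA D = 0) (z : QA D R) :
    evalRoot ρ h z = z.re + z.im * ρ := rfl

theorem conj_root {ρ : R} (h : ρ ^ 2 - cB D * ρ - cA D = 0) :
    ((cB D : R) - ρ) ^ 2 - cB D * ((cB D : R) - ρ) - cA D = 0 := by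
  linear_combination h

/-- The isotropic vector `ω - ρ`. -/
def isoE (D : ℤ) {R : Type} [CommRing R] (ρ : R) : QA D R := ⟨-ρ, 1⟩

/-- The algebra acts on the isotropic line of `ω - ρ` through evaluation at the conjugate root, so
these lines diagonalize the torus. -/
theorem mul_isoE {ρ : R} (h : ρ ^ 2 - cB D * ρ - cA D = 0) (w : QA D R) :
    w * isoE D ρ = (evalRoot _ (conj_root h) w) • isoE D ρ := by
  ext
  · simp [isoE, evalRoot_apply]; linear_combination (-w.im) * h
  · simp [isoE, evalRoot_apply]; ring

theorem bil_isoE_self {ρ : R} (h : ρ ^ 2 - cB D * ρ - cA D = 0) :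
    bil (vec (isoE D ρ)) (vec (isoE D ρ)) = 0 := by
  simp [bil, vec, isoE]
  linear_combination 2 * h

theorem bil_isoE_conj {ρ : R} (h : ρ ^ 2 - cB D * ρ - cA D = 0) :
    bil (vec (isoE D ρ)) (vec (isoE D ((cB D : R) - ρ))) = -(2 * ρ - cB D) ^ 2 := by
  simp [bil, vec, isoE]
  linear_combination 2 * h

theorem bil_smul_right (c : R) (u w : Fin 3 → R) : bil u (c • w) = c * bil u w := by
  simp [bil]; ring

theorem bil_smul_left (c : R) (u w : Fin 3 → R) : bil (c • u) w = c * bil u w := by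
  simp [bil]; ring

theorem evalRoot_star {ρ : R} (h : ρ ^ 2 - cB D * ρ - cA D = 0) (z : QA D R) :
    evalRoot ρ h (star z) = evalRoot _ (conj_root h) z := by
  simp [evalRoot_apply]; ring

theorem evalRoot_conj_star {ρ : R} (h : ρ ^ 2 - cB D * ρ - cA D = 0) (z : QA D R) :
    evalRoot _ (conj_root h) (star z) = evalRoot ρ h z := by
  simp [evalRoot_apply]; ring

theorem evalRoot_mul_conj {ρ : R} (h : ρ ^ 2 - cB D * ρ - cA D = 0) (z : QA D R) :
    evalRoot ρ h z * evalRoot _ (conj_root h) z = z.norm := by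
  rw [QuadraticAlgebra.norm_def]
  simp [evalRoot_apply]
  linear_combination (-z.im ^ 2) * h

/-- A nonzero isotropic vector is proportional to `ω - ρ` for a root `ρ`. -/
theorem exists_root_of_isotropic {K : Type} [Field K] {z : QA D K} (hz : z.norm = 0)
    (h0 : z ≠ 0) : ∃ ρ : K, ρ ^ 2 - cB D * ρ - cA D = 0 ∧ z.im ≠ 0 ∧ z = z.im • isoE D ρ := by
  rw [QuadraticAlgebra.norm_def] at hz
  have him : z.im ≠ 0 := by
    intro h
    rw [h] at hz
    simp at hz
    exact h0 (by ext <;> simp [hz, h])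
  refine ⟨-z.re / z.im, ?_, him, ?_⟩
  · field_simp
    linear_combination hz
  · ext
    · simp [isoE]; field_simp
    · simp [isoE]

variable {v : Pl}

theorem vl_root_le {ρ : Qv v} (h : ρ ^ 2 - cB D * ρ - cA D = 0) : vl v ρ ≤ 1 := by
  by_contra! hc
  have e : ρ ^ 2 = cB D * ρ + cA D := by linear_combination h
  have h1 : vl v (cB D * ρ + cA D) ≤ vl v ρ := by
    refine (vl v).map_add_le ?_ ((vl_intCast_le v _).trans hc.le)
    rw [map_mul]
    exact mul_le_of_le_one_left' (vl_intCast_le v _)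
  rw [← e, map_pow, sq] at h1
  exact absurd h1 (not_le.2 (lt_mul_of_one_lt_right (zero_lt_one.trans hc) hc))

theorem nf_cast_root {ρ : R} (h : ρ ^ 2 - cB D * ρ - cA D = 0) (r : ℤ) :
    (nf D r : R) = (ρ - r) * ((cB D : R) - r - ρ) := by
  simp only [nf]
  push_cast
  linear_combination h

variable [ImagDisc D]

/-- Let `r` be the residue of `ρ`. If it were a double root modulo `p`, both factors of `nf D r = (ρ
- r)(cB - r - ρ)` would be nonunits, against `not_sq_dvd_nf`. Ramified primes thus have no root in
the completion. -/
theorem exists_int_of_root {ρ : Qv v} (h : ρ ^ 2 - cB D * ρ - cA D = 0) :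
    ∃ r : ℤ, (resChar v : ℤ) ∣ nf D r ∧ ¬ (resChar v : ℤ) ∣ 2 * r - cB D := by
  have hρ := vl_root_le h
  obtain ⟨r, hr⟩ := exists_int_sub_lt hρ
  have hb : vl v ((cB D : Qv v) - r - ρ) ≤ 1 :=
    vl_sub_le (vl_sub_le (vl_intCast_le v _) (vl_intCast_le v _)) hρ
  have h1 : (resChar v : ℤ) ∣ nf D r := by
    rw [← vl_intCast_lt_iff v, nf_cast_root h, map_mul]
    exact mul_lt_one_of_lt_of_le hr hb
  refine ⟨r, h1, fun h2 => ?_⟩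
  have h3 := not_sq_dvd_nf D r (resChar_prime v) h2
  have h4 := vl_intCast_eq_exp v h1 h3
  have h5 : vl v ((cB D : Qv v) - r - ρ) < 1 := by
    have e : (cB D : Qv v) - r - ρ = -((2 * r - cB D : ℤ) : Qv v) - (ρ - r) := by push_cast; ring
    rw [e]
    refine (vl v).map_sub_lt ?_ hr
    rw [Valuation.map_neg]
    exact (vl_intCast_lt_iff v _).2 h2
  rw [nf_cast_root h, map_mul] at h4
  rw [vl_lt_one_iff] at hr h5
  have h6 := mul_le_mul' hr h5
  rw [h4, ← WithZero.exp_add, WithZero.exp_le_exp] at h6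
  omega

theorem exists_root_of_int {r : ℤ} (h : (resChar v : ℤ) ∣ nf D r)
    (h' : ¬ (resChar v : ℤ) ∣ 2 * r - cB D) :
    ∃ ρ : Qv v, ρ ^ 2 - cB D * ρ - cA D = 0 ∧ vl v (2 * ρ - cB D) = 1 := by
  obtain ⟨ρ, h1, h2, h3⟩ := exists_root_of_simple (cA D) (cB D) r h h'
  refine ⟨ρ, h1, ?_⟩
  have e : 2 * ρ - cB D = ((2 * r - cB D : ℤ) : Qv v) + 2 * (ρ - r) := by push_cast; ring
  have h4 := vl_intCast_eq_one v h'
  rw [e, (vl v).map_add_eq_of_lt_left, h4]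
  rw [h4, map_mul, mul_comm]
  refine mul_lt_one_of_lt_of_le h3 ?_
  have := vl_intCast_le v 2
  rwa [Int.cast_ofNat] at this

theorem IsHypPair.exists_root {e e' : Fin 3 → Qv v} (h : IsHypPair D v e e') :
    ∃ ρ c : Qv v, ρ ^ 2 - cB D * ρ - cA D = 0 ∧ c ≠ 0 ∧ e = c • vec (isoE D ρ) := by
  obtain ⟨h1, -, h2, -, h3⟩ := h
  obtain ⟨z, hz, rfl⟩ := (mem_latXi_iff e).1 h1
  have : CharZero (Qv v) := algebraRat.charZero _
  obtain ⟨ρ, hρ, him, hzρ⟩ := exists_root_of_isotropic (z := z) (by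
    rw [bil_vec, mul_star_eq, QuadraticAlgebra.trace_def] at h2
    simpa using h2) (by
    rintro rfl
    simp [vec_zero, bil] at h3)
  exact ⟨ρ, z.im, hρ, him, by rw [← vec_smul, ← hzρ]⟩

/-- The hyperbolic pair attached to a root. -/
theorem isHypPair_of_root {ρ : Qv v} (h : ρ ^ 2 - cB D * ρ - cA D = 0)
    (h2 : vl v (2 * ρ - cB D) = 1) : IsHypPair D v (vec (isoE D ρ))
      (-((2 * ρ - cB D) ^ 2)⁻¹ • vec (isoE D ((cB D : Qv v) - ρ))) := by
  have h0 : 2 * ρ - cB D ≠ 0 := by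
    intro h0
    simp [h0] at h2
  refine ⟨vec_mem_latXi.2 ⟨?_, ?_⟩, ?_, bil_isoE_self h, ?_, ?_⟩
  · simp only [isoE, Valuation.map_neg]; exact vl_root_le h
  · simp [isoE]
  · rw [← vec_smul, vec_mem_latXi]
    refine IntL.smul ?_ ⟨?_, ?_⟩
    · rw [Valuation.map_neg, map_inv₀, map_pow, h2, one_pow, inv_one]
    · simp only [isoE, Valuation.map_neg]; exact vl_root_le (conj_root h)
    · simp [isoE]
  · rw [bil_smul_left, bil_smul_right, bil_isoE_self (conj_root h), mul_zero, mul_zero]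
  · rw [bil_smul_right, bil_isoE_conj h, neg_mul_neg, inv_mul_cancel₀ (pow_ne_zero 2 h0)]

/-- Isotropic lines correspond to roots of the minimal polynomial of `ω`. A simple root modulo `p`
lifts by Hensel, and the difference of the two roots is then a unit, so the hyperbolic pair can be
normalized integrally. -/
theorem isWittOne_iff : IsWittOne D v ↔
    ∃ r : ℤ, (resChar v : ℤ) ∣ nf D r ∧ ¬ (resChar v : ℤ) ∣ 2 * r - cB D := by
  constructor
  · rintro ⟨e, e', h⟩
    obtain ⟨ρ, c, hρ, -, -⟩ := h.exists_root
    exact exists_int_of_root hρ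
  · rintro ⟨r, h, h'⟩
    obtain ⟨ρ, h1, h2⟩ := exists_root_of_int h h'
    exact ⟨_, _, isHypPair_of_root h1 h2⟩

/-- There is a torus element acting as `diag(p, p⁻¹)` on a hyperbolic pair. -/
theorem exists_tor_isHypPair {r : ℤ} (h : (resChar v : ℤ) ∣ nf D r)
    (h' : ¬ (resChar v : ℤ) ∣ 2 * r - cB D) : ∃ (t : (QA D (Qv v))ˣ) (e e' : Fin 3 → Qv v),
      IsHypPair D v e e' ∧ (tor t).mat *ᵥ e = (resChar v : Qv v) • e ∧
      (tor t).mat *ᵥ e' = (resChar v : Qv v)⁻¹ • e' := by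
  obtain ⟨ρ, h1, h2⟩ := exists_root_of_int h h'
  have h0 : 2 * ρ - cB D ≠ 0 := by
    intro h0
    simp [h0] at h2
  have hp := resChar_ne_zero v
  generalize (resChar v : Qv v) = p at hp
  -- By interpolation `z` takes the value `p` at `ρ` and `1` at the conjugate root, so `z̄/z` acts
  -- by `p` and `p⁻¹` on the two isotropic lines.
  let z : QA D (Qv v) := ⟨p - (p - 1) / (2 * ρ - cB D) * ρ, (p - 1) / (2 * ρ - cB D)⟩
  have e1 : evalRoot ρ h1 z = p := by
    simp only [evalRoot_apply, z]; ring
  have e2 : evalRoot _ (conj_root h1) z = 1 := by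
    simp only [evalRoot_apply, z]; field_simp; ring
  obtain ⟨t, ht⟩ := isUnit_of_norm_ne_zero (z := z) (by
    rw [← evalRoot_mul_conj h1, e1, e2, mul_one]; exact hp)
  have key : ∀ φ : QA D (Qv v) →+* Qv v,
      φ (star (t : QA D (Qv v)) * ((t⁻¹ : (QA D (Qv v))ˣ) : QA D (Qv v))) * φ z = φ (star z) := by
    intro φ
    rw [← map_mul, mul_assoc, ← ht, Units.inv_mul, mul_one]
  have k1 := key (evalRoot _ (conj_root h1))
  have k2 := key (evalRoot ρ h1)
  rw [evalRoot_conj_star h1, e1, e2, mul_one] at k1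
  rw [evalRoot_star h1, e1, e2] at k2
  refine ⟨t, _, _, isHypPair_of_root h1 h2, ?_, ?_⟩
  · rw [tor_vec, mul_isoE h1, k1, vec_smul]
  · rw [Matrix.mulVec_smul, tor_vec, mul_isoE (conj_root h1), smul_comm]
    have : evalRoot _ (conj_root (conj_root h1)) (star (t : QA D (Qv v)) *
        ((t⁻¹ : (QA D (Qv v))ˣ) : QA D (Qv v))) = p⁻¹ := by
      rw [← eq_inv_of_mul_eq_one_left k2]
      simp only [evalRoot_apply, sub_sub_cancel]
    rw [this, vec_smul]

/-- Independence of the Satake generator of the chosen pair: the eigenvalue `p` pins down the class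
of `t` modulo scalars and units, up to inversion. -/
theorem tor_of_isHypPair {r : ℤ} (hr : IsRootAt D v r) {e e' : Fin 3 → Qv v}
    (h : IsHypPair D v e e') {g : GD D (Qv v)} (hg : g.mat *ᵥ e = (resChar v : Qv v) • e) :
    ∃ t : (QA D (Qv v))ˣ, g = tor t ∧
      (t * piU D r (Qv v) ∈ scalInt D v ∨ t * (piU D r (Qv v))⁻¹ ∈ scalInt D v) := by
  obtain ⟨ρ, c, hρ, hc, he⟩ := h.exists_root
  have hc0 := hc
  have hp := resChar_ne_zero v
  have hvec0 : ∀ x : Qv v, x • vec (isoE D ρ) = 0 → x = 0 := by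
    intro x hx
    have := congrFun hx 0
    simpa [vec, isoE] using this
  have hge : g.mat *ᵥ vec (isoE D ρ) = (resChar v : Qv v) • vec (isoE D ρ) := by
    have : vec (isoE D ρ) = c⁻¹ • e := by rw [he, smul_smul, inv_mul_cancel₀ hc, one_smul]
    rw [this, Matrix.mulVec_smul, hg, smul_comm]
  obtain ⟨t, rfl | rfl⟩ := g.exists_tor
  · refine ⟨t, rfl, ?_⟩
    rw [tor_vec, mul_isoE hρ, vec_smul, ← sub_eq_zero, ← sub_smul] at hge
    have hφ := sub_eq_zero.1 (hvec0 _ hge)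
    obtain ⟨k, hk⟩ := exists_mul_zpow_mem hr t
    obtain ⟨q, s, hs, hqs⟩ := mem_scalInt.1 hk
    have hval : ∀ u : (QA D (Qv v))ˣ, vl v (evalRoot _ (conj_root hρ) (star (u : QA D (Qv v)) *
      ((u⁻¹ : (QA D (Qv v))ˣ) : QA D (Qv v)))) = vl v (evalRoot ρ hρ (u : QA D (Qv v))) /
        vl v (evalRoot _ (conj_root hρ) (u : QA D (Qv v))) := by
      intro u
      have h1 : evalRoot _ (conj_root hρ) (u : QA D (Qv v)) *
          evalRoot _ (conj_root hρ) ((u⁻¹ : (QA D (Qv v))ˣ) : QA D (Qv v)) = 1 := by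
        rw [← map_mul, Units.mul_inv, map_one]
      rw [map_mul, evalRoot_conj_star, map_mul, eq_inv_of_mul_eq_one_right h1, map_inv₀, div_eq_mul_inv]
    rw [← hφ] at hp
    have h2 := congrArg (vl v) hφ
    rw [hval, vl_resChar] at h2
    -- The ratio of the absolute values of the two evaluations is trivial on scalars and integral
    -- units, so it only sees the exponent of `π`.
    let V : (QA D (Qv v))ˣ →* WithZero (Multiplicative ℤ) :=
      { toFun := fun u => vl v (evalRoot ρ hρ (u : QA D (Qv v))) /
          vl v (evalRoot _ (conj_root hρ) (u : QA D (Qv v)))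
        map_one' := by simp
        map_mul' := by
          intro x y
          rw [Units.val_mul, map_mul, map_mul, map_mul, map_mul, mul_div_mul_comm] }
    have hVd : ∀ u, V u = vl v (evalRoot ρ hρ (u : QA D (Qv v))) /
          vl v (evalRoot _ (conj_root hρ) (u : QA D (Qv v))) := fun _ => rfl
    have hVs : V s = 1 := by
      have hle : ∀ (ρ : Qv v) (hρ : ρ ^ 2 - cB D * ρ - cA D = 0) (z : QA D (Qv v)), IntL z →
          vl v (evalRoot ρ hρ z) ≤ 1 := fun ρ hρ z hz =>
        vl_add_le hz.1 (vl_mul_le hz.2 (vl_root_le hρ))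
      have hone : ∀ (ρ : Qv v) (hρ : ρ ^ 2 - cB D * ρ - cA D = 0),
          vl v (evalRoot ρ hρ (s : QA D (Qv v))) = 1 := by
        intro ρ hρ
        refine le_antisymm (hle ρ hρ _ hs.1) ?_
        have h1 : vl v (evalRoot ρ hρ (s : QA D (Qv v))) *
            vl v (evalRoot ρ hρ ((s⁻¹ : (QA D (Qv v))ˣ) : QA D (Qv v))) = 1 := by
          rw [← map_mul, ← map_mul, Units.mul_inv, map_one, map_one]
        calc 1 = _ := h1.symm
          _ ≤ vl v (evalRoot ρ hρ (s : QA D (Qv v))) * 1 := mul_le_mul_right (hle ρ hρ _ hs.2) _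
          _ = _ := mul_one _
      rw [hVd, hone, hone, div_one]
    have hVq : V (scal q) = 1 := by
      rw [hVd, evalRoot_apply, evalRoot_apply, scal_val]
      simp only [zero_mul, add_zero]
      exact div_self (vl_pos q.ne_zero).ne'
    -- The two evaluations of `π` are integral with product of valuation one, so exactly one of them
    -- is a unit.
    have hVπ : V (piU D r (Qv v)) = WithZero.exp (-1) ∨ V (piU D r (Qv v)) = WithZero.exp 1 := by
      have h3 := vl_nf D hr
      have hi : vl v (ρ - r) ≤ 1 := vl_sub_le (vl_root_le hρ) (vl_intCast_le v _)
      have hj : vl v ((cB D : Qv v) - r - ρ) ≤ 1 :=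
        vl_sub_le (vl_sub_le (vl_intCast_le v _) (vl_intCast_le v _)) (vl_root_le hρ)
      have hV : V (piU D r (Qv v)) = vl v (ρ - r) / vl v ((cB D : Qv v) - r - ρ) := by
        rw [hVd, piU_val, evalRoot_apply, evalRoot_apply]
        simp only [piE, one_mul]
        congr 2 <;> ring
      rw [nf_cast_root hρ, map_mul] at h3
      have hi0 : ρ - r ≠ 0 := by
        intro h0; rw [h0, map_zero, zero_mul] at h3; exact WithZero.exp_ne_zero h3.symm
      have hj0 : (cB D : Qv v) - r - ρ ≠ 0 := by
        intro h0; rw [h0, map_zero, mul_zero] at h3; exact WithZero.exp_ne_zero h3.symm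
      obtain ⟨m, hm⟩ := exists_vl_eq_exp hi0
      obtain ⟨n, hn⟩ := exists_vl_eq_exp hj0
      rw [hV, hm, hn, ← WithZero.exp_sub]
      rw [hm, hn, ← WithZero.exp_add] at h3
      rw [hm, ← WithZero.exp_zero, WithZero.exp_le_exp] at hi
      rw [hn, ← WithZero.exp_zero, WithZero.exp_le_exp] at hj
      have h4 := WithZero.exp_injective h3
      rcases (show m = 0 ∨ n = 0 by omega) with h0 | h0
      · right; congr 1; omega
      · left; congr 1; omega
    have hVt : V t = WithZero.exp (-1) := h2
    have h5 := congrArg V hqs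
    rw [map_mul, hVq, hVs, map_mul, hVt, map_zpow, mul_one, ← WithZero.exp_zero] at h5
    rcases hVπ with h6 | h6
    · rw [h6, ← WithZero.exp_zsmul, ← WithZero.exp_add] at h5
      have h7 := WithZero.exp_injective h5
      rw [smul_eq_mul] at h7
      obtain rfl : k = -1 := by omega
      right
      rwa [zpow_neg_one] at hk
    · rw [h6, ← WithZero.exp_zsmul, ← WithZero.exp_add] at h5
      have h7 := WithZero.exp_injective h5
      rw [smul_eq_mul] at h7
      obtain rfl : k = 1 := by omega
      left
      rwa [zpow_one] at hk
  · exfalso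
    -- Elements of the coset of `σ̃` are involutions and cannot have the eigenvalue `p`.
    have h1 : tor t * sig D (Qv v) * (tor t * sig D (Qv v)) = 1 := by
      rw [mul_assoc, ← mul_assoc (sig D _), sig_mul_tor, mul_assoc, sig_mul_sig, mul_one, ← map_mul,
        tor_eq_one_iff, mul_conjU]
    have h2 := GD.mul_vec (tor t * sig D (Qv v)) (tor t * sig D (Qv v)) (vec (isoE D ρ))
    rw [h1, GD.mat_one, Matrix.one_mulVec, hge, Matrix.mulVec_smul, hge, smul_smul, eq_comm,
      ← sub_eq_zero] at h2
    have h3 : ((resChar v : Qv v) * resChar v - 1) • vec (isoE D ρ) = 0 := by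
      rw [sub_smul, one_smul]; exact h2
    have h4 := hvec0 _ h3
    have h5 : vl v ((resChar v : Qv v) * resChar v) = 1 := by
      rw [sub_eq_zero.1 h4, map_one]
    rw [map_mul, vl_resChar, ← WithZero.exp_add, ← WithZero.exp_zero] at h5
    have := WithZero.exp_injective h5
    omega

end split

/-! ### Finite ideles of `E` and the idelic class group -/

section adeles

variable {D : ℤ}

theorem evalAt_apply (v : Pl) (x : Af) : evalAt v x = x v := rfl

theorem af_ext {x y : Af} (h : ∀ v, evalAt v x = evalAt v y) : x = y :=
  FiniteAdeleRing.ext ℚ h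

/-- An adele with given components. -/
def mkAf (f : ∀ v : Pl, Qv v) (h : ∀ᶠ v in Filter.cofinite, vl v (f v) ≤ 1) : Af :=
  ⟨f, h.mono fun _ hv => mem_O_iff.2 hv⟩

theorem eventually_vl_le (x : Af) : ∀ᶠ v in Filter.cofinite, vl v (evalAt v x) ≤ 1 :=
  x.2.mono fun _ hv => mem_O_iff.1 hv

/-- The component at `v` of a finite adele of `E`. -/
def compAt (v : Pl) : AE D →+* QA D (Qv v) := qmap (evalAt v : Af →+* Qv v)

theorem ae_ext {x y : AE D} (h : ∀ v, compAt v x = compAt v y) : x = y := by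
  ext1
  · exact af_ext fun v => congrArg QuadraticAlgebra.re (h v)
  · exact af_ext fun v => congrArg QuadraticAlgebra.im (h v)

theorem isIntAE_iff (z : AE D) : IsIntAE z ↔ ∀ v, IntL (compAt v z) := by
  refine forall_congr' fun v => ?_
  rw [mem_O_iff, mem_O_iff]
  rfl

theorem eventually_intL (z : AE D) : ∀ᶠ v in Filter.cofinite, IntL (compAt v z) := by
  filter_upwards [eventually_vl_le z.re, eventually_vl_le z.im] with v h1 h2
  exact ⟨h1, h2⟩

/-- The component at `v` of a finite idele of `E`. -/
def unitAt (v : Pl) : (AE D)ˣ →* (QA D (Qv v))ˣ := 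
  Units.map ((compAt v : AE D →+* QA D (Qv v)) : AE D →* QA D (Qv v))

theorem idele_ext {t u : (AE D)ˣ} (h : ∀ v, unitAt v t = unitAt v u) : t = u :=
  Units.ext (ae_ext fun v => congrArg Units.val (h v))

theorem eventually_mem_intUnits (t : (AE D)ˣ) :
    ∀ᶠ v in Filter.cofinite, unitAt v t ∈ intUnits D v := by
  filter_upwards [eventually_intL (t : AE D), eventually_intL ((t⁻¹ : (AE D)ˣ) : AE D)] with v h1 h2
  exact ⟨h1, by rw [← map_inv]; exact h2⟩

theorem exists_ae (f : ∀ v : Pl, QA D (Qv v)) (h : ∀ᶠ v in Filter.cofinite, IntL (f v)) :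
    ∃ z : AE D, ∀ v, compAt v z = f v :=
  ⟨⟨mkAf (fun v => (f v).re) (h.mono fun _ hv => hv.1),
    mkAf (fun v => (f v).im) (h.mono fun _ hv => hv.2)⟩, fun v => by ext1 <;> rfl⟩

theorem exists_idele (f : ∀ v : Pl, (QA D (Qv v))ˣ)
    (h : ∀ᶠ v in Filter.cofinite, f v ∈ intUnits D v) : ∃ t : (AE D)ˣ, ∀ v, unitAt v t = f v := by
  obtain ⟨z, hz⟩ := exists_ae (fun v => (f v : QA D (Qv v))) (h.mono fun _ hv => hv.1)
  obtain ⟨w, hw⟩ := exists_ae (fun v => (((f v)⁻¹ : (QA D (Qv v))ˣ) : QA D (Qv v)))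
    (h.mono fun _ hv => hv.2)
  refine ⟨⟨z, w, ae_ext fun v => ?_, ae_ext fun v => ?_⟩, fun v => Units.ext (hz v)⟩
  · rw [map_mul, hz, hw, Units.mul_inv, map_one]
  · rw [map_mul, hz, hw, Units.inv_mul, map_one]

/-- A finite idele with given components. -/
def mkIdele (f : ∀ v : Pl, (QA D (Qv v))ˣ) (h : ∀ᶠ v in Filter.cofinite, f v ∈ intUnits D v) :
    (AE D)ˣ := (exists_idele f h).choose

@[simp] theorem unitAt_mkIdele (f : ∀ v : Pl, (QA D (Qv v))ˣ)
    (h : ∀ᶠ v in Filter.cofinite, f v ∈ intUnits D v) (v : Pl) : unitAt v (mkIdele f h) = f v :=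
  (exists_idele f h).choose_spec v

open Classical in
theorem eventually_update_mem (v : Pl) (t : (QA D (Qv v))ˣ) : ∀ᶠ w in Filter.cofinite,
    Function.update (1 : ∀ w : Pl, (QA D (Qv w))ˣ) v t w ∈ intUnits D w := by
  filter_upwards [(Set.finite_singleton v).compl_mem_cofinite] with w hw
  rw [Function.update_of_ne hw]
  exact one_mem _

open Classical in
/-- The idele with component `t` at `v` and trivial components at the other places. -/
def locIdele (v : Pl) (t : (QA D (Qv v))ˣ) : (AE D)ˣ :=
  mkIdele (Function.update 1 v t) (eventually_update_mem v t)

theorem unitAt_locIdele_self (v : Pl) (t : (QA D (Qv v))ˣ) : unitAt v (locIdele v t) = t := by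
  classical
  rw [locIdele, unitAt_mkIdele, Function.update_self]

theorem unitAt_locIdele_of_ne {v w : Pl} (h : w ≠ v) (t : (QA D (Qv v))ˣ) :
    unitAt w (locIdele v t) = 1 := by
  classical
  rw [locIdele, unitAt_mkIdele, Function.update_of_ne h]
  rfl

theorem locIdele_mul (v : Pl) (t u : (QA D (Qv v))ˣ) :
    locIdele v (t * u) = locIdele v t * locIdele v u := by
  refine idele_ext fun w => ?_
  by_cases h : w = v
  · subst h
    simp only [map_mul, unitAt_locIdele_self]
  · simp only [map_mul, unitAt_locIdele_of_ne h, mul_one]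

theorem locIdele_one (v : Pl) : locIdele v (1 : (QA D (Qv v))ˣ) = 1 := by
  refine idele_ext fun w => ?_
  by_cases h : w = v
  · subst h
    rw [map_one, unitAt_locIdele_self]
  · rw [map_one, unitAt_locIdele_of_ne h]

theorem locIdele_inv (v : Pl) (t : (QA D (Qv v))ˣ) : locIdele v t⁻¹ = (locIdele v t)⁻¹ :=
  eq_inv_of_mul_eq_one_left (by rw [← locIdele_mul, inv_mul_cancel, locIdele_one])

theorem unitAt_conj (v : Pl) (t : (AE D)ˣ) : unitAt v (conjIdele D t) = conjU (unitAt v t) :=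
  Units.ext (qmap_star _ _)

/-- The principal idele of an element of `E`. -/
def ratIdele : (QA D ℚ)ˣ →* (AE D)ˣ :=
  Units.map ((qmap (algebraMap ℚ Af) : QA D ℚ →+* AE D) : QA D ℚ →* AE D)

/-- The component at `v` of an element of `E`. -/
def ratAt (v : Pl) : (QA D ℚ)ˣ →* (QA D (Qv v))ˣ :=
  Units.map ((qmap (algebraMap ℚ (Qv v)) : QA D ℚ →+* QA D (Qv v)) : QA D ℚ →* QA D (Qv v))

theorem unitAt_ratIdele (v : Pl) (e : (QA D ℚ)ˣ) : unitAt v (ratIdele e) = ratAt v e := rfl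

variable (D) in
/-- The unit ideles. -/
def intIdeles : Subgroup (AE D)ˣ where
  carrier := {t | ∀ v, unitAt v t ∈ intUnits D v}
  one_mem' := fun v => by rw [map_one]; exact one_mem _
  mul_mem' := fun h h' v => by rw [map_mul]; exact mul_mem (h v) (h' v)
  inv_mem' := fun h v => by rw [map_inv]; exact inv_mem (h v)

theorem mem_intIdeles_iff {t : (AE D)ˣ} : t ∈ intIdeles D ↔
    IsIntAE (t : AE D) ∧ IsIntAE ((t⁻¹ : (AE D)ˣ) : AE D) := by
  rw [isIntAE_iff, isIntAE_iff, ← forall_and]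
  rfl

theorem isPrincipalAE_iff (t : (AE D)ˣ) :
    IsPrincipalAE (t : AE D) ↔ ∃ e : (QA D ℚ)ˣ, t = ratIdele e := by
  constructor
  · rintro ⟨x, y, hx, hy⟩
    have e : (t : AE D) = qmap (algebraMap ℚ Af) (⟨x, y⟩ : QA D ℚ) := by ext1 <;> assumption
    obtain ⟨u, hu⟩ := isUnit_of_norm_ne_zero (z := (⟨x, y⟩ : QA D ℚ)) (by
      intro h0
      have h1 := QuadraticAlgebra.isUnit_iff_norm_isUnit.1 t.isUnit
      rw [e, qmap_norm, h0, map_zero] at h1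
      obtain ⟨v, -⟩ := exists_place Nat.prime_two
      have h2 := h1.map (evalAt v)
      rw [map_zero] at h2
      exact not_isUnit_zero h2)
    refine ⟨u, Units.ext ?_⟩
    rw [e, ← hu]
    rfl
  · rintro ⟨e, rfl⟩
    exact ⟨_, _, rfl, rfl⟩

theorem princSub_eq : princSub D = (ratIdele : (QA D ℚ)ˣ →* (AE D)ˣ).range ⊔ intIdeles D := by
  rw [princSub, Subgroup.closure_union]
  congr 1
  · rw [← Subgroup.closure_eq (ratIdele : (QA D ℚ)ˣ →* (AE D)ˣ).range]
    congr 1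
    ext t
    exact (isPrincipalAE_iff t).trans ⟨fun ⟨e, h⟩ => ⟨e, h.symm⟩, fun ⟨e, h⟩ => ⟨e, h.symm⟩⟩
  · rw [← Subgroup.closure_eq (intIdeles D)]
    congr 1
    ext t
    exact mem_intIdeles_iff.symm

theorem mem_princSub {t : (AE D)ˣ} :
    t ∈ princSub D ↔ ∃ e : (QA D ℚ)ˣ, ∃ u ∈ intIdeles D, ratIdele e * u = t := by
  rw [princSub_eq, Subgroup.mem_sup]
  constructor
  · rintro ⟨_, ⟨e, rfl⟩, u, hu, h⟩
    exact ⟨e, u, hu, h⟩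
  · rintro ⟨e, u, hu, h⟩
    exact ⟨_, ⟨e, rfl⟩, u, hu, h⟩

theorem vl_resChar_of_ne {v w : Pl} (h : w ≠ v) : vl w (resChar v : Qv w) = 1 := by
  have := vl_intCast_eq_one w (n := (resChar v : ℤ)) (by
    intro hd
    have := (Nat.prime_dvd_prime_iff_eq (resChar_prime w) (resChar_prime v)).1 (by exact_mod_cast hd)
    exact h (resChar_injective this))
  rwa [Int.cast_natCast] at this

/-- A family of exponents is realized by a positive rational number. -/
theorem exists_rat_vl (n : Pl → ℤ) (hn : ∀ᶠ v in Filter.cofinite, n v = 0) :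
    ∃ q : ℚ, q ≠ 0 ∧ ∀ v, vl v (algebraMap ℚ (Qv v) q) = WithZero.exp (-(n v)) := by
  classical
  have hfin : {v | n v ≠ 0}.Finite := hn
  have hp : ∀ v : Pl, (resChar v : ℚ) ≠ 0 := fun v => by exact_mod_cast (resChar_prime v).ne_zero
  refine ⟨∏ v ∈ hfin.toFinset, (resChar v : ℚ) ^ n v,
    Finset.prod_ne_zero_iff.2 fun v _ => zpow_ne_zero _ (hp v), fun w => ?_⟩
  rw [map_prod, map_prod]
  have e : ∀ v, vl w (algebraMap ℚ (Qv w) ((resChar v : ℚ) ^ n v)) =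
      if v = w then WithZero.exp (-(n w)) else 1 := by
    intro v
    rw [map_zpow₀, map_natCast]
    split_ifs with h
    · subst h
      exact vl_zpow_resChar v _
    · rw [map_zpow₀, vl_resChar_of_ne (Ne.symm h), one_zpow]
  simp only [e]
  rw [Finset.prod_ite_eq']
  split_ifs with h
  · rfl
  · simp only [Set.Finite.mem_toFinset, Set.mem_ofPred_eq, not_not] at h
    rw [h, neg_zero, WithZero.exp_zero]

/-- This uses that `ℚ` has class number one: the local scalars are only needed up to units, and one
rational number realizes all their valuations. -/
theorem exists_scal_mul_mem_intIdeles {t : (AE D)ˣ} (h : ∀ v, unitAt v t ∈ scalInt D v) :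
    ∃ q : ℚˣ, ratIdele (scal q) * t ∈ intIdeles D := by
  -- The exponent is required to vanish where `t` is already a unit, so that only finitely many
  -- primes occur.
  have key : ∀ v, ∃ n : ℤ, (∀ q : (Qv v)ˣ, vl v (q : Qv v) = WithZero.exp (-n) →
      scal q * unitAt v t ∈ intUnits D v) ∧ (unitAt v t ∈ intUnits D v → n = 0) := by
    intro v
    by_cases hv : unitAt v t ∈ intUnits D v
    · refine ⟨0, fun q hq => mul_mem ((mem_intUnits_iff _).2 ?_) hv, fun _ => rfl⟩
      rw [neg_zero, WithZero.exp_zero] at hq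
      rw [scal_val, QuadraticAlgebra.norm_def]
      refine ⟨⟨hq.le, by simp⟩, ?_⟩
      simp only [mul_zero, sub_zero, add_zero]
      rw [map_mul, hq, one_mul]
    · obtain ⟨q, s, hs, hqs⟩ := mem_scalInt.1 (h v)
      obtain ⟨n, hn⟩ := exists_vl_eq_exp q.ne_zero
      refine ⟨n, fun q' hq' => ?_, fun h => absurd h hv⟩
      rw [← hqs, ← mul_assoc, ← map_mul]
      refine mul_mem ((mem_intUnits_iff _).2 ?_) hs
      have h1 : vl v ((q' * q : (Qv v)ˣ) : Qv v) = 1 := by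
        rw [Units.val_mul, map_mul, hq', hn, ← WithZero.exp_add, neg_add_cancel, WithZero.exp_zero]
      rw [scal_val, QuadraticAlgebra.norm_def]
      refine ⟨⟨h1.le, by simp⟩, ?_⟩
      simp only [mul_zero, sub_zero, add_zero]
      rw [map_mul, h1, one_mul]
  choose n hn hn0 using key
  obtain ⟨q, hq0, hq⟩ := exists_rat_vl n ((eventually_mem_intUnits t).mono hn0)
  refine ⟨Units.mk0 q hq0, fun v => ?_⟩
  rw [map_mul, unitAt_ratIdele]
  have hqv : algebraMap ℚ (Qv v) q ≠ 0 := (map_ne_zero _).2 hq0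
  have e : ratAt v (scal (Units.mk0 q hq0)) = (scal (Units.mk0 _ hqv) : (QA D (Qv v))ˣ) := by
    ext
    · rfl
    · exact map_zero _
  rw [e]
  exact hn v _ (hq v)

theorem mem_princSub_of_scalInt {t : (AE D)ˣ} (h : ∀ v, unitAt v t ∈ scalInt D v) :
    t ∈ princSub D := by
  obtain ⟨q, hq⟩ := exists_scal_mul_mem_intIdeles h
  exact mem_princSub.2 ⟨(scal q)⁻¹, _, hq, by rw [map_inv, inv_mul_cancel_left]⟩

theorem mul_conjU_mem_scalInt {v : Pl} (t : (QA D (Qv v))ˣ) : t * conjU t ∈ scalInt D v := by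
  have : t * conjU t = scal (Units.mk0 _ (norm_ne_zero_of_unit t)) := by
    ext1
    rw [mul_conjU]
    rfl
  rw [this]
  exact scal_mem_scalInt _

theorem mul_conjIdele_mem (t : (AE D)ˣ) : t * conjIdele D t ∈ princSub D :=
  mem_princSub_of_scalInt fun v => by
    rw [map_mul, unitAt_conj]
    exact mul_conjU_mem_scalInt _

/-- The product `t t̄` is the norm, a scalar at every place, hence trivial in the class group.
Galois conjugation is therefore inversion. -/
theorem mk_conjIdele (t : (AE D)ˣ) : ((conjIdele D t : (AE D)ˣ) : ClD D) = (t : ClD D)⁻¹ := by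
  refine eq_inv_of_mul_eq_one_right ?_
  rw [← QuotientGroup.mk_mul, QuotientGroup.eq_one_iff]
  exact mul_conjIdele_mem t

theorem conjCl_eq_inv (c : ClD D) : conjCl D c = c⁻¹ := by
  induction c using QuotientGroup.induction_on with
  | H t => exact mk_conjIdele t

theorem mk_eq_of_scalInt {t u : (AE D)ˣ} (h : ∀ v, (unitAt v t)⁻¹ * unitAt v u ∈ scalInt D v) :
    (t : ClD D) = (u : ClD D) := by
  rw [QuotientGroup.eq]
  exact mem_princSub_of_scalInt fun v => by rw [map_mul, map_inv]; exact h v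

theorem locIdele_mem_princSub {v : Pl} {t : (QA D (Qv v))ˣ} (h : t ∈ scalInt D v) :
    locIdele v t ∈ princSub D := by
  refine mem_princSub_of_scalInt fun w => ?_
  by_cases hw : w = v
  · subst hw
    rwa [unitAt_locIdele_self]
  · rw [unitAt_locIdele_of_ne hw]
    exact one_mem _

theorem mk_locIdele_eq {v : Pl} {t u : (QA D (Qv v))ˣ} (h : t⁻¹ * u ∈ scalInt D v) :
    ((locIdele v t : (AE D)ˣ) : ClD D) = ((locIdele v u : (AE D)ˣ) : ClD D) := by
  rw [QuotientGroup.eq, ← locIdele_inv, ← locIdele_mul]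
  exact locIdele_mem_princSub h

end adeles

/-! ### The ideal class of an adelic point and the double coset space -/

section group

variable {D : ℤ} [ImagDisc D]

theorem GD.at_mat (h : GD D Af) (v : Pl) : (h.at v).mat = h.mat.map (evalAt v) := rfl

theorem GD.at_mul (g h : GD D Af) (v : Pl) : (g * h).at v = g.at v * h.at v := map_mul _ _ _
theorem GD.at_inv (g : GD D Af) (v : Pl) : (g⁻¹).at v = (g.at v)⁻¹ := map_inv _ _
theorem GD.at_one (v : Pl) : (1 : GD D Af).at v = 1 := map_one _

theorem GD.ext_at {g h : GD D Af} (e : ∀ v, g.at v = h.at v) : g = h := by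
  refine GD.ext (Matrix.ext fun i j => af_ext fun v => ?_)
  have := congrArg (fun x : GD D (Qv v) => x.mat i j) (e v)
  exact this

theorem GD.at_tor (t : (AE D)ˣ) (v : Pl) : (tor t).at v = tor (unitAt v t) :=
  GD.map_tor (evalAt v) t

theorem GD.at_sig (v : Pl) : (sig D Af).at v = sig D (Qv v) := GD.map_sig (evalAt v)

theorem cls_one_mul (c : ClD D) : 1 * c = c := one_mul c

theorem hasTorusPart_iff (h : GD D Af) (t : (AE D)ˣ) : HasTorusPart h t ↔
    ∀ v, h.at v = tor (unitAt v t) ∨ h.at v = tor (unitAt v t) * sig D (Qv v) := by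
  constructor
  · rintro ⟨τ, hτ, e⟩ v
    have e' : h = tor t * τ := GD.ext e
    rw [e', GD.at_mul, GD.at_tor]
    rcases hτ v with h1 | h1
    · left
      rw [show τ.at v = 1 from GD.ext h1, mul_one]
    · right
      rw [show τ.at v = sig D (Qv v) from GD.ext h1]
  · intro H
    refine ⟨(tor t)⁻¹ * h, fun v => ?_, ?_⟩
    · rw [GD.at_mul, GD.at_inv, GD.at_tor]
      rcases H v with e | e
      · left
        rw [e, inv_mul_cancel]
        rfl
      · right
        rw [e, inv_mul_cancel_left]
        rfl
    · have : h.mat = (tor t * ((tor t)⁻¹ * h)).mat := by rw [mul_inv_cancel_left]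
      exact this

/-- Where `D` is a unit the lattice is self-dual, and the condition on the discriminant group is
void. -/
theorem mem_locKs_of_integral {v : Pl} (hD : vl v (D : Qv v) = 1) {g : GD D (Qv v)}
    (h1 : ∀ i j, vl v (g.mat i j) ≤ 1) (h2 : ∀ i j, vl v (g⁻¹.mat i j) ≤ 1) : g ∈ locKs D v := by
  have key : ∀ g : GD D (Qv v), (∀ i j, vl v (g.mat i j) ≤ 1) →
      ∀ u ∈ latXi D v, g.mat *ᵥ u ∈ latXi D v := by
    rintro g hg u ⟨hu, hu'⟩
    refine ⟨fun i => ?_, ?_⟩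
    · rw [mem_O_iff, Matrix.mulVec, dotProduct]
      exact (vl v).map_sum_le fun j _ => vl_mul_le (hg i j) (mem_O_iff.1 (hu j))
    · rw [← g.mat_xi, g.bil_mat, hu']
  refine ⟨(mem_locK_iff g).2 ⟨key g h1, key _ h2⟩, fun u hu => ?_⟩
  obtain ⟨z, hz, rfl⟩ := (mem_latXiDual_iff u).1 hu
  have hzi : IntL z := by
    have e : (D : Qv v)⁻¹ • (sqD D (Qv v) * (sqD D (Qv v) * z)) = z := by
      rw [← mul_assoc, sqD_mul_self]
      have := disc_cast_ne_zero D (Qv v)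
      refine QuadraticAlgebra.ext ?_ ?_
      · simp only [QuadraticAlgebra.re_smul, QuadraticAlgebra.re_mul, zero_mul, add_zero, mul_zero, smul_eq_mul]
        exact inv_mul_cancel_left₀ this _
      · simp only [QuadraticAlgebra.im_smul, QuadraticAlgebra.im_mul, zero_mul, add_zero, mul_zero, smul_eq_mul]
        exact inv_mul_cancel_left₀ this _
    rw [← e]
    exact IntL.smul (by rw [map_inv₀, hD, inv_one]) (intL_sqD.mul hz)
  rw [sub_eq_add_neg]
  exact latXi_add (key g h1 _ (vec_mem_latXi.2 hzi)) (latXi_neg (vec_mem_latXi.2 hzi))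

theorem eventually_vl_intCast {n : ℤ} (hn : n ≠ 0) :
    ∀ᶠ v : Pl in Filter.cofinite, vl v (n : Qv v) = 1 := by
  have : {v : Pl | (resChar v : ℤ) ∣ n}.Finite := by
    refine Set.Finite.of_finite_image (f := resChar) ?_ resChar_injective.injOn
    refine (Nat.divisors n.natAbs).finite_toSet.subset ?_
    rintro _ ⟨v, hv, rfl⟩
    simp only [Finset.mem_coe, Nat.mem_divisors]
    exact ⟨Int.natCast_dvd.1 hv, by simpa using hn⟩
  filter_upwards [this.compl_mem_cofinite] with v hv
  exact vl_intCast_eq_one v hv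

theorem eventually_at_mem_locKs (h : GD D Af) : ∀ᶠ v in Filter.cofinite, h.at v ∈ locKs D v := by
  have h1 : ∀ᶠ v in Filter.cofinite, ∀ i j, vl v (evalAt v (h.mat i j)) ≤ 1 :=
    Filter.eventually_all.2 fun i => Filter.eventually_all.2 fun j => eventually_vl_le _
  have h2 : ∀ᶠ v in Filter.cofinite, ∀ i j, vl v (evalAt v (h⁻¹.mat i j)) ≤ 1 :=
    Filter.eventually_all.2 fun i => Filter.eventually_all.2 fun j => eventually_vl_le _
  filter_upwards [h1, h2, eventually_vl_intCast (ImagDisc.ne_zero D)] with v h1 h2 h3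
  exact mem_locKs_of_integral h3 h1 (by rw [← GD.at_inv]; exact h2)

/-- Torus parts exist place by place. At almost all places the component lies in `K_v^*` and the
torus part can be chosen to be a unit, which is what makes the family an idele. -/
theorem exists_hasTorusPart (h : GD D Af) : ∃ t, HasTorusPart h t := by
  have key : ∀ v, ∃ t : (QA D (Qv v))ˣ, (h.at v = tor t ∨ h.at v = tor t * sig D (Qv v)) ∧
      (h.at v ∈ locKs D v → t ∈ intUnits D v) := by
    intro v
    by_cases hv : h.at v ∈ locKs D v
    · obtain ⟨s, hs, e⟩ := (mem_locKs_iff _).1 hv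
      exact ⟨s, e, fun _ => hs⟩
    · obtain ⟨t, e⟩ := (h.at v).exists_tor
      exact ⟨t, e, fun h => absurd h hv⟩
  choose f hf hf' using key
  refine ⟨mkIdele f ((eventually_at_mem_locKs h).mono hf'), (hasTorusPart_iff _ _).2 fun v => ?_⟩
  rw [unitAt_mkIdele]
  exact hf v

/-- The torus part of an element of `G(𝔸_fin)`. -/
def torPart (h : GD D Af) : (AE D)ˣ := (exists_hasTorusPart h).choose

theorem torPart_spec (h : GD D Af) : HasTorusPart h (torPart h) := (exists_hasTorusPart h).choose_spec

/-- The ideal class of an element of `G(𝔸_fin)`. -/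
def cls (h : GD D Af) : ClD D := ((torPart h : (AE D)ˣ) : ClD D)

theorem tor_eq_or {K : Type} [Field K] [Algebra ℚ K] {t u : (QA D K)ˣ} {g : GD D K}
    (ht : g = tor t ∨ g = tor t * sig D K) (hu : g = tor u ∨ g = tor u * sig D K) :
    ∃ q : Kˣ, t⁻¹ * u = scal q := by
  refine exists_scal_of_tor_eq_one ?_
  rw [map_mul, map_inv, inv_mul_eq_one]
  have h1 : ∀ x y : (QA D K)ˣ, tor x ≠ tor y * sig D K := fun x y e =>
    tor_ne_sig (y⁻¹ * x) (by rw [map_mul, map_inv, e, inv_mul_cancel_left])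
  rcases ht with rfl | rfl <;> rcases hu with h | h
  · exact h
  · exact absurd h (h1 _ _)
  · exact absurd h.symm (h1 _ _)
  · exact mul_right_cancel h

/-- Two torus parts differ by a scalar at each place, and `mem_princSub_of_scalInt` makes such
ideles trivial. This is the well-definedness of `f_χ`. -/
theorem HasTorusPart.mk_eq {h : GD D Af} {t u : (AE D)ˣ} (ht : HasTorusPart h t)
    (hu : HasTorusPart h u) : (t : ClD D) = (u : ClD D) := by
  rw [hasTorusPart_iff] at ht hu
  refine mk_eq_of_scalInt fun v => ?_
  obtain ⟨q, hq⟩ := tor_eq_or (ht v) (hu v)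
  rw [hq]
  exact scal_mem_scalInt q

theorem HasTorusPart.cls_eq {h : GD D Af} {t : (AE D)ˣ} (ht : HasTorusPart h t) :
    cls h = (t : ClD D) := (torPart_spec h).mk_eq ht

theorem hasTorusPart_tor (t : (AE D)ˣ) : HasTorusPart (tor t) t :=
  (hasTorusPart_iff _ _).2 fun v => Or.inl (GD.at_tor t v)

theorem cls_tor (t : (AE D)ˣ) : cls (tor t) = (t : ClD D) := (hasTorusPart_tor t).cls_eq

theorem HasTorusPart.tor_mul {h : GD D Af} {t : (AE D)ˣ} (ht : HasTorusPart h t) (u : (AE D)ˣ) :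
    HasTorusPart (tor u * h) (u * t) := by
  rw [hasTorusPart_iff] at *
  intro v
  rw [GD.at_mul, GD.at_tor, map_mul, map_mul, mul_assoc]
  rcases ht v with e | e
  · exact Or.inl (by rw [e])
  · exact Or.inr (by rw [e])

theorem HasTorusPart.sig_mul {h : GD D Af} {t : (AE D)ˣ} (ht : HasTorusPart h t) :
    HasTorusPart (sig D Af * h) (conjIdele D t) := by
  rw [hasTorusPart_iff] at *
  intro v
  rw [GD.at_mul, GD.at_sig, unitAt_conj]
  rcases ht v with e | e
  · exact Or.inr (by rw [e, sig_mul_tor])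
  · exact Or.inl (by rw [e, ← mul_assoc, sig_mul_tor, mul_assoc, sig_mul_sig, mul_one])

theorem cls_tor_mul (u : (AE D)ˣ) (h : GD D Af) : cls (tor u * h) = (u : ClD D) * cls h := by
  rw [((torPart_spec h).tor_mul u).cls_eq]
  rfl

theorem cls_sig_mul (h : GD D Af) : cls (sig D Af * h) = (cls h)⁻¹ := by
  rw [((torPart_spec h).sig_mul).cls_eq, mk_conjIdele]
  rfl

variable (D) in
/-- `K_fin^{ξ*}` as a subgroup. -/
def finKsGrp : Subgroup (GD D Af) where
  carrier := finKs D
  one_mem' := fun v => by rw [GD.at_one]; exact (locKsGrp D v).one_mem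
  mul_mem' := fun h h' v => by rw [GD.at_mul]; exact (locKsGrp D v).mul_mem (h v) (h' v)
  inv_mem' := fun h v => by rw [GD.at_inv]; exact (locKsGrp D v).inv_mem (h v)

/-- Moving `σ̃` past a unit only conjugates the unit, so the torus part changes by units and
scalars. -/
theorem cls_mul_of_mem {h k : GD D Af} (hk : k ∈ finKs D) : cls (h * k) = cls h := by
  have h1 := (hasTorusPart_iff _ _).1 (torPart_spec h)
  have h2 := (hasTorusPart_iff _ _).1 (torPart_spec (h * k))
  refine (mk_eq_of_scalInt fun v => ?_).symm
  obtain ⟨s, hs, e⟩ := (mem_locKs_iff _).1 (hk v)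
  have h3 := h2 v
  rw [GD.at_mul] at h3
  have key : ∃ s' ∈ intUnits D v, h.at v * k.at v = tor (unitAt v (torPart h) * s') ∨
      h.at v * k.at v = tor (unitAt v (torPart h) * s') * sig D (Qv v) := by
    rcases h1 v with e1 | e1 <;> rcases e with e2 | e2 <;> rw [e1, e2]
    · exact ⟨s, hs, Or.inl (by rw [map_mul])⟩
    · exact ⟨s, hs, Or.inr (by rw [map_mul, mul_assoc])⟩
    · exact ⟨conjU s, conjU_mem_intUnits hs, Or.inr (by rw [mul_assoc, sig_mul_tor, map_mul, mul_assoc])⟩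
    · refine ⟨conjU s, conjU_mem_intUnits hs, Or.inl ?_⟩
      rw [mul_assoc, ← mul_assoc (sig _ _), sig_mul_tor, mul_assoc (tor _), sig_mul_sig, mul_one, map_mul]
  obtain ⟨s', hs', e'⟩ := key
  obtain ⟨q, hq⟩ := tor_eq_or e' h3
  have : (unitAt v (torPart h))⁻¹ * unitAt v (torPart (h * k)) = scal q * s' := by
    rw [← hq, mul_inv]
    rw [mul_right_comm, inv_mul_cancel_right]
  rw [this, scal_mul_mem_scalInt_iff]
  exact intUnits_le_scalInt hs'

theorem tor_mem_finKs {u : (AE D)ˣ} (hu : u ∈ intIdeles D) : tor u ∈ finKs D := fun v => by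
  rw [GD.at_tor]
  exact tor_mem_locKs (hu v)

/-- The image of a rational point in `G(𝔸_fin)`. -/
def ratFin (D : ℤ) : GD D ℚ →* GD D Af := GD.map (Algebra.ofId ℚ Af)

theorem ratFin_tor (e : (QA D ℚ)ˣ) : ratFin D (tor e) = tor (ratIdele e) := GD.map_tor _ _

theorem ratFin_sig : ratFin D (sig D ℚ) = sig D Af := GD.map_sig _

/-- Rational torus points are principal ideles, and `σ̃` acts on classes by conjugation, which is
inversion. -/
theorem cls_ratFin_mul (γ : GD D ℚ) (h : GD D Af) :
    cls (ratFin D γ * h) = cls h ∨ cls (ratFin D γ * h) = (cls h)⁻¹ := by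
  have h1 : ∀ e : (QA D ℚ)ˣ, ((ratIdele e : (AE D)ˣ) : ClD D) = 1 := fun e =>
    (QuotientGroup.eq_one_iff _).2 (mem_princSub.2 ⟨e, 1, one_mem _, mul_one _⟩)
  obtain ⟨e, rfl | rfl⟩ := γ.exists_tor
  · left
    rw [ratFin_tor, cls_tor_mul, h1, cls_one_mul]
  · right
    rw [map_mul, ratFin_tor, ratFin_sig, mul_assoc, cls_tor_mul, h1, cls_one_mul, cls_sig_mul]

/-- The quotient of the torus parts is a principal idele times a unit idele. The local reflections
lie in `K_v^*`, so they and the unit are absorbed into `k`. -/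
theorem exists_tor_of_cls_eq {h h' : GD D Af} (e : cls h' = cls h) :
    ∃ x : (QA D ℚ)ˣ, ∃ k ∈ finKs D, h' = ratFin D (tor x) * h * k := by
  have h1 := (hasTorusPart_iff _ _).1 (torPart_spec h)
  have h2 := (hasTorusPart_iff _ _).1 (torPart_spec h')
  have e' : (torPart h)⁻¹ * torPart h' ∈ princSub D := QuotientGroup.eq.1 e.symm
  obtain ⟨x, u, hu, hxu⟩ := mem_princSub.1 e'
  have e3 : torPart h' = ratIdele x * torPart h * u := by
    rw [mul_right_comm, hxu, inv_mul_cancel_comm]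
  refine ⟨x, (ratFin D (tor x) * h)⁻¹ * h', fun v => ?_, by rw [mul_inv_cancel_left]⟩
  rw [GD.at_mul, GD.at_inv, GD.at_mul, ratFin_tor, GD.at_tor]
  have e4 := congrArg (unitAt v) e3
  rw [map_mul, map_mul] at e4
  have hs : sig D (Qv v) ∈ locKsGrp D v := sig_mem_locKs
  have hu' : tor (unitAt v u) ∈ locKsGrp D v := tor_mem_locKs (hu v)
  have hi : (sig D (Qv v))⁻¹ ∈ locKsGrp D v := inv_mem hs
  change _ ∈ locKsGrp D v
  rcases h1 v with e1 | e1 <;> rcases h2 v with e2 | e2 <;> rw [e1, e2, e4, map_mul, map_mul]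
  · rw [← mul_assoc, inv_mul_cancel, one_mul]
    exact hu'
  · rw [mul_assoc (tor _ * tor _), inv_mul_cancel_left]
    exact mul_mem hu' hs
  · rw [← mul_assoc (tor _) (tor _) (sig _ _), mul_inv_rev (tor _ * tor _), mul_assoc, inv_mul_cancel_left]
    exact mul_mem hi hu'
  · rw [← mul_assoc (tor _) (tor _) (sig _ _), mul_inv_rev (tor _ * tor _), mul_assoc, mul_assoc (tor _ * tor _),
      inv_mul_cancel_left]
    exact mul_mem hi (mul_mem hu' hs)

theorem exists_of_cls_eq {h h' : GD D Af} (e : cls h' = cls h) :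
    ∃ γ : GD D ℚ, ∃ k ∈ finKs D, h' = ratFin D γ * h * k := by
  obtain ⟨x, h⟩ := exists_tor_of_cls_eq e
  exact ⟨tor x, h⟩

theorem exists_of_cls_eq_inv {h h' : GD D Af} (e : cls h' = (cls h)⁻¹) :
    ∃ γ : GD D ℚ, ∃ k ∈ finKs D, h' = ratFin D γ * h * k := by
  rw [← cls_sig_mul] at e
  obtain ⟨γ, k, hk, e'⟩ := exists_of_cls_eq e
  exact ⟨γ * sig D ℚ, k, hk, by rw [e', map_mul, ratFin_sig, ← mul_assoc (ratFin D γ)]⟩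

end group

/-! ### `OE D` as the full ring of integers -/

section dedekind

variable (D : ℤ) [h : ImagDisc D]

theorem factNoRoot : Fact (∀ r : ℚ, r ^ 2 ≠ (cA D : ℚ) + (cB D : ℚ) * r) := ⟨by
  intro r hr
  have h1 := cB_sq_cast D ℚ
  have h2 : (D : ℚ) < 0 := by exact_mod_cast h.neg
  nlinarith [sq_nonneg (2 * r - cB D)]⟩

attribute [local instance] factNoRoot

instance isDomainOE : IsDomain (OE D) := isDomain_OE h.isFundDisc h.neg

instance algebraOE : Algebra (OE D) (QA D ℚ) := (qmap (Int.castRingHom ℚ)).toAlgebra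

theorem algebraMap_OE (z : OE D) : algebraMap (OE D) (QA D ℚ) z = ⟨z.re, z.im⟩ := rfl

theorem algebraMap_OE_injective : Function.Injective (algebraMap (OE D) (QA D ℚ)) := by
  intro z w e
  rw [algebraMap_OE, algebraMap_OE, QuadraticAlgebra.mk.injEq] at e
  ext
  · exact_mod_cast e.1
  · exact_mod_cast e.2

-- The number `D y² = T² - 4N` is an integer. If `D` is squarefree, `y` is an integer. If `D = 4m`,
-- then `k = 2y` is an integer and `m k² ≡ T² mod 4` with `m ≡ 2, 3` forces `k` to be even. The
-- coordinate `x` is then integral, as a rational root of a monic polynomial.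
variable {D} in
theorem isInt_of_trace_norm {x y : ℚ} {T N : ℤ} (hT : 2 * x + cB D * y = T)
    (hN : x * x + cB D * x * y - cA D * y * y = N) :
    ∃ m n : ℤ, x = m ∧ y = n := by
  have h1 := cB_sq_cast D ℚ
  have hDy : (D : ℚ) * y ^ 2 = ((T ^ 2 - 4 * N : ℤ) : ℚ) := by
    push_cast
    rw [← hT, ← hN, ← h1]; ring
  have hsq : ∀ q : ℚ, (∃ n : ℤ, q ^ 2 = n) → ∃ m : ℤ, q = m := by
    rintro q ⟨n, hn⟩
    have : IsIntegral ℤ q := by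
      refine IsIntegral.of_pow (n := 2) two_pos ?_
      rw [hn]
      exact isIntegral_algebraMap (R := ℤ) (A := ℚ) (x := n)
    obtain ⟨m, hm⟩ := IsIntegrallyClosed.isIntegral_iff.1 this
    exact ⟨m, hm.symm⟩
  have hfin : ∀ n : ℤ, y = n → ∃ m n : ℤ, x = m ∧ y = n := by
    intro n hn
    have hx : ∃ m : ℤ, x = m := by
      have : IsIntegral ℤ x := by
        refine ⟨Polynomial.X ^ 2 + Polynomial.C (cB D * n) * Polynomial.X +
          Polynomial.C (-cA D * n * n - N), ?_, ?_⟩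
        · monicity!
        · simp only [Polynomial.eval₂_add, Polynomial.eval₂_mul, Polynomial.eval₂_pow,
            Polynomial.eval₂_X, Polynomial.eval₂_C]
          rw [eq_intCast, eq_intCast]
          push_cast
          rw [← hn, ← hN]
          ring
      obtain ⟨m, hm⟩ := IsIntegrallyClosed.isIntegral_iff.1 this
      exact ⟨m, hm.symm⟩
    obtain ⟨m, hm⟩ := hx
    exact ⟨m, n, hm, hn⟩
  have hsf : ∀ (m : ℤ) (q : ℚ), Squarefree m → (∃ n : ℤ, (m : ℚ) * q ^ 2 = n) → ∃ k : ℤ, q = k := by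
    rintro m q hm ⟨n, hn⟩
    have hd0 : (q.den : ℚ) ≠ 0 := by exact_mod_cast q.den_ne_zero
    have e : m * q.num ^ 2 = n * (q.den : ℤ) ^ 2 := by
      have : (m : ℚ) * q.num ^ 2 = n * (q.den : ℚ) ^ 2 := by
        have h3 : (q.num : ℚ) = q * q.den := (Rat.mul_den_eq_num q).symm
        rw [← hn, h3]
        ring
      exact_mod_cast this
    have hc : IsCoprime ((q.den : ℤ) ^ 2) (q.num ^ 2) := by
      refine IsCoprime.pow ?_
      rw [Int.isCoprime_iff_nat_coprime, Nat.coprime_comm]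
      simpa using q.reduced
    have hdvd : (q.den : ℤ) * q.den ∣ m := by
      rw [← sq]
      exact hc.dvd_of_dvd_mul_right ⟨n, by rw [e]; ring⟩
    have hu := Int.isUnit_iff.1 (hm _ hdvd)
    have hden : q.den = 1 := by
      have := q.den_pos
      omega
    exact ⟨q.num, (Rat.den_eq_one_iff q).1 hden |>.symm⟩
  rcases h.isFundDisc.2 with ⟨-, hs⟩ | ⟨m, hm, hs, hm4⟩
  · obtain ⟨k, hk⟩ := hsf D y hs ⟨_, hDy⟩
    exact hfin k hk
  · have hb : cB D = 0 := by rw [cB, if_pos (by omega)]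
    rw [hb] at hT
    simp only [Int.cast_zero, zero_mul, add_zero] at hT
    have e1 : (m : ℚ) * (2 * y) ^ 2 = ((T ^ 2 - 4 * N : ℤ) : ℚ) := by
      rw [← hDy, hm]; push_cast; ring
    obtain ⟨k, hk⟩ := hsf m (2 * y) hs ⟨_, e1⟩
    have e2 : m * k ^ 2 = T ^ 2 - 4 * N := by
      rw [hk] at e1
      exact_mod_cast e1
    have hk2 : k % 2 = 0 := by
      by_contra hodd
      have hk1 : k ^ 2 % 4 = 1 := by
        obtain ⟨j, rfl⟩ : ∃ j, k = 2 * j + 1 := ⟨k / 2, by omega⟩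
        ring_nf; omega
      have hT4 : T ^ 2 % 4 = 0 ∨ T ^ 2 % 4 = 1 := by
        rcases Int.even_or_odd' T with ⟨j, rfl | rfl⟩
        · left; ring_nf; omega
        · right; ring_nf; omega
      have hmk : (m * k ^ 2) % 4 = m % 4 := by
        rw [Int.mul_emod, hk1]; simp
      omega
    refine hfin (k / 2) ?_
    have : (k : ℚ) = 2 * ((k / 2 : ℤ) : ℚ) := by
      have : k = 2 * (k / 2) := by omega
      exact_mod_cast this
    linarith

theorem isIntegralClosureOE : IsIntegralClosure (OE D) ℤ (QA D ℚ) where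
  algebraMap_injective := algebraMap_OE_injective D
  isIntegral_iff := by
    intro z
    constructor
    · intro hz
      have hstar : IsIntegral ℤ (star z) := by
        have := hz.map (((starRingEnd (QA D ℚ)) : QA D ℚ →+* QA D ℚ).toIntAlgHom)
        exact this
      have hint : ∀ q : ℚ, IsIntegral ℤ (⟨q, 0⟩ : QA D ℚ) → ∃ n : ℤ, q = n := by
        intro q hq
        rw [show (⟨q, 0⟩ : QA D ℚ) = algebraMap ℚ (QA D ℚ) q from rfl] at hq
        rw [isIntegral_algebraMap_iff (FaithfulSMul.algebraMap_injective ℚ (QA D ℚ))] at hq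
        obtain ⟨m, hm⟩ := IsIntegrallyClosed.isIntegral_iff.1 hq
        exact ⟨m, hm.symm⟩
      obtain ⟨T, hT⟩ := hint z.trace (by
        have := hz.add hstar
        rwa [← QuadraticAlgebra.algebraMap_trace_eq_add_star] at this)
      obtain ⟨N, hN⟩ := hint z.norm (by
        have := hz.mul hstar
        rwa [mul_star_eq] at this)
      rw [QuadraticAlgebra.trace_def] at hT
      rw [QuadraticAlgebra.norm_def] at hN
      obtain ⟨m, n, hm, hn⟩ := isInt_of_trace_norm hT hN
      exact ⟨⟨m, n⟩, by rw [algebraMap_OE]; ext <;> simp [hm, hn]⟩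
    · rintro ⟨y, rfl⟩
      have : IsIntegral ℤ y := by
        have : Module.Finite ℤ (OE D) := inferInstance
        exact IsIntegral.of_finite ℤ y
      exact this.map ((algebraMap (OE D) (QA D ℚ)).toIntAlgHom)

theorem scalarTowerOE : IsScalarTower ℤ (OE D) (QA D ℚ) := by
  exact IsScalarTower.of_algebraMap_eq fun n => by
    simp

theorem finiteDimQA : FiniteDimensional ℚ (QA D ℚ) :=
  inferInstanceAs (Module.Finite ℚ (QuadraticAlgebra ℚ _ _))

attribute [local instance] isIntegralClosureOE scalarTowerOE finiteDimQA

instance isDedekindDomainOE : IsDedekindDomain (OE D) :=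
  IsIntegralClosure.isDedekindDomain ℤ ℚ (QA D ℚ) (OE D)

instance finiteClassGroupOE : Finite (ClassGroup (OE D)) :=
  @Finite.of_fintype _ (ClassGroup.fintypeOfAdmissibleOfFinite (R := ℤ) (S := OE D) ℚ (QA D ℚ)
    AbsoluteValue.absIsAdmissible)

end dedekind

/-! ### The dictionary between integral ideles and ideals -/

section ideals

variable {D : ℤ} {v : Pl}

theorem vl_intCast_le_exp_iff (v : Pl) (m : ℤ) (n : ℕ) :
    vl v (m : Qv v) ≤ WithZero.exp (-(n : ℤ)) ↔ (resChar v : ℤ) ^ n ∣ m := by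
  rw [vl_intCast, intValuation_le_pow_iff_dvd, asIdeal_eq_span, Ideal.span_singleton_pow,
    Ideal.dvd_span_singleton, Ideal.mem_span_singleton]

/-- Integral adeles are approximated by integers. -/
theorem exists_int_sub_le {x : Qv v} (hx : vl v x ≤ 1) (n : ℕ) :
    ∃ m : ℤ, vl v (x - m) ≤ WithZero.exp (-(n : ℤ)) := by
  induction n with
  | zero =>
    refine ⟨0, ?_⟩
    simpa using hx
  | succ n ih =>
    obtain ⟨m, hm⟩ := ih
    have hp := resChar_ne_zero v
    have h1 : vl v ((x - m) / (resChar v : Qv v) ^ n) ≤ 1 := by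
      rw [map_div₀, map_pow, vl_resChar, ← WithZero.exp_nsmul]
      rw [div_le_iff₀ (by simp), one_mul]
      simpa using hm
    obtain ⟨k, hk⟩ := exists_int_sub_lt h1
    rw [vl_lt_one_iff] at hk
    refine ⟨m + k * resChar v ^ n, ?_⟩
    have e : x - ((m + k * resChar v ^ n : ℤ) : Qv v) =
        ((x - m) / (resChar v : Qv v) ^ n - k) * (resChar v : Qv v) ^ n := by
      push_cast
      rw [sub_mul, div_mul_cancel₀ _ (pow_ne_zero n hp)]
      ring
    rw [e, map_mul, map_pow, vl_resChar, ← WithZero.exp_nsmul]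
    calc _ ≤ WithZero.exp (-1 : ℤ) * WithZero.exp (n • (-1 : ℤ)) := by gcongr
      _ = _ := by
        rw [← WithZero.exp_add]
        congr 1
        push_cast
        simp [add_comm]

/-- The component of an element of `OE D` at `v`. -/
def locOE (v : Pl) : OE D →+* QA D (Qv v) := qmap (Int.castRingHom (Qv v))

theorem compAt_toAE (x : OE D) : compAt v (toAE x) = locOE v x := by
  ext1
  · exact map_intCast (evalAt v) x.re
  · exact map_intCast (evalAt v) x.im

theorem intL_locOE (x : OE D) : IntL (locOE v x) := ⟨vl_intCast_le v _, vl_intCast_le v _⟩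

theorem locOE_zsmul (m : ℤ) (x : OE D) : locOE v (m • x) = (m : Qv v) • locOE v x := by
  rw [map_zsmul]
  exact QuadraticAlgebra.ext (zsmul_eq_mul _ _) (zsmul_eq_mul _ _)

theorem intL_zero : IntL (0 : QA D (Qv v)) := by simp [IntL]

/-- The ideal of an idele. -/
def idl (t : (AE D)ˣ) : Ideal (OE D) where
  carrier := {x | ∀ v, IntL ((((unitAt v t)⁻¹ : (QA D (Qv v))ˣ) : QA D (Qv v)) * locOE v x)}
  zero_mem' := fun v => by rw [map_zero, mul_zero]; exact intL_zero
  add_mem' := fun h h' v => by rw [map_add, mul_add]; exact (h v).add (h' v)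
  smul_mem' := fun c x h v => by
    rw [smul_eq_mul, map_mul, mul_left_comm]
    exact (intL_locOE c).mul (h v)

theorem mem_idl {t : (AE D)ˣ} {x : OE D} :
    x ∈ idl t ↔ ∀ v, IntL ((((unitAt v t)⁻¹ : (QA D (Qv v))ˣ) : QA D (Qv v)) * locOE v x) := Iff.rfl

variable (D) in
/-- The integral ideles. -/
def intMon : Submonoid (AE D)ˣ where
  carrier := {t | ∀ v, IntL (unitAt v t : QA D (Qv v))}
  one_mem' := fun v => by rw [map_one]; exact intL_one
  mul_mem' := fun h h' v => by rw [map_mul]; exact (h v).mul (h' v)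

theorem isIdeleOf_iff {t : (AE D)ˣ} {P : Ideal (OE D)} :
    IsIdeleOf t P ↔ t ∈ intMon D ∧ P = idl t := by
  rw [IsIdeleOf, isIntAE_iff, Ideal.ext_iff]
  refine and_congr Iff.rfl (forall_congr' fun x => iff_congr Iff.rfl ?_)
  rw [isIntAE_iff, mem_idl]
  refine forall_congr' fun v => ?_
  rw [map_mul, compAt_toAE, ← map_inv]
  rfl

theorem intL_mul_of_mem_intUnits {u : (QA D (Qv v))ˣ} (hu : u ∈ intUnits D v) {z : QA D (Qv v)} :
    IntL ((u : QA D (Qv v)) * z) ↔ IntL z := by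
  constructor
  · intro h
    have := hu.2.mul h
    rwa [← mul_assoc, Units.inv_mul, one_mul] at this
  · intro h
    exact hu.1.mul h

theorem vl_eq_one_of_ne {w : Pl} (h : w ≠ v) (n : ℕ) : vl w ((resChar v : Qv w) ^ n) = 1 := by
  rw [map_pow, vl_resChar_of_ne h, one_pow]

/-- Divisibility by a prime power in `OE D` is a local condition. -/
theorem exists_mul_of_intL {x : OE D} {n : ℕ}
    (h : IntL (((resChar v : Qv v) ^ n)⁻¹ • locOE v x)) :
    ∃ c : OE D, x = ((resChar v : ℤ) ^ n) • c := by
  have key : ∀ m : ℤ, vl v (((resChar v : Qv v) ^ n)⁻¹ * (m : Qv v)) ≤ 1 →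
      (resChar v : ℤ) ^ n ∣ m := by
    intro m hm
    rw [← vl_intCast_le_exp_iff]
    rw [map_mul, map_inv₀, map_pow, vl_resChar, ← WithZero.exp_nsmul,
      inv_mul_le_iff₀ (by simp), mul_one] at hm
    simpa using hm
  obtain ⟨a, ha⟩ := key _ h.1
  obtain ⟨b, hb⟩ := key _ h.2
  exact ⟨⟨a, b⟩, by ext <;> simp [ha, hb]⟩

/-- Scaling of integral ideles: a positive integer divisible by a given integral idele. -/
theorem exists_nat_smul (t : (AE D)ˣ) : ∃ M : ℕ, M ≠ 0 ∧
    ∀ v, IntL ((M : Qv v) • (((unitAt v t)⁻¹ : (QA D (Qv v))ˣ) : QA D (Qv v))) := by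
  have key : ∀ v, ∃ n : ℕ, (∀ x : Qv v, vl v x ≤ WithZero.exp (-(n : ℤ)) →
      IntL (x • (((unitAt v t)⁻¹ : (QA D (Qv v))ˣ) : QA D (Qv v)))) ∧
      (unitAt v t ∈ intUnits D v → n = 0) := by
    intro v
    by_cases hv : unitAt v t ∈ intUnits D v
    · refine ⟨0, fun x hx => ?_, fun _ => rfl⟩
      rw [Nat.cast_zero, neg_zero, WithZero.exp_zero] at hx
      exact IntL.smul hx hv.2
    · have h1 : ∀ y : Qv v, ∃ n : ℕ, ∀ x : Qv v, vl v x ≤ WithZero.exp (-(n : ℤ)) →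
          vl v (x * y) ≤ 1 := by
        intro y
        by_cases hy : y = 0
        · exact ⟨0, fun x _ => by simp [hy]⟩
        obtain ⟨k, hk⟩ := exists_vl_eq_exp hy
        refine ⟨k.natAbs, fun x hx => ?_⟩
        rw [map_mul, hk]
        calc _ ≤ WithZero.exp (-(k.natAbs : ℤ)) * WithZero.exp k := by gcongr
          _ ≤ 1 := by
            rw [← WithZero.exp_add, ← WithZero.exp_zero, WithZero.exp_le_exp]
            omega
      obtain ⟨m, hm⟩ := h1 ((((unitAt v t)⁻¹ : (QA D (Qv v))ˣ) : QA D (Qv v))).re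
      obtain ⟨n, hn⟩ := h1 ((((unitAt v t)⁻¹ : (QA D (Qv v))ˣ) : QA D (Qv v))).im
      refine ⟨max m n, fun x hx => ⟨hm x (hx.trans ?_), hn x (hx.trans ?_)⟩, fun h => absurd h hv⟩
      · rw [WithZero.exp_le_exp]; push_cast; omega
      · rw [WithZero.exp_le_exp]; push_cast; omega
  choose n hn hn0 using key
  have hfin : {v | n v ≠ 0}.Finite := (eventually_mem_intUnits t).mono hn0
  refine ⟨∏ v ∈ hfin.toFinset, resChar v ^ n v,
    Finset.prod_ne_zero_iff.2 fun v _ => pow_ne_zero _ (resChar_prime v).ne_zero, fun v => ?_⟩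
  refine hn v _ ?_
  have hd : ((resChar v : ℤ) ^ n v) ∣ ((∏ v ∈ hfin.toFinset, resChar v ^ n v : ℕ) : ℤ) := by
    by_cases h0 : n v = 0
    · rw [h0, pow_zero]; exact one_dvd _
    · have := Finset.dvd_prod_of_mem (fun v => resChar v ^ n v) (hfin.mem_toFinset.2 h0)
      exact_mod_cast this
  have := (vl_intCast_le_exp_iff v _ _).2 hd
  rwa [Int.cast_natCast] at this

theorem vl_resChar_smul_lt {x : Qv v} (hx : vl v x ≤ 1) : vl v ((resChar v : Qv v) * x) < 1 := by
  rw [map_mul]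
  refine mul_lt_one_of_lt_of_le ?_ hx
  rw [vl_resChar, ← WithZero.exp_zero, WithZero.exp_lt_exp]
  omega

theorem exists_intUnits_one_add {y : QA D (Qv v)} (hy : IntL y) :
    ∃ u ∈ intUnits D v, (u : QA D (Qv v)) = 1 + (resChar v : Qv v) • y := by
  have hn : vl v (1 + (resChar v : Qv v) • y).norm = 1 := by
    have e : (1 + (resChar v : Qv v) • y).norm =
        1 + (resChar v : Qv v) * (2 * y.re + cB D * y.im + (resChar v : Qv v) * y.norm) := by
      rw [QuadraticAlgebra.norm_def, QuadraticAlgebra.norm_def]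
      simp
      ring
    rw [e]
    refine (vl v).map_one_add_of_lt (vl_resChar_smul_lt ?_)
    refine vl_add_le (vl_add_le (vl_mul_le ?_ hy.1) (vl_mul_le (vl_intCast_le v _) hy.2))
      (vl_resChar_smul_lt hy.norm_le).le
    have := vl_intCast_le v 2
    rwa [Int.cast_ofNat] at this
  obtain ⟨u, hu⟩ := isUnit_of_norm_ne_zero (z := 1 + (resChar v : Qv v) • y) (by
    intro h0
    simp [h0] at hn)
  refine ⟨u, (mem_intUnits_iff u).2 ?_, hu⟩
  rw [hu]
  refine ⟨intL_one.add (IntL.smul ?_ hy), hn⟩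
  have := vl_intCast_le v (resChar v)
  rwa [Int.cast_natCast] at this

/-- Strong approximation: the ideal of an integral idele contains a local generator at `v`. -/
theorem exists_mem_idl_local {t : (AE D)ˣ} (ht : t ∈ intMon D) (v : Pl) :
    ∃ a ∈ idl t, ∃ u ∈ intUnits D v, locOE v a = ((unitAt v t * u : (QA D (Qv v))ˣ) : QA D (Qv v)) := by
  obtain ⟨M, hM0, hM⟩ := exists_nat_smul t
  obtain ⟨k, M', hM', rfl⟩ := Nat.exists_eq_pow_mul_and_not_dvd hM0 (resChar v) (resChar_prime v).ne_one
  have hp := resChar_ne_zero v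
  have hM'1 : vl v (M' : Qv v) = 1 := by
    have := vl_intCast_eq_one v (n := (M' : ℤ)) (by exact_mod_cast hM')
    rwa [Int.cast_natCast] at this
  have hM'0 : (M' : Qv v) ≠ 0 := by
    intro h0
    simp [h0] at hM'1
  -- The factor `M'` of `M` prime to `p` clears the denominators of `t⁻¹` away from `v`. At `v` one
  -- approximates `M'⁻¹ t` modulo `p^(k+1)`, one power more than the denominator `p^k` requires.
  have happ : ∀ y : Qv v, vl v y ≤ 1 → ∃ (c : ℤ) (z : Qv v), vl v z ≤ 1 ∧
      (c : Qv v) = (M' : Qv v)⁻¹ * y + (resChar v : Qv v) ^ (k + 1) * z := by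
    intro y hy
    obtain ⟨c, hc⟩ := exists_int_sub_le (x := (M' : Qv v)⁻¹ * y) (by
      rw [map_mul, map_inv₀, hM'1, inv_one, one_mul]; exact hy) (k + 1)
    refine ⟨c, (c - (M' : Qv v)⁻¹ * y) / (resChar v : Qv v) ^ (k + 1), ?_, ?_⟩
    · rw [map_div₀, map_pow, vl_resChar, ← WithZero.exp_nsmul,
        div_le_iff₀ (by simp), one_mul, Valuation.map_sub_swap]
      simpa using hc
    · rw [mul_div_cancel₀ _ (pow_ne_zero _ hp)]
      ring
  obtain ⟨c1, z1, hz1, hc1⟩ := happ _ (ht v).1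
  obtain ⟨c2, z2, hz2, hc2⟩ := happ _ (ht v).2
  have hz : IntL (⟨z1, z2⟩ : QA D (Qv v)) := ⟨hz1, hz2⟩
  -- Because of the extra power of `p`, the relative error has the form `1 + p y` with `y` integral,
  -- which is a unit.
  obtain ⟨u, hu, hu'⟩ := exists_intUnits_one_add ((hM v).mul hz)
  have hloc : locOE v ((M' : ℤ) • (⟨c1, c2⟩ : OE D)) =
      ((unitAt v t * u : (QA D (Qv v))ˣ) : QA D (Qv v)) := by
    rw [Units.val_mul, hu', mul_add, mul_one, mul_smul_comm, smul_mul_assoc, mul_smul_comm, ← mul_assoc,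
      Units.mul_inv, one_mul]
    have e : ∀ c z y : Qv v, c = (M' : Qv v)⁻¹ * y + (resChar v : Qv v) ^ (k + 1) * z →
        M' * c = y + (resChar v : Qv v) * (((resChar v ^ k * M' : ℕ) : Qv v) * z) := by
      rintro c z y rfl
      rw [mul_add, mul_inv_cancel_left₀ hM'0]
      push_cast
      ring
    rw [locOE_zsmul]
    exact QuadraticAlgebra.ext (by rw [Int.cast_natCast]; exact e _ _ _ hc1)
      (by rw [Int.cast_natCast]; exact e _ _ _ hc2)
  refine ⟨(M' : ℤ) • (⟨c1, c2⟩ : OE D), fun w => ?_, u, hu, hloc⟩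
  by_cases hw : w = v
  · subst hw
    rw [hloc, Units.val_mul, ← mul_assoc, Units.inv_mul, one_mul]
    exact hu.1
  · have h1 := vl_eq_one_of_ne hw k
    have h2 := IntL.smul (c := ((resChar v : Qv w) ^ k)⁻¹) (by rw [map_inv₀, h1, inv_one]) (hM w)
    have hpw : (resChar v : Qv w) ^ k ≠ 0 := by
      intro h0
      simp [h0] at h1
    have e : locOE w ((M' : ℤ) • (⟨c1, c2⟩ : OE D)) = (M' : Qv w) • locOE w ⟨c1, c2⟩ := by
      rw [locOE_zsmul, Int.cast_natCast]
    rw [e, mul_smul_comm, ← smul_mul_assoc]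
    refine IntL.mul ?_ (intL_locOE _)
    convert h2 using 1
    rw [smul_smul]
    push_cast
    rw [inv_mul_cancel_left₀ hpw]

theorem norm_locOE (x : OE D) : (locOE v x).norm = ((x.norm : ℤ) : Qv v) := by
  rw [locOE, qmap_norm]
  rfl

theorem locOE_star (x : OE D) : locOE v (star x) = star (locOE v x) := qmap_star _ _

theorem mul_star_OE (x : OE D) : x * star x = x.norm • (1 : OE D) := by
  rw [mul_star_eq]
  ext <;> simp

/-- Membership in an ideal of `OE D` is a local condition. -/
theorem mem_of_local {J : Ideal (OE D)} {y : OE D} (h : ∀ v : Pl, ∃ a ∈ J,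
    ∃ s : (QA D (Qv v))ˣ, locOE v a = s ∧ IntL (((s⁻¹ : (QA D (Qv v))ˣ) : QA D (Qv v)) * locOE v y)) :
    y ∈ J := by
  -- Here `m` is the prime-to-`p` part of `N(a) = p^j m`. Locally `ā y = N(a) s⁻¹ y`, so `p^j`
  -- divides `ā y`, and cancelling `p^j` shows that `m y` is a multiple of `a`.
  have key : ∀ v : Pl, ∃ m : ℤ, ¬ (resChar v : ℤ) ∣ m ∧ m • y ∈ J := by
    intro v
    obtain ⟨a, ha, s, hs, hint⟩ := h v
    have hN0 : a.norm ≠ 0 := by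
      intro h0
      have h1 := norm_ne_zero_of_unit s
      rw [← hs, norm_locOE, h0, Int.cast_zero] at h1
      exact h1 rfl
    have hp0 : (resChar v : ℤ) ≠ 0 := by exact_mod_cast (resChar_prime v).ne_zero
    have hp := resChar_ne_zero v
    obtain ⟨j, m, hm, hN⟩ := WfDvdMonoid.max_power_factor hN0
      (Nat.prime_iff_prime_int.1 (resChar_prime v)).irreducible
    obtain ⟨c, hc⟩ := exists_mul_of_intL (v := v) (x := star a * y) (n := j) (by
      have e : ((resChar v : Qv v) ^ j)⁻¹ • locOE v (star a * y) =
          (m : Qv v) • (((s⁻¹ : (QA D (Qv v))ˣ) : QA D (Qv v)) * locOE v y) := by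
        have e1 : star (s : QA D (Qv v)) = ((a.norm : ℤ) : Qv v) •
            ((s⁻¹ : (QA D (Qv v))ˣ) : QA D (Qv v)) := by
          rw [unit_inv_eq, smul_smul, ← hs, norm_locOE, mul_inv_cancel₀, one_smul]
          have := norm_ne_zero_of_unit s
          rwa [← hs, norm_locOE] at this
        rw [map_mul, locOE_star, hs, e1, smul_mul_assoc, smul_smul, hN]
        congr 1
        push_cast
        rw [inv_mul_cancel_left₀ (pow_ne_zero j hp)]
      rw [e]
      exact IntL.smul (vl_intCast_le v m) hint)
    refine ⟨m, hm, ?_⟩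
    have e : (resChar v : ℤ) ^ j • (m • y) = (resChar v : ℤ) ^ j • (a * c) := by
      rw [smul_smul, ← hN, ← mul_smul_comm, ← hc, ← mul_assoc, mul_star_OE, smul_mul_assoc, one_mul]
    have e2 : m • y = a * c := by
      have hpj := pow_ne_zero j hp0
      ext
      · have := congrArg QuadraticAlgebra.re e
        rw [QuadraticAlgebra.re_smul, QuadraticAlgebra.re_smul, smul_eq_mul, smul_eq_mul] at this
        exact mul_left_cancel₀ hpj this
      · have := congrArg QuadraticAlgebra.im e
        rw [QuadraticAlgebra.im_smul, QuadraticAlgebra.im_smul, smul_eq_mul, smul_eq_mul] at this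
        exact mul_left_cancel₀ hpj this
    rw [e2]
    exact J.mul_mem_right _ ha
  -- The integers multiplying `y` into `J` form an ideal of `ℤ` contained in no maximal ideal.
  let C : Ideal ℤ := (J.restrictScalars ℤ).comap (LinearMap.toSpanSingleton ℤ (OE D) y)
  have hC : ∀ n : ℤ, n ∈ C ↔ n • y ∈ J := fun n => Iff.rfl
  have hT : C = ⊤ := by
    by_contra hne
    obtain ⟨M, hM, hle⟩ := Ideal.exists_le_maximal C hne
    have hbot : M ≠ ⊥ := by
      rintro rfl
      obtain ⟨v, -⟩ := exists_place Nat.prime_two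
      obtain ⟨m, hm, hmy⟩ := key v
      have h0 : m = 0 := hle ((hC m).2 hmy)
      exact hm (h0 ▸ dvd_zero _)
    let v : Pl := ⟨M, hM.isPrime, hbot⟩
    obtain ⟨m, hm, hmy⟩ := key v
    have h1 : m ∈ v.asIdeal := hle ((hC m).2 hmy)
    rw [asIdeal_eq_span, Ideal.mem_span_singleton] at h1
    exact hm h1
  have h1 : (1 : ℤ) ∈ C := hT ▸ Submodule.mem_top
  rwa [hC, one_smul] at h1

/-- For the nontrivial inclusion, membership in the product is tested locally, where products of
local generators of the two ideals are available. -/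
theorem idl_mul {t u : (AE D)ˣ} (ht : t ∈ intMon D) (hu : u ∈ intMon D) :
    idl (t * u) = idl t * idl u := by
  apply le_antisymm
  · intro x hx
    refine mem_of_local fun v => ?_
    obtain ⟨a, ha, s, hs, has⟩ := exists_mem_idl_local ht v
    obtain ⟨b, hb, s', hs', hbs⟩ := exists_mem_idl_local hu v
    refine ⟨a * b, Ideal.mul_mem_mul ha hb, _, by rw [map_mul, has, hbs, ← Units.val_mul], ?_⟩
    have h1 := hx v
    have e : unitAt v t * s * (unitAt v u * s') = (s * s') * unitAt v (t * u) := by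
      rw [mul_mul_mul_comm, map_mul, mul_comm]
    rw [e, mul_inv, Units.val_mul, mul_assoc]
    exact (intL_mul_of_mem_intUnits (inv_mem (mul_mem hs hs'))).2 h1
  · rw [Ideal.mul_le]
    intro x hx y hy v
    rw [map_mul, map_mul, mul_inv, Units.val_mul, mul_mul_mul_comm]
    exact (hx v).mul (hy v)

theorem idl_one : idl (1 : (AE D)ˣ) = ⊤ := by
  rw [Ideal.eq_top_iff_one]
  intro v
  rw [map_one, inv_one, map_one, Units.val_one, one_mul]
  exact intL_one

theorem idl_mul_intIdeles (t : (AE D)ˣ) {u : (AE D)ˣ} (hu : u ∈ intIdeles D) :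
    idl (t * u) = idl t := by
  ext x
  rw [mem_idl, mem_idl]
  refine forall_congr' fun v => ?_
  rw [map_mul, mul_inv_rev, Units.val_mul, mul_assoc]
  exact intL_mul_of_mem_intUnits (inv_mem (hu v))

/-- A local generator of the common ideal is a unit multiple of the first idele and is divisible by
the second; by symmetry the quotient is a unit everywhere. -/
theorem inv_mul_mem_of_idl_eq {t u : (AE D)ˣ} (ht : t ∈ intMon D) (hu : u ∈ intMon D)
    (h : idl t = idl u) : t⁻¹ * u ∈ intIdeles D := by
  have key : ∀ t u : (AE D)ˣ, t ∈ intMon D → idl t = idl u → ∀ v,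
      IntL (((unitAt v u)⁻¹ * unitAt v t : (QA D (Qv v))ˣ) : QA D (Qv v)) := by
    intro t u ht h v
    obtain ⟨a, ha, s, hs, has⟩ := exists_mem_idl_local ht v
    rw [h] at ha
    have h1 := ha v
    rw [has, ← Units.val_mul, ← mul_assoc, mul_comm, Units.val_mul] at h1
    exact (intL_mul_of_mem_intUnits hs).1 h1
  intro v
  rw [map_mul, map_inv]
  refine ⟨key u t hu h.symm v, ?_⟩
  rw [mul_inv, inv_inv, mul_comm]
  exact key t u ht h v

theorem idl_ne_bot {t : (AE D)ˣ} (ht : t ∈ intMon D) : idl t ≠ ⊥ := by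
  intro h
  obtain ⟨v, -⟩ := exists_place Nat.prime_two
  obtain ⟨a, ha, s, hs, has⟩ := exists_mem_idl_local ht v
  rw [h, Ideal.mem_bot] at ha
  rw [ha, map_zero] at has
  have := norm_ne_zero_of_unit (unitAt v t * s)
  rw [← has, QuadraticAlgebra.norm_zero] at this
  exact this rfl

variable [ImagDisc D]

theorem norm_OE_ne_zero {x : OE D} (hx : x ≠ 0) : x.norm ≠ 0 := by
  intro h0
  have h1 := mul_star_OE x
  rw [h0, zero_smul] at h1
  rcases mul_eq_zero.1 h1 with h | h
  · exact hx h
  · exact hx (star_eq_zero.1 h)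

theorem exists_ratUnit {x : OE D} (hx : x ≠ 0) :
    ∃ e : (QA D ℚ)ˣ, (e : QA D ℚ) = qmap (Int.castRingHom ℚ) x :=
  isUnit_of_norm_ne_zero (by
    rw [qmap_norm]
    simpa using norm_OE_ne_zero hx)

/-- The principal idele of a nonzero element of `OE D`. -/
def oeIdele (x : OE D) (hx : x ≠ 0) : (AE D)ˣ := ratIdele (exists_ratUnit hx).choose

theorem unitAt_oeIdele {x : OE D} (hx : x ≠ 0) (v : Pl) :
    (unitAt v (oeIdele x hx) : QA D (Qv v)) = locOE v x := by
  have : (unitAt v (oeIdele x hx) : QA D (Qv v)) =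
      qmap (algebraMap ℚ (Qv v)) ((exists_ratUnit hx).choose : QA D ℚ) := rfl
  rw [this, (exists_ratUnit hx).choose_spec]
  exact QuadraticAlgebra.ext (map_intCast _ _) (map_intCast _ _)

theorem oeIdele_mem_intMon {x : OE D} (hx : x ≠ 0) : oeIdele x hx ∈ intMon D := fun v => by
  rw [unitAt_oeIdele]
  exact intL_locOE x

theorem oeIdele_mem_princSub {x : OE D} (hx : x ≠ 0) : oeIdele x hx ∈ princSub D :=
  mem_princSub.2 ⟨_, 1, one_mem _, mul_one _⟩

theorem idl_oeIdele {x : OE D} (hx : x ≠ 0) : idl (oeIdele x hx) = Ideal.span {x} := by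
  apply le_antisymm
  · intro y hy
    exact mem_of_local fun v => ⟨x, Ideal.mem_span_singleton_self x, unitAt v (oeIdele x hx),
      (unitAt_oeIdele hx v).symm, hy v⟩
  · rw [Ideal.span_singleton_le_iff_mem]
    intro v
    rw [← unitAt_oeIdele hx, Units.inv_mul]
    exact intL_one

/-- Every finite idele is, up to principal ideles, integral. -/
theorem exists_intMon_mul (t : (AE D)ˣ) : ∃ (M : OE D) (hM : M ≠ 0), t * oeIdele M hM ∈ intMon D := by
  obtain ⟨M, hM0, hM⟩ := exists_nat_smul t⁻¹
  have hM' : (M : OE D) ≠ 0 := by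
    intro h0
    have := congrArg QuadraticAlgebra.re h0
    simp at this
    exact hM0 this
  refine ⟨M, hM', fun v => ?_⟩
  rw [map_mul, Units.val_mul, unitAt_oeIdele, mul_comm]
  have h1 := hM v
  rw [map_inv, inv_inv] at h1
  have e : locOE v (M : OE D) * (unitAt v t : QA D (Qv v)) = (M : Qv v) • (unitAt v t : QA D (Qv v)) := by
    rw [map_natCast, ← nsmul_eq_mul]
    exact QuadraticAlgebra.ext (nsmul_eq_mul _ _) (nsmul_eq_mul _ _)
  rw [e]
  exact h1

end ideals

/-! ### Prime ideals of `OE D` and the comparison of the two class groups -/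

section primes

variable {D : ℤ} {v : Pl}

theorem mem_idl_locIdele {t : (QA D (Qv v))ˣ} {x : OE D} : x ∈ idl (locIdele v t) ↔
    IntL (((t⁻¹ : (QA D (Qv v))ˣ) : QA D (Qv v)) * locOE v x) := by
  rw [mem_idl]
  constructor
  · intro h
    have := h v
    rwa [unitAt_locIdele_self] at this
  · intro h w
    by_cases hw : w = v
    · subst hw
      rwa [unitAt_locIdele_self]
    · rw [unitAt_locIdele_of_ne hw, inv_one, Units.val_one, one_mul]
      exact intL_locOE x

theorem locIdele_mem_intMon {t : (QA D (Qv v))ˣ} (h : IntL (t : QA D (Qv v))) :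
    locIdele v t ∈ intMon D := fun w => by
  by_cases hw : w = v
  · subst hw
    rwa [unitAt_locIdele_self]
  · rw [unitAt_locIdele_of_ne hw, Units.val_one]
    exact intL_one

theorem IsRootAt.cast_eq {r : ℤ} (h : IsRootAt D v r) :
    (r : ZMod (resChar v)) ^ 2 - cB D * r - cA D = 0 := by
  have := (ZMod.intCast_zmod_eq_zero_iff_dvd (nf D r) (resChar v)).2 h.1
  simpa [nf] using this

/-- Reduction modulo the prime ideal `(p, ω - r)`. -/
def redAt {r : ℤ} (h : IsRootAt D v r) : OE D →+* ZMod (resChar v) :=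
  (evalRoot (D := D) (r : ZMod (resChar v)) h.cast_eq).comp (qmap (Int.castRingHom _))

theorem redAt_apply {r : ℤ} (h : IsRootAt D v r) (x : OE D) :
    redAt h x = ((x.re + r * x.im : ℤ) : ZMod (resChar v)) := by
  have : redAt h x = ((x.re : ℤ) : ZMod (resChar v)) + ((x.im : ℤ) : ZMod (resChar v)) * r := rfl
  rw [this]
  push_cast
  ring

theorem mem_ker_redAt {r : ℤ} (h : IsRootAt D v r) {x : OE D} :
    x ∈ RingHom.ker (redAt h) ↔ (resChar v : ℤ) ∣ x.re + r * x.im := by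
  rw [RingHom.mem_ker, redAt_apply, ZMod.intCast_zmod_eq_zero_iff_dvd]

theorem redAt_surjective {r : ℤ} (h : IsRootAt D v r) : Function.Surjective (redAt h) := fun y => by
  obtain ⟨n, rfl⟩ := ZMod.intCast_surjective y
  exact ⟨⟨n, 0⟩, by rw [redAt_apply]; simp⟩

instance factPrimeResChar (v : Pl) : Fact (resChar v).Prime := ⟨resChar_prime v⟩

theorem ker_redAt_isMaximal {r : ℤ} (h : IsRootAt D v r) : (RingHom.ker (redAt h)).IsMaximal :=
  RingHom.ker_isMaximal_of_surjective _ (redAt_surjective h)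

theorem card_quot_ker_redAt {r : ℤ} (h : IsRootAt D v r) :
    Nat.card (OE D ⧸ RingHom.ker (redAt h)) = resChar v := by
  rw [Nat.card_congr (RingHom.quotientKerEquivOfSurjective (redAt_surjective h)).toEquiv,
    Nat.card_zmod]

theorem mem_asIdeal {n : ℤ} : n ∈ v.asIdeal ↔ (resChar v : ℤ) ∣ n := by
  rw [asIdeal_eq_span, Ideal.mem_span_singleton]

theorem comap_ker_redAt {r : ℤ} (h : IsRootAt D v r) :
    (RingHom.ker (redAt h)).comap (Int.castRingHom (OE D)) = v.asIdeal := by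
  ext n
  rw [Ideal.mem_comap, mem_ker_redAt, mem_asIdeal]
  simp

theorem natCast_mem_of_comap {P : Ideal (OE D)}
    (hP : P.comap (Int.castRingHom (OE D)) = v.asIdeal) : ((resChar v : ℕ) : OE D) ∈ P := by
  have : (resChar v : ℤ) ∈ P.comap (Int.castRingHom (OE D)) := by
    rw [hP, mem_asIdeal]
  simpa using this

theorem ker_redAt_le {r : ℤ} (h : IsRootAt D v r) {P : Ideal (OE D)}
    (hp : ((resChar v : ℕ) : OE D) ∈ P) (hP : piE D r ℤ ∈ P) : RingHom.ker (redAt h) ≤ P := by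
  intro x hx
  obtain ⟨k, hk⟩ := (mem_ker_redAt h).1 hx
  have : x = (k : OE D) * ((resChar v : ℕ) : OE D) + (x.im : OE D) * piE D r ℤ := by
    refine QuadraticAlgebra.ext ?_ ?_
    · simp [piE]
      linear_combination hk
    · simp [piE]
  rw [this]
  exact P.add_mem (P.mul_mem_left _ hp) (P.mul_mem_left _ hP)

/-- The prime contains `p`, hence `N(ω - r)`, hence `ω - r` or its conjugate; each of these together
with `p` generates a maximal ideal. -/
theorem eq_ker_redAt {r : ℤ} (h : IsRootAt D v r) {P : Ideal (OE D)} (hP : P.IsPrime)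
    (hc : P.comap (Int.castRingHom (OE D)) = v.asIdeal) :
    P = RingHom.ker (redAt h) ∨ P = RingHom.ker (redAt h.conj) := by
  have hp := natCast_mem_of_comap hc
  have hmul : piE D r ℤ * star (piE D r ℤ) ∈ P := by
    obtain ⟨k, hk⟩ := h.1
    have : piE D r ℤ * star (piE D r ℤ) = (k : OE D) * ((resChar v : ℕ) : OE D) := by
      rw [mul_star_OE, norm_piE]
      refine QuadraticAlgebra.ext ?_ ?_
      · simp
        linear_combination hk
      · simp
    rw [this]
    exact P.mul_mem_left _ hp
  rcases hP.mem_or_mem hmul with h1 | h1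
  · exact Or.inl ((ker_redAt_isMaximal h).eq_of_le hP.ne_top (ker_redAt_le h hp h1)).symm
  · rw [star_piE, P.neg_mem_iff] at h1
    exact Or.inr ((ker_redAt_isMaximal h.conj).eq_of_le hP.ne_top
      (ker_redAt_le h.conj hp h1)).symm

theorem ker_redAt_conj_eq_iff {r : ℤ} (h : IsRootAt D v r) :
    RingHom.ker (redAt h.conj) = RingHom.ker (redAt h) ↔ (resChar v : ℤ) ∣ 2 * r - cB D := by
  constructor
  · intro e
    have : piE D r ℤ ∈ RingHom.ker (redAt h.conj) := by
      rw [e, mem_ker_redAt]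
      simp [piE]
    rw [mem_ker_redAt] at this
    simp only [piE, Int.cast_id] at this
    rw [← dvd_neg]
    rwa [show -(2 * r - cB D) = -r + (cB D - r) * 1 by ring]
  · intro e
    ext x
    rw [mem_ker_redAt, mem_ker_redAt, show x.re + (cB D - r) * x.im =
      x.re + r * x.im - (2 * r - cB D) * x.im by ring]
    exact dvd_sub_left (e.mul_right _)

section inert

variable (hin : ∀ r : ℤ, ¬ (resChar v : ℤ) ∣ nf D r)

include hin in
theorem fact_inert : Fact (∀ r : ZMod (resChar v), r ^ 2 ≠
    ((cA D : ℤ) : ZMod (resChar v)) + ((cB D : ℤ) : ZMod (resChar v)) * r) := ⟨fun r hr => by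
  obtain ⟨n, rfl⟩ := ZMod.intCast_surjective r
  refine hin n ((ZMod.intCast_zmod_eq_zero_iff_dvd _ _).1 ?_)
  simp only [nf]
  push_cast
  linear_combination hr⟩

/-- Reduction modulo an inert prime. -/
def redInert (D : ℤ) (v : Pl) : OE D →+* QA D (ZMod (resChar v)) := qmap (Int.castRingHom _)

theorem mem_ker_redInert {x : OE D} : x ∈ RingHom.ker (redInert D v) ↔
    (resChar v : ℤ) ∣ x.re ∧ (resChar v : ℤ) ∣ x.im := by
  rw [RingHom.mem_ker, ← ZMod.intCast_zmod_eq_zero_iff_dvd, ← ZMod.intCast_zmod_eq_zero_iff_dvd,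
    QuadraticAlgebra.ext_iff]
  exact Iff.rfl

theorem redInert_surjective : Function.Surjective (redInert D v) := fun y => by
  obtain ⟨m, hm⟩ := ZMod.intCast_surjective y.re
  obtain ⟨n, hn⟩ := ZMod.intCast_surjective y.im
  exact ⟨⟨m, n⟩, QuadraticAlgebra.ext hm hn⟩

include hin in
theorem ker_redInert_isMaximal : (RingHom.ker (redInert D v)).IsMaximal := by
  have := fact_inert hin
  have hF : IsField (QA D (ZMod (resChar v))) := Field.toIsField _
  let _ : Field (QA D (ZMod (resChar v))) := hF.toField
  exact RingHom.ker_isMaximal_of_surjective (redInert D v) redInert_surjective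

theorem card_quot_ker_redInert :
    Nat.card (OE D ⧸ RingHom.ker (redInert D v)) = resChar v ^ 2 := by
  rw [Nat.card_congr (RingHom.quotientKerEquivOfSurjective redInert_surjective).toEquiv,
    Nat.card_congr (QuadraticAlgebra.equivProd _ _), Nat.card_prod, Nat.card_zmod, sq]

theorem comap_ker_redInert :
    (RingHom.ker (redInert D v)).comap (Int.castRingHom (OE D)) = v.asIdeal := by
  ext n
  rw [Ideal.mem_comap, mem_ker_redInert, mem_asIdeal]
  simp

include hin in
theorem eq_ker_redInert {P : Ideal (OE D)} (hP : P.IsPrime)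
    (hc : P.comap (Int.castRingHom (OE D)) = v.asIdeal) : P = RingHom.ker (redInert D v) := by
  refine ((ker_redInert_isMaximal hin).eq_of_le hP.ne_top fun x hx => ?_).symm
  obtain ⟨⟨m, hm⟩, n, hn⟩ := mem_ker_redInert.1 hx
  have : x = (⟨m, n⟩ : OE D) * ((resChar v : ℕ) : OE D) := by
    refine QuadraticAlgebra.ext ?_ ?_
    · simp [hm]; ring
    · simp [hn]; ring
  rw [this]
  exact P.mul_mem_left _ (natCast_mem_of_comap hc)

theorem idl_locIdele_resU : idl (locIdele v (scal (resU v) : (QA D (Qv v))ˣ)) =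
    RingHom.ker (redInert D v) := by
  ext x
  rw [mem_idl_locIdele, mem_ker_redInert, ← map_inv]
  have e : ((scal (resU v)⁻¹ : (QA D (Qv v))ˣ) : QA D (Qv v)) * locOE v x =
      ⟨(resChar v : Qv v)⁻¹ * (x.re : Qv v), (resChar v : Qv v)⁻¹ * (x.im : Qv v)⟩ := by
    rw [scal_val]
    refine QuadraticAlgebra.ext ?_ ?_ <;> simp [resU, locOE]
  have key : ∀ n : ℤ, vl v ((resChar v : Qv v)⁻¹ * (n : Qv v)) ≤ 1 ↔ (resChar v : ℤ) ∣ n :=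
    fun n => by rw [mul_comm, ← div_eq_mul_inv, ← vl_lt_one_iff_div, vl_intCast_lt_iff]
  rw [e, IntL, key, key]

theorem locIdele_resU_mem : locIdele v (scal (resU v) : (QA D (Qv v))ˣ) ∈ intMon D :=
  locIdele_mem_intMon (by
    rw [scal_val]
    exact ⟨by simpa [resU] using vl_intCast_le v (resChar v), by simp⟩)

end inert

variable [ImagDisc D]

/-- Because `N(ω - r)` has valuation exactly one, divisibility by `ω - r` at `v` reduces to the
single congruence `x.re + r x.im ≡ 0`. -/
theorem idl_locIdele_piU {r : ℤ} (h : IsRootAt D v r) :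
    idl (locIdele v (piU D r (Qv v))) = RingHom.ker (redAt h) := by
  ext x
  rw [mem_idl_locIdele, mem_ker_redAt, ← vl_intCast_lt_iff, piU_inv, smul_mul_assoc, mul_comm,
    mul_star_piE]
  have hn : vl v (nf D r : Qv v) = WithZero.exp (-1) := vl_nf D h
  have hn0 : (nf D r : Qv v) ≠ 0 := nf_cast_ne_zero D r _
  set X : Qv v := ((x.re + r * x.im : ℤ) : Qv v) with hX
  have e : (locOE v x).re + (r : Qv v) * (locOE v x).im = X := by
    rw [hX]
    push_cast
    rfl
  rw [e]
  have key : vl v ((nf D r : Qv v)⁻¹ * X) ≤ 1 ↔ vl v X < 1 := by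
    rw [vl_lt_one_iff_div, div_eq_mul_inv, map_mul, map_mul, map_inv₀, map_inv₀, hn, vl_resChar,
      mul_comm]
  constructor
  · rintro ⟨-, h2⟩
    rw [← key]
    have := h2
    rw [QuadraticAlgebra.im_smul, smul_eq_mul, mul_neg, Valuation.map_neg] at this
    exact this
  · intro h1
    have h2 := key.2 h1
    refine ⟨?_, ?_⟩
    · rw [QuadraticAlgebra.re_smul, smul_eq_mul, mul_add, mul_left_comm, mul_left_comm _ _ (nf D r : Qv v),
        inv_mul_cancel₀ hn0, mul_one]
      refine vl_add_le (vl_mul_le ?_ h2) (vl_intCast_le v _)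
      rw [← Int.cast_sub]
      exact vl_intCast_le v _
    · rw [QuadraticAlgebra.im_smul, smul_eq_mul, mul_neg, Valuation.map_neg]
      exact h2

theorem intL_piU (r : ℤ) : IntL (piU D r (Qv v) : QA D (Qv v)) := by
  rw [piU_val]
  refine ⟨?_, ?_⟩
  · simpa [piE] using vl_intCast_le v r
  · simp [piE]

theorem locIdele_piU_mem (r : ℤ) : locIdele v (piU D r (Qv v)) ∈ intMon D :=
  locIdele_mem_intMon (intL_piU r)

theorem exists_resChar_mem {P : Ideal (OE D)} [hP : P.IsPrime] (h0 : P ≠ ⊥) :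
    ∃ v : Pl, P.comap (Int.castRingHom (OE D)) = v.asIdeal := by
  obtain ⟨x, hx, hx0⟩ := Submodule.exists_mem_ne_zero_of_ne_bot h0
  have hn : x.norm ∈ P.comap (Int.castRingHom (OE D)) := by
    have : Int.castRingHom (OE D) x.norm = x * star x := by
      rw [mul_star_OE]
      simp
    rw [Ideal.mem_comap, this]
    exact P.mul_mem_right _ hx
  refine ⟨⟨P.comap (Int.castRingHom (OE D)), inferInstance, fun hb => ?_⟩, rfl⟩
  rw [hb, Ideal.mem_bot] at hn
  exact norm_OE_ne_zero hx0 hn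

/-- The prime ideals of `OE D`. -/
theorem isPrime_cases {P : Ideal (OE D)} (hP : P.IsPrime) (h0 : P ≠ ⊥) :
    (∃ (v : Pl) (r : ℤ) (h : IsRootAt D v r), P = RingHom.ker (redAt h)) ∨
    (∃ v : Pl, (∀ r : ℤ, ¬ (resChar v : ℤ) ∣ nf D r) ∧ P = RingHom.ker (redInert D v)) := by
  obtain ⟨v, hv⟩ := exists_resChar_mem h0
  by_cases hin : ∀ r : ℤ, ¬ (resChar v : ℤ) ∣ nf D r
  · exact Or.inr ⟨v, hin, eq_ker_redInert hin hP hv⟩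
  · push Not at hin
    obtain ⟨r, hr⟩ := hin
    obtain ⟨k, hk⟩ := exists_isRootAt hr
    rcases eq_ker_redAt hk hP hv with h | h
    · exact Or.inl ⟨v, _, hk, h⟩
    · exact Or.inl ⟨v, _, hk.conj, h⟩

/-- Every nonzero ideal is the ideal of an integral idele. -/
theorem exists_idl_eq {I : Ideal (OE D)} (hI : I ≠ ⊥) : ∃ t ∈ intMon D, I = idl t := by
  induction I using UniqueFactorizationMonoid.induction_on_prime with
  | h₁ => exact absurd rfl hI
  | h₂ I h => exact ⟨1, one_mem _, by rw [idl_one, Ideal.isUnit_iff.1 h]⟩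
  | h₃ I P hI0 hP ih =>
    obtain ⟨t, ht, e⟩ := ih hI0
    have hPp : P.IsPrime := Ideal.isPrime_of_prime hP
    have : ∃ u ∈ intMon D, P = idl u := by
      rcases isPrime_cases hPp hP.ne_zero with ⟨v, r, hr, h⟩ | ⟨v, hv, h⟩
      · exact ⟨_, locIdele_piU_mem r, by rw [h, idl_locIdele_piU hr]⟩
      · exact ⟨_, locIdele_resU_mem, by rw [h, idl_locIdele_resU]⟩
    obtain ⟨u, hu, e'⟩ := this
    exact ⟨u * t, mul_mem hu ht, by rw [idl_mul hu ht, e, e']⟩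

open Classical in
/-- The class in `ClD D` of an ideal. -/
def idCls (I : Ideal (OE D)) : ClD D :=
  if h : ∃ t ∈ intMon D, I = idl t then (h.choose : ClD D) else 1

theorem idCls_idl {t : (AE D)ˣ} (ht : t ∈ intMon D) : idCls (idl t) = (t : ClD D) := by
  have h : ∃ u ∈ intMon D, idl t = idl u := ⟨t, ht, rfl⟩
  rw [idCls, dif_pos h]
  obtain ⟨h1, h2⟩ := h.choose_spec
  exact (QuotientGroup.eq.2 (princSub_eq (D := D) ▸ Subgroup.mem_sup_right
    (inv_mul_mem_of_idl_eq ht h1 h2))).symm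

theorem idCls_mul {I J : Ideal (OE D)} (hI : I ≠ ⊥) (hJ : J ≠ ⊥) :
    idCls (I * J) = idCls I * idCls J := by
  obtain ⟨t, ht, rfl⟩ := exists_idl_eq hI
  obtain ⟨u, hu, rfl⟩ := exists_idl_eq hJ
  rw [← idl_mul ht hu, idCls_idl ht, idCls_idl hu, idCls_idl (mul_mem ht hu)]
  rfl

theorem idCls_span {x : OE D} (hx : x ≠ 0) : idCls (Ideal.span {x}) = 1 := by
  rw [← idl_oeIdele hx, idCls_idl (oeIdele_mem_intMon hx)]
  exact (QuotientGroup.eq_one_iff _).2 (oeIdele_mem_princSub hx)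

theorem idCls_top : idCls (⊤ : Ideal (OE D)) = 1 := by
  rw [← Ideal.span_singleton_one]
  exact idCls_span one_ne_zero

theorem exists_idCls_eq (c : ClD D) : ∃ I : Ideal (OE D), I ≠ ⊥ ∧ idCls I = c := by
  obtain ⟨t, rfl⟩ := QuotientGroup.mk_surjective c
  obtain ⟨M, hM, h⟩ := exists_intMon_mul t
  refine ⟨idl _, idl_ne_bot h, ?_⟩
  rw [idCls_idl h]
  refine (QuotientGroup.eq.2 ?_).symm
  rw [inv_mul_cancel_left]
  exact oeIdele_mem_princSub hM

theorem span_singleton_ne_bot {x : OE D} (hx : x ≠ 0) : Ideal.span {x} ≠ ⊥ := by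
  rwa [Ne, Ideal.span_singleton_eq_bot]

theorem exists_clear_denominator (e : (QA D ℚ)ˣ) : ∃ (M x : OE D) (hM : M ≠ 0) (hx : x ≠ 0),
    ratIdele e * oeIdele M hM = oeIdele x hx := by
  obtain ⟨n, hn⟩ := IsLocalization.exist_integer_multiples_of_finset (nonZeroDivisors ℤ)
    ({(e : QA D ℚ).re, (e : QA D ℚ).im} : Finset ℚ)
  have hn0 : ((n : ℤ) : ℚ) ≠ 0 := by exact_mod_cast nonZeroDivisors.ne_zero n.2
  obtain ⟨x, hx⟩ := hn (e : QA D ℚ).re (by simp)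
  obtain ⟨y, hy⟩ := hn (e : QA D ℚ).im (by simp)
  have hM : ((n : ℤ) : OE D) ≠ 0 := fun h0 => by
    have := congrArg QuadraticAlgebra.re h0
    simp at this
  have key : (⟨(x : ℤ), (y : ℤ)⟩ : QA D ℚ) = (e : QA D ℚ) * ⟨((n : ℤ) : ℚ), 0⟩ := by
    refine QuadraticAlgebra.ext ?_ ?_
    · have : ((x : ℤ) : ℚ) = ((n : ℤ) : ℚ) * (e : QA D ℚ).re := by
        rw [← zsmul_eq_mul]; exact hx
      simp [this, mul_comm]
    · have : ((y : ℤ) : ℚ) = ((n : ℤ) : ℚ) * (e : QA D ℚ).im := by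
        rw [← zsmul_eq_mul]; exact hy
      simp [this, mul_comm]
  have hx0 : (⟨x, y⟩ : OE D) ≠ 0 := fun h0 => by
    have h1 : x = 0 := congrArg QuadraticAlgebra.re h0
    have h2 : y = 0 := congrArg QuadraticAlgebra.im h0
    have h3 : (e : QA D ℚ) * ⟨((n : ℤ) : ℚ), 0⟩ = 0 := by
      rw [← key, h1, h2]
      refine QuadraticAlgebra.ext ?_ ?_ <;> simp
    rw [Units.mul_right_eq_zero] at h3
    exact hn0 (congrArg QuadraticAlgebra.re h3)
  refine ⟨_, _, hM, hx0, ?_⟩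
  have h1 := (exists_ratUnit hM).choose_spec
  have h2 := (exists_ratUnit hx0).choose_spec
  rw [oeIdele, oeIdele, ← map_mul]
  congr 1
  ext1
  rw [Units.val_mul, h1, h2]
  refine Eq.trans ?_ (key.symm.trans ?_)
  · congr 1
  · refine QuadraticAlgebra.ext ?_ ?_ <;> simp [qmap]

theorem exists_of_idCls_eq {I J : Ideal (OE D)} (hI : I ≠ ⊥) (hJ : J ≠ ⊥)
    (h : idCls I = idCls J) :
    ∃ x y : OE D, x ≠ 0 ∧ y ≠ 0 ∧ Ideal.span {x} * I = Ideal.span {y} * J := by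
  obtain ⟨t, ht, rfl⟩ := exists_idl_eq hI
  obtain ⟨u, hu, rfl⟩ := exists_idl_eq hJ
  rw [idCls_idl ht, idCls_idl hu, QuotientGroup.eq, mem_princSub] at h
  obtain ⟨e, w, hw, he⟩ := h
  obtain ⟨M, x, hM, hx, hMx⟩ := exists_clear_denominator e
  refine ⟨x, M, hx, hM, ?_⟩
  rw [← idl_oeIdele hx, ← idl_oeIdele hM, ← idl_mul (oeIdele_mem_intMon hx) ht,
    ← idl_mul (oeIdele_mem_intMon hM) hu, ← idl_mul_intIdeles (oeIdele x hx * t) hw, ← hMx]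
  congr 1
  rw [show u = t * (ratIdele e * w) by rw [he, mul_inv_cancel_left]]
  rw [mul_comm (ratIdele e), mul_assoc, mul_assoc, mul_left_comm (ratIdele e)]

theorem idCls_eq_of_span {I J : Ideal (OE D)} (hI : I ≠ ⊥) (hJ : J ≠ ⊥) {x y : OE D} (hx : x ≠ 0)
    (hy : y ≠ 0) (h : Ideal.span {x} * I = Ideal.span {y} * J) : idCls I = idCls J := by
  have := congrArg idCls h
  rwa [idCls_mul (span_singleton_ne_bot hx) hI, idCls_mul (span_singleton_ne_bot hy) hJ,
    idCls_span hx, idCls_span hy, cls_one_mul, cls_one_mul] at this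

theorem mk0_eq_iff {I J : nonZeroDivisors (Ideal (OE D))} :
    ClassGroup.mk0 I = ClassGroup.mk0 J ↔ idCls (I : Ideal (OE D)) = idCls (J : Ideal (OE D)) := by
  have hI : (I : Ideal (OE D)) ≠ ⊥ := nonZeroDivisors.ne_zero I.2
  have hJ : (J : Ideal (OE D)) ≠ ⊥ := nonZeroDivisors.ne_zero J.2
  rw [ClassGroup.mk0_eq_mk0_iff]
  constructor
  · rintro ⟨x, y, hx, hy, h⟩
    exact idCls_eq_of_span hI hJ hx hy h
  · intro h
    obtain ⟨x, y, hx, hy, h⟩ := exists_of_idCls_eq hI hJ h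
    exact ⟨x, y, hx, hy, h⟩

/-- The classical relation `xI = yJ` between ideals matches equality of their idelic classes, so any
choice of representatives gives a bijection. -/
theorem card_classGroup : Nat.card (ClassGroup (OE D)) = Nat.card (ClD D) := by
  choose s hs using ClassGroup.mk0_surjective (R := OE D)
  refine Nat.card_eq_of_bijective (fun c => idCls (s c : Ideal (OE D))) ⟨fun c d h => ?_, fun c => ?_⟩
  · rw [← hs c, ← hs d]
    exact mk0_eq_iff.2 h
  · obtain ⟨I, hI, rfl⟩ := exists_idCls_eq c
    refine ⟨ClassGroup.mk0 ⟨I, mem_nonZeroDivisors_of_ne_zero hI⟩, ?_⟩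
    exact mk0_eq_iff.1 (hs (ClassGroup.mk0 ⟨I, mem_nonZeroDivisors_of_ne_zero hI⟩))

instance finiteClD : Finite (ClD D) := by
  have : 0 < Nat.card (ClD D) := by
    rw [← card_classGroup]
    exact Nat.card_pos
  exact (Nat.card_pos_iff.1 this).2

theorem chiIdeal_eq (χ : ClDual D) {I : Ideal (OE D)} (hI : I ≠ ⊥) :
    chiIdeal χ I = (χ (idCls I) : ℂˣ) := by
  obtain ⟨t, ht, rfl⟩ := exists_idl_eq hI
  have h : ∃ u, IsIdeleOf u (idl t) := ⟨t, isIdeleOf_iff.2 ⟨ht, rfl⟩⟩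
  rw [chiIdeal, dif_pos h, chi]
  obtain ⟨h1, h2⟩ := isIdeleOf_iff.1 h.choose_spec
  rw [← idCls_idl h1, ← h2]

end primes

/-! ### Openness of `K^*` and local constancy -/

section topology

variable {D : ℤ} [ImagDisc D]

/-- Multiplication by `D = √D · √D` maps the dual lattice into the lattice, so `g ≡ 1 mod D` moves
each dual vector by a lattice vector. -/
theorem mem_locKs_of_congr {v : Pl} {g : GD D (Qv v)}
    (h1 : ∀ i j, vl v (g.mat i j - (1 : Matrix (Fin 3) (Fin 3) (Qv v)) i j) ≤ vl v (D : Qv v))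
    (h2 : ∀ i j, vl v (g⁻¹.mat i j - (1 : Matrix (Fin 3) (Fin 3) (Qv v)) i j) ≤ vl v (D : Qv v)) :
    g ∈ locKs D v := by
  have hD1 : vl v (D : Qv v) ≤ 1 := vl_intCast_le v D
  have hone : ∀ i j, vl v ((1 : Matrix (Fin 3) (Fin 3) (Qv v)) i j) ≤ 1 := fun i j => by
    rw [Matrix.one_apply]
    split_ifs <;> simp
  have hint : ∀ g : GD D (Qv v), (∀ i j, vl v (g.mat i j -
      (1 : Matrix (Fin 3) (Fin 3) (Qv v)) i j) ≤ vl v (D : Qv v)) →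
      ∀ u ∈ latXi D v, g.mat *ᵥ u ∈ latXi D v := by
    rintro g hg u ⟨hu, hu'⟩
    refine ⟨fun i => ?_, by rw [← g.mat_xi, g.bil_mat, hu']⟩
    rw [mem_O_iff, Matrix.mulVec, dotProduct]
    refine (vl v).map_sum_le fun j _ => vl_mul_le ?_ (mem_O_iff.1 (hu j))
    rw [← sub_add_cancel (g.mat i j) ((1 : Matrix (Fin 3) (Fin 3) (Qv v)) i j)]
    exact vl_add_le ((hg i j).trans hD1) (hone i j)
  refine ⟨(mem_locK_iff g).2 ⟨hint g h1, hint _ h2⟩, fun u hu => ?_⟩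
  have hperp : bil (g.mat *ᵥ u - u) (xi D (Qv v)) = 0 := by
    have e1 : bil (g.mat *ᵥ u) (xi D (Qv v)) = 0 := by rw [← g.mat_xi, g.bil_mat, hu.1]
    have e2 := hu.1
    simp only [bil, Pi.sub_apply] at e1 e2 ⊢
    linear_combination e1 - e2
  obtain ⟨z, hz, rfl⟩ := (mem_latXiDual_iff u).1 hu
  have hDz : IntL ((D : Qv v) • z) := by
    have e : (D : Qv v) • z = sqD D (Qv v) * (sqD D (Qv v) * z) := by
      rw [← mul_assoc, sqD_mul_self]
      refine QuadraticAlgebra.ext ?_ ?_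
      · simp only [QuadraticAlgebra.re_smul, QuadraticAlgebra.re_mul, zero_mul, add_zero, mul_zero,
          smul_eq_mul]
      · simp only [QuadraticAlgebra.im_smul, QuadraticAlgebra.im_mul, zero_mul, add_zero, mul_zero,
          smul_eq_mul]
    rw [e]
    exact intL_sqD.mul hz
  have hDv := vec_mem_latXi.2 hDz
  refine ⟨fun i => ?_, hperp⟩
  have e : (g.mat *ᵥ vec z - vec z) i =
      ∑ j, (g.mat i j - (1 : Matrix (Fin 3) (Fin 3) (Qv v)) i j) * vec z j := by
    have : g.mat *ᵥ vec z - vec z = (g.mat - 1) *ᵥ vec z := by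
      rw [Matrix.sub_mulVec, Matrix.one_mulVec]
    rw [this]
    rfl
  rw [e, mem_O_iff]
  refine (vl v).map_sum_le fun j _ => ?_
  have hj : vl v ((D : Qv v) * vec z j) ≤ 1 := by
    have := mem_O_iff.1 (hDv.1 j)
    rwa [vec_smul] at this
  rw [map_mul] at hj ⊢
  exact (mul_le_mul_left (h1 i j) _).trans hj

theorem continuous_mat {R : Type} [CommRing R] [Algebra ℚ R] [TopologicalSpace R] :
    Continuous (GD.mat : GD D R → Matrix (Fin 3) (Fin 3) R) :=
  Units.continuous_val.comp continuous_subtype_val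

theorem isOpen_integral_af : IsOpen {x : Af | ∀ v : Pl, vl v (x v) ≤ 1} := by
  have : IsOpen {x : Af | ∀ v : Pl, x v ∈ v.adicCompletionIntegers ℚ} :=
    RestrictedProduct.isOpen_forall_mem fun v => Valued.isOpen_valuationSubring _
  exact this

theorem isOpen_finKs : IsOpen (finKs D) := by
  -- The elements congruent to `1` modulo `D` at every place. Both `g` and `g⁻¹` must satisfy this,
  -- hence the intersection with `U⁻¹` below.
  set U : Set (GD D Af) := {g | ∀ i j, ∀ v : Pl, vl v ((((D : ℚ)⁻¹) •
    (g.mat i j - (1 : Matrix (Fin 3) (Fin 3) Af) i j) : Af) v) ≤ 1} with hU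
  have hUo : IsOpen U := by
    have e : U = ⋂ i, ⋂ j, (fun g : GD D Af => ((D : ℚ)⁻¹) •
        (g.mat i j - (1 : Matrix (Fin 3) (Fin 3) Af) i j)) ⁻¹' {x : Af | ∀ v : Pl, vl v (x v) ≤ 1} := by
      refine Set.ext fun g => ?_
      rw [Set.mem_iInter]
      refine forall_congr' fun i => ?_
      rw [Set.mem_iInter]
      exact Iff.rfl
    rw [e]
    refine isOpen_iInter_of_finite fun i => isOpen_iInter_of_finite fun j => ?_
    have hc : Continuous fun g : GD D Af => ((D : ℚ)⁻¹) •
        (g.mat i j - (1 : Matrix (Fin 3) (Fin 3) Af) i j) := by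
      simp only [Algebra.smul_def]
      exact continuous_const.mul ((continuous_mat.matrix_elem i j).sub continuous_const)
    exact isOpen_integral_af.preimage hc
  have h1 : (1 : GD D Af) ∈ U := fun i j v => by
    have : (1 : GD D Af).mat = 1 := GD.mat_one
    rw [this, sub_self, smul_zero]
    change vl v 0 ≤ 1
    simp
  have key : U ∩ U⁻¹ ⊆ finKs D := by
    rintro g ⟨hg, hg'⟩ v
    have conv : ∀ g : GD D Af, g ∈ U → ∀ i j, vl v ((g.at v).mat i j -
        (1 : Matrix (Fin 3) (Fin 3) (Qv v)) i j) ≤ vl v (D : Qv v) := by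
      intro g hg i j
      have h := hg i j v
      have e : (((D : ℚ)⁻¹) • (g.mat i j - (1 : Matrix (Fin 3) (Fin 3) Af) i j) : Af) v =
          (D : Qv v)⁻¹ * ((g.at v).mat i j - (1 : Matrix (Fin 3) (Fin 3) (Qv v)) i j) := by
        rw [← evalAt_apply, map_smul, map_sub, Algebra.smul_def, map_inv₀, map_intCast, GD.at_mat]
        congr 2
        rw [Matrix.one_apply, Matrix.one_apply]
        split_ifs
        · exact map_one _
        · exact map_zero _
      rw [e, map_mul, map_inv₀] at h
      have hD0 : 0 < vl v (D : Qv v) := vl_pos (disc_cast_ne_zero D _)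
      rwa [inv_mul_le_iff₀ hD0, mul_one] at h
    refine mem_locKs_of_congr (conv g hg) ?_
    rw [← GD.at_inv]
    exact conv _ hg'
  have : (finKsGrp D : Set (GD D Af)) ∈ nhds (1 : GD D Af) := by
    refine Filter.mem_of_superset (Filter.inter_mem (hUo.mem_nhds h1) ?_) key
    exact hUo.inv.mem_nhds (by simpa using h1)
  exact Subgroup.isOpen_of_mem_nhds _ this

theorem one_mem_finKs : (1 : GD D Af) ∈ finKs D := one_mem (finKsGrp D)

theorem continuous_of_finKs {Y : Type*} [TopologicalSpace Y] {φ : GD D Af → Y}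
    (h : ∀ g, ∀ k ∈ finKs D, φ (g * k) = φ g) : Continuous φ := by
  refine IsLocallyConstant.continuous ?_
  rw [IsLocallyConstant.iff_exists_open]
  intro g
  refine ⟨(g * ·) '' finKs D, (isOpenMap_mul_left g) _ isOpen_finKs, ⟨1, one_mem_finKs, mul_one g⟩, ?_⟩
  rintro _ ⟨k, hk, rfl⟩
  exact h g k hk

theorem continuous_cls_comp (F : ClD D → ℂ) : Continuous fun g : GD D Af => F (cls g) :=
  continuous_of_finKs fun g k hk => by rw [cls_mul_of_mem hk]

end topology

/-! ### Spherical automorphic functions as even functions on the class group -/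

section classFunctions

variable {D : ℤ} [ImagDisc D]

/-- The function on `G(𝔸)` attached to a function on the class group. -/
def clsFun : (ClD D → ℂ) →ₗ[ℂ] (GA D → ℂ) := LinearMap.funLeft ℂ ℂ fun h => cls h.2

theorem clsFun_apply (F : ClD D → ℂ) (h : GA D) : clsFun F h = F (cls h.2) := rfl

theorem rTrans_apply (g : GD D Af) (f : GA D → ℂ) (h : GA D) :
    rTrans g f h = f (h * ((1 : GD D ℝ), g)) := rfl

theorem rTrans_mul (g k : GD D Af) (f : GA D → ℂ) : rTrans (g * k) f = rTrans g (rTrans k f) := by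
  funext h
  rw [rTrans_apply, rTrans_apply, rTrans_apply, mul_assoc]
  congr 2
  exact Prod.ext (one_mul 1).symm rfl

theorem rTrans_one (f : GA D → ℂ) : rTrans 1 f = f := by
  funext h
  rw [rTrans_apply, ← Prod.one_eq_mk, mul_one]

/-- Left `G(ℚ)`-invariance and right `G(ℝ)`-invariance. -/
def IsAutInv (f : GA D → ℂ) : Prop := (∀ δ ∈ ratPts D, ∀ h, f (δ * h) = f h) ∧
    (∀ (u : GD D ℝ) (h : GA D), f (h * (u, 1)) = f h)

theorem IsAutInv.eq_one {f : GA D → ℂ} (hf : IsAutInv f) (h : GA D) : f h = f (1, h.2) := by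
  rw [← hf.2 h.1 (1, h.2)]
  simp

theorem IsAutInv.rat_mul {f : GA D → ℂ} (hf : IsAutInv f) (γ : GD D ℚ) (h : GD D Af) :
    f (1, ratFin D γ * h) = f (1, h) := by
  rw [← hf.1 (GD.map (Algebra.ofId ℚ ℝ) γ, ratFin D γ) ⟨γ, rfl⟩ (1, h), hf.eq_one]
  conv_rhs => rw [hf.eq_one]
  rfl

/-- The double coset description: equal or inverse classes are connected by a rational point on the
left and an element of `K^*` on the right. -/
theorem IsAutInv.eq_of_cls {f : GA D → ℂ} (hf : IsAutInv f) (hk : ∀ k ∈ finKs D, rTrans k f = f)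
    {h h' : GA D} (e : cls h'.2 = cls h.2 ∨ cls h'.2 = (cls h.2)⁻¹) : f h' = f h := by
  have : ∃ γ : GD D ℚ, ∃ k ∈ finKs D, h'.2 = ratFin D γ * h.2 * k :=
    e.elim exists_of_cls_eq exists_of_cls_eq_inv
  obtain ⟨γ, k, hk', e'⟩ := this
  rw [hf.eq_one h', hf.eq_one h, e', ← hf.rat_mul γ h.2]
  conv_rhs => rw [← hk k hk']
  rw [rTrans_apply, Prod.mk_mul_mk, mul_one]

theorem cls_surjective (c : ClD D) : ∃ g : GD D Af, cls g = c := by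
  obtain ⟨t, rfl⟩ := QuotientGroup.mk_surjective c
  exact ⟨_, cls_tor t⟩

theorem IsAutInv.exists_clsFun {f : GA D → ℂ} (hf : IsAutInv f)
    (hk : ∀ k ∈ finKs D, rTrans k f = f) :
    ∃ F : ClD D → ℂ, (∀ c, F c⁻¹ = F c) ∧ f = clsFun F := by
  choose s hs using cls_surjective (D := D)
  refine ⟨fun c => f (1, s c), fun c => ?_, ?_⟩
  · exact hf.eq_of_cls hk (Or.inr (by rw [hs, hs]))
  · funext h
    exact hf.eq_of_cls hk (Or.inl (by rw [hs]))

theorem isAutInv_clsFun {F : ClD D → ℂ} (hF : ∀ c, F c⁻¹ = F c) : IsAutInv (clsFun F) := by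
  refine ⟨?_, fun u h => ?_⟩
  · rintro _ ⟨γ, rfl⟩ h
    rcases cls_ratFin_mul γ h.2 with e | e
    · exact congrArg F e
    · exact (congrArg F e).trans (hF _)
  · rw [clsFun_apply, clsFun_apply, Prod.snd_mul, mul_one]

theorem rTrans_clsFun {F : ClD D → ℂ} {k : GD D Af} (hk : k ∈ finKs D) :
    rTrans k (clsFun F) = clsFun F := by
  funext h
  rw [rTrans_apply, clsFun_apply, Prod.snd_mul, cls_mul_of_mem hk]
  rfl

theorem clsFun_mem_autV {F : ClD D → ℂ} (hF : ∀ c, F c⁻¹ = F c) : clsFun F ∈ autV D :=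
  ⟨(isAutInv_clsFun hF).1, (isAutInv_clsFun hF).2, finKsGrp D, isOpen_finKs,
    fun _ hk => rTrans_clsFun hk⟩

theorem isAutInv_of_mem {f : GA D → ℂ} (hf : f ∈ autV D) : IsAutInv f := ⟨hf.1, hf.2.1⟩

/-- Reduces the space of spherical functions to finite Fourier analysis. -/
theorem mem_fixK_autV {f : GA D → ℂ} : f ∈ fixK (autV D) ↔
    ∃ F : ClD D → ℂ, (∀ c, F c⁻¹ = F c) ∧ f = clsFun F := by
  constructor
  · rintro ⟨h1, h2⟩
    exact (isAutInv_of_mem h1).exists_clsFun h2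
  · rintro ⟨F, hF, rfl⟩
    exact ⟨clsFun_mem_autV hF, fun _ hk => rTrans_clsFun hk⟩

theorem clsFun_injective : Function.Injective (clsFun : (ClD D → ℂ) → GA D → ℂ) := fun F F' e => by
  funext c
  obtain ⟨g, rfl⟩ := cls_surjective c
  exact congrFun e (1, g)

/-- The value of a class group character. -/
def ev (χ : ClDual D) (c : ClD D) : ℂ := (χ c : ℂˣ)

theorem ev_mul (χ : ClDual D) (c d : ClD D) : ev χ (c * d) = ev χ c * ev χ d := by
  rw [ev, map_mul, Units.val_mul]
  rfl

theorem ev_one (χ : ClDual D) : ev χ 1 = 1 := by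
  rw [ev, map_one, Units.val_one]

theorem ev_inv (χ : ClDual D) (c : ClD D) : ev χ c⁻¹ = (ev χ c)⁻¹ := by
  rw [ev, map_inv, Units.val_inv_eq_inv_val]
  rfl

theorem ev_inv_char (χ : ClDual D) (c : ClD D) : ev χ⁻¹ c = (ev χ c)⁻¹ := by
  rw [ev, MonoidHom.inv_apply, Units.val_inv_eq_inv_val]
  rfl

theorem ev_mul_char (χ ψ : ClDual D) (c : ClD D) : ev (χ * ψ) c = ev χ c * ev ψ c := by
  rw [ev, MonoidHom.mul_apply, Units.val_mul]
  rfl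

theorem ev_one_char (c : ClD D) : ev (1 : ClDual D) c = 1 := rfl

theorem ev_ne_zero (χ : ClDual D) (c : ClD D) : ev χ c ≠ 0 := Units.ne_zero _

theorem norm_ev (χ : ClDual D) (c : ClD D) : ‖ev χ c‖ = 1 := by
  refine Complex.norm_eq_one_of_pow_eq_one (n := Nat.card (ClD D)) ?_ Nat.card_pos.ne'
  have : (χ c) ^ Nat.card (ClD D) = 1 := by rw [← map_pow, pow_card_eq_one', map_one]
  exact congrArg Units.val this

theorem conj_ev (χ : ClDual D) (c : ClD D) : conj (ev χ c) = (ev χ c)⁻¹ :=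
  (Complex.inv_eq_conj (norm_ev χ c)).symm

/-- The function `c ↦ (χ(c) + χ(c)⁻¹) / 2` on the class group. -/
def symF (χ : ClDual D) (c : ClD D) : ℂ := (1 / 2 : ℂ) * (ev χ c + (ev χ c)⁻¹)

theorem symF_inv (χ : ClDual D) (c : ClD D) : symF χ c⁻¹ = symF χ c := by
  rw [symF, symF, ev_inv, inv_inv, add_comm]

theorem symF_one (χ : ClDual D) : symF χ 1 = 1 := by
  rw [symF, ev_one]
  norm_num

theorem chi_eq (χ : ClDual D) (t : (AE D)ˣ) : chi χ t = ev χ (t : ClD D) := rfl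

theorem chi_conjIdele (χ : ClDual D) (t : (AE D)ˣ) :
    chi χ (conjIdele D t) = (ev χ (t : ClD D))⁻¹ := by
  rw [chi_eq, mk_conjIdele, ev_inv]

theorem fChi_of_hasTorusPart (χ : ClDual D) (h : GA D) (t : (AE D)ˣ) (ht : HasTorusPart h.2 t) :
    fChi χ h = (1 / 2 : ℂ) * (chi χ t + chi χ (conjIdele D t)) := by
  have H : ∃ t, HasTorusPart h.2 t := ⟨t, ht⟩
  rw [fChi, dif_pos H, chi_conjIdele, chi_conjIdele, chi_eq, chi_eq, H.choose_spec.mk_eq ht]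

theorem fChi_eq (χ : ClDual D) : fChi χ = clsFun (symF χ) := by
  funext h
  rw [fChi_of_hasTorusPart χ h _ (torPart_spec h.2), chi_conjIdele]
  rfl

theorem fChi_apply (χ : ClDual D) (h : GA D) : fChi χ h = symF χ (cls h.2) := by
  rw [fChi_eq]
  rfl

theorem fChi_mem (χ : ClDual D) : fChi χ ∈ fixK (autV D) :=
  mem_fixK_autV.2 ⟨_, symF_inv χ, fChi_eq χ⟩

theorem comp_conjCl (χ : ClDual D) : χ.comp (conjCl D) = χ⁻¹ := by
  refine MonoidHom.ext fun c => ?_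
  rw [MonoidHom.comp_apply, conjCl_eq_inv, map_inv, MonoidHom.inv_apply]

theorem gal_iff {χ ψ : ClDual D} :
    Quotient.mk (galSetoid D) χ = Quotient.mk (galSetoid D) ψ ↔ ψ = χ ∨ ψ = χ⁻¹ := by
  rw [Quotient.eq, ← comp_conjCl]
  rfl

theorem symF_inv_char (χ : ClDual D) : symF χ⁻¹ = symF χ := by
  funext c
  rw [symF, symF, ev_inv_char, inv_inv, add_comm]

/-- A function on the class group which is a combination of `χ` and `χ⁻¹` and is invariant under
inversion is a multiple of `symF χ`. -/
theorem eq_smul_symF {χ : ClDual D} {F : ClD D → ℂ} {a b : ℂ}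
    (h : ∀ c, F c = a * ev χ c + b * (ev χ c)⁻¹) (hF : ∀ c, F c⁻¹ = F c) :
    F = (a + b) • symF χ := by
  funext c
  have h1 := h c
  have h2 := h c⁻¹
  rw [hF, ev_inv, inv_inv] at h2
  rw [Pi.smul_apply, smul_eq_mul, symF]
  linear_combination (h1 + h2) / 2

end classFunctions

/-! ### Characters of a finite abelian group -/

section characters

variable {M : Type*} [MulOneClass M]

theorem hom_mul_inv (χ : M →* ℂˣ) : χ * χ⁻¹ = 1 := mul_inv_cancel χ

theorem hom_inv_mul (χ : M →* ℂˣ) : χ⁻¹ * χ = 1 := inv_mul_cancel χ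

theorem hom_inv_mul_inv (χ ψ : M →* ℂˣ) : χ⁻¹ * ψ⁻¹ = (χ * ψ)⁻¹ := (mul_inv χ ψ).symm

theorem hom_inv_eq_one {χ : M →* ℂˣ} : χ⁻¹ = 1 ↔ χ = 1 := by
  constructor
  · exact fun h => MonoidHom.ext fun c => inv_eq_one.1 (DFunLike.congr_fun h c)
  · exact fun h => MonoidHom.ext fun c => inv_eq_one.2 (DFunLike.congr_fun h c)

theorem hom_eq_inv {χ ψ : M →* ℂˣ} (h : χ * ψ = 1) : ψ = χ⁻¹ :=
  MonoidHom.ext fun c => eq_inv_of_mul_eq_one_right (DFunLike.congr_fun h c)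

theorem hom_eq_of_mul_inv {χ ψ : M →* ℂˣ} (h : χ * ψ⁻¹ = 1) : ψ = χ := (mul_inv_eq_one.1 h).symm

theorem hom_eq_of_inv_mul {χ ψ : M →* ℂˣ} (h : χ⁻¹ * ψ = 1) : ψ = χ := (inv_mul_eq_one.1 h).symm

theorem hom_sq (χ : M →* ℂˣ) : χ ^ 2 = χ * χ := sq χ

/-- Distinct characters are linearly independent, and there are as many of them as elements of the
group. -/
theorem span_characters (G : Type*) [CommGroup G] [Finite G] :
    Submodule.span ℂ (Set.range fun (χ : G →* ℂˣ) (c : G) => ((χ c : ℂˣ) : ℂ)) = ⊤ := by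
  have : NeZero (Monoid.exponent G) := ⟨Monoid.exponent_ne_zero_of_finite⟩
  have hc := CommGroup.card_monoidHom_of_hasEnoughRootsOfUnity G ℂ
  have : Finite (G →* ℂˣ) := (Nat.card_pos_iff.1 (hc ▸ Nat.card_pos)).2
  have : Fintype (G →* ℂˣ) := Fintype.ofFinite _
  have : Fintype G := Fintype.ofFinite _
  have hli := (linearIndependent_monoidHom G ℂ).comp
    (fun χ : G →* ℂˣ => (Units.coeHom ℂ).comp χ) fun χ ψ e => by
      refine MonoidHom.ext fun c => Units.ext ?_
      exact DFunLike.congr_fun e c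
  refine hli.span_eq_top_of_card_eq_finrank' ?_
  rw [Module.finrank_fintype_fun_eq_card, ← Nat.card_eq_fintype_card, ← Nat.card_eq_fintype_card, hc]

end characters

/-! ### Orthogonality and the basis of the `f_χ` -/

section basis

variable {D : ℤ} [ImagDisc D]

instance fintypeClD : Fintype (ClD D) := Fintype.ofFinite _

theorem sum_ev (χ : ClDual D) (h : χ ≠ 1) : ∑ c, ev χ c = 0 := by
  have := sum_hom_units_eq_zero ((Units.coeHom ℂ).comp χ) fun e => h (by
    refine MonoidHom.ext fun c => Units.ext ?_
    exact DFunLike.congr_fun e c)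
  exact this

theorem sum_ev_one : ∑ c, ev (1 : ClDual D) c = Fintype.card (ClD D) := by
  simp [ev_one_char]

theorem conj_symF (χ : ClDual D) (c : ClD D) : conj (symF χ c) = symF χ c := by
  rw [symF, map_mul, map_add, map_inv₀, conj_ev, inv_inv, add_comm, map_div₀, map_one,
    map_ofNat]

theorem symF_mul_symF (χ ψ : ClDual D) (c : ClD D) : symF χ c * symF ψ c =
    (1 / 4 : ℂ) * (ev (χ * ψ) c + ev (χ * ψ⁻¹) c + ev (χ⁻¹ * ψ) c + ev (χ⁻¹ * ψ⁻¹) c) := by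
  simp only [symF, ev_mul_char, ev_inv_char]
  ring

/-- The two hypotheses say precisely that all four characters `χ^{±1} ψ^{±1}` are nontrivial, so
each of their sums vanishes. -/
theorem sum_symF_mul_symF {χ ψ : ClDual D} (h1 : ψ ≠ χ) (h2 : ψ ≠ χ⁻¹) :
    ∑ c, symF χ c * symF ψ c = 0 := by
  simp only [symF_mul_symF, ← Finset.mul_sum, Finset.sum_add_distrib]
  rw [sum_ev, sum_ev, sum_ev, sum_ev]
  · simp
  · intro h
    rw [hom_inv_mul_inv, hom_inv_eq_one] at h
    exact h2 (hom_eq_inv h)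
  · exact fun h => h1 (hom_eq_of_inv_mul h)
  · exact fun h => h1 (hom_eq_of_mul_inv h)
  · exact fun h => h2 (hom_eq_inv h)

open Classical in
theorem sum_symF_sq (χ : ClDual D) :
    ∑ c, symF χ c * symF χ c = (Nat.card (ClD D) : ℂ) / 2 * (1 + if χ ^ 2 = 1 then 1 else 0) := by
  simp only [symF_mul_symF, ← Finset.mul_sum, Finset.sum_add_distrib]
  rw [hom_mul_inv, hom_inv_mul, hom_inv_mul_inv, sum_ev_one, Nat.card_eq_fintype_card]
  by_cases h : χ ^ 2 = 1
  · have h' : χ * χ = 1 := by rwa [← hom_sq]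
    rw [if_pos h, h', hom_inv_eq_one.2 rfl, sum_ev_one]
    ring
  · have h' : χ * χ ≠ 1 := by rwa [← hom_sq]
    rw [if_neg h, sum_ev _ h', sum_ev _ (mt hom_inv_eq_one.1 h')]
    ring

theorem sum_symF_sq_ne_zero (χ : ClDual D) : ∑ c, symF χ c * symF χ c ≠ 0 := by
  rw [sum_symF_sq]
  have h : (Nat.card (ClD D) : ℂ) ≠ 0 := Nat.cast_ne_zero.2 Nat.card_pos.ne'
  split_ifs <;> simp [h]

theorem span_ev : Submodule.span ℂ (Set.range (ev : ClDual D → ClD D → ℂ)) = ⊤ :=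
  span_characters (ClD D)

theorem mem_span_symF {F : ClD D → ℂ} (hF : ∀ c, F c⁻¹ = F c) :
    F ∈ Submodule.span ℂ (Set.range (symF : ClDual D → ClD D → ℂ)) := by
  -- The projection onto even functions; it fixes `F` and sends `χ` to `symF χ`.
  set T : (ClD D → ℂ) →ₗ[ℂ] (ClD D → ℂ) :=
    (1 / 2 : ℂ) • (LinearMap.id + LinearMap.funLeft ℂ ℂ fun c => c⁻¹) with hT
  have hTF : T F = F := by
    funext c
    change (1 / 2 : ℂ) * (F c + F c⁻¹) = F c
    rw [hF]
    ring
  have hTe : ∀ χ : ClDual D, T (ev χ) = symF χ := fun χ => by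
    funext c
    change (1 / 2 : ℂ) * (ev χ c + ev χ c⁻¹) = _
    rw [ev_inv]
    rfl
  have : T F ∈ (Submodule.span ℂ (Set.range (ev : ClDual D → ClD D → ℂ))).map T :=
    ⟨F, by rw [span_ev]; trivial, rfl⟩
  rw [hTF, Submodule.map_span, ← Set.range_comp] at this
  have e : (T ∘ ev : ClDual D → ClD D → ℂ) = symF := funext hTe
  rwa [e] at this

theorem fChi_eq_iff {χ ψ : ClDual D} : fChi χ = fChi ψ ↔ ψ = χ ∨ ψ = χ⁻¹ := by
  constructor
  · intro e
    by_contra h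
    push Not at h
    rw [fChi_eq, fChi_eq] at e
    have e' := clsFun_injective e
    have h0 := sum_symF_mul_symF h.1 h.2
    rw [← e'] at h0
    exact sum_symF_sq_ne_zero χ h0
  · rintro (rfl | rfl)
    · rfl
    · rw [fChi_eq, fChi_eq, symF_inv_char]

theorem fChi_out (χ : ClDual D) : fChi (Quotient.mk (galSetoid D) χ).out = fChi χ :=
  fChi_eq_iff.2 (gal_iff.1 (Quotient.out_eq _))

/-- The vectors `f_χ` of the space of spherical automorphic functions. -/
def basisVec (q : ClDualGal D) : fixK (autV D) := ⟨fChi q.out, fChi_mem _⟩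

theorem linearIndependent_basisVec : LinearIndependent ℂ (basisVec : ClDualGal D → fixK (autV D)) := by
  rw [linearIndependent_iff']
  intro s g hg q hq
  have h1 : clsFun (∑ i ∈ s, g i • symF i.out) = (0 : GA D → ℂ) := by
    have := congrArg Subtype.val hg
    refine Eq.trans ?_ this
    rw [map_sum, Submodule.coe_sum]
    refine Finset.sum_congr rfl fun i _ => ?_
    rw [map_smul, ← fChi_eq]
    rfl
  have h2 := clsFun_injective (h1.trans (map_zero clsFun).symm)
  have h3 : ∑ c, (∑ i ∈ s, g i • symF i.out) c * symF q.out c = 0 := by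
    rw [h2]
    simp
  simp only [Finset.sum_apply, Pi.smul_apply, smul_eq_mul, Finset.sum_mul] at h3
  rw [Finset.sum_comm, Finset.sum_eq_single q] at h3
  · simp only [mul_assoc, ← Finset.mul_sum] at h3
    exact (mul_eq_zero.1 h3).resolve_right (sum_symF_sq_ne_zero _)
  · intro i _ hi
    simp only [mul_assoc, ← Finset.mul_sum]
    have hne : ¬ (q.out = i.out ∨ q.out = i.out⁻¹) := fun h => by
      rw [← gal_iff, Quotient.out_eq, Quotient.out_eq] at h
      exact hi h
    push Not at hne
    rw [sum_symF_mul_symF hne.1 hne.2, mul_zero]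
  · exact fun h => absurd hq h

theorem span_basisVec : ⊤ ≤ Submodule.span ℂ (Set.range (basisVec : ClDualGal D → fixK (autV D))) := by
  rintro ⟨f, hf⟩ -
  obtain ⟨F, hF, rfl⟩ := mem_fixK_autV.1 hf
  have h1 : clsFun F ∈ (Submodule.span ℂ (Set.range (symF : ClDual D → ClD D → ℂ))).map clsFun :=
    ⟨F, mem_span_symF hF, rfl⟩
  rw [Submodule.map_span, ← Set.range_comp] at h1
  have h2 : Set.range (clsFun ∘ symF : ClDual D → GA D → ℂ) ⊆
      Set.range ((fixK (autV D)).subtype ∘ basisVec) := by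
    rintro _ ⟨χ, rfl⟩
    refine ⟨Quotient.mk (galSetoid D) χ, ?_⟩
    change fChi _ = clsFun (symF χ)
    rw [fChi_out, fChi_eq]
  have h3 := Submodule.span_mono (R := ℂ) h2 h1
  rw [Set.range_comp, ← Submodule.map_span] at h3
  obtain ⟨x, hx, e⟩ := h3
  rwa [← show x = ⟨clsFun F, hf⟩ from Subtype.ext e]

variable (D) in
theorem exists_basis : ∃ B : Module.Basis (ClDualGal D) ℂ (fixK (autV D)),
    ∀ χ : ClDual D, (B (Quotient.mk (galSetoid D) χ) : GA D → ℂ) = fChi χ := by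
  refine ⟨Module.Basis.mk linearIndependent_basisVec span_basisVec, fun χ => ?_⟩
  rw [Module.Basis.mk_apply]
  exact fChi_out χ

end basis

/-! ### Hecke eigenfunctions -/

section hecke

variable {D : ℤ} [ImagDisc D] (μf : Measure (GD D Af)) [μf.IsHaarMeasure]

theorem integrable_hecke {φ : GD D Af → ℂ} (hφ : φ ∈ heckeSet D) (F : ClD D → ℂ) :
    Integrable (fun g => φ g * F (cls g)) μf := by
  have hc : Continuous φ := continuous_of_finKs fun g k hk => by
    have := hφ.2 1 one_mem_finKs k hk g
    rwa [one_mul] at this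
  exact (hc.mul (continuous_cls_comp F)).integrable_of_hasCompactSupport hφ.1.mul_right

/-- The result is again spherical, hence an even function of the class. Along the torus the
integrand is a combination of `χ(t)` and `χ(t)⁻¹` with coefficients depending on `g` only, so
`eq_smul_symF` applies. -/
theorem heckeAct_fChi (χ : ClDual D) {φ : GD D Af → ℂ} (hφ : φ ∈ heckeSet D) :
    ∃ c : ℂ, heckeAct μf φ (fChi χ) = c • fChi χ := by
  have hinv := isAutInv_of_mem (fChi_mem χ).1
  have h1 : IsAutInv (heckeAct μf φ (fChi χ)) := by
    refine ⟨fun δ hδ h => ?_, fun u h => ?_⟩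
    · refine integral_congr_ae (Filter.Eventually.of_forall fun g => ?_)
      change φ g * fChi χ (δ * h * _) = φ g * fChi χ (h * _)
      rw [mul_assoc, hinv.1 δ hδ]
    · refine integral_congr_ae (Filter.Eventually.of_forall fun g => ?_)
      change φ g * fChi χ (h * (u, 1) * (1, g)) = φ g * fChi χ (h * (1, g))
      rw [mul_assoc, show ((u, 1) * (1, g) : GA D) = (1, g) * (u, 1) by
        rw [Prod.mk_mul_mk, Prod.mk_mul_mk, mul_one, one_mul, mul_one, one_mul], ← mul_assoc,
        hinv.2]
  have h2 : ∀ k ∈ finKs D, rTrans k (heckeAct μf φ (fChi χ)) = heckeAct μf φ (fChi χ) := by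
    intro k hk
    funext h
    change ∫ g, φ g * fChi χ (h * (1, k) * (1, g)) ∂μf = ∫ g, φ g * fChi χ (h * (1, g)) ∂μf
    -- Invariance of the Haar measure moves the translation by `k` onto `φ`, which is left invariant
    -- under `K^*`.
    rw [← integral_mul_left_eq_self (fun g => φ g * fChi χ (h * (1, g))) k]
    refine integral_congr_ae (Filter.Eventually.of_forall fun g => ?_)
    change _ = φ (k * g) * fChi χ (h * (1, k * g))
    have e1 : φ (k * g) = φ g := by
      have := hφ.2 k hk 1 one_mem_finKs g
      rwa [mul_one] at this
    rw [e1]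
    change φ g * fChi χ (h * (1, k) * (1, g)) = _
    rw [mul_assoc, show ((1, k) * (1, g) : GA D) = (1, k * g) from Prod.ext (one_mul 1) rfl]
  obtain ⟨F, hF, e⟩ := h1.exists_clsFun h2
  refine ⟨(1 / 2 : ℂ) * (∫ g, φ g * ev χ (cls g) ∂μf) +
      (1 / 2 : ℂ) * ∫ g, φ g * (ev χ (cls g))⁻¹ ∂μf, ?_⟩
  rw [e, fChi_eq, ← map_smul]
  congr 1
  refine eq_smul_symF (fun c => ?_) hF
  obtain ⟨t, rfl⟩ := QuotientGroup.mk_surjective c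
  have e2 := congrFun e (1, tor t)
  rw [clsFun_apply] at e2
  rw [← cls_tor t, ← e2]
  change ∫ g, φ g * fChi χ (1 * 1, tor t * g) ∂μf = _
  have e3 : ∀ g, φ g * fChi χ (1 * 1, tor t * g) =
      (1 / 2 * ev χ (cls (tor t))) * (φ g * ev χ (cls g)) +
      (1 / 2 * (ev χ (cls (tor t)))⁻¹) * (φ g * (ev χ (cls g))⁻¹) := by
    intro g
    rw [fChi_apply, symF, cls_tor_mul, ev_mul, cls_tor, mul_inv]
    ring
  simp only [e3]
  rw [integral_add ((integrable_hecke μf hφ _).const_mul _)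
    ((integrable_hecke μf hφ fun c => (ev χ c)⁻¹).const_mul _), integral_const_mul,
    integral_const_mul]
  ring

end hecke

/-! ### The submodules `𝒰_χ`: fixed vectors and irreducibility -/

section submodules

variable {D : ℤ} [ImagDisc D]

theorem rTrans_mem_autV {f : GA D → ℂ} (hf : f ∈ autV D) (g : GD D Af) : rTrans g f ∈ autV D := by
  obtain ⟨h1, h2, U, hU, h3⟩ := hf
  refine ⟨fun δ hδ h => ?_, fun u h => ?_, U.comap (MulAut.conj g⁻¹).toMonoidHom, ?_, ?_⟩
  · rw [rTrans_apply, mul_assoc, h1 δ hδ]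
    rfl
  · rw [rTrans_apply, rTrans_apply, mul_assoc, show ((u, 1) * (1, g) : GA D) = (1, g) * (u, 1) by
        rw [Prod.mk_mul_mk, Prod.mk_mul_mk, mul_one, one_mul, mul_one, one_mul], ← mul_assoc, h2]
  · refine hU.preimage ?_
    change Continuous fun x => g⁻¹ * x * g⁻¹⁻¹
    fun_prop
  · intro k hk
    have hk' : g⁻¹ * k * g ∈ U := by simpa using hk
    rw [← rTrans_mul, show k * g = g * (g⁻¹ * k * g) by group, rTrans_mul, h3 _ hk']

theorem rTrans_fChi_mem (χ : ClDual D) (g : GD D Af) : rTrans g (fChi χ) ∈ genU χ :=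
  Submodule.subset_span (Set.mem_range_self g)

theorem isStable_genU (χ : ClDual D) : IsStable (genU χ) := by
  intro g f hf
  induction hf using Submodule.span_induction with
  | mem x hx =>
    obtain ⟨k, rfl⟩ := hx
    rw [← rTrans_mul]
    exact rTrans_fChi_mem χ _
  | zero => rw [map_zero]; exact zero_mem _
  | add x y _ _ hx hy => rw [map_add]; exact add_mem hx hy
  | smul a x _ hx => rw [map_smul]; exact Submodule.smul_mem _ _ hx

theorem genU_le_of_mem {χ : ClDual D} {W : Submodule ℂ (GA D → ℂ)} (hW : IsStable W)
    (h : fChi χ ∈ W) : genU χ ≤ W := by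
  refine Submodule.span_le.2 ?_
  rintro _ ⟨g, rfl⟩
  exact hW g _ h

theorem fChi_mem_genU (χ : ClDual D) : fChi χ ∈ genU χ :=
  Submodule.subset_span ⟨1, rTrans_one _⟩

theorem genU_le_autV (χ : ClDual D) : genU χ ≤ autV D := by
  refine Submodule.span_le.2 ?_
  rintro _ ⟨g, rfl⟩
  exact rTrans_mem_autV (fChi_mem χ).1 g

theorem fChi_ne_zero (χ : ClDual D) : fChi χ ≠ 0 := fun h => by
  have := congrFun h (1, tor 1)
  rw [fChi_apply, cls_tor] at this
  exact one_ne_zero ((symF_one χ).symm.trans this)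

theorem exists_tor_inv_mul_mem (h : GD D Af) :
    ∃ t : (AE D)ˣ, ∃ k ∈ finKs D, h = tor t * k := by
  refine ⟨torPart h, (tor (torPart h))⁻¹ * h, fun v => ?_, by rw [mul_inv_cancel_left]⟩
  rw [GD.at_mul, GD.at_inv, GD.at_tor]
  rcases (hasTorusPart_iff _ _).1 (torPart_spec h) v with e | e
  · rw [e, inv_mul_cancel]
    exact (locKsGrp D v).one_mem
  · rw [e, inv_mul_cancel_left]
    exact sig_mem_locKs

/-- Elements of `U_χ` are combinations of translates of `f_χ` under the torus. -/
theorem mem_genU {χ : ClDual D} {w : GA D → ℂ} (hw : w ∈ genU χ) :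
    ∃ c : (AE D)ˣ →₀ ℂ, w = c.sum fun t a => a • rTrans (tor t) (fChi χ) := by
  have : genU χ ≤ Submodule.span ℂ (Set.range fun t : (AE D)ˣ => rTrans (tor t) (fChi χ)) := by
    refine Submodule.span_le.2 ?_
    rintro _ ⟨g, rfl⟩
    obtain ⟨t, k, hk, rfl⟩ := exists_tor_inv_mul_mem g
    refine Submodule.subset_span ⟨t, ?_⟩
    change _ = rTrans (tor t * k) (fChi χ)
    rw [rTrans_mul, (fChi_mem χ).2 k hk]
  obtain ⟨c, hc⟩ := Finsupp.mem_span_range_iff_exists_finsupp.1 (this hw)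
  exact ⟨c, hc.symm⟩

/-- At each place conjugation by `h` acts on the torus trivially or by Galois conjugation, according
to the coset of the component. Both preserve units, so the twisted family is still an idele. -/
theorem exists_mul_tor (h : GD D Af) (a : (AE D)ˣ) : ∃ a' : (AE D)ˣ, h * tor a = tor a' * h := by
  classical
  have hs := (hasTorusPart_iff _ _).1 (torPart_spec h)
  set f : ∀ v : Pl, (QA D (Qv v))ˣ := fun v =>
    if h.at v = tor (unitAt v (torPart h)) then unitAt v a else conjU (unitAt v a) with hf
  have hfe : ∀ᶠ v in Filter.cofinite, f v ∈ intUnits D v := by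
    filter_upwards [eventually_mem_intUnits a] with v hv
    simp only [hf]
    split_ifs
    · exact hv
    · exact conjU_mem_intUnits hv
  refine ⟨mkIdele f hfe, GD.ext_at fun v => ?_⟩
  rw [GD.at_mul, GD.at_mul, GD.at_tor, GD.at_tor, unitAt_mkIdele]
  simp only [hf]
  split_ifs with e
  · rw [e, ← map_mul, mul_comm, map_mul]
  · rw [(hs v).resolve_left e, mul_assoc, sig_mul_tor, ← mul_assoc, ← mul_assoc, ← map_mul,
      ← map_mul, mul_comm]

theorem group_mul_right_cancel {G : Type*} [Group G] {a b c : G} (h : a * b = c * b) : a = c :=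
  mul_right_cancel h

theorem cls_mul_one (c : ClD D) : c * 1 = c := mul_one c

/-- The class depends on the torus variable through a homomorphism even after twisting by `h`, so
`χ` of it is again a character of the ideles. -/
theorem exists_hom_cls (h : GD D Af) :
    ∃ κ : (AE D)ˣ →* ClD D, ∀ a, cls (h * tor a) = κ a * cls h := by
  choose s hs using exists_mul_tor h
  have key : ∀ a, cls (h * tor a) = ((s a : (AE D)ˣ) : ClD D) * cls h := fun a => by
    rw [hs, cls_tor_mul]
  refine ⟨MonoidHom.mk' (fun a => ((s a : (AE D)ˣ) : ClD D)) fun a b => ?_, key⟩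
  refine group_mul_right_cancel (b := cls h) ?_
  rw [← key, map_mul, ← mul_assoc, hs a, mul_assoc, cls_tor_mul, key b, mul_assoc]

theorem cls_of_mem {k : GD D Af} (hk : k ∈ finKs D) : cls k = 1 := by
  rw [← one_mul k, cls_mul_of_mem hk, ← map_one (tor (D := D) (R := Af)), cls_tor]
  rfl

/-- A fixed vector is a combination of torus translates of `f_χ`. By commutativity of the torus its
value at `s` is a combination of `χ(s)` and `χ(s)⁻¹`, and an even such function is a multiple of
`f_χ`. -/
theorem fixK_genU (χ : ClDual D) : fixK (genU χ) = Submodule.span ℂ {fChi χ} := by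
  refine le_antisymm ?_ ?_
  · rintro f ⟨h1, h2⟩
    obtain ⟨F, hF, e⟩ := mem_fixK_autV.1 ⟨genU_le_autV χ h1, h2⟩
    obtain ⟨c, hc⟩ := mem_genU h1
    rw [Submodule.mem_span_singleton, e, fChi_eq]
    refine ⟨(1 / 2 : ℂ) * (c.sum fun t a => a * ev χ (t : ClD D)) +
        (1 / 2 : ℂ) * (c.sum fun t a => a * (ev χ (t : ClD D))⁻¹), ?_⟩
    rw [← map_smul]
    congr 1
    refine (eq_smul_symF (fun x => ?_) hF).symm
    obtain ⟨s, rfl⟩ := QuotientGroup.mk_surjective x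
    have e2 := congrFun e (1, tor s)
    rw [clsFun_apply] at e2
    rw [← cls_tor s, ← e2, hc, Finsupp.sum, Finsupp.sum, Finsupp.sum, Finset.sum_apply,
      Finset.mul_sum, Finset.mul_sum, Finset.sum_mul, Finset.sum_mul, ← Finset.sum_add_distrib]
    refine Finset.sum_congr rfl fun t _ => ?_
    rw [Pi.smul_apply, rTrans_apply, fChi_apply, Prod.mk_mul_mk, cls_tor_mul, cls_tor, cls_tor,
      symF, ev_mul, mul_inv, smul_eq_mul]
    ring
  · rw [Submodule.span_le, Set.singleton_subset_iff]
    exact ⟨fChi_mem_genU χ, (fChi_mem χ).2⟩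

open scoped Pointwise in
/-- Averaging a smooth vector over the compact group `K`. -/
theorem exists_average (μf : Measure (GD D Af)) [μf.IsHaarMeasure] (hμ : μf (finKs D) ≠ ⊤)
    {f : GA D → ℂ} (hf : f ∈ autV D) :
    ∃ (ι : Type) (_ : Fintype ι) (k : ι → GD D Af), (∀ i, k i ∈ finKs D) ∧
      (∃ i, rTrans (k i) f = f) ∧
      ∀ k' ∈ finKs D, rTrans k' (∑ i, rTrans (k i) f) = ∑ i, rTrans (k i) f := by
  obtain ⟨-, -, U, hU, hUf⟩ := hf
  set K : Subgroup (GD D Af) := finKsGrp D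
  set Q : Type := K ⧸ (U.subgroupOf K)
  have hopen : IsOpen ((U ⊓ K : Subgroup (GD D Af)) : Set (GD D Af)) := hU.inter isOpen_finKs
  set A : Q → Set (GD D Af) := fun q => ((q.out : K) : GD D Af) • ((U ⊓ K : Subgroup (GD D Af)) : Set (GD D Af))
  -- Finite index without invoking compactness: the cosets of the open group `U ∩ K` are disjoint,
  -- of equal positive measure, and fit into `K`, whose measure is finite.
  have hfin : Finite Q := by
    have h1 : ∀ q, μf (A q) = μf ((U ⊓ K : Subgroup (GD D Af)) : Set (GD D Af)) := fun q =>
      measure_smul _ _ _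
    have h2 : 0 < μf ((U ⊓ K : Subgroup (GD D Af)) : Set (GD D Af)) :=
      hopen.measure_pos μf ⟨1, one_mem _⟩
    have h3 := Measure.finite_const_le_meas_of_disjoint_iUnion μf h2
      (As := A) (fun q => (hopen.smul _).measurableSet) ?_ ?_
    · rw [← Set.finite_univ_iff]
      refine h3.subset fun q _ => ?_
      exact (h1 q).ge
    · intro q q' hne
      refine Set.disjoint_left.2 ?_
      rintro _ ⟨x, ⟨hx, hx'⟩, rfl⟩ ⟨y, ⟨hy, hy'⟩, e⟩
      apply hne
      rw [← q.out_eq', ← q'.out_eq']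
      refine QuotientGroup.eq.2 ?_
      rw [Subgroup.mem_subgroupOf]
      have e' : ((q'.out : K) : GD D Af) * y = ((q.out : K) : GD D Af) * x := e
      have : (((q.out : K)⁻¹ * (q'.out : K) : K) : GD D Af) = x * y⁻¹ := by
        rw [Subgroup.coe_mul, Subgroup.coe_inv, eq_mul_inv_iff_mul_eq, mul_assoc, e',
          inv_mul_cancel_left]
      rw [this]
      exact U.mul_mem hx (U.inv_mem hy)
    · refine ne_top_of_le_ne_top hμ (measure_mono ?_)
      refine Set.iUnion_subset fun q => ?_
      rintro _ ⟨x, ⟨hx, hx'⟩, rfl⟩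
      exact K.mul_mem (q.out : K).2 hx'
  let _ : Fintype Q := Fintype.ofFinite Q
  have hout : ∀ (k : K), rTrans (((k : Q).out : K) : GD D Af) f = rTrans (k : GD D Af) f := by
    intro k
    obtain ⟨u, hu⟩ := QuotientGroup.mk_out_eq_mul (U.subgroupOf K) k
    rw [hu, Subgroup.coe_mul, rTrans_mul, hUf _ (Subgroup.mem_subgroupOf.1 u.2)]
  refine ⟨Q, inferInstance, fun q => (q.out : K), fun q => (q.out : K).2,
    ⟨((1 : K) : Q), ?_⟩, fun k' hk' => ?_⟩
  · rw [hout, Subgroup.coe_one, rTrans_one]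
  · rw [map_sum]
    refine Fintype.sum_equiv (MulAction.toPerm (⟨k', hk'⟩ : K)) _ _ fun q => ?_
    rw [← rTrans_mul]
    have e : MulAction.toPerm (⟨k', hk'⟩ : K) q = (((⟨k', hk'⟩ : K) * q.out : K) : Q) := by
      conv_lhs => rw [← q.out_eq']
      rfl
    rw [e, hout, Subgroup.coe_mul]

/-- A nonnegative form of the value at the identity of the projection to the line of `f_χ`. -/
theorem exists_positive {χ : ClDual D} (c : (AE D)ˣ →₀ ℂ) {w : GA D → ℂ}
    (hw : w = c.sum fun t a => a • rTrans (tor t) (fChi χ)) {k : GD D Af} (hk : k ∈ finKs D) :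
    ∃ r : ℝ, 0 ≤ r ∧ (c.sum fun s a => conj a • rTrans (tor s⁻¹) w) (1, k) = r ∧
      (w (1, k) ≠ 0 → 0 < r) := by
  obtain ⟨κ, hκ⟩ := exists_hom_cls k
  rw [cls_of_mem hk] at hκ
  have hκ' : ∀ a, cls (k * tor a) = κ a := fun a => (hκ a).trans (cls_mul_one _)
  have hv : ∀ b : (AE D)ˣ, w (1, k * tor b) =
      c.sum fun t a => a * symF χ (κ b * κ t) := by
    intro b
    rw [hw, Finsupp.sum, Finsupp.sum, Finset.sum_apply]
    refine Finset.sum_congr rfl fun t _ => ?_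
    rw [Pi.smul_apply, rTrans_apply, fChi_apply, Prod.mk_mul_mk, mul_assoc, ← map_mul, hκ', map_mul,
      smul_eq_mul]
  set x : (AE D)ˣ → ℂ := fun t => ev χ (κ t)
  have hx : ∀ t, conj (x t) = (x t)⁻¹ := fun t => conj_ev χ _
  -- `A` and `B` are the coefficients of `w` along the twisted character and its inverse, so that
  -- `w(k) = (A + B)/2`.
  set A : ℂ := c.sum fun t a => a * x t with hA
  set B : ℂ := c.sum fun t a => a * (x t)⁻¹ with hB
  have h1 : w (1, k) = 1 / 2 * (A + B) := by
    have := hv 1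
    rw [map_one, mul_one, map_one] at this
    rw [this, hA, hB, Finsupp.sum, Finsupp.sum, Finsupp.sum, ← Finset.sum_add_distrib,
      Finset.mul_sum]
    refine Finset.sum_congr rfl fun t _ => ?_
    rw [cls_one_mul, symF]
    ring
  have hcA : conj A = c.sum fun t a => conj a * (x t)⁻¹ := by
    rw [hA, Finsupp.sum, map_sum]
    exact Finset.sum_congr rfl fun t _ => by rw [map_mul, hx]
  have hcB : conj B = c.sum fun t a => conj a * x t := by
    rw [hB, Finsupp.sum, map_sum]
    exact Finset.sum_congr rfl fun t _ => by rw [map_mul, map_inv₀, hx, inv_inv]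
  -- Applying the adjoint of the operator that produces `w` from `f_χ` turns the value into `(|A|² +
  -- |B|²)/2`.
  have h2 : (c.sum fun s a => conj a • rTrans (tor s⁻¹) w) (1, k) =
      1 / 2 * (conj A * A + conj B * B) := by
    have e : ∀ s, w (1, k * tor s⁻¹) = 1 / 2 * ((x s)⁻¹ * A + x s * B) := by
      intro s
      rw [hv, hA, hB, Finsupp.sum, Finsupp.sum, Finsupp.sum, Finset.mul_sum, Finset.mul_sum,
        ← Finset.sum_add_distrib, Finset.mul_sum]
      refine Finset.sum_congr rfl fun t _ => ?_
      rw [symF, map_inv, ev_mul, ev_inv, mul_inv, inv_inv]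
      ring
    rw [hcA, hcB, Finsupp.sum, Finsupp.sum, Finsupp.sum, Finset.sum_apply, Finset.sum_mul,
      Finset.sum_mul, ← Finset.sum_add_distrib, Finset.mul_sum]
    refine Finset.sum_congr rfl fun s _ => ?_
    rw [Pi.smul_apply, rTrans_apply, Prod.mk_mul_mk, mul_one, e, smul_eq_mul]
    ring
  refine ⟨1 / 2 * (Complex.normSq A + Complex.normSq B), ?_, ?_, fun h => ?_⟩
  · have := Complex.normSq_nonneg A
    have := Complex.normSq_nonneg B
    positivity
  · rw [h2, mul_comm (conj A), mul_comm (conj B), Complex.mul_conj, Complex.mul_conj]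
    push_cast
    ring
  · have hAB : A ≠ 0 ∨ B ≠ 0 := by
      by_contra h0
      push Not at h0
      rw [h1, h0.1, h0.2] at h
      simp at h
    have := Complex.normSq_nonneg A
    have := Complex.normSq_nonneg B
    rcases hAB with h0 | h0
    · have := Complex.normSq_pos.2 h0
      positivity
    · have := Complex.normSq_pos.2 h0
      positivity

/-- A nonzero submodule contains a vector with nonzero value at `1`. The adjoint operator makes its
values on `K^*` nonnegative and positive at `1`, so averaging over `K^*` cannot annihilate it. The
average is a nonzero multiple of `f_χ` by `fixK_genU`. -/
theorem isIrred_genU (μf : Measure (GD D Af)) [μf.IsHaarMeasure] (hμ : μf (finKs D) ≠ ⊤)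
    (χ : ClDual D) : IsIrred (genU χ) := by
  refine ⟨isStable_genU χ, fun h => fChi_ne_zero χ ?_, fun W hW hle => ?_⟩
  · have := fChi_mem_genU χ
    rwa [h, Submodule.mem_bot] at this
  · refine or_iff_not_imp_left.2 fun hne => le_antisymm hle (genU_le_of_mem hW ?_)
    obtain ⟨w₀, hw₀, hne₀⟩ := Submodule.exists_mem_ne_zero_of_ne_bot hne
    obtain ⟨h₀, hh₀⟩ := Function.ne_iff.1 hne₀
    set w := rTrans h₀.2 w₀ with hwdef
    have hwW : w ∈ W := hW _ _ hw₀
    have hw1 : w (1, 1) ≠ 0 := by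
      rw [hwdef, rTrans_apply, Prod.mk_mul_mk, one_mul, one_mul,
        ← (isAutInv_of_mem (genU_le_autV χ (hle hw₀))).eq_one]
      exact hh₀
    obtain ⟨c, hc⟩ := mem_genU (hle hwW)
    set y := c.sum fun s a => conj a • rTrans (tor s⁻¹) w with hy
    have hyW : y ∈ W := W.sum_mem fun s _ => W.smul_mem _ (hW _ _ hwW)
    obtain ⟨ι, _, k, hk, ⟨i₀, hi₀⟩, hfix⟩ := exists_average μf hμ (genU_le_autV χ (hle hyW))
    set z := ∑ i, rTrans (k i) y with hz
    have hzW : z ∈ W := W.sum_mem fun i _ => hW _ _ hyW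
    have hz1 : z (1, 1) ≠ 0 := by
      have hval : ∀ i, rTrans (k i) y (1, 1) = y (1, k i) := fun i => by
        rw [rTrans_apply, Prod.mk_mul_mk, one_mul, one_mul]
      choose r hr0 hr hrpos using fun i => exists_positive c hc (hk i)
      have e : z (1, 1) = ((∑ i, r i : ℝ) : ℂ) := by
        rw [hz, Finset.sum_apply, Complex.ofReal_sum]
        exact Finset.sum_congr rfl fun i _ => (hval i).trans (hr i)
      rw [e, Complex.ofReal_ne_zero]
      refine (Finset.sum_pos' (fun i _ => hr0 i) ⟨i₀, Finset.mem_univ _, ?_⟩).ne'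
      obtain ⟨r', -, hr', hpos⟩ := exists_positive c hc (one_mem_finKs (D := D))
      -- The index `i₀` represents the trivial coset: its translate does not change `y`, so its term
      -- is the value at `1`, which is positive.
      have h3 : ((r i₀ : ℝ) : ℂ) = r' := by
        rw [← hr, ← hr', ← hy, ← hval, hi₀]
      rw [Complex.ofReal_inj.1 h3]
      exact hpos hw1
    have hzfix : z ∈ fixK (genU χ) := ⟨hle hzW, hfix⟩
    rw [fixK_genU, Submodule.mem_span_singleton] at hzfix
    obtain ⟨a, ha⟩ := hzfix
    have ha0 : a ≠ 0 := fun h => by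
      rw [h, zero_smul] at ha
      exact hz1 (congrFun ha.symm _)
    have : fChi χ = a⁻¹ • z := by rw [← ha, smul_smul, inv_mul_cancel₀ ha0, one_smul]
    rw [this]
    exact W.smul_mem _ hzW

end submodules

/-! ### Units of `OE D` and rational points of the torus in `K^*` -/

section units

variable {D : ℤ} [ImagDisc D]

theorem norm_unit_OE (u : (OE D)ˣ) : (u : OE D).norm = 1 := by
  have h := QuadraticAlgebra.isUnit_iff_norm_isUnit.1 u.isUnit
  have h0 : 0 ≤ (u : OE D).norm := by
    have hD := cB_sq_add D (ImagDisc.isFundDisc (D := D)).mod_four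
    have hneg := ImagDisc.neg (D := D)
    rw [QuadraticAlgebra.norm_def]
    simp only [Int.cast_id]
    nlinarith [sq_nonneg (2 * (u : OE D).re + cB D * (u : OE D).im), sq_nonneg (u : OE D).im]
  rcases Int.isUnit_iff.1 h with h | h
  · exact h
  · omega

instance finite_units : Finite (OE D)ˣ := by
  have key : ∀ u : (OE D)ˣ, (u : OE D).im ∈ Set.Icc (-2 : ℤ) 2 ∧
      2 * (u : OE D).re + cB D * (u : OE D).im ∈ Set.Icc (-2 : ℤ) 2 := by
    intro u
    have h := norm_unit_OE u
    have hD := cB_sq_add D (ImagDisc.isFundDisc (D := D)).mod_four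
    have hneg := ImagDisc.neg (D := D)
    rw [QuadraticAlgebra.norm_def] at h
    simp only [Int.cast_id] at h
    set x := (u : OE D).re
    set y := (u : OE D).im
    have h4 : (2 * x + cB D * y) ^ 2 + (-D) * y ^ 2 = 4 := by
      linear_combination 4 * h + y ^ 2 * hD
    have hy : y ^ 2 ≤ (-D) * y ^ 2 := by nlinarith [sq_nonneg y]
    refine ⟨⟨?_, ?_⟩, ?_, ?_⟩ <;> nlinarith [sq_nonneg (2 * x + cB D * y), sq_nonneg y]
  refine Finite.of_injective (fun u : (OE D)ˣ =>
    ((⟨_, (key u).1⟩, ⟨_, (key u).2⟩) : Set.Icc (-2 : ℤ) 2 × Set.Icc (-2 : ℤ) 2)) ?_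
  intro u u' e
  have e1 : (u : OE D).im = (u' : OE D).im := congrArg (fun x => (x.1 : ℤ)) e
  have e2 : 2 * (u : OE D).re + cB D * (u : OE D).im = 2 * (u' : OE D).re + cB D * (u' : OE D).im :=
    congrArg (fun x => (x.2 : ℤ)) e
  rw [e1] at e2
  exact Units.ext (QuadraticAlgebra.ext (by linarith) e1)

variable (D) in
/-- The rational torus elements attached to the units of `OE D`. -/
def unitTor : (OE D)ˣ →* GD D ℚ := tor.comp
  (Units.map ((qmap (Int.castRingHom ℚ) : OE D →+* QA D ℚ) : OE D →* QA D ℚ))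

theorem card_ker_unitTor : Nat.card (unitTor D).ker = 2 := by
  have h : ((unitTor D).ker : Set (OE D)ˣ) = {1, -1} := by
    ext u
    rw [SetLike.mem_coe, MonoidHom.mem_ker, unitTor, MonoidHom.comp_apply, tor_eq_one_iff]
    have e : ((Units.map ((qmap (Int.castRingHom ℚ) : OE D →+* QA D ℚ) : OE D →* QA D ℚ) u :
      (QA D ℚ)ˣ) : QA D ℚ).im = (((u : OE D).im : ℤ) : ℚ) := rfl
    rw [e, Int.cast_eq_zero, Set.mem_insert_iff, Set.mem_singleton_iff]
    constructor
    · intro h0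
      have hn := norm_unit_OE u
      rw [QuadraticAlgebra.norm_def, h0] at hn
      have h1 : (u : OE D).re = 1 ∨ (u : OE D).re = -1 :=
        mul_self_eq_one_iff.1 (by linear_combination hn)
      rcases h1 with h1 | h1
      · exact Or.inl (Units.ext (QuadraticAlgebra.ext h1 h0))
      · refine Or.inr (Units.ext (QuadraticAlgebra.ext ?_ ?_))
        · simpa using h1
        · simpa using h0
    · rintro (rfl | rfl) <;> simp
  have hne : (1 : (OE D)ˣ) ≠ -1 := fun h => by
    have := congrArg (fun u : (OE D)ˣ => (u : OE D).re) h
    simp at this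
  change Nat.card ((unitTor D).ker : Set (OE D)ˣ) = 2
  rw [h, Nat.card_coe_set_eq, Set.ncard_pair hne]

/-- If `e` is locally a scalar times a unit, a rational scalar makes it a unit everywhere, hence a
unit of `OE D`; scalars are invisible in `G`. -/
theorem mem_range_unitTor {γ : GD D ℚ} : γ ∈ (unitTor D).range ↔
    (∃ e, γ = tor e) ∧ ratFin D γ ∈ finKs D := by
  constructor
  · rintro ⟨u, rfl⟩
    refine ⟨⟨_, rfl⟩, ?_⟩
    have : ratFin D (unitTor D u) = tor (ratIdele (Units.map
        ((qmap (Int.castRingHom ℚ) : OE D →+* QA D ℚ) : OE D →* QA D ℚ) u)) := ratFin_tor _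
    rw [this]
    refine tor_mem_finKs fun v => ?_
    have key : ∀ u : (OE D)ˣ, IntL ((unitAt v (ratIdele (Units.map
        ((qmap (Int.castRingHom ℚ) : OE D →+* QA D ℚ) : OE D →* QA D ℚ) u)) :
        (QA D (Qv v))ˣ) : QA D (Qv v)) := fun u => by
      have e : ((unitAt v (ratIdele (Units.map
        ((qmap (Int.castRingHom ℚ) : OE D →+* QA D ℚ) : OE D →* QA D ℚ) u)) :
        (QA D (Qv v))ˣ) : QA D (Qv v)) = locOE v u :=
        QuadraticAlgebra.ext (map_intCast (algebraMap ℚ (Qv v)) _) (map_intCast (algebraMap ℚ (Qv v)) _)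
      rw [e]
      exact intL_locOE _
    refine ⟨key u, ?_⟩
    rw [← map_inv, ← map_inv, ← map_inv]
    exact key u⁻¹
  · rintro ⟨⟨e, rfl⟩, h⟩
    rw [ratFin_tor] at h
    have h1 : ∀ v, unitAt v (ratIdele e) ∈ scalInt D v := fun v => by
      have := h v
      rwa [GD.at_tor, tor_mem_locKs_iff] at this
    obtain ⟨q, hq⟩ := exists_scal_mul_mem_intIdeles h1
    rw [← map_mul] at hq
    have hint : ∀ x : (QA D ℚ)ˣ, ratIdele x ∈ intIdeles D →
        ∃ z : OE D, qmap (Int.castRingHom ℚ) z = (x : QA D ℚ) := by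
      intro x hx
      have hz : ∀ y : ℚ, (∀ v : Pl, vl v (algebraMap ℚ (Qv v) y) ≤ 1) → ∃ n : ℤ, (n : ℚ) = y := by
        intro y hy
        exact HeightOneSpectrum.mem_integers_of_valuation_le_one ℚ y fun v => by
          rw [← vl_ratCast]
          exact hy v
      obtain ⟨m, hm⟩ := hz _ fun v => (hx v).1.1
      obtain ⟨n, hn⟩ := hz _ fun v => (hx v).1.2
      exact ⟨⟨m, n⟩, QuadraticAlgebra.ext hm hn⟩
    obtain ⟨z, hz⟩ := hint _ hq
    obtain ⟨z', hz'⟩ := hint (scal q * e)⁻¹ (by rw [map_inv]; exact inv_mem hq)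
    have hinj : Function.Injective (qmap (Int.castRingHom ℚ) : OE D →+* QA D ℚ) :=
      algebraMap_OE_injective D
    have hzz : z * z' = 1 := hinj (by rw [map_mul, hz, hz', ← Units.val_mul, mul_inv_cancel,
      Units.val_one, map_one])
    refine ⟨⟨z, z', hzz, by rw [mul_comm, hzz]⟩, ?_⟩
    have e' : (Units.map ((qmap (Int.castRingHom ℚ) : OE D →+* QA D ℚ) : OE D →* QA D ℚ)
        ⟨z, z', hzz, by rw [mul_comm, hzz]⟩) = scal q * e := Units.ext hz
    rw [unitTor, MonoidHom.comp_apply, e', map_mul, tor_scal, one_mul]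

theorem card_range_unitTor : 2 * Nat.card (unitTor D).range = unitNo D := by
  have := (unitTor D).ker.card_mul_index
  rwa [Subgroup.index_ker, card_ker_unitTor] at this

theorem unitNo_pos : 0 < unitNo D := Nat.card_pos

end units

/-! ### Counting rational points in a double coset -/

section counting

variable {D : ℤ} [ImagDisc D]

theorem encard_range_unitTor :
    ((unitTor D).range : Set (GD D ℚ)).encard = ((unitNo D / 2 : ℕ) : ℕ∞) := by
  have hf : ((unitTor D).range : Set (GD D ℚ)).Finite := Set.finite_range _
  rw [← hf.cast_ncard_eq, ← Nat.card_coe_set_eq, ← card_range_unitTor]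
  rw [Nat.mul_div_cancel_left _ two_pos]
  rfl

-- The set is empty unless the classes agree, and otherwise it is a translate of the group of units
-- modulo `±1`, of order `w_D/2`.
open Classical in
theorem encard_tor_part (h : GD D Af) (t : (AE D)ˣ) :
    {γ : GD D ℚ | (∃ e, γ = tor e) ∧ (tor t)⁻¹ * (ratFin D γ * h) ∈ finKs D}.encard =
      if cls h = (t : ClD D) then ((unitNo D / 2 : ℕ) : ℕ∞) else 0 := by
  split_ifs with hc
  · have hc' : cls (tor t) = cls h := by rw [cls_tor, hc]
    obtain ⟨x, k, hk, e⟩ := exists_tor_of_cls_eq hc'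
    have e1 : ratFin D (tor x) * h = tor t * k⁻¹ := by rw [e, mul_inv_cancel_right]
    rw [← encard_range_unitTor]
    have himg : {γ : GD D ℚ | (∃ e, γ = tor e) ∧ (tor t)⁻¹ * (ratFin D γ * h) ∈ finKs D} =
        (fun γ => γ * tor x) '' ((unitTor D).range : Set (GD D ℚ)) := by
      have key : ∀ y : (QA D ℚ)ˣ, (tor t)⁻¹ * (ratFin D (tor y * tor x) * h) =
          ratFin D (tor y) * k⁻¹ := by
        intro y
        rw [map_mul, mul_assoc, e1, ratFin_tor, ← mul_assoc, ← mul_assoc, ← map_inv, ← map_mul,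
          ← map_mul, inv_mul_cancel_comm]
      ext γ
      constructor
      · rintro ⟨⟨y, rfl⟩, hy⟩
        refine ⟨tor (y * x⁻¹), mem_range_unitTor.2 ⟨⟨_, rfl⟩, ?_⟩, ?_⟩
        · have h2 := key (y * x⁻¹)
          rw [← map_mul, inv_mul_cancel_right] at h2
          rw [h2] at hy
          have := (finKsGrp D).mul_mem hy hk
          rwa [inv_mul_cancel_right] at this
        · change tor (y * x⁻¹) * tor x = tor y
          rw [← map_mul, inv_mul_cancel_right]
      · rintro ⟨γ', hγ', rfl⟩
        obtain ⟨⟨y, rfl⟩, hy⟩ := mem_range_unitTor.1 hγ'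
        refine ⟨⟨y * x, (map_mul _ _ _).symm⟩, ?_⟩
        change (tor t)⁻¹ * (ratFin D (tor y * tor x) * h) ∈ finKs D
        rw [key]
        exact (finKsGrp D).mul_mem hy ((finKsGrp D).inv_mem hk)
    rw [himg, (mul_left_injective (tor x)).encard_image]
  · rw [Set.encard_eq_zero, Set.eq_empty_iff_forall_notMem]
    rintro _ ⟨⟨y, rfl⟩, hy⟩
    apply hc
    have h1 : cls (ratFin D (tor y) * h) = cls h := by
      rw [ratFin_tor, cls_tor_mul, (QuotientGroup.eq_one_iff _).2
        (mem_princSub.2 ⟨y, 1, one_mem _, mul_one _⟩), cls_one_mul]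
    rw [← h1, ← mul_inv_cancel_left (tor t) (ratFin D (tor y) * h), cls_mul_of_mem hy, cls_tor]

-- The torus part and the coset of `σ̃` contribute separately; the second is the torus count for `σ̃
-- h`, whose class is the inverse one.
open Classical in
theorem encard_coset (h : GD D Af) (t : (AE D)ˣ) :
    {γ : GD D ℚ | (tor t)⁻¹ * (ratFin D γ * h) ∈ finKs D}.encard =
      (if cls h = (t : ClD D) then ((unitNo D / 2 : ℕ) : ℕ∞) else 0) +
      if (cls h)⁻¹ = (t : ClD D) then ((unitNo D / 2 : ℕ) : ℕ∞) else 0 := by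
  have hsplit : {γ : GD D ℚ | (tor t)⁻¹ * (ratFin D γ * h) ∈ finKs D} =
      {γ : GD D ℚ | (∃ e, γ = tor e) ∧ (tor t)⁻¹ * (ratFin D γ * h) ∈ finKs D} ∪
      (fun γ => γ * sig D ℚ) '' {γ : GD D ℚ | (∃ e, γ = tor e) ∧
        (tor t)⁻¹ * (ratFin D γ * (sig D Af * h)) ∈ finKs D} := by
    have key : ∀ e : (QA D ℚ)ˣ, ratFin D (tor e * sig D ℚ) * h =
        ratFin D (tor e) * (sig D Af * h) := fun e => by
      rw [map_mul, ratFin_sig, mul_assoc]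
    ext γ
    constructor
    · intro hγ
      obtain ⟨e, rfl | rfl⟩ := γ.exists_tor
      · exact Or.inl ⟨⟨e, rfl⟩, hγ⟩
      · refine Or.inr ⟨tor e, ⟨⟨e, rfl⟩, ?_⟩, rfl⟩
        rw [← key]
        exact hγ
    · rintro (⟨-, hγ⟩ | ⟨_, ⟨⟨e, rfl⟩, he⟩, rfl⟩)
      · exact hγ
      · change (tor t)⁻¹ * (ratFin D (tor e * sig D ℚ) * h) ∈ finKs D
        rwa [key]
  rw [hsplit, Set.encard_union_eq, (mul_left_injective (sig D ℚ)).encard_image, encard_tor_part,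
    encard_tor_part, cls_sig_mul]
  refine Set.disjoint_left.2 ?_
  rintro _ ⟨⟨e, rfl⟩, -⟩ ⟨_, ⟨⟨e', rfl⟩, -⟩, h2⟩
  refine tor_ne_sig (e'⁻¹ * e) ?_
  rw [map_mul, ← h2, map_inv, inv_mul_cancel_left]

theorem finite_ratFin_mem : {γ : GD D ℚ | ratFin D γ ∈ finKs D}.Finite := by
  have h := encard_coset (1 : GD D Af) (1 : (AE D)ˣ)
  have e : {γ : GD D ℚ | (tor (1 : (AE D)ˣ))⁻¹ * (ratFin D γ * 1) ∈ finKs D} =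
      {γ : GD D ℚ | ratFin D γ ∈ finKs D} := by
    ext γ
    rw [Set.mem_ofPred_eq, Set.mem_ofPred_eq, map_one, inv_one, one_mul, mul_one]
  rw [e] at h
  rw [← Set.encard_lt_top_iff, h]
  split_ifs <;> simp

end counting

/-! ### A fundamental domain for `G(ℚ)` in `G(𝔸)` -/

section fundamentalDomain

/-- A countable group acting on `X` has a fundamental domain if `X` is covered by countably many
measurable sets which are disjoint from their nontrivial translates. -/
theorem exists_isFundamentalDomain {Γ X : Type*} [Group Γ] [Countable Γ] [MulAction Γ X]
    [MeasurableSpace X] [MeasurableConstSMul Γ X] (μ : Measure X) (U : ℕ → Set X)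
    (hU : ∀ n, MeasurableSet (U n)) (hcov : ∀ x, ∃ n, x ∈ U n)
    (hdisj : ∀ n, ∀ g : Γ, ∀ x ∈ U n, g • x ∈ U n → g = 1) :
    ∃ F : Set X, IsFundamentalDomain Γ F μ := by
  classical
  set B : ℕ → Set X := fun m => ⋃ g : Γ, (fun x => g • x) ⁻¹' U m with hB
  have hBm : ∀ m, MeasurableSet (B m) := fun m =>
    MeasurableSet.iUnion fun g => measurable_const_smul g (hU m)
  have hBmem : ∀ m x, x ∈ B m ↔ ∃ g : Γ, g • x ∈ U m := fun m x => by
    rw [hB, Set.mem_iUnion]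
    rfl
  have hBinv : ∀ m (g : Γ) x, g • x ∈ B m ↔ x ∈ B m := by
    intro m g x
    rw [hBmem, hBmem]
    constructor
    · rintro ⟨k, hk⟩
      exact ⟨k * g, by rwa [mul_smul]⟩
    · rintro ⟨k, hk⟩
      exact ⟨k * g⁻¹, by rwa [mul_smul, inv_smul_smul]⟩
  -- A point is kept when it lies in the first `U n` that its orbit meets; disjointness from
  -- translates makes the choice in the orbit unique.
  set F : Set X := {x | ∃ n, x ∈ U n ∧ ∀ m < n, x ∉ B m} with hF
  have hFm : MeasurableSet F := by
    have : F = ⋃ n, (U n ∩ ⋂ m, ⋂ _ : m < n, (B m)ᶜ) := by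
      ext x
      simp [hF]
    rw [this]
    refine MeasurableSet.iUnion fun n => (hU n).inter ?_
    exact MeasurableSet.iInter fun m => MeasurableSet.iInter fun _ => (hBm m).compl
  refine ⟨F, IsFundamentalDomain.mk' hFm.nullMeasurableSet fun x => ?_⟩
  have hex : ∃ n, x ∈ B n := by
    obtain ⟨n, hn⟩ := hcov x
    exact ⟨n, (hBmem n x).2 ⟨1, by rwa [one_smul]⟩⟩
  obtain ⟨g, hg⟩ := (hBmem _ _).1 (Nat.find_spec hex)
  refine ⟨g, ⟨Nat.find hex, hg, fun m hm h => Nat.find_min hex hm ((hBinv m g x).1 h)⟩, ?_⟩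
  rintro g' ⟨n, hn, hn'⟩
  have hn0 : n = Nat.find hex := by
    refine le_antisymm ?_ ?_
    · by_contra! h
      exact hn' _ h ((hBinv _ g' x).2 (Nat.find_spec hex))
    · exact Nat.find_min' hex ((hBmem _ _).2 ⟨g', hn⟩)
  rw [hn0] at hn
  have := hdisj _ (g' * g⁻¹) (g • x) hg (by rwa [mul_smul, inv_smul_smul])
  exact mul_inv_eq_one.1 this

theorem mem_of_mul_mem {G : Type*} [Group G] (K : Subgroup G) {a b c : G} (h1 : a * b * c ∈ K)
    (h2 : b * c ∈ K) : a ∈ K := by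
  rw [mul_assoc] at h1
  exact (K.mul_mem_cancel_right h2).1 h1

theorem group_mul_mul_div {G : Type*} [Group G] (a b c : G) : a * b * c / (b * c) = a := by
  rw [mul_assoc, mul_div_cancel_right]

theorem group_inv_mul_inv_inv {G : Type*} [Group G] (a b : G) : (a⁻¹ * b⁻¹)⁻¹ = b * a := by
  group

variable {D : ℤ} [ImagDisc D]

instance secondCountableGDReal : SecondCountableTopology (GD D ℝ) := by
  have h1 : Topology.IsEmbedding (Subtype.val : stabXi D ℝ → GL (Fin 3) ℝ) :=
    Topology.IsEmbedding.subtypeVal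
  have h2 : Topology.IsEmbedding (Units.embedProduct (Matrix (Fin 3) (Fin 3) ℝ)) :=
    Units.isEmbedding_embedProduct
  have : SecondCountableTopology (Matrix (Fin 3) (Fin 3) ℝ) :=
    inferInstanceAs (SecondCountableTopology (Fin 3 → Fin 3 → ℝ))
  have : SecondCountableTopology (Matrix (Fin 3) (Fin 3) ℝ)ᵐᵒᵖ :=
    MulOpposite.opHomeomorph.symm.isEmbedding.secondCountableTopology
  exact (h2.comp h1).secondCountableTopology

instance t2GDReal : T2Space (GD D ℝ) := by
  have h1 : Topology.IsEmbedding (Subtype.val : stabXi D ℝ → GL (Fin 3) ℝ) :=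
    Topology.IsEmbedding.subtypeVal
  have h2 : Topology.IsEmbedding (Units.embedProduct (Matrix (Fin 3) (Fin 3) ℝ)) :=
    Units.isEmbedding_embedProduct
  have : T2Space (Matrix (Fin 3) (Fin 3) ℝ) := inferInstanceAs (T2Space (Fin 3 → Fin 3 → ℝ))
  exact (h2.comp h1).t2Space

instance countableGDRat : Countable (GD D ℚ) := by
  have hinj : Function.Injective (GD.mat : GD D ℚ → Matrix (Fin 3) (Fin 3) ℚ) := fun _ _ h =>
    GD.ext h
  have : Countable (Matrix (Fin 3) (Fin 3) ℚ) := inferInstanceAs (Countable (Fin 3 → Fin 3 → ℚ))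
  exact hinj.countable

/-- The real point attached to a rational point. -/
def ratReal (D : ℤ) : GD D ℚ →* GD D ℝ := GD.map (Algebra.ofId ℚ ℝ)

theorem ratReal_injective : Function.Injective (ratReal D) := fun g h e => by
  refine GD.ext (Matrix.ext fun i j => ?_)
  have := congrFun (congrFun (congrArg GD.mat e) i) j
  exact (algebraMap ℚ ℝ).injective this

/-- The diagonal embedding of the rational points. -/
def ratEquiv (D : ℤ) [ImagDisc D] : GD D ℚ ≃* ratPts D :=
  MonoidHom.ofInjective (f := MonoidHom.prod (ratReal D) (ratFin D)) fun _ _ e =>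
    ratReal_injective (congrArg Prod.fst e)

theorem ratEquiv_smul (γ : GD D ℚ) (x : GA D) :
    ratEquiv D γ • x = (ratReal D γ * x.1, ratFin D γ * x.2) := rfl

theorem ratEquiv_smul_mem {γ : GD D ℚ} {x : GA D} {A : Set (GD D ℝ)} {B : Set (GD D Af)}
    (h : ratEquiv D γ • x ∈ A ×ˢ B) : ratReal D γ * x.1 ∈ A ∧ ratFin D γ * x.2 ∈ B := by
  rw [ratEquiv_smul] at h
  exact h

instance countableRatPts : Countable (ratPts D) := (ratEquiv D).symm.injective.countable

instance measurableConstSMulRatPts : MeasurableConstSMul (ratPts D) (GA D) where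
  measurable_const_smul γ := by
    obtain ⟨γ, rfl⟩ := (ratEquiv D).surjective γ
    exact ((measurable_const_mul _).comp measurable_fst).prodMk
      ((measurable_const_mul _).comp measurable_snd)

theorem exists_countable_cover (D : ℤ) [ImagDisc D] :
    ∃ s : ℕ → GD D Af, ∀ h, ∃ n, (s n)⁻¹ * h ∈ finKs D := by
  choose t ht using fun c : ClD D => QuotientGroup.mk_surjective c
  set S : GD D ℚ × ClD D → GD D Af := fun p => ratFin D p.1 * tor (t p.2)
  obtain ⟨e, he⟩ := exists_surjective_nat (GD D ℚ × ClD D)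
  refine ⟨S ∘ e, fun h => ?_⟩
  have hc : cls h = cls (tor (t (cls h))) := by
    rw [cls_tor]
    exact (ht _).symm
  obtain ⟨γ, k, hk, e1⟩ := exists_of_cls_eq hc
  obtain ⟨n, hn⟩ := he (γ, cls h)
  refine ⟨n, ?_⟩
  have e2 : (S ∘ e) n = ratFin D γ * tor (t (cls h)) := by
    rw [Function.comp_apply, hn]
  rw [e2, inv_mul_eq_of_eq_mul e1]
  exact hk

theorem sigmaFinite_of_finKs (μf : Measure (GD D Af)) [μf.IsHaarMeasure]
    (hμ : μf (finKs D) = 1) : SigmaFinite μf := by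
  obtain ⟨s, hs⟩ := exists_countable_cover D
  refine ⟨⟨{ set := fun n => (fun h => (s n)⁻¹ * h) ⁻¹' finKs D
             set_mem := fun _ => trivial
             finite := fun n => ?_
             spanning := ?_ }⟩⟩
  · rw [measure_preimage_mul, hμ]
    exact ENNReal.one_lt_top
  · rw [Set.eq_univ_iff_forall]
    intro h
    obtain ⟨n, hn⟩ := hs h
    exact Set.mem_iUnion.2 ⟨n, hn⟩

theorem smulInvariant_prod (μR : Measure (GD D ℝ)) [μR.IsHaarMeasure] [IsProbabilityMeasure μR]
    (μf : Measure (GD D Af)) [μf.IsHaarMeasure] (hμ : μf (finKs D) = 1) :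
    SMulInvariantMeasure (ratPts D) (GA D) (μR.prod μf) := by
  have := sigmaFinite_of_finKs μf hμ
  refine ⟨fun γ s hs => ?_⟩
  obtain ⟨γ, rfl⟩ := (ratEquiv D).surjective γ
  have := (measurePreserving_mul_left μR (ratReal D γ)).prod
    (measurePreserving_mul_left μf (ratFin D γ))
  exact this.measure_preimage hs.nullMeasurableSet

/-- The rational points in `K^*` form a finite group, so they are separated from `1` by a small real
neighbourhood. Right translates of the product of such a neighbourhood with `K^*` cover `G(𝔸)`
countably. -/
theorem exists_fundamentalDomain (μ : Measure (GA D)) :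
    ∃ F : Set (GA D), IsFundamentalDomain (ratPts D) F μ := by
  set Θ : Set (GD D ℝ) := ratReal D '' ({γ : GD D ℚ | ratFin D γ ∈ finKs D} \ {1}) with hΘ
  have hΘf : Θ.Finite := (finite_ratFin_mem.subset Set.sdiff_subset).image _
  have h1 : Θᶜ ∈ nhds (1 : GD D ℝ) := by
    refine hΘf.isClosed.isOpen_compl.mem_nhds ?_
    rintro ⟨γ, ⟨-, hne⟩, e⟩
    exact hne (ratReal_injective (e.trans (map_one _).symm))
  -- Quotients of elements of `V` avoid `Θ`. The cover uses right translates so that the quotient of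
  -- `γx` and `x` recovers `γ`.
  obtain ⟨V, hV, hVΘ⟩ := exists_nhds_split_inv h1
  obtain ⟨W, hWV, hWo, hW1⟩ := mem_nhds_iff.1 hV
  obtain ⟨T, hT, hTc⟩ := TopologicalSpace.countable_cover_nhds
    (f := fun a : GD D ℝ => (fun x => x * a⁻¹) ⁻¹' W) fun a =>
      (hWo.preimage (continuous_mul_const _)).mem_nhds (by simpa using hW1)
  have hTne : T.Nonempty := by
    by_contra h
    rw [Set.not_nonempty_iff_eq_empty] at h
    rw [h, Set.biUnion_empty] at hTc
    exact (Set.empty_ne_univ hTc)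
  obtain ⟨a, ha⟩ := hT.exists_eq_range hTne
  obtain ⟨s, hs⟩ := exists_countable_cover D
  obtain ⟨e, he⟩ := exists_surjective_nat (ℕ × ℕ)
  refine exists_isFundamentalDomain μ
    (fun n => ((fun x => x * (a (e n).1)⁻¹) ⁻¹' W) ×ˢ ((fun x => x * s (e n).2) ⁻¹' finKs D))
    (fun n => ?_) (fun x => ?_) fun n γ x hx hγx => ?_
  · exact (hWo.preimage (continuous_mul_const _)).measurableSet.prod
      (isOpen_finKs.preimage (continuous_mul_const _)).measurableSet
  · obtain ⟨m, hm⟩ := hs x.2⁻¹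
    have h2 : x.1 ∈ ⋃ b ∈ T, (fun x => x * b⁻¹) ⁻¹' W := hTc ▸ Set.mem_univ _
    rw [ha, Set.biUnion_range, Set.mem_iUnion] at h2
    obtain ⟨l, hl⟩ := h2
    obtain ⟨n, hn⟩ := he (l, m)
    refine ⟨n, ?_⟩
    rw [hn]
    refine ⟨hl, ?_⟩
    have := (finKsGrp D).inv_mem hm
    rwa [group_inv_mul_inv_inv] at this
  · obtain ⟨γ, rfl⟩ := (ratEquiv D).surjective γ
    replace hγx := ratEquiv_smul_mem hγx
    have h3 : ratFin D γ ∈ finKs D := by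
      have h5 : ratFin D γ * x.2 * s (e n).2 ∈ finKsGrp D := Set.mem_preimage.1 hγx.2
      have h6 : x.2 * s (e n).2 ∈ finKsGrp D := hx.2
      exact mem_of_mul_mem (finKsGrp D) h5 h6
    have h4 : ratReal D γ ∈ Θᶜ := by
      have h5 : (ratReal D γ * x.1 * (a (e n).1)⁻¹) / (x.1 * (a (e n).1)⁻¹) ∈ Θᶜ :=
        hVΘ _ (hWV hγx.1) _ (hWV hx.1)
      rwa [group_mul_mul_div] at h5
    rw [map_eq_one_iff _ (ratEquiv D).injective]
    by_contra hne
    exact h4 ⟨γ, ⟨h3, hne⟩, rfl⟩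

theorem group_inv_eq_iff {G : Type*} [Group G] {a b : G} : a⁻¹ = b ↔ a = b⁻¹ :=
  inv_eq_iff_eq_inv

/-! ### Unfolding the integral over `G(ℚ) \ G(𝔸)` -/

section unfolding

variable (μR : Measure (GD D ℝ)) [μR.IsHaarMeasure] [IsProbabilityMeasure μR]
    (μf : Measure (GD D Af)) [μf.IsHaarMeasure] (hμ : μf (finKs D) = 1)

theorem measurableSet_cls (c : ClD D) : MeasurableSet {x : GA D | cls x.2 = c} := by
  classical
  have h := (isOpen_compl_singleton (x := (0 : ℂ))).preimage
    (continuous_cls_comp (D := D) fun c' => if c' = c then (1 : ℂ) else 0)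
  have e : {x : GA D | cls x.2 = c} = Prod.snd ⁻¹'
      ((fun g : GD D Af => if cls g = c then (1 : ℂ) else 0) ⁻¹' {0}ᶜ) := by
    ext x
    simp
  rw [e]
  exact h.measurableSet.preimage measurable_snd

-- Unfolding the indicator function of `G(ℝ) × tK^*`, of measure one: each `x` in the fundamental
-- domain is counted as often as `encard_coset` prescribes.
include hμ in
theorem measure_cls_add {F : Set (GA D)} (hF : IsFundamentalDomain (ratPts D) F (μR.prod μf))
    (c : ClD D) : ((unitNo D / 2 : ℕ) : ENNReal) *
      ((μR.prod μf) (F ∩ {x | cls x.2 = c}) + (μR.prod μf) (F ∩ {x | cls x.2 = c⁻¹})) = 1 := by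
  classical
  have := sigmaFinite_of_finKs μf hμ
  have := smulInvariant_prod μR μf hμ
  obtain ⟨t, rfl⟩ := QuotientGroup.mk_surjective c
  set S : Set (GA D) := Set.univ ×ˢ ((fun h => (tor t)⁻¹ * h) ⁻¹' finKs D) with hS
  have hSm : MeasurableSet S :=
    MeasurableSet.univ.prod (isOpen_finKs.preimage (continuous_const_mul _)).measurableSet
  have h1 : (μR.prod μf) S = 1 := by
    rw [hS, Measure.prod_prod, measure_univ, one_mul, measure_preimage_mul, hμ]
  have h2 := hF.lintegral_eq_tsum'' (S.indicator 1)
  rw [lintegral_indicator_one hSm, h1, ← lintegral_tsum] at h2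
  swap
  · intro γ
    exact (((measurable_one.indicator hSm)).comp (measurable_const_smul γ)).aemeasurable
  have h3 : ∀ x : GA D, ∑' γ : ratPts D, S.indicator (1 : GA D → ENNReal) (γ • x) =
      ((unitNo D / 2 : ℕ) : ENNReal) * ({x : GA D | cls x.2 = (t : ClD D)}.indicator 1 x +
        {x : GA D | cls x.2 = (t : ClD D)⁻¹}.indicator 1 x) := by
    intro x
    rw [← (ratEquiv D).toEquiv.tsum_eq]
    have e1 : ∀ γ : GD D ℚ, S.indicator (1 : GA D → ENNReal) ((ratEquiv D).toEquiv γ • x) =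
        {γ : GD D ℚ | (tor t)⁻¹ * (ratFin D γ * x.2) ∈ finKs D}.indicator (fun _ => 1) γ := by
      intro γ
      rw [Set.indicator_apply, Set.indicator_apply]
      exact if_congr ⟨fun h => h.2, fun h => ⟨trivial, h⟩⟩ rfl rfl
    have e5 : (cls x.2)⁻¹ = (t : ClD D) ↔ cls x.2 = (t : ClD D)⁻¹ :=
      group_inv_eq_iff
    simp only [e1]
    rw [← tsum_subtype, ENNReal.tsum_set_one, encard_coset]
    simp only [Set.indicator_apply, Set.mem_ofPred_eq, Pi.one_apply, e5]
    split_ifs <;> simp [mul_add]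
  simp only [h3] at h2
  have hm : ∀ c : ClD D, Measurable fun a : GA D =>
      {x : GA D | cls x.2 = c}.indicator (1 : GA D → ENNReal) a := fun c =>
    measurable_one.indicator (measurableSet_cls c)
  have hm2 : Measurable fun a : GA D =>
      {x : GA D | cls x.2 = (t : ClD D)}.indicator (1 : GA D → ENNReal) a +
      {x : GA D | cls x.2 = (t : ClD D)⁻¹}.indicator (1 : GA D → ENNReal) a := (hm _).add (hm _)
  rw [lintegral_const_mul _ hm2, lintegral_add_left (hm _),
    lintegral_indicator_one (measurableSet_cls _), lintegral_indicator_one (measurableSet_cls _),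
    Measure.restrict_apply (measurableSet_cls _), Measure.restrict_apply (measurableSet_cls _),
    Set.inter_comm, Set.inter_comm _ F] at h2
  exact h2.symm

theorem two_mul_half_unitNo : 2 * (unitNo D / 2) = unitNo D := by
  rw [← card_range_unitTor, Nat.mul_div_cancel_left _ two_pos]

include hμ in
/-- Integration over `G(ℚ) \ G(𝔸)` of a function on the class group. -/
theorem setIntegral_cls {E : Type*} [NormedAddCommGroup E] [NormedSpace ℝ E] [CompleteSpace E]
    {F : Set (GA D)} (hF : IsFundamentalDomain (ratPts D) F (μR.prod μf)) {f : ClD D → E}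
    (hf : ∀ c, f c⁻¹ = f c) :
    ∫ x in F, f (cls x.2) ∂(μR.prod μf) = (unitNo D : ℝ)⁻¹ • ∑ c, f c := by
  classical
  set ν := (μR.prod μf).restrict F with hν
  set A : ClD D → Set (GA D) := fun c => {x | cls x.2 = c} with hA
  have hAm : ∀ c, MeasurableSet (A c) := fun c => measurableSet_cls c
  have hw : 0 < unitNo D / 2 := by
    have := two_mul_half_unitNo (D := D)
    have := unitNo_pos (D := D)
    omega
  have h1 : ∀ c, ((unitNo D / 2 : ℕ) : ENNReal) * (ν (A c) + ν (A c⁻¹)) = 1 := fun c => by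
    rw [hν, Measure.restrict_apply (hAm _), Measure.restrict_apply (hAm _), Set.inter_comm,
      Set.inter_comm _ F]
    exact measure_cls_add μR μf hμ hF c
  have hfin : ∀ c, ν (A c) ≠ ⊤ := fun c h => by
    have := h1 c
    rw [h, top_add, ENNReal.mul_top (by exact_mod_cast hw.ne')] at this
    exact ENNReal.top_ne_one this
  have h2 : ∀ c, ν.real (A c) + ν.real (A c⁻¹) = 2 * (unitNo D : ℝ)⁻¹ := fun c => by
    have := congrArg ENNReal.toReal (h1 c)
    rw [ENNReal.toReal_mul, ENNReal.toReal_add (hfin _) (hfin _), ENNReal.toReal_natCast,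
      ENNReal.toReal_one] at this
    have hw' : (unitNo D : ℝ) = 2 * ((unitNo D / 2 : ℕ) : ℝ) := by
      exact_mod_cast two_mul_half_unitNo.symm
    have hw0 : ((unitNo D / 2 : ℕ) : ℝ) ≠ 0 := by exact_mod_cast hw.ne'
    rw [hw', mul_inv, ← mul_assoc, mul_inv_cancel₀ two_ne_zero, one_mul]
    exact eq_inv_of_mul_eq_one_right this
  have h3 : ∀ x : GA D, f (cls x.2) = ∑ c, (A c).indicator (fun _ => f c) x := fun x => by
    rw [Finset.sum_eq_single (cls x.2)]
    · rw [Set.indicator_of_mem (show x ∈ A (cls x.2) from rfl)]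
    · intro c _ hc
      exact Set.indicator_of_notMem (fun h : x ∈ A c => hc (show cls x.2 = c from h).symm) _
    · exact fun h => absurd (Finset.mem_univ _) h
  have h4 : ∫ x, f (cls x.2) ∂ν = ∑ c, ν.real (A c) • f c := by
    simp only [h3]
    rw [integral_finsetSum]
    · exact Finset.sum_congr rfl fun c _ => integral_indicator_const _ (hAm c)
    · intro c _
      exact (integrable_indicator_iff (hAm c)).2 (integrableOn_const (hfin c))
  -- Only the total measure of the classes `c` and `c⁻¹` is known; evenness of `f` allows the sum to
  -- be symmetrized.
  have h5 : ∑ c, ν.real (A c) • f c = ∑ c, ν.real (A c⁻¹) • f c := by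
    exact Fintype.sum_equiv (Equiv.inv (ClD D)) _ _ fun c => by
      rw [Equiv.inv_apply, inv_inv, hf]
  have h6 : (2 : ℝ) • ∑ c, ν.real (A c) • f c = (2 : ℝ) • (unitNo D : ℝ)⁻¹ • ∑ c, f c := by
    rw [two_smul]
    nth_rewrite 2 [h5]
    rw [← Finset.sum_add_distrib, smul_smul, Finset.smul_sum]
    exact Finset.sum_congr rfl fun c _ => by rw [← add_smul, h2]
  rw [h4]
  exact smul_right_injective E (two_ne_zero : (2 : ℝ) ≠ 0) h6

end unfolding

/-! ### Orthogonality and norms in `L²` -/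

section norms

variable (μR : Measure (GD D ℝ)) [μR.IsHaarMeasure] [IsProbabilityMeasure μR]
    (μf : Measure (GD D Af)) [μf.IsHaarMeasure] (hμ : μf (finKs D) = 1)
    {F : Set (GA D)} (hF : IsFundamentalDomain (ratPts D) F (μR.prod μf))

include hμ hF

theorem setIntegral_fChi_mul_conj {χ ψ : ClDual D} (h1 : ψ ≠ χ) (h2 : ψ ≠ χ⁻¹) :
    ∫ h in F, fChi χ h * conj (fChi ψ h) ∂(μR.prod μf) = 0 := by
  simp only [fChi_apply, conj_symF]
  rw [setIntegral_cls μR μf hμ hF (f := fun c => symF χ c * symF ψ c)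
    fun c => by rw [symF_inv, symF_inv], sum_symF_mul_symF h1 h2, smul_zero]

open Classical in
theorem setIntegral_norm_fChi (χ : ClDual D) :
    ∫ h in F, ‖fChi χ h‖ ^ 2 ∂(μR.prod μf) =
      (Nat.card (ClD D) : ℝ) / (2 * unitNo D) * (1 + if χ ^ 2 = 1 then 1 else 0) := by
  simp only [fChi_apply]
  rw [setIntegral_cls μR μf hμ hF (f := fun c => ‖symF χ c‖ ^ 2) fun c => by rw [symF_inv]]
  have h : ∑ c, ‖symF χ c‖ ^ 2 =
      (Nat.card (ClD D) : ℝ) / 2 * (1 + if χ ^ 2 = 1 then 1 else 0) := by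
    have h1 := sum_symF_sq χ
    have h2 : ∀ c, symF χ c * symF χ c = ((‖symF χ c‖ ^ 2 : ℝ) : ℂ) := fun c => by
      nth_rewrite 1 [← conj_symF χ c]
      rw [Complex.conj_mul']
      push_cast
      rfl
    simp only [h2] at h1
    rw [← Complex.ofReal_sum] at h1
    apply Complex.ofReal_injective
    rw [h1]
    push_cast
    split_ifs <;> simp
  rw [h, smul_eq_mul]
  have := unitNo_pos (D := D)
  field_simp

end norms

end fundamentalDomain

/-! ### Satake parameters of `𝒰_χ` -/

section satake

variable {D : ℤ} [ImagDisc D] {v : Pl}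

theorem suppAt_tor_locIdele (t : (QA D (Qv v))ˣ) : SuppAt v (tor (locIdele v t)) := fun w hw => by
  rw [GD.at_tor, unitAt_locIdele_of_ne hw, map_one]

theorem at_tor_locIdele (t : (QA D (Qv v))ˣ) : (tor (locIdele v t)).at v = tor t := by
  rw [GD.at_tor, unitAt_locIdele_self]

theorem SuppAt.eq_tor {g : GD D Af} (h : SuppAt v g) {t : (QA D (Qv v))ˣ} (ht : g.at v = tor t) :
    g = tor (locIdele v t) := GD.ext_at fun w => by
  by_cases hw : w = v
  · subst hw
    rw [ht, at_tor_locIdele]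
  · rw [h w hw, suppAt_tor_locIdele t w hw]

theorem conjIdele_locIdele (t : (QA D (Qv v))ˣ) :
    conjIdele D (locIdele v t) = locIdele v (conjU t) := idele_ext fun w => by
  rw [unitAt_conj]
  by_cases hw : w = v
  · subst hw
    rw [unitAt_locIdele_self, unitAt_locIdele_self]
  · rw [unitAt_locIdele_of_ne hw, unitAt_locIdele_of_ne hw, map_one]

theorem mul_tor_locIdele (h : GD D Af) (t : (QA D (Qv v))ˣ) :
    h * tor (locIdele v t) = tor (locIdele v t) * h ∨
    h * tor (locIdele v t) = tor (conjIdele D (locIdele v t)) * h := by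
  have hs := (hasTorusPart_iff _ _).1 (torPart_spec h) v
  rw [conjIdele_locIdele]
  rcases hs with e | e
  · refine Or.inl (GD.ext_at fun w => ?_)
    rw [GD.at_mul, GD.at_mul]
    by_cases hw : w = v
    · subst hw
      rw [e, at_tor_locIdele, ← map_mul, ← map_mul, mul_comm]
    · rw [suppAt_tor_locIdele t w hw, one_mul, mul_one]
  · refine Or.inr (GD.ext_at fun w => ?_)
    rw [GD.at_mul, GD.at_mul]
    by_cases hw : w = v
    · subst hw
      rw [e, at_tor_locIdele, at_tor_locIdele, mul_assoc, sig_mul_tor, ← mul_assoc, ← map_mul,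
        mul_comm, map_mul, mul_assoc]
    · rw [suppAt_tor_locIdele t w hw, suppAt_tor_locIdele _ w hw, one_mul, mul_one]

/-- The class of the idele with component `t` at `v` and `1` elsewhere. -/
abbrev locCls (v : Pl) (t : (QA D (Qv v))ˣ) : ClD D := ((locIdele v t : (AE D)ˣ) : ClD D)

theorem locCls_inv (t : (QA D (Qv v))ˣ) : locCls v t⁻¹ = (locCls v t)⁻¹ := by
  rw [locCls, locIdele_inv]
  rfl

theorem locCls_mul (t u : (QA D (Qv v))ˣ) : locCls v (t * u) = locCls v t * locCls v u := by
  rw [locCls, locIdele_mul]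
  rfl

theorem locCls_conjU (t : (QA D (Qv v))ˣ) : locCls v (conjU t) = (locCls v t)⁻¹ := by
  rw [locCls, ← conjIdele_locIdele, mk_conjIdele]

theorem locCls_of_mem {t : (QA D (Qv v))ˣ} (h : t ∈ scalInt D v) : locCls v t = 1 :=
  (QuotientGroup.eq_one_iff _).2 (locIdele_mem_princSub h)

theorem cls_mul_tor_locIdele (h : GD D Af) (t : (QA D (Qv v))ˣ) :
    cls (h * tor (locIdele v t)) = locCls v t * cls h ∨
    cls (h * tor (locIdele v t)) = (locCls v t)⁻¹ * cls h := by
  rcases mul_tor_locIdele h t with e | e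
  · exact Or.inl (by rw [e, cls_tor_mul])
  · exact Or.inr (by rw [e, cls_tor_mul, mk_conjIdele])

theorem cls_mul_tor_locIdele_inv (h : GD D Af) (t : (QA D (Qv v))ˣ) :
    (cls (h * tor (locIdele v t)) = locCls v t * cls h ∧
      cls (h * (tor (locIdele v t))⁻¹) = (locCls v t)⁻¹ * cls h) ∨
    (cls (h * tor (locIdele v t)) = (locCls v t)⁻¹ * cls h ∧
      cls (h * (tor (locIdele v t))⁻¹) = locCls v t * cls h) := by
  have key : ∀ a b : (AE D)ˣ, h * tor a = tor b * h → h * (tor a)⁻¹ = (tor b)⁻¹ * h := by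
    intro a b e
    rw [eq_inv_mul_iff_mul_eq, ← mul_assoc, ← e, mul_inv_cancel_right]
  have hinv : ∀ b : (AE D)ˣ, cls ((tor b)⁻¹ * h) = (b : ClD D)⁻¹ * cls h := fun b => by
    rw [← map_inv, cls_tor_mul]
    rfl
  rcases mul_tor_locIdele h t with e | e
  · exact Or.inl ⟨by rw [e, cls_tor_mul], by rw [key _ _ e, hinv]⟩
  · refine Or.inr ⟨by rw [e, cls_tor_mul, mk_conjIdele], ?_⟩
    rw [key _ _ e, hinv, mk_conjIdele]
    exact congrArg (· * cls h) (inv_inv (locCls v t))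

theorem symF_mul_add (χ : ClDual D) (c d : ClD D) :
    symF χ (c * d) + symF χ (c⁻¹ * d) = (ev χ c + (ev χ c)⁻¹) * symF χ d := by
  simp only [symF, ev_mul, ev_inv]
  have h1 := ev_ne_zero χ c
  have h2 := ev_ne_zero χ d
  field_simp
  ring

theorem symF_mul_of_inv_eq {χ : ClDual D} {c : ClD D} (hc : (ev χ c)⁻¹ = ev χ c) (d : ClD D) :
    symF χ (c * d) = ev χ c * symF χ d := by
  simp only [symF, ev_mul, mul_inv, hc]
  ring

/-- Depending on the component of `h` at `v`, the two translates act by the class of `t` and its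
inverse in one order or the other; their sum does not see the order. -/
theorem rTrans_add_rTrans_inv_fChi (χ : ClDual D) (t : (QA D (Qv v))ˣ) :
    rTrans (tor (locIdele v t)) (fChi χ) + rTrans (tor (locIdele v t))⁻¹ (fChi χ) =
      (ev χ (locCls v t) + (ev χ (locCls v t))⁻¹) • fChi χ := by
  funext h
  rw [Pi.add_apply, Pi.smul_apply, rTrans_apply, rTrans_apply, fChi_apply, fChi_apply, fChi_apply,
    smul_eq_mul]
  change symF χ (cls (h.2 * _)) + symF χ (cls (h.2 * _)) = _
  rcases cls_mul_tor_locIdele_inv h.2 t with ⟨e1, e2⟩ | ⟨e1, e2⟩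
  · rw [e1, e2, symF_mul_add]
  · rw [e1, e2, add_comm, symF_mul_add]

theorem rTrans_fChi_of_inv_eq {χ : ClDual D} {t : (QA D (Qv v))ˣ}
    (hc : (ev χ (locCls v t))⁻¹ = ev χ (locCls v t)) :
    rTrans (tor (locIdele v t)) (fChi χ) = ev χ (locCls v t) • fChi χ := by
  funext h
  rw [Pi.smul_apply, rTrans_apply, fChi_apply, fChi_apply, smul_eq_mul]
  change symF χ (cls (h.2 * _)) = _
  rcases cls_mul_tor_locIdele h.2 t with e | e
  · rw [e, symF_mul_of_inv_eq hc]
  · rw [e, symF_mul_of_inv_eq (by rw [ev_inv, hc, hc]), ev_inv, hc]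

theorem add_inv_eq_iff {z e : ℂ} (hz : z ≠ 0) (he : e ≠ 0) :
    z + z⁻¹ = e + e⁻¹ ↔ z = e ∨ z = e⁻¹ := by
  constructor
  · intro h
    have : (z - e) * (z * e - 1) = 0 := by
      field_simp at h
      linear_combination h
    rcases mul_eq_zero.1 this with h | h
    · exact Or.inl (sub_eq_zero.1 h)
    · exact Or.inr (eq_inv_of_mul_eq_one_left (sub_eq_zero.1 h))
  · rintro (rfl | rfl)
    · rfl
    · rw [inv_inv, add_comm]

theorem smul_fChi_injective (χ : ClDual D) {a b : ℂ} (h : a • fChi χ = b • fChi χ) : a = b :=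
  smul_left_injective ℂ (fChi_ne_zero χ) h

theorem fChi_mem_fixK_genU (χ : ClDual D) : fChi χ ∈ fixK (genU χ) := by
  rw [fixK_genU]
  exact Submodule.mem_span_singleton_self _

theorem locCls_of_mul_mem {t u : (QA D (Qv v))ˣ} (h : t * u⁻¹ ∈ scalInt D v) :
    locCls v t = locCls v u :=
  (mk_locIdele_eq (by rwa [mul_comm])).symm

/-- Every generator `diag(p, p⁻¹)` equals `ω - r` or its inverse up to scalars and units, so the
eigenvalue is `χ(P) + χ(P)⁻¹`. This determines the parameter up to inversion. Existence of a
generator excludes a vacuous condition. -/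
theorem isSatake_iff {r : ℤ} (hr : IsRootAt D v r) (hs : ¬ (resChar v : ℤ) ∣ 2 * r - cB D)
    (χ : ClDual D) (z : ℂ) : IsSatake (genU χ) v z ↔
      z = ev χ (locCls v (piU D r (Qv v))) ∨ z = (ev χ (locCls v (piU D r (Qv v))))⁻¹ := by
  have he := ev_ne_zero χ (locCls v (piU D r (Qv v)))
  have hcl : ∀ t : (QA D (Qv v))ˣ, (t * piU D r (Qv v) ∈ scalInt D v ∨
      t * (piU D r (Qv v))⁻¹ ∈ scalInt D v) →
      ev χ (locCls v t) + (ev χ (locCls v t))⁻¹ =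
      ev χ (locCls v (piU D r (Qv v))) + (ev χ (locCls v (piU D r (Qv v))))⁻¹ := by
    rintro t (h | h)
    · rw [locCls_of_mul_mem (u := (piU D r (Qv v))⁻¹) (by rwa [inv_inv]), locCls_inv, ev_inv,
        inv_inv, add_comm]
    · rw [locCls_of_mul_mem h]
  have hgen : ∀ g, IsTorusGen v g → rTrans g (fChi χ) + rTrans g⁻¹ (fChi χ) =
      (ev χ (locCls v (piU D r (Qv v))) + (ev χ (locCls v (piU D r (Qv v))))⁻¹) • fChi χ := by
    rintro g ⟨hg, e, e', hee, h1, -⟩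
    obtain ⟨t, ht, ht'⟩ := tor_of_isHypPair hr hee h1
    rw [hg.eq_tor ht, rTrans_add_rTrans_inv_fChi, hcl t ht']
  have hex : ∃ g : GD D Af, IsTorusGen v g := by
    obtain ⟨t, e, e', h1, h2, h3⟩ := exists_tor_isHypPair hr.1 hs
    exact ⟨_, suppAt_tor_locIdele t, e, e', h1, by rw [at_tor_locIdele]; exact h2,
      by rw [at_tor_locIdele]; exact h3⟩
  constructor
  · rintro ⟨hz, h⟩
    obtain ⟨g, hg⟩ := hex
    have := h _ (fChi_mem_fixK_genU χ) g hg
    rw [hgen g hg] at this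
    exact (add_inv_eq_iff hz he).1 (smul_fChi_injective χ this).symm
  · intro h
    have hz : z ≠ 0 := by
      rcases h with rfl | rfl
      · exact he
      · exact inv_ne_zero he
    refine ⟨hz, fun f hf g hg => ?_⟩
    rw [fixK_genU] at hf
    obtain ⟨a, rfl⟩ := Submodule.mem_span_singleton.1 hf
    rw [map_smul, map_smul, ← smul_add, hgen g hg, (add_inv_eq_iff hz he).2 h, smul_comm]

/-- The square of `ω - r` is a scalar times a unit, so `χ(P) = ±1`. Elements outside `K_v^*` have
torus part in the class of `ω - r`, and a reflection factor lies in `K_v^*`. -/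
theorem isSatakeSign_iff {r : ℤ} (hr : IsRootAt D v r) (hram : (resChar v : ℤ) ∣ 2 * r - cB D)
    (χ : ClDual D) (ρ : ℂ) : IsSatakeSign (genU χ) v ρ ↔
      ρ = ev χ (locCls v (piU D r (Qv v))) := by
  have hsq : (ev χ (locCls v (piU D r (Qv v))))⁻¹ = ev χ (locCls v (piU D r (Qv v))) := by
    refine (eq_inv_of_mul_eq_one_left ?_).symm
    rw [← ev_mul, ← locCls_mul, ← sq, locCls_of_mem (piU_sq_mem_scalInt hr hram), ev_one]
  constructor
  · intro h
    have := h _ (fChi_mem_fixK_genU χ) (tor (locIdele v (piU D r (Qv v))))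
      (suppAt_tor_locIdele _) (by rw [at_tor_locIdele]; exact tor_piU_mem_locK hr hram)
      (by rw [at_tor_locIdele, tor_mem_locKs_iff]; exact piU_not_mem_scalInt hr)
    rw [rTrans_fChi_of_inv_eq hsq] at this
    exact (smul_fChi_injective χ this).symm
  · rintro rfl f hf k hk - hk'
    rw [fixK_genU] at hf
    obtain ⟨a, rfl⟩ := Submodule.mem_span_singleton.1 hf
    have key : ∀ t : (QA D (Qv v))ˣ, t ∉ scalInt D v →
        rTrans (tor (locIdele v t)) (fChi χ) = ev χ (locCls v (piU D r (Qv v))) • fChi χ := by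
      intro t ht
      have hm := mul_piU_mem_scalInt_of_not_mem hr hram ht
      have e1 : locCls v t = (locCls v (piU D r (Qv v)))⁻¹ := by
        rw [← locCls_inv]
        exact locCls_of_mul_mem (by rwa [inv_inv])
      have e2 : ev χ (locCls v t) = ev χ (locCls v (piU D r (Qv v))) := by
        rw [e1, ev_inv, hsq]
      rw [rTrans_fChi_of_inv_eq (by rw [e2, hsq]), e2]
    rw [map_smul, smul_comm]
    congr 1
    obtain ⟨t, ht | ht⟩ := (k.at v).exists_tor
    · rw [ht, tor_mem_locKs_iff] at hk'
      rw [hk.eq_tor ht, key t hk']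
    · rw [ht, tor_mul_sig_mem_locKs_iff] at hk'
      have hk2 : (tor (locIdele v t))⁻¹ * k ∈ finKs D := fun w => by
        rw [GD.at_mul, GD.at_inv]
        by_cases hw : w = v
        · subst hw
          rw [at_tor_locIdele, ht, inv_mul_cancel_left]
          exact sig_mem_locKs
        · rw [suppAt_tor_locIdele t w hw, hk w hw, inv_one, one_mul]
          exact (locKsGrp D w).one_mem
      rw [← mul_inv_cancel_left (tor (locIdele v t)) k, rTrans_mul, (fChi_mem χ).2 _ hk2, key t hk']

end satake

/-! ### Local factors in the split, ramified and inert cases -/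

section localFactors

variable {D : ℤ} [ImagDisc D] {v : Pl}

theorem exists_tor_part_cases (v : Pl) :
    (∃ r, IsRootAt D v r ∧ ¬ (resChar v : ℤ) ∣ 2 * r - cB D) ∨
    (∃ r, IsRootAt D v r ∧ (resChar v : ℤ) ∣ 2 * r - cB D) ∨
    (∀ r : ℤ, ¬ (resChar v : ℤ) ∣ nf D r) := by
  by_cases h : ∀ r : ℤ, ¬ (resChar v : ℤ) ∣ nf D r
  · exact Or.inr (Or.inr h)
  · push Not at h
    obtain ⟨r, hr⟩ := h
    obtain ⟨k, hk⟩ := exists_isRootAt hr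
    by_cases h2 : (resChar v : ℤ) ∣ 2 * (r + k * resChar v) - cB D
    · exact Or.inr (Or.inl ⟨_, hk, h2⟩)
    · exact Or.inl ⟨_, hk, h2⟩

theorem dvd_sub_or_of_dvd_nf {p : ℤ} (hp : Prime p) {r s : ℤ} (hr : p ∣ nf D r) (hs : p ∣ nf D s) :
    p ∣ s - r ∨ p ∣ s - (cB D - r) := by
  refine hp.dvd_or_dvd ?_
  have := dvd_sub hs hr
  convert this using 1
  unfold nf
  ring

theorem not_isWittOne_of_ramified {r : ℤ} (hr : IsRootAt D v r)
    (hram : (resChar v : ℤ) ∣ 2 * r - cB D) : ¬ IsWittOne D v := by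
  rw [isWittOne_iff]
  rintro ⟨s, hs, hs'⟩
  refine hs' ?_
  rcases dvd_sub_or_of_dvd_nf (Nat.prime_iff_prime_int.1 (resChar_prime v)) hr.1 hs with h | h
  · rw [show 2 * s - cB D = 2 * (s - r) + (2 * r - cB D) by ring]
    exact dvd_add (Dvd.dvd.mul_left h 2) hram
  · rw [show 2 * s - cB D = 2 * (s - (cB D - r)) - (2 * r - cB D) by ring]
    exact dvd_sub (Dvd.dvd.mul_left h 2) hram

theorem idCls_ker_redAt {r : ℤ} (hr : IsRootAt D v r) :
    idCls (RingHom.ker (redAt hr)) = locCls v (piU D r (Qv v)) := by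
  rw [← idl_locIdele_piU hr, idCls_idl (locIdele_piU_mem r)]

theorem piU_conj (r : ℤ) (K : Type) [Field K] [Algebra ℚ K] :
    piU D (cB D - r) K = scal (-1) * conjU (piU D r K) := by
  refine Units.ext ?_
  rw [scal_mul_val, piU_val]
  change _ = _ • star (piU D r K : QA D K)
  rw [piU_val, star_piE]
  simp

theorem locCls_piU_conj (r : ℤ) :
    locCls v (piU D (cB D - r) (Qv v)) = (locCls v (piU D r (Qv v)))⁻¹ := by
  rw [piU_conj, locCls_mul, locCls_of_mem (scal_mem_scalInt _), locCls_conjU, cls_one_mul]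

theorem idCls_ker_redInert :
    idCls (RingHom.ker (redInert D v)) = 1 := by
  rw [← idl_locIdele_resU, idCls_idl locIdele_resU_mem]
  exact locCls_of_mem (scal_mem_scalInt _)

theorem ne_bot_of_comap {P : Ideal (OE D)} (h : P.comap (Int.castRingHom (OE D)) = v.asIdeal) :
    P ≠ ⊥ := by
  rintro rfl
  have h0 := congrArg QuadraticAlgebra.re (Ideal.mem_bot.1 (natCast_mem_of_comap h))
  rw [QuadraticAlgebra.re_natCast, QuadraticAlgebra.re_zero] at h0
  exact (resChar_prime v).ne_zero (by exact_mod_cast h0)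

theorem locAI_eq (χ : ClDual D) (v : Pl) (s : ℂ) : locAI χ v s =
    ∏ᶠ P ∈ {P : Ideal (OE D) | P.IsPrime ∧ P.comap (Int.castRingHom (OE D)) = v.asIdeal},
      (1 - ev χ (idCls P) * (Nat.card (OE D ⧸ P) : ℂ) ^ (-s))⁻¹ :=
  finprod_mem_congr rfl fun P hP => by rw [chiIdeal_eq χ (ne_bot_of_comap hP.2)]; rfl

theorem primesOver_of_isRootAt {r : ℤ} (hr : IsRootAt D v r) :
    {P : Ideal (OE D) | P.IsPrime ∧ P.comap (Int.castRingHom (OE D)) = v.asIdeal} =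
      {RingHom.ker (redAt hr), RingHom.ker (redAt hr.conj)} := by
  refine Set.Subset.antisymm ?_ ?_
  · rintro P ⟨hP, h⟩
    exact eq_ker_redAt hr hP h
  · rintro P (rfl | rfl)
    · exact ⟨(ker_redAt_isMaximal hr).isPrime, comap_ker_redAt hr⟩
    · exact ⟨(ker_redAt_isMaximal hr.conj).isPrime, comap_ker_redAt hr.conj⟩

theorem locAI_split {r : ℤ} (hr : IsRootAt D v r) (hs : ¬ (resChar v : ℤ) ∣ 2 * r - cB D)
    (χ : ClDual D) (s : ℂ) : locAI χ v s =
      (1 - ev χ (locCls v (piU D r (Qv v))) * (resChar v : ℂ) ^ (-s))⁻¹ *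
      (1 - (ev χ (locCls v (piU D r (Qv v))))⁻¹ * (resChar v : ℂ) ^ (-s))⁻¹ := by
  rw [locAI_eq, primesOver_of_isRootAt hr,
    finprod_mem_pair fun h => hs ((ker_redAt_conj_eq_iff hr).1 h.symm), idCls_ker_redAt,
    idCls_ker_redAt, card_quot_ker_redAt, card_quot_ker_redAt, locCls_piU_conj, ev_inv]

theorem locAI_ramified {r : ℤ} (hr : IsRootAt D v r) (hs : (resChar v : ℤ) ∣ 2 * r - cB D)
    (χ : ClDual D) (s : ℂ) : locAI χ v s =
      (1 - ev χ (locCls v (piU D r (Qv v))) * (resChar v : ℂ) ^ (-s))⁻¹ := by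
  rw [locAI_eq, primesOver_of_isRootAt hr, (ker_redAt_conj_eq_iff hr).2 hs, Set.pair_eq_singleton,
    finprod_mem_singleton, idCls_ker_redAt, card_quot_ker_redAt]

theorem locAI_inert (hin : ∀ r : ℤ, ¬ (resChar v : ℤ) ∣ nf D r)
    (χ : ClDual D) (s : ℂ) : locAI χ v s = (1 - (resChar v : ℂ) ^ (-2 * s))⁻¹ := by
  have h : {P : Ideal (OE D) | P.IsPrime ∧ P.comap (Int.castRingHom (OE D)) = v.asIdeal} =
      {RingHom.ker (redInert D v)} := by
    refine Set.Subset.antisymm ?_ ?_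
    · rintro P ⟨hP, h⟩
      exact eq_ker_redInert hin hP h
    · rintro P rfl
      exact ⟨(ker_redInert_isMaximal hin).isPrime, comap_ker_redInert⟩
  rw [locAI_eq, h, finprod_mem_singleton, idCls_ker_redInert, ev_one, one_mul,
    card_quot_ker_redInert]
  congr 2
  rw [Nat.cast_pow, sq, Complex.natCast_mul_natCast_cpow, ← Complex.cpow_add _ _
    (Nat.cast_ne_zero.2 (resChar_prime v).ne_zero)]
  congr 1
  ring

/-- The Satake parameter is chosen only up to inversion, but the split factor is symmetric; in the
ramified case the sign is unique. -/
theorem locL_genU (χ : ClDual D) (v : Pl) (s : ℂ) : locL (genU χ) v s = locAI χ v s := by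
  rcases exists_tor_part_cases (D := D) v with ⟨r, hr, hs⟩ | ⟨r, hr, hs⟩ | hin
  · have H : ∃ z, IsSatake (genU χ) v z := ⟨_, (isSatake_iff hr hs χ _).2 (Or.inl rfl)⟩
    rw [locL, if_pos (isWittOne_iff.2 ⟨r, hr.1, hs⟩), dif_pos H, locAI_split hr hs]
    rcases (isSatake_iff hr hs χ _).1 H.choose_spec with e | e
    · rw [e, mul_inv]
    · rw [e, mul_inv, inv_inv, mul_comm]
  · have H : ∃ z, IsSatakeSign (genU χ) v z := ⟨_, (isSatakeSign_iff hr hs χ _).2 rfl⟩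
    rw [locL, if_neg (not_isWittOne_of_ramified hr hs), if_neg (locK_ne_locKs_of_ramified hr hs),
      dif_pos H, locAI_ramified hr hs, (isSatakeSign_iff hr hs χ _).1 H.choose_spec]
  · rw [locL, if_neg fun h => ?_, if_pos (locK_eq_locKs_of_inert hin), locAI_inert hin]
    obtain ⟨r, hr, -⟩ := isWittOne_iff.1 h
    exact hin r hr

end localFactors

/-! ### The Kronecker symbol and the splitting of primes -/

section kronecker

variable {D : ℤ}

theorem exists_dirichletCharacter {N : ℕ} [NeZero N] (f : ℕ → ℤ) (hper : ∀ n, f (n % N) = f n)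
    (h1 : f 1 = 1) (hmul : ∀ m n, f (m * n) = f m * f n)
    (h0 : ∀ n : ℕ, ¬ n.Coprime N → f n = 0) :
    ∃ η : DirichletCharacter ℂ N, ∀ n : ℕ, η n = f n := by
  have hv : ∀ n : ℕ, f (n : ZMod N).val = f n := fun n => by rw [ZMod.val_natCast, hper]
  refine ⟨{ toFun := fun x => f x.val
            map_one' := ?_
            map_mul' := fun x y => ?_
            map_nonunit' := fun x hx => ?_ }, fun n => ?_⟩
  · have := hv 1
    rw [Nat.cast_one] at this
    rw [this, h1, Int.cast_one]
  · rw [ZMod.val_mul, hper, hmul, Int.cast_mul]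
  · rw [h0, Int.cast_zero]
    intro h
    exact hx (by rw [← ZMod.natCast_zmod_val x]; exact (ZMod.isUnit_iff_coprime _ _).2 h)
  · exact congrArg (Int.cast : ℤ → ℂ) (hv n)

/-- The Kronecker symbol `(D / n)`. -/
def kron (D : ℤ) (n : ℕ) : ℤ :=
  if D % 4 = 0 then (if n % 2 = 1 then jacobiSym (D / 4) n else 0) else jacobiSym n D.natAbs

theorem kron_one (D : ℤ) : kron D 1 = 1 := by
  simp [kron]

theorem kron_mul (D : ℤ) (m n : ℕ) : kron D (m * n) = kron D m * kron D n := by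
  unfold kron
  by_cases h : D % 4 = 0
  · rw [if_pos h, if_pos h, if_pos h]
    rcases Nat.mod_two_eq_zero_or_one m with hm | hm
    · rw [if_neg (by rw [Nat.mul_mod, hm, zero_mul]; decide), if_neg (by omega : ¬ m % 2 = 1),
        zero_mul]
    rcases Nat.mod_two_eq_zero_or_one n with hn | hn
    · rw [if_neg (by rw [Nat.mul_mod, hn, mul_zero]; decide), if_neg (by omega : ¬ n % 2 = 1),
        mul_zero]
    have : NeZero m := ⟨by omega⟩
    have : NeZero n := ⟨by omega⟩
    rw [if_pos (by rw [Nat.mul_mod, hm, hn]), if_pos hm, if_pos hn, jacobiSym.mul_right]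
  · rw [if_neg h, if_neg h, if_neg h, Nat.cast_mul, jacobiSym.mul_left]

theorem kron_mod (D : ℤ) (n : ℕ) : kron D (n % D.natAbs) = kron D n := by
  unfold kron
  split_ifs with h h1 h2 h3
  · have e : D.natAbs = 4 * (D / 4).natAbs := by omega
    rw [e, ← jacobiSym.mod_right _ (Nat.odd_iff.2 h2)]
  · rw [Nat.mod_mod_of_dvd _ (by omega)] at h1
    exact absurd h1 h2
  · rw [Nat.mod_mod_of_dvd _ (by omega)] at h1
    exact absurd h3 h1
  · rfl
  · rw [Int.natCast_mod, ← jacobiSym.mod_left]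

theorem kron_eq_zero {n : ℕ} (h : ¬ n.Coprime D.natAbs) : kron D n = 0 := by
  unfold kron
  split_ifs with h4 h2
  · rw [jacobiSym.eq_zero_iff]
    refine ⟨by omega, fun hc => h ?_⟩
    have e : D.natAbs = 2 * 2 * (D / 4).natAbs := by omega
    have hn2 : n.Coprime 2 := Nat.coprime_two_right.2 (Nat.odd_iff.2 h2)
    rw [e]
    refine (hn2.mul_right hn2).mul_right ?_
    rw [Nat.coprime_comm]
    exact hc
  · rfl
  · rw [jacobiSym.eq_zero_iff]
    exact ⟨by omega, fun hc => h hc⟩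

/-- `kron` is written so that periodicity modulo `|D|` and multiplicativity are immediate. Quadratic
reciprocity, with the sign from `D = -|D|`, gives back `(D/p)`; at `p = 2` it is the supplementary
law. -/
theorem kron_eq_kronAtPrime (hneg : D < 0) (h14 : D % 4 = 0 ∨ D % 4 = 1) {p : ℕ} (hp : p.Prime) :
    kron D p = kronAtPrime D p := by
  unfold kron kronAtPrime
  rcases hp.eq_two_or_odd' with rfl | hodd
  · rw [if_pos rfl]
    rcases h14 with h | h
    · rw [if_pos h, if_neg (by decide), if_pos (by omega)]
    · rw [if_neg (by omega), if_neg (by omega : ¬ D % 2 = 0), Nat.cast_ofNat,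
        jacobiSym.at_two (Nat.odd_iff.2 (by omega)), ZMod.χ₈_nat_eq_if_mod_eight]
      split_ifs <;> omega
  · have h2 : p ≠ 2 := by
      rintro rfl
      exact absurd hodd (by decide)
    rw [if_neg h2]
    rcases h14 with h | h
    · rw [if_pos h, if_pos (Nat.odd_iff.1 hodd)]
      conv_rhs => rw [show D = 4 * (D / 4) by omega]
      rw [jacobiSym.mul_left, jacobiSym.at_four hodd, one_mul]
    · rw [if_neg (by omega)]
      have e : D = -(D.natAbs : ℤ) := by omega
      conv_rhs => rw [e]
      rw [jacobiSym.neg _ hodd]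
      rcases Nat.odd_mod_four_iff.1 (Nat.odd_iff.1 hodd) with h1 | h3
      · rw [ZMod.χ₄_nat_one_mod_four h1, one_mul,
          jacobiSym.quadratic_reciprocity_one_mod_four h1 (Nat.odd_iff.2 (by omega))]
      · rw [ZMod.χ₄_nat_three_mod_four h3,
          jacobiSym.quadratic_reciprocity_three_mod_four (by omega : D.natAbs % 4 = 3) h3]
        ring

/-- The quadratic Dirichlet character attached to `ℚ(√D)`. -/
theorem exists_kronecker_character (hneg : D < 0) :
    ∃ η : DirichletCharacter ℂ D.natAbs, ∀ n : ℕ, η n = kron D n := by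
  have : NeZero D.natAbs := ⟨by omega⟩
  exact exists_dirichletCharacter (kron D) (kron_mod D) (kron_one D) (kron_mul D)
    fun n h => kron_eq_zero h

variable [ImagDisc D] {v : Pl}

theorem disc_eq_sq_sub (D r : ℤ) [ImagDisc D] : D = (2 * r - cB D) ^ 2 - 4 * nf D r := by
  rw [four_mul_nf]; ring

theorem kronAtPrime_two (D : ℤ) : kronAtPrime D 2 =
    if D % 2 = 0 then 0 else if D % 8 = 1 then 1 else -1 := if_pos rfl

/-- Modulo `p`, `D` is the nonzero square of `2r - cB`. For `p = 2` it is an odd square minus `8k`,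
hence `1` modulo `8`. -/
theorem kronAtPrime_split {r : ℤ} (hr : (resChar v : ℤ) ∣ nf D r)
    (hs : ¬ (resChar v : ℤ) ∣ 2 * r - cB D) : kronAtPrime D (resChar v) = 1 := by
  have hD := disc_eq_sq_sub D r
  by_cases h2 : resChar v = 2
  · rw [h2] at hr hs ⊢
    obtain ⟨k, hk⟩ := hr
    obtain ⟨m, hm⟩ := (Int.not_even_iff_odd.1 fun h => hs (even_iff_two_dvd.1 h))
    have hm2 := Int.even_mul_succ_self m
    obtain ⟨l, hl⟩ := hm2
    have e : D = 8 * (l - k) + 1 := by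
      rw [hD, hk, hm]
      push_cast
      linear_combination 4 * hl
    rw [kronAtPrime_two, if_neg (by omega), if_pos (by omega)]
  · rw [kronAtPrime, if_neg h2, ← jacobiSym.legendreSym.to_jacobiSym]
    have hsq : ((D : ℤ) : ZMod (resChar v)) = ((2 * r - cB D : ℤ) : ZMod (resChar v)) ^ 2 := by
      conv_lhs => rw [hD]
      rw [Int.cast_sub, Int.cast_mul, (ZMod.intCast_zmod_eq_zero_iff_dvd _ _).2 hr, mul_zero,
        sub_zero, Int.cast_pow]
    refine (legendreSym.eq_one_iff _ ?_).2 ⟨_, by rw [hsq, sq]⟩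
    rw [hsq]
    exact pow_ne_zero 2 fun h => hs ((ZMod.intCast_zmod_eq_zero_iff_dvd _ _).1 h)

theorem kronAtPrime_ramified {r : ℤ} (hr : (resChar v : ℤ) ∣ nf D r)
    (hs : (resChar v : ℤ) ∣ 2 * r - cB D) : kronAtPrime D (resChar v) = 0 := by
  have hd : (resChar v : ℤ) ∣ D := by
    rw [disc_eq_sq_sub D r]
    exact dvd_sub (dvd_pow hs two_ne_zero) (Dvd.dvd.mul_left hr 4)
  by_cases h2 : resChar v = 2
  · rw [h2] at hd ⊢
    rw [kronAtPrime_two, if_pos (by omega)]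
  · rw [kronAtPrime, if_neg h2, ← jacobiSym.legendreSym.to_jacobiSym, legendreSym.eq_zero_iff]
    exact (ZMod.intCast_zmod_eq_zero_iff_dvd _ _).2 hd

/-- For odd `p`, a square root `y` of `D` modulo `p` could be adjusted by `p` to the parity of `cB`,
and `(y + cB)/2` would be a root of the minimal polynomial. -/
theorem kronAtPrime_inert (hin : ∀ r : ℤ, ¬ (resChar v : ℤ) ∣ nf D r) :
    kronAtPrime D (resChar v) = -1 := by
  have h14 := cB_sq D
  by_cases h2 : resChar v = 2
  · rw [h2] at hin ⊢
    have h0 := hin 0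
    have h1 := hin 1
    have hb : cB D = 0 ∨ cB D = -1 := by
      unfold cB
      split_ifs <;> simp
    simp only [nf] at h0 h1
    rw [kronAtPrime_two]
    rcases hb with h | h <;> rw [h] at h14 h0 h1
    · omega
    · rw [if_neg (by omega), if_neg (by omega)]
  · have hodd : resChar v % 2 = 1 := ((resChar_prime v).eq_two_or_odd).resolve_left h2
    rw [kronAtPrime, if_neg h2, ← jacobiSym.legendreSym.to_jacobiSym, legendreSym.eq_neg_one_iff]
    rintro ⟨y, hy⟩
    obtain ⟨y, rfl⟩ := ZMod.intCast_surjective y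
    have hd : (resChar v : ℤ) ∣ y ^ 2 - D := by
      rw [← ZMod.intCast_zmod_eq_zero_iff_dvd, Int.cast_sub, hy]
      push_cast
      ring
    have key : ∀ z : ℤ, (resChar v : ℤ) ∣ z ^ 2 - D → (z - cB D) % 2 = 0 → False := by
      intro z hz hz2
      have e : 2 * ((z + cB D) / 2) - cB D = z := by omega
      refine hin ((z + cB D) / 2) ?_
      have h4 : (resChar v : ℤ) ∣ 4 * nf D ((z + cB D) / 2) := by rwa [four_mul_nf, e]
      refine (Int.Prime.dvd_mul' (resChar_prime v) h4).resolve_left fun h => ?_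
      have : resChar v ∣ 2 ^ 2 := by exact_mod_cast h
      exact h2 ((Nat.prime_dvd_prime_iff_eq (resChar_prime v) Nat.prime_two).1
        ((resChar_prime v).dvd_of_dvd_pow this))
    rcases Int.emod_two_eq_zero_or_one (y - cB D) with h | h
    · exact key y hd h
    · refine key (y + resChar v) ?_ (by omega)
      rw [show (y + resChar v) ^ 2 - D = (y ^ 2 - D) + resChar v * (2 * y + resChar v) by ring]
      exact dvd_add hd (dvd_mul_right _ _)

end kronecker

/-! ### Euler products and the case of the trivial character -/

section globalLFunction

variable {D : ℤ} [ImagDisc D]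

/-- A uniform degree two shape for the convergence argument: the ramified factor takes `b = 0`, the
inert one takes `±1`. -/
theorem exists_locAI_eq (χ : ClDual D) (v : Pl) : ∃ a b : ℂ, ‖a‖ ≤ 1 ∧ ‖b‖ ≤ 1 ∧ ∀ s : ℂ,
    locAI χ v s = (1 - a * (resChar v : ℂ) ^ (-s))⁻¹ * (1 - b * (resChar v : ℂ) ^ (-s))⁻¹ := by
  rcases exists_tor_part_cases (D := D) v with ⟨r, hr, hs⟩ | ⟨r, hr, hs⟩ | hin
  · refine ⟨_, _, ?_, ?_, fun s => locAI_split hr hs χ s⟩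
    · rw [norm_ev]
    · rw [norm_inv, norm_ev, inv_one]
  · refine ⟨ev χ (locCls v (piU D r (Qv v))), 0, (norm_ev _ _).le, norm_zero.trans_le zero_le_one,
      fun s => ?_⟩
    rw [locAI_ramified hr hs, zero_mul, sub_zero, inv_one, mul_one]
  · refine ⟨1, -1, by simp, by simp, fun s => ?_⟩
    rw [locAI_inert hin, ← mul_inv, neg_one_mul, sub_neg_eq_add, one_mul,
      show -2 * s = -s + -s by ring, Complex.cpow_add _ _
        (Nat.cast_ne_zero.2 (resChar_prime v).ne_zero)]
    congr 1
    ring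

theorem locAI_one (v : Pl) (s : ℂ) : locAI (1 : ClDual D) v s =
    (1 - (resChar v : ℂ) ^ (-s))⁻¹ *
      (1 - (kronAtPrime D (resChar v) : ℂ) * (resChar v : ℂ) ^ (-s))⁻¹ := by
  rcases exists_tor_part_cases (D := D) v with ⟨r, hr, hs⟩ | ⟨r, hr, hs⟩ | hin
  · rw [locAI_split hr hs, kronAtPrime_split hr.1 hs, ev_one_char, inv_one, one_mul, Int.cast_one,
      one_mul]
  · rw [locAI_ramified hr hs, kronAtPrime_ramified hr.1 hs, ev_one_char, one_mul, Int.cast_zero,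
      zero_mul, sub_zero, inv_one, mul_one]
  · rw [locAI_inert hin, kronAtPrime_inert hin, ← mul_inv, Int.cast_neg, Int.cast_one, neg_one_mul,
      sub_neg_eq_add, show -2 * s = -s + -s by ring, Complex.cpow_add _ _
        (Nat.cast_ne_zero.2 (resChar_prime v).ne_zero)]
    congr 1
    ring

theorem norm_resChar_cpow (v : Pl) (s : ℂ) :
    ‖(resChar v : ℂ) ^ (-s)‖ = (resChar v : ℝ) ^ (-s.re) := by
  rw [Complex.norm_natCast_cpow_of_pos (resChar_prime v).pos, Complex.neg_re]

theorem summable_resChar {s : ℝ} (hs : 1 < s) : Summable fun v : Pl => (resChar v : ℝ) ^ (-s) := by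
  have := (Real.summable_nat_rpow.2 (by linarith : -s < -1)).comp_injective resChar_injective
  exact this

theorem multipliable_inv_one_sub {a : Pl → ℂ} (ha : ∀ v, ‖a v‖ ≤ 1) {s : ℂ} (hs : 1 < s.re) :
    Multipliable fun v => (1 - a v * (resChar v : ℂ) ^ (-s))⁻¹ := by
  set x : Pl → ℂ := fun v => a v * (resChar v : ℂ) ^ (-s) with hx
  have hxn : ∀ v, ‖x v‖ ≤ (resChar v : ℝ) ^ (-s.re) := fun v => by
    rw [hx, norm_mul, norm_resChar_cpow]
    exact mul_le_of_le_one_left (by positivity) (ha v)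
  have hx2 : ∀ v, ‖x v‖ ≤ 1 / 2 := fun v => by
    refine (hxn v).trans ?_
    have h2 : (2 : ℝ) ≤ resChar v := by exact_mod_cast (resChar_prime v).two_le
    calc (resChar v : ℝ) ^ (-s.re) ≤ (resChar v : ℝ) ^ (-1 : ℝ) :=
          Real.rpow_le_rpow_of_exponent_le (by linarith) (by linarith)
      _ = (resChar v : ℝ)⁻¹ := Real.rpow_neg_one _
      _ ≤ 1 / 2 := by rw [one_div]; exact inv_anti₀ two_pos h2
  have hne : ∀ v, 1 - x v ≠ 0 := fun v h => by
    have := hx2 v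
    rw [← sub_eq_zero.1 h, norm_one] at this
    norm_num at this
  have e : ∀ v, (1 - x v)⁻¹ = 1 + x v / (1 - x v) := fun v => by
    field_simp [hne v]
    ring
  change Multipliable fun v => (1 - x v)⁻¹
  simp only [e]
  refine multipliable_one_add_of_summable (Summable.of_nonneg_of_le (fun _ => norm_nonneg _)
    (fun v => ?_) ((summable_resChar hs).mul_left 2))
  rw [norm_div, div_le_iff₀ (norm_pos_iff.2 (hne v))]
  have h1 : 1 / 2 ≤ ‖1 - x v‖ := by
    have := norm_sub_norm_le (1 : ℂ) (x v)
    rw [norm_one] at this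
    linarith [hx2 v]
  have h0 : 0 ≤ (resChar v : ℝ) ^ (-s.re) := by positivity
  nlinarith [hxn v]

theorem multipliable_locAI (χ : ClDual D) {s : ℂ} (hs : 1 < s.re) :
    Multipliable fun v => locAI χ v s := by
  choose a b ha hb h using exists_locAI_eq χ
  simp only [h]
  exact (multipliable_inv_one_sub ha hs).mul (multipliable_inv_one_sub hb hs)

theorem hasProd_place {f : ℕ → ℂ} {a : ℂ} (h : HasProd (fun p : Nat.Primes => f p) a) :
    HasProd (fun v : Pl => f (resChar v)) a := by
  have := (Rat.HeightOneSpectrum.primesEquiv (R := ℤ)).hasProd_iff.2 h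
  convert this using 2 with v
  rw [Function.comp_apply, primesEquiv_eq_resChar]

/-- The product `(z - a)² f(z)` tends to `0` at `a` and has the value `0` there whatever `f(a)` is,
so the singularity is removable. The exponent two makes the default value of `f` at the pole
harmless. -/
theorem meromorphicAt_of_tendsto {f : ℂ → ℂ} {a c : ℂ}
    (hd : ∀ z ≠ a, DifferentiableAt ℂ f z)
    (ht : Filter.Tendsto (fun z => (z - a) * f z) (nhdsWithin a {a}ᶜ) (nhds c)) :
    MeromorphicAt f a := by
  refine ⟨2, Complex.analyticAt_of_differentiable_on_punctured_nhds_of_continuousAt ?_ ?_⟩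
  · filter_upwards [self_mem_nhdsWithin] with z hz
    exact ((differentiableAt_id.sub_const a).pow 2).smul (hd z hz)
  · rw [continuousAt_iff_punctured_nhds]
    have h1 : Filter.Tendsto (fun z : ℂ => z - a) (nhdsWithin a {a}ᶜ) (nhds 0) := by
      have : ContinuousAt (fun z : ℂ => z - a) a := by fun_prop
      have := this.tendsto.mono_left (nhdsWithin_le_nhds (s := {a}ᶜ))
      rwa [sub_self] at this
    have h2 := h1.mul ht
    rw [sub_self, zero_pow two_ne_zero, zero_smul]
    rw [zero_mul] at h2
    refine h2.congr fun z => ?_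
    rw [smul_eq_mul]
    ring

theorem meromorphic_riemannZeta : MeromorphicOn riemannZeta Set.univ := fun z _ => by
  by_cases hz : z = 1
  · rw [hz]
    exact meromorphicAt_of_tendsto (fun z hz => differentiableAt_riemannZeta hz)
      riemannZeta_residue_one
  · have : AnalyticAt ℂ riemannZeta z := by
      refine Complex.analyticAt_iff_eventually_differentiableAt.2 ?_
      filter_upwards [isOpen_compl_singleton.mem_nhds hz] with w hw
      exact differentiableAt_riemannZeta hw
    exact this.meromorphicAt

theorem meromorphic_LFunction {N : ℕ} [NeZero N] (η : DirichletCharacter ℂ N) :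
    MeromorphicOn η.LFunction Set.univ := fun z _ => by
  by_cases hz : z = 1
  · rw [hz]
    by_cases h : η = 1
    · rw [h]
      exact meromorphicAt_of_tendsto
        (fun z hz => DirichletCharacter.differentiableAt_LFunction _ _ (Or.inl hz))
        DirichletCharacter.LFunctionTrivChar_residue_one
    · exact ((DirichletCharacter.differentiable_LFunction h).analyticAt 1).meromorphicAt
  · have : AnalyticAt ℂ η.LFunction z := by
      refine Complex.analyticAt_iff_eventually_differentiableAt.2 ?_
      filter_upwards [isOpen_compl_singleton.mem_nhds hz] with w hw
      exact DirichletCharacter.differentiableAt_LFunction _ _ (Or.inl hw)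
    exact this.meromorphicAt

theorem isLFunction_locAI_one [NeZero D.natAbs] (η : DirichletCharacter ℂ D.natAbs)
    (hη : ∀ p : ℕ, p.Prime → η p = kronAtPrime D p) :
    IsLFunction (locAI (1 : ClDual D)) fun s => riemannZeta s * η.LFunction s := by
  refine ⟨fun z hz => (meromorphic_riemannZeta z hz).mul (meromorphic_LFunction η z hz),
    fun s hs => ?_⟩
  have h1 := hasProd_place (f := fun p => (1 - (p : ℂ) ^ (-s))⁻¹)
    (riemannZeta_eulerProduct_hasProd hs)
  have h2 := hasProd_place (f := fun p => (1 - η p * (p : ℂ) ^ (-s))⁻¹)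
    (DirichletCharacter.LSeries_eulerProduct_hasProd η hs)
  change HasProd _ (riemannZeta s * η.LFunction s)
  rw [DirichletCharacter.LFunction_eq_LSeries η hs]
  convert h1.mul h2 using 2 with v
  rw [locAI_one, hη _ (resChar_prime v)]

end globalLFunction

/-! ### Lattice sums over `OE D` and over subgroups of finite index -/

section latticeSum

/-- A mean value estimate obtained from `exp x ≥ 1 + x` and `log x ≤ x - 1`. -/
theorem rpow_neg_sub_le {a b t : ℝ} (ha : 0 < a) (hab : a ≤ b) (ht : 0 ≤ t) :
    a ^ (-t) - b ^ (-t) ≤ t * (b - a) * a ^ (-t - 1) := by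
  have hb := ha.trans_le hab
  have h1 : b ^ (-t) = a ^ (-t) * Real.exp (-t * Real.log (b / a)) := by
    rw [mul_comm (-t) (Real.log _), ← Real.rpow_def_of_pos (div_pos hb ha),
      ← Real.mul_rpow ha.le (div_pos hb ha).le, mul_div_cancel₀ _ ha.ne']
  have h2 := Real.add_one_le_exp (-t * Real.log (b / a))
  have h3 := Real.log_le_sub_one_of_pos (div_pos hb ha)
  have h4 : 1 - t * (b / a - 1) ≤ Real.exp (-t * Real.log (b / a)) := by nlinarith
  have h5 : 0 < a ^ (-t) := Real.rpow_pos_of_pos ha _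
  rw [h1, Real.rpow_sub_one ha.ne']
  have : t * (b - a) * (a ^ (-t) / a) = a ^ (-t) * (t * (b / a - 1)) := by field_simp
  rw [this]
  nlinarith

/-- The constant is `32 = 4 · 8`: the exponent is at most `4`, and both bases are at least `u/2`,
which costs `2³`. -/
theorem abs_rpow_neg_sub_le {u w R t : ℝ} (hR : 0 ≤ R) (hu : 2 * R + 2 ≤ u) (huw : |w - u| ≤ R)
    (h2 : 2 ≤ t) (h4 : t ≤ 4) : |w ^ (-t) - u ^ (-t)| ≤ 32 * R * u ^ (-3 : ℝ) := by
  have hu0 : 0 < u := by linarith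
  obtain ⟨h5, h6⟩ := abs_le.1 huw
  have hw : u / 2 ≤ w := by linarith
  have hw1 : 1 ≤ w := by linarith
  have key : ∀ m : ℝ, u / 2 ≤ m → 1 ≤ m → m ^ (-t - 1) ≤ 8 * u ^ (-3 : ℝ) := by
    intro m hm hm1
    calc m ^ (-t - 1) ≤ m ^ (-3 : ℝ) := Real.rpow_le_rpow_of_exponent_le hm1 (by linarith)
      _ ≤ (u / 2) ^ (-3 : ℝ) := Real.rpow_le_rpow_of_nonpos (by linarith) hm (by norm_num)
      _ = 8 * u ^ (-3 : ℝ) := by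
        rw [Real.div_rpow hu0.le two_pos.le, Real.rpow_neg two_pos.le]
        norm_num
        ring
  have hpos : ∀ m : ℝ, 1 ≤ m → 0 < m ^ (-t - 1) := fun m hm =>
    Real.rpow_pos_of_pos (by linarith) _
  have hfin : ∀ m d : ℝ, u / 2 ≤ m → 1 ≤ m → 0 ≤ d → d ≤ R →
      t * d * m ^ (-t - 1) ≤ 32 * R * u ^ (-3 : ℝ) := by
    intro m d hm hm1 hd hdR
    have hk := key m hm hm1
    have hp := hpos m hm1
    have h7 : t * d ≤ 4 * R := mul_le_mul h4 hdR hd (by norm_num)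
    calc t * d * m ^ (-t - 1) ≤ 4 * R * (8 * u ^ (-3 : ℝ)) :=
          mul_le_mul h7 hk hp.le (by positivity)
      _ = _ := by ring
  rcases le_total w u with h | h
  · have hmono : u ^ (-t) ≤ w ^ (-t) :=
      Real.rpow_le_rpow_of_nonpos (by linarith) h (by linarith)
    rw [abs_of_nonneg (by linarith)]
    exact (rpow_neg_sub_le (by linarith) h (by linarith)).trans
      (hfin w (u - w) hw hw1 (by linarith) (by linarith))
  · have hmono : w ^ (-t) ≤ u ^ (-t) := Real.rpow_le_rpow_of_nonpos hu0 h (by linarith)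
    rw [abs_sub_comm, abs_of_nonneg (by linarith)]
    exact (rpow_neg_sub_le hu0 h (by linarith)).trans
      (hfin u (w - u) (by linarith) (by linarith) (by linarith) (by linarith))

theorem tsum_eq_sum_cosets {G : Type*} [AddGroup G] (J : AddSubgroup G) [Fintype (G ⧸ J)]
    {f : G → ℝ} (hf : Summable f) :
    ∑' x, f x = ∑ q : G ⧸ J, ∑' x : J, f (Quotient.out q + (x : G)) := by
  have hbij : Function.Bijective fun p : (G ⧸ J) × J => Quotient.out p.1 + (p.2 : G) := by
    constructor
    · rintro ⟨q, x⟩ ⟨q', x'⟩ e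
      have e' : Quotient.out q + (x : G) = Quotient.out q' + (x' : G) := e
      have hq : q = q' := by
        have h1 := congrArg (QuotientAddGroup.mk (s := J)) e'
        rw [QuotientAddGroup.mk_add_of_mem _ x.2, QuotientAddGroup.mk_add_of_mem _ x'.2] at h1
        rwa [show QuotientAddGroup.mk (s := J) (Quotient.out q) = q from Quotient.out_eq q,
          show QuotientAddGroup.mk (s := J) (Quotient.out q') = q' from Quotient.out_eq q'] at h1
      subst hq
      exact Prod.ext rfl (Subtype.ext (add_left_cancel e'))
    · intro g
      refine ⟨(QuotientAddGroup.mk g, ⟨-Quotient.out (QuotientAddGroup.mk (s := J) g) + g, ?_⟩), ?_⟩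
      · rw [← QuotientAddGroup.eq]
        exact Quotient.out_eq _
      · exact add_neg_cancel_left _ _
  have h := (Equiv.ofBijective _ hbij).summable_iff.2 hf
  rw [← (Equiv.ofBijective _ hbij).tsum_eq]
  exact h.tsum_prod.trans (tsum_fintype _)

variable {D : ℤ} [ImagDisc D]

/-- The generator `ω` as a point of the upper half plane. -/
def omegaH (D : ℤ) [h : ImagDisc D] : UpperHalfPlane :=
  ⟨⟨(cB D : ℝ) / 2, √(-(D : ℝ)) / 2⟩, by
    have : (0 : ℝ) < -(D : ℝ) := by exact_mod_cast neg_pos.2 h.neg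
    exact div_pos (Real.sqrt_pos.2 this) two_pos⟩

/-- The complex embedding of `OE D`. -/
def toC (x : OE D) : ℂ := (x.im : ℂ) * (omegaH D : ℂ) + (x.re : ℂ)

theorem toC_add (x y : OE D) : toC (x + y) = toC x + toC y := by
  simp only [toC, QuadraticAlgebra.re_add, QuadraticAlgebra.im_add, Int.cast_add]
  ring

theorem norm_toC_sq (x : OE D) : ‖toC x‖ ^ 2 = ((x.norm : ℤ) : ℝ) := by
  have hD : (0 : ℝ) ≤ -(D : ℝ) := by exact_mod_cast (neg_pos.2 (ImagDisc.neg (D := D))).le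
  have h1 := cB_sq_cast D ℝ
  have h2 := Real.sq_sqrt hD
  rw [← Complex.normSq_eq_norm_sq, Complex.normSq_apply, QuadraticAlgebra.norm_def]
  have hre : (toC x).re = x.im * ((cB D : ℝ) / 2) + x.re := by
    simp [toC, omegaH]
  have him : (toC x).im = x.im * (√(-(D : ℝ)) / 2) := by
    simp [toC, omegaH]
  rw [hre, him]
  push_cast
  linear_combination (x.im : ℝ) ^ 2 / 4 * (h1 + h2)

theorem toC_zero : toC (0 : OE D) = 0 := by simp [toC]

theorem norm_OE_nonneg (x : OE D) : 0 ≤ x.norm := by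
  have := norm_toC_sq x
  have h : (0 : ℝ) ≤ ((x.norm : ℤ) : ℝ) := by rw [← this]; positivity
  exact_mod_cast h

theorem one_le_norm_OE {x : OE D} (hx : x ≠ 0) : 1 ≤ x.norm := by
  have h1 := norm_OE_nonneg x
  have h2 := norm_OE_ne_zero hx
  omega

theorem one_le_norm_toC {x : OE D} (hx : x ≠ 0) : 1 ≤ ‖toC x‖ := by
  have h : (1 : ℝ) ≤ ‖toC x‖ ^ 2 := by
    rw [norm_toC_sq]
    exact_mod_cast one_le_norm_OE hx
  exact (one_le_sq_iff₀ (norm_nonneg _)).1 h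

theorem norm_toC_eq (x : OE D) : ‖toC x‖ =
    ‖(((![x.im, x.re] : Fin 2 → ℤ) 0 : ℤ) : ℂ) * (omegaH D : ℂ) +
      (((![x.im, x.re] : Fin 2 → ℤ) 1 : ℤ) : ℂ)‖ := rfl

/-- The terms are those of an Eisenstein series for the lattice `ℤω + ℤ`, whose convergence is
known. -/
theorem summable_norm_toC {t : ℝ} (ht : 2 < t) : Summable fun x : OE D => ‖toC x‖ ^ (-t) := by
  have h1 := (EisensteinSeries.summable_one_div_norm_rpow ht).mul_left
    ((EisensteinSeries.r (omegaH D)) ^ (-t))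
  have h2 : Summable fun x : Fin 2 → ℤ => ‖(x 0 : ℂ) * (omegaH D : ℂ) + x 1‖ ^ (-t) :=
    Summable.of_nonneg_of_le (fun _ => by positivity)
      (fun x => EisensteinSeries.summand_bound (omegaH D) (by linarith) x) h1
  have hinj : Function.Injective fun x : OE D => (![x.im, x.re] : Fin 2 → ℤ) := fun x y e =>
    QuadraticAlgebra.ext (congrFun e 1) (congrFun e 0)
  simp only [norm_toC_eq]
  exact h2.comp_injective hinj

/-- The summand `N(x)⁻ˢ`. -/
def normPow (s : ℝ) (x : OE D) : ℝ := ((x.norm : ℤ) : ℝ) ^ (-s)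

theorem normPow_eq (s : ℝ) (x : OE D) : normPow s x = ‖toC x‖ ^ (-(2 * s)) := by
  rw [normPow, ← norm_toC_sq, ← Real.rpow_natCast, ← Real.rpow_mul (norm_nonneg _)]
  congr 1
  push_cast
  ring

theorem normPow_nonneg (s : ℝ) (x : OE D) : 0 ≤ normPow s x := by
  rw [normPow_eq]; positivity

theorem normPow_zero {s : ℝ} (hs : 0 < s) : normPow s (0 : OE D) = 0 := by
  rw [normPow_eq, toC_zero, norm_zero, Real.zero_rpow (by linarith)]

theorem normPow_le_one {s : ℝ} (hs : 0 < s) (x : OE D) : normPow s x ≤ 1 := by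
  by_cases hx : x = 0
  · rw [hx, normPow_zero hs]
    exact zero_le_one
  · rw [normPow_eq]
    exact Real.rpow_le_one_of_one_le_of_nonpos (one_le_norm_toC hx) (by linarith)

theorem normPow_mul (s : ℝ) (x y : OE D) : normPow s (x * y) = normPow s x * normPow s y := by
  rw [normPow, normPow, normPow, map_mul, Int.cast_mul, Real.mul_rpow] <;>
  exact_mod_cast norm_OE_nonneg _

theorem summable_normPow {s : ℝ} (hs : 1 < s) : Summable (normPow s : OE D → ℝ) := by
  simp only [funext (normPow_eq (D := D) s)]
  exact summable_norm_toC (by linarith)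

/-- The values of `N(x)⁻ˢ` on a coset and on the lattice are close. -/
theorem exists_bound_normPow_sub (r : OE D) : ∃ h : OE D → ℝ, Summable h ∧
    ∀ s ∈ Set.Ioc (1 : ℝ) 2, ∀ x, |normPow s (r + x) - normPow s x| ≤ h x := by
  classical
  set R := ‖toC r‖ with hR
  have hR0 : 0 ≤ R := norm_nonneg _
  -- The first constant serves large `x`; the term `(2R + 2)³` covers the `x` of size below `2R +
  -- 2`, where the difference is at most `1`; the last summand covers `x = 0`. The exponent `-3` is
  -- summable in the plane, uniformly in `s`.
  refine ⟨fun x => (32 * R + (2 * R + 2) ^ 3) * ‖toC x‖ ^ (-3 : ℝ) + if x = 0 then 1 else 0,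
    ((summable_norm_toC (by norm_num)).mul_left _).add
      (summable_of_ne_finset_zero (s := {0}) fun x hx => if_neg (by simpa using hx)), ?_⟩
  rintro s ⟨hs1, hs2⟩ x
  beta_reduce
  have h1 : |normPow s (r + x) - normPow s x| ≤ 1 := by
    rw [abs_le]
    have := normPow_nonneg s x
    have := normPow_nonneg s (r + x)
    have := normPow_le_one (s := s) (by linarith) x
    have := normPow_le_one (s := s) (by linarith) (r + x)
    constructor <;> linarith
  by_cases hx : x = 0
  · rw [hx] at h1 ⊢
    rw [if_pos rfl]
    have : 0 ≤ (32 * R + (2 * R + 2) ^ 3) * ‖toC (0 : OE D)‖ ^ (-3 : ℝ) := by positivity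
    linarith
  · rw [if_neg hx, add_zero]
    have hx1 := one_le_norm_toC hx
    have hp : 0 < ‖toC x‖ ^ (-3 : ℝ) := Real.rpow_pos_of_pos (by linarith) _
    by_cases hlt : 2 * R + 2 ≤ ‖toC x‖
    · rw [normPow_eq, normPow_eq]
      refine (abs_rpow_neg_sub_le hR0 hlt ?_ (by linarith) (by linarith)).trans ?_
      · refine (abs_norm_sub_norm_le _ _).trans ?_
        rw [toC_add, add_sub_cancel_right]
      · exact mul_le_mul_of_nonneg_right (le_add_of_nonneg_right (by positivity)) hp.le
    · push Not at hlt
      refine h1.trans ?_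
      have h3 : ‖toC x‖ ^ (-3 : ℝ) = (‖toC x‖ ^ 3)⁻¹ := by
        rw [Real.rpow_neg (norm_nonneg _)]
        norm_num
      have h4 : ‖toC x‖ ^ 3 ≤ (2 * R + 2) ^ 3 := pow_le_pow_left₀ (norm_nonneg _) hlt.le 3
      have h5 : 0 < ‖toC x‖ ^ 3 := by positivity
      rw [h3, ← div_eq_mul_inv, le_div_iff₀ h5]
      linarith [mul_nonneg (by norm_num : (0 : ℝ) ≤ 32) hR0]

/-- Comparison of the lattice sums for `OE D` and for a subgroup of finite index. -/
theorem exists_abs_tsum_sub_le (J : AddSubgroup (OE D)) [Finite (OE D ⧸ J)] : ∃ C : ℝ,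
    ∀ s ∈ Set.Ioc (1 : ℝ) 2,
      |∑' x : OE D, normPow s x - Nat.card (OE D ⧸ J) * ∑' x : J, normPow s (x : OE D)| ≤ C := by
  have : Fintype (OE D ⧸ J) := Fintype.ofFinite _
  choose h hh hle using fun q : OE D ⧸ J => exists_bound_normPow_sub (Quotient.out q)
  refine ⟨∑ q : OE D ⧸ J, ∑' x : J, h q (x : OE D), fun s hs => ?_⟩
  have hsum := summable_normPow (D := D) hs.1
  have e1 : ∑' x : OE D, normPow s x =
      ∑ q : OE D ⧸ J, ∑' x : J, normPow s (Quotient.out q + (x : OE D)) := tsum_eq_sum_cosets J hsum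
  have hJ : Summable fun x : J => normPow s (x : OE D) := hsum.subtype _
  have hJq : ∀ q : OE D ⧸ J, Summable fun x : J => normPow s (Quotient.out q + (x : OE D)) :=
    fun q => hsum.comp_injective ((add_right_injective _).comp Subtype.val_injective)
  have e2 : Nat.card (OE D ⧸ J) * ∑' x : J, normPow s (x : OE D) =
      ∑ _q : OE D ⧸ J, ∑' x : J, normPow s (x : OE D) := by
    rw [Finset.sum_const, Finset.card_univ, Nat.card_eq_fintype_card, nsmul_eq_mul]
  rw [e1, e2, ← Finset.sum_sub_distrib]
  refine (Finset.abs_sum_le_sum_abs _ _).trans (Finset.sum_le_sum fun q _ => ?_)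
  rw [← (hJq q).tsum_sub hJ, ← Real.norm_eq_abs]
  have hsq : Summable fun x : J => h q (x : OE D) :=
    (hh q).comp_injective Subtype.val_injective
  refine tsum_of_norm_bounded hsq.hasSum fun x => ?_
  exact hle q s hs x

end latticeSum

/-! ### Class zeta sums near `s = 1` -/

section classSums

theorem ideal_mul_ne_bot {R : Type*} [CommRing R] [IsDomain R] {I J : Ideal R} (hI : I ≠ ⊥)
    (hJ : J ≠ ⊥) : I * J ≠ ⊥ := fun h => (Ideal.mul_eq_bot.1 h).elim hI hJ

theorem ideal_mul_right_cancel {R : Type*} [CommRing R] [IsDedekindDomain R] {I I' J : Ideal R}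
    (hJ : J ≠ ⊥) (h : I * J = I' * J) : I = I' := by
  have hJ0 : J ≠ 0 := hJ
  exact mul_right_cancel₀ hJ0 h

variable {D : ℤ} [ImagDisc D]

theorem algebra_norm_OE (x : OE D) : Algebra.norm ℤ x = x.norm := by
  rw [Algebra.norm_apply, ← QuadraticAlgebra.det_toLinearMap_eq_norm]
  rfl

theorem absNorm_span_OE (x : OE D) : ((Ideal.absNorm (Ideal.span {x}) : ℕ) : ℤ) = x.norm := by
  rw [Ideal.absNorm_span_singleton, algebra_norm_OE, Int.natAbs_of_nonneg (norm_OE_nonneg x)]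

theorem absNorm_pos {I : Ideal (OE D)} (hI : I ≠ ⊥) : 0 < Ideal.absNorm I :=
  Nat.pos_of_ne_zero fun h => hI (Ideal.absNorm_eq_zero_iff.1 h)

/-- The summand `N(I)⁻ˢ`. -/
def idPow (s : ℝ) (I : Ideal (OE D)) : ℝ := (Ideal.absNorm I : ℝ) ^ (-s)

theorem idPow_mul (s : ℝ) (I J : Ideal (OE D)) : idPow s (I * J) = idPow s I * idPow s J := by
  rw [idPow, idPow, idPow, map_mul, Nat.cast_mul,
    Real.mul_rpow (Nat.cast_nonneg _) (Nat.cast_nonneg _)]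

theorem idPow_span (s : ℝ) (x : OE D) : idPow s (Ideal.span {x}) = normPow s x := by
  rw [idPow, normPow, ← absNorm_span_OE, Int.cast_natCast]

theorem idPow_nonneg (s : ℝ) (I : Ideal (OE D)) : 0 ≤ idPow s I := by
  unfold idPow; positivity

theorem idPow_pos (s : ℝ) {I : Ideal (OE D)} (hI : I ≠ ⊥) : 0 < idPow s I :=
  Real.rpow_pos_of_pos (Nat.cast_pos.2 (absNorm_pos hI)) _

theorem idPow_top (s : ℝ) : idPow s (⊤ : Ideal (OE D)) = 1 := by
  rw [idPow, Ideal.absNorm_top, Nat.cast_one, Real.one_rpow]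

theorem idPow_bot {s : ℝ} (hs : 0 < s) : idPow s (⊥ : Ideal (OE D)) = 0 := by
  rw [idPow, Ideal.absNorm_bot, Nat.cast_zero, Real.zero_rpow (by linarith)]

variable (D) in
/-- The sum of `N(x)⁻ˢ` over the nonzero elements of `OE D`. -/
def latZ (s : ℝ) : ℝ := ∑' x : OE D, normPow s x

theorem latZ_nonneg (s : ℝ) : 0 ≤ latZ D s := tsum_nonneg fun _ => normPow_nonneg _ _

theorem exists_abs_latZ_sub_le {J : Ideal (OE D)} (hJ : J ≠ ⊥) : ∃ C : ℝ,
    ∀ s ∈ Set.Ioc (1 : ℝ) 2,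
      |latZ D s - Ideal.absNorm J * ∑' x : J, normPow s (x : OE D)| ≤ C := by
  have hfin : Finite (OE D ⧸ J) := Nat.finite_of_card_ne_zero (absNorm_pos hJ).ne'
  have : Finite (OE D ⧸ J.toAddSubgroup) := hfin
  exact exists_abs_tsum_sub_le J.toAddSubgroup

theorem tsum_span (s : ℝ) {a : OE D} (ha : a ≠ 0) :
    ∑' x : Ideal.span {a}, normPow s (x : OE D) = normPow s a * latZ D s := by
  have hbij : Function.Bijective fun x : OE D =>
      (⟨a * x, Ideal.mul_mem_right x _ (Ideal.mem_span_singleton_self a)⟩ : Ideal.span {a}) := by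
    constructor
    · intro x y e
      exact mul_left_cancel₀ ha (congrArg Subtype.val e)
    · rintro ⟨y, hy⟩
      obtain ⟨x, rfl⟩ := Ideal.mem_span_singleton'.1 hy
      exact ⟨x, Subtype.ext (mul_comm _ _)⟩
  rw [← (Equiv.ofBijective _ hbij).tsum_eq, latZ, ← tsum_mul_left]
  exact tsum_congr fun x => normPow_mul s a x

/-- Comparison with the sublattice `2 OE D` of index `4` bounds `(1 - 4^{1-s}) Z(s)`, where `Z` is
`latZ`, and `1 - 4^{1-s}` is at least a constant times `s - 1`. -/
theorem exists_sub_one_mul_latZ_le : ∃ C : ℝ, ∀ s ∈ Set.Ioc (1 : ℝ) 2, (s - 1) * latZ D s ≤ C := by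
  have h2 : (2 : OE D) ≠ 0 := two_ne_zero
  obtain ⟨C, hC⟩ := exists_abs_latZ_sub_le (D := D) (span_singleton_ne_bot h2)
  have hn : (2 : OE D).norm = 4 := by
    rw [QuadraticAlgebra.norm_def]
    simp [QuadraticAlgebra.re_ofNat, QuadraticAlgebra.im_ofNat]
  have hN : (Ideal.absNorm (Ideal.span {(2 : OE D)}) : ℝ) = 4 := by
    have := absNorm_span_OE (2 : OE D)
    rw [hn] at this
    exact_mod_cast this
  refine ⟨3 * C, fun s hs => ?_⟩
  have h := (abs_le.1 (hC s hs)).2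
  rw [tsum_span s h2, hN, normPow, hn, ← mul_assoc] at h
  have e1 : (4 : ℝ) * ((4 : ℤ) : ℝ) ^ (-s) = Real.exp (-((s - 1) * Real.log 4)) := by
    rw [Int.cast_ofNat]
    nth_rewrite 1 [← Real.rpow_one 4]
    rw [← Real.rpow_add (by norm_num), Real.rpow_def_of_pos (by norm_num)]
    congr 1
    ring
  rw [e1] at h
  have hl4 : Real.log 4 = 2 * Real.log 2 := by
    rw [show (4 : ℝ) = 2 ^ 2 by norm_num, Real.log_pow]
    push_cast
    ring
  have hlog1 : 1 ≤ Real.log 4 := by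
    have := Real.log_two_gt_d9
    rw [hl4]; linarith
  have hlog2 : Real.log 4 ≤ 2 := by
    have := Real.log_two_lt_d9
    rw [hl4]; linarith
  have hs1 : 0 < s - 1 := by linarith [hs.1]
  have hs2 : s - 1 ≤ 1 := by linarith [hs.2]
  set y := (s - 1) * Real.log 4 with hy
  have hy0 : s - 1 ≤ y := by rw [hy]; nlinarith
  have hy2 : y ≤ 2 := by rw [hy]; nlinarith
  have hexp : Real.exp (-y) * (1 + y) ≤ 1 := by
    have h1 := Real.add_one_le_exp y
    have h2 : Real.exp (-y) * Real.exp y = 1 := by rw [← Real.exp_add, neg_add_cancel, Real.exp_zero]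
    have h3 := Real.exp_pos (-y)
    nlinarith
  -- From `1 - e^{-y} ≥ y/(1 + y)` with `s - 1 ≤ y ≤ 2`; this is the source of the constant `3`.
  have hge : (s - 1) / 3 ≤ 1 - Real.exp (-y) := by
    have h3 := Real.exp_pos (-y)
    rw [div_le_iff₀ (by norm_num)]
    nlinarith
  have hZ := latZ_nonneg (D := D) s
  nlinarith

/-- The sum of `N(I)⁻ˢ` over the nonzero ideals in a class. -/
def clsZ (s : ℝ) (c : ClD D) : ℝ :=
  ∑' I : {I : Ideal (OE D) // I ≠ ⊥ ∧ idCls I = c}, idPow s I.1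

theorem exists_generator {I : Ideal (OE D)} (hI : I ≠ ⊥) (h : idCls I = 1) :
    ∃ g : OE D, g ≠ 0 ∧ I = Ideal.span {g} := by
  obtain ⟨x, y, hx, hy, e⟩ := exists_of_idCls_eq hI (top_ne_bot) (h.trans idCls_top.symm)
  rw [Ideal.mul_top] at e
  have hyx : y ∈ Ideal.span {x} * I := by
    rw [e]
    exact Ideal.mem_span_singleton_self y
  obtain ⟨g, rfl⟩ := Ideal.mem_span_singleton.1 (Ideal.mul_le_left hyx)
  refine ⟨g, right_ne_zero_of_mul hy, ?_⟩
  rw [← Ideal.span_singleton_mul_span_singleton] at e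
  exact (Ideal.span_singleton_mul_right_inj hx).1 e

/-- Nonzero elements `x` of `J` correspond to pairs of an ideal `I` in the inverse class, with `(x)
= IJ`, and a unit fixing the generator. -/
theorem card_units_mul_clsZ {J : Ideal (OE D)} (hJ : J ≠ ⊥) {s : ℝ} (hs : 1 < s) :
    Summable (fun I : {I : Ideal (OE D) // I ≠ ⊥ ∧ idCls I = (idCls J)⁻¹} => idPow s I.1) ∧
    ∑' x : J, normPow s (x : OE D) =
      Nat.card (OE D)ˣ * (idPow s J * clsZ s (idCls J)⁻¹) := by
  classical
  set X := {I : Ideal (OE D) // I ≠ ⊥ ∧ idCls I = (idCls J)⁻¹} with hX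
  have hgen : ∀ I : X, ∃ g : OE D, g ≠ 0 ∧ I.1 * J = Ideal.span {g} := fun I => by
    refine exists_generator (ideal_mul_ne_bot I.2.1 hJ) ?_
    rw [idCls_mul I.2.1 hJ, I.2.2]
    exact inv_mul_cancel (idCls J)
  choose g hg0 hg using hgen
  have hmem : ∀ p : X × (OE D)ˣ, g p.1 * (p.2 : OE D) ∈ J := fun p => by
    refine Ideal.mul_mem_right _ _ ?_
    have : g p.1 ∈ p.1.1 * J := by
      rw [hg p.1]
      exact Ideal.mem_span_singleton_self _
    exact Ideal.mul_le_right this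
  set m : X × (OE D)ˣ → J := fun p => ⟨g p.1 * (p.2 : OE D), hmem p⟩ with hm
  have hspan : ∀ p : X × (OE D)ˣ, Ideal.span {g p.1 * (p.2 : OE D)} = p.1.1 * J := fun p => by
    rw [hg, Ideal.span_singleton_mul_right_unit p.2.isUnit]
  have hinj : Function.Injective m := by
    rintro ⟨I, u⟩ ⟨I', u'⟩ e
    have e1 : g I * (u : OE D) = g I' * (u' : OE D) := congrArg Subtype.val e
    have e2 : I = I' := by
      have h1 := hspan (I, u)
      have h2 := hspan (I', u')
      simp only [e1] at h1 h2
      exact Subtype.ext (ideal_mul_right_cancel hJ (h1.symm.trans h2))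
    subst e2
    exact Prod.ext rfl (Units.ext (mul_left_cancel₀ (hg0 I) e1))
  have hrange : ∀ x : J, x ∉ Set.range m → normPow s (x : OE D) = 0 := by
    rintro ⟨x, hx⟩ hnr
    by_cases h0 : x = 0
    · change normPow s x = 0
      rw [h0]
      exact normPow_zero (by linarith)
    · refine absurd ?_ hnr
      have hle : Ideal.span {x} ≤ J := (Ideal.span_singleton_le_iff_mem _).2 hx
      obtain ⟨I, hI⟩ := Ideal.dvd_iff_le.2 hle
      have hI0 : I ≠ ⊥ := by
        rintro rfl
        rw [Ideal.mul_bot] at hI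
        exact span_singleton_ne_bot h0 hI
      have hIc : idCls I = (idCls J)⁻¹ := by
        have := congrArg idCls hI
        rw [idCls_span h0, idCls_mul hJ hI0] at this
        exact eq_inv_of_mul_eq_one_right this.symm
      have hass : Ideal.span {g ⟨I, hI0, hIc⟩} = Ideal.span {x} := by
        rw [← hg, hI, mul_comm]
      obtain ⟨u, hu⟩ := Ideal.span_singleton_eq_span_singleton.1 hass
      exact ⟨(⟨I, hI0, hIc⟩, u), Subtype.ext hu⟩
  have hval : ∀ p : X × (OE D)ˣ, normPow s ((m p : J) : OE D) = idPow s p.1.1 * idPow s J :=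
    fun p => by rw [← idPow_mul, ← hspan p, idPow_span]
  have hsum : Summable fun x : J => normPow s (x : OE D) :=
    (summable_normPow hs).comp_injective Subtype.val_injective
  have hsum2 : Summable fun p : X × (OE D)ˣ => idPow s p.1.1 * idPow s J := by
    have := (hinj.summable_iff hrange).2 hsum
    exact this.congr hval
  have hJp := idPow_pos s hJ
  have hsum3 : Summable fun I : X => idPow s I.1 := by
    have h1 : Summable fun I : X => idPow s I.1 * idPow s J :=
      hsum2.comp_injective (i := fun I : X => (I, (1 : (OE D)ˣ))) fun I I' e =>
        congrArg Prod.fst e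
    exact (summable_mul_right_iff hJp.ne').1 h1
  refine ⟨hsum3, ?_⟩
  have h2 : ∑' p : X × (OE D)ˣ, normPow s ((m p : J) : OE D) = ∑' x : J, normPow s (x : OE D) :=
    hinj.tsum_eq (f := fun x : J => normPow s (x : OE D)) fun x hx => by
      by_contra h
      exact hx (hrange x h)
  have : Fintype (OE D)ˣ := Fintype.ofFinite _
  rw [← h2]
  simp only [hval]
  rw [hsum2.tsum_prod]
  simp only [tsum_fintype, Finset.sum_const, Finset.card_univ, nsmul_eq_mul]
  rw [tsum_mul_left, tsum_mul_right, Nat.card_eq_fintype_card, clsZ, mul_comm (idPow s J)]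

theorem exists_idCls_inv_eq (c : ClD D) : ∃ J : Ideal (OE D), J ≠ ⊥ ∧ (idCls J)⁻¹ = c := by
  obtain ⟨J, hJ, h⟩ := exists_idCls_eq c⁻¹
  exact ⟨J, hJ, by rw [h]; exact inv_inv c⟩

theorem summable_class {s : ℝ} (hs : 1 < s) (c : ClD D) :
    Summable (fun I : {I : Ideal (OE D) // I ≠ ⊥ ∧ idCls I = c} => idPow s I.1) := by
  obtain ⟨J, hJ, rfl⟩ := exists_idCls_inv_eq c
  exact (card_units_mul_clsZ hJ hs).1

/-- The class zeta functions differ by bounded functions near `1`. -/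
theorem exists_abs_clsZ_sub_le (c : ClD D) : ∃ C : ℝ, ∀ s ∈ Set.Ioc (1 : ℝ) 2,
    |Nat.card (OE D)ˣ * clsZ s c - latZ D s| ≤ C := by
  obtain ⟨J, hJ, rfl⟩ := exists_idCls_inv_eq c
  obtain ⟨C, hC⟩ := exists_abs_latZ_sub_le hJ
  obtain ⟨C', hC'⟩ := exists_sub_one_mul_latZ_le (D := D)
  set n : ℝ := (Ideal.absNorm J : ℝ) with hn
  have hn1 : 1 ≤ n := Nat.one_le_cast.2 (absNorm_pos hJ)
  refine ⟨n * C + n * n * C', fun s hs => ?_⟩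
  have h1 := hC s hs
  have h2 := hC' s hs
  have hZ := latZ_nonneg (D := D) s
  have e := (card_units_mul_clsZ hJ hs.1).2
  rw [e] at h1
  set W := (Nat.card (OE D)ˣ : ℝ) * clsZ s (idCls J)⁻¹ with hW
  have hp : idPow s J = n ^ (-s) := rfl
  have hn0 : 0 < n := by linarith
  have hmul : n ^ (s - 1) * (n * n ^ (-s)) = 1 := by
    nth_rewrite 2 [← Real.rpow_one n]
    rw [← Real.rpow_add hn0, ← Real.rpow_add hn0, show s - 1 + (1 + -s) = 0 by ring, Real.rpow_zero]
  have hq1 : 1 ≤ n ^ (s - 1) := Real.one_le_rpow hn1 (by linarith [hs.1])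
  have hqn : n ^ (s - 1) ≤ n := by
    conv_rhs => rw [← Real.rpow_one n]
    exact Real.rpow_le_rpow_of_exponent_le hn1 (by linarith [hs.2])
  have hq2 : n ^ (s - 1) - 1 ≤ (s - 1) * n * n := by
    have h3 : n ^ (s - 1) = Real.exp (Real.log n * (s - 1)) := Real.rpow_def_of_pos hn0 _
    have h4 := Real.add_one_le_exp (-(Real.log n * (s - 1)))
    have h5 : Real.exp (-(Real.log n * (s - 1))) * n ^ (s - 1) = 1 := by
      rw [h3, ← Real.exp_add, neg_add_cancel, Real.exp_zero]
    have h6 := Real.log_le_sub_one_of_pos hn0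
    have h7 : 0 ≤ Real.log n := Real.log_nonneg hn1
    have h8 : 0 < s - 1 := by linarith [hs.1]
    have h9 : n ^ (s - 1) - 1 ≤ Real.log n * (s - 1) * n ^ (s - 1) := by nlinarith
    calc n ^ (s - 1) - 1 ≤ Real.log n * (s - 1) * n ^ (s - 1) := h9
      _ ≤ n * (s - 1) * n := by
        refine mul_le_mul (mul_le_mul_of_nonneg_right (by linarith) h8.le) hqn (by linarith)
          (by positivity)
      _ = _ := by ring
  -- The lattice estimate is multiplied by `n^{s-1}` to remove the factor `n · n^{-s}`. The
  -- remaining error `(n^{s-1} - 1) Z(s)` is bounded because `(s - 1) Z(s)` is.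
  have key : W - latZ D s = n ^ (s - 1) * (n * (↑(Nat.card (OE D)ˣ) *
      (idPow s J * clsZ s (idCls J)⁻¹)) - latZ D s) + (n ^ (s - 1) - 1) * latZ D s := by
    rw [hp, hW]
    linear_combination -(↑(Nat.card (OE D)ˣ) * clsZ s (idCls J)⁻¹) * hmul
  rw [key]
  refine (abs_add_le _ _).trans (add_le_add ?_ ?_)
  · rw [abs_mul, abs_of_pos (by linarith), abs_sub_comm]
    exact mul_le_mul hqn h1 (abs_nonneg _) hn0.le
  · rw [abs_of_nonneg (mul_nonneg (by linarith) hZ)]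
    calc (n ^ (s - 1) - 1) * latZ D s ≤ (s - 1) * n * n * latZ D s :=
          mul_le_mul_of_nonneg_right hq2 hZ
      _ = n * n * ((s - 1) * latZ D s) := by ring
      _ ≤ _ := mul_le_mul_of_nonneg_left h2 (by positivity)

end classSums

/-! ### Sums over ideals twisted by a class character -/

section idealSums

variable {D : ℤ} [ImagDisc D]

/-- Nonzero ideals, sorted by their classes. -/
def idealSigma (D : ℤ) [ImagDisc D] :
    (Σ c : ClD D, {I : Ideal (OE D) // I ≠ ⊥ ∧ idCls I = c}) ≃ {I : Ideal (OE D) // I ≠ ⊥} :=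
  (Equiv.sigmaCongrRight fun c => (Equiv.subtypeSubtypeEquivSubtypeInter
    (fun I : Ideal (OE D) => I ≠ ⊥) (fun I => idCls I = c)).symm).trans
    (Equiv.sigmaFiberEquiv fun I : {I : Ideal (OE D) // I ≠ ⊥} => idCls I.1)

theorem summable_idPow_ne_bot {s : ℝ} (hs : 1 < s) :
    Summable fun I : {I : Ideal (OE D) // I ≠ ⊥} => idPow s I.1 := by
  rw [← (idealSigma D).summable_iff]
  exact (summable_sigma_of_nonneg fun p => idPow_nonneg s _).2 ⟨fun c => summable_class hs c, (hasSum_fintype _).summable⟩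

theorem notMem_range_ne_bot {I : Ideal (OE D)}
    (h : I ∉ Set.range (Subtype.val : {I : Ideal (OE D) // I ≠ ⊥} → Ideal (OE D))) : I = ⊥ := by
  by_contra h0
  exact h ⟨⟨I, h0⟩, rfl⟩

theorem summable_idPow {s : ℝ} (hs : 1 < s) : Summable (idPow s : Ideal (OE D) → ℝ) :=
  (Subtype.val_injective.summable_iff fun I h => by
    rw [notMem_range_ne_bot h, idPow_bot (by linarith)]).1 (summable_idPow_ne_bot hs)

/-- The completely multiplicative function `ψ(I) N(I)⁻ˢ`. -/
def idChar (ψ : ClDual D) {s : ℝ} (hs : 0 < s) : Ideal (OE D) →*₀ ℂ where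
  toFun I := ev ψ (idCls I) * (idPow s I : ℝ)
  map_zero' := by
    rw [Ideal.zero_eq_bot, idPow_bot hs, Complex.ofReal_zero, mul_zero]
  map_one' := by
    rw [Ideal.one_eq_top, idPow_top, Complex.ofReal_one, mul_one, idCls_top, ev_one]
  map_mul' I J := by
    by_cases hI : I = ⊥
    · rw [hI, Ideal.bot_mul, idPow_bot hs, Complex.ofReal_zero, mul_zero, zero_mul]
    by_cases hJ : J = ⊥
    · rw [hJ, Ideal.mul_bot, idPow_bot hs, Complex.ofReal_zero, mul_zero, mul_zero]
    rw [idCls_mul hI hJ, ev_mul, idPow_mul, Complex.ofReal_mul]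
    ring

theorem idChar_apply (ψ : ClDual D) {s : ℝ} (hs : 0 < s) (I : Ideal (OE D)) :
    idChar ψ hs I = ev ψ (idCls I) * (idPow s I : ℝ) := rfl

theorem norm_idChar (ψ : ClDual D) {s : ℝ} (hs : 0 < s) (I : Ideal (OE D)) :
    ‖idChar ψ hs I‖ = idPow s I := by
  rw [idChar_apply, norm_mul, norm_ev, one_mul, Complex.norm_real,
    Real.norm_of_nonneg (idPow_nonneg s I)]

theorem tsum_idChar (ψ : ClDual D) {s : ℝ} (hs : 1 < s) (hs0 : 0 < s) :
    ∑' I, idChar ψ hs0 I = ∑ c, ev ψ c * (clsZ s c : ℝ) := by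
  have h1 : ∑' I : {I : Ideal (OE D) // I ≠ ⊥}, idChar ψ hs0 I.1 = ∑' I, idChar ψ hs0 I :=
    Subtype.val_injective.tsum_eq fun I hI => by
      by_contra h
      exact hI (by rw [notMem_range_ne_bot h, ← Ideal.zero_eq_bot, map_zero])
  have h2 : Summable fun I : {I : Ideal (OE D) // I ≠ ⊥} => idChar ψ hs0 I.1 := by
    refine Summable.of_norm ?_
    simp only [norm_idChar]
    exact summable_idPow_ne_bot hs
  have h3 := (idealSigma D).summable_iff.2 h2
  rw [← h1, ← (idealSigma D).tsum_eq]
  refine h3.tsum_sigma.trans ?_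
  rw [tsum_fintype]
  refine Finset.sum_congr rfl fun c _ => ?_
  rw [clsZ, Complex.ofReal_tsum, ← tsum_mul_left]
  refine tsum_congr fun I => ?_
  change ev ψ (idCls I.1) * _ = _
  rw [I.2.2]
  rfl

/-- All classes share the main term `Z(s)/w`, which is cancelled by `∑_c ψ(c) = 0`. -/
theorem exists_norm_tsum_idChar_le {ψ : ClDual D} (hψ : ψ ≠ 1) : ∃ C : ℝ,
    ∀ s ∈ Set.Ioc (1 : ℝ) 2, ∀ hs0 : 0 < s, ‖∑' I, idChar ψ hs0 I‖ ≤ C := by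
  choose C hC using fun c : ClD D => exists_abs_clsZ_sub_le c
  set w : ℝ := ((Nat.card (OE D)ˣ : ℕ) : ℝ) with hw
  have hw0 : 0 < w := Nat.cast_pos.2 Nat.card_pos
  refine ⟨w⁻¹ * ∑ c, C c, fun s hs hs0 => ?_⟩
  have e : ∑' I, idChar ψ hs0 I =
      ((w⁻¹ : ℝ) : ℂ) * ∑ c, ev ψ c * ((w * clsZ s c - latZ D s : ℝ) : ℂ) := by
    rw [tsum_idChar ψ hs.1]
    simp only [Complex.ofReal_sub, mul_sub, Finset.sum_sub_distrib]
    rw [← Finset.sum_mul, sum_ev ψ hψ, zero_mul, mul_zero, sub_zero, Finset.mul_sum]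
    refine Finset.sum_congr rfl fun c _ => ?_
    have : (w : ℂ) ≠ 0 := Complex.ofReal_ne_zero.2 hw0.ne'
    push_cast
    field_simp
  rw [e, norm_mul, Complex.norm_real, Real.norm_of_nonneg (inv_pos.2 hw0).le]
  refine mul_le_mul_of_nonneg_left ((norm_sum_le _ _).trans (Finset.sum_le_sum fun c _ => ?_))
    (inv_pos.2 hw0).le
  rw [norm_mul, norm_ev, one_mul, Complex.norm_real, Real.norm_eq_abs]
  exact hC c s hs

theorem normPow_one_eq (x : OE D) : normPow 1 x = ((x.norm : ℤ) : ℝ)⁻¹ := Real.rpow_neg_one _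

/-- The `n` lattice points `n + iω` with `0 ≤ i < n` have norm at most `A n²`, so the sum dominates
a harmonic series. -/
theorem not_summable_normPow_one : ¬ Summable (normPow 1 : OE D → ℝ) := by
  intro h
  set A : ℝ := |(cB D : ℝ)| + |(cA D : ℝ)| + 1 with hA
  have hA0 : 0 < A := by positivity
  have hinj : Function.Injective fun p : Σ n : ℕ, Fin n =>
      (⟨(p.1 : ℤ), (p.2 : ℤ)⟩ : OE D) := by
    rintro ⟨n, i⟩ ⟨m, j⟩ e
    have e1 : (n : ℤ) = m := congrArg QuadraticAlgebra.re e
    have e2 : ((i : ℕ) : ℤ) = (j : ℕ) := congrArg QuadraticAlgebra.im e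
    have e1' : n = m := by exact_mod_cast e1
    subst e1'
    have e2' : i = j := Fin.ext (by exact_mod_cast e2)
    rw [e2']
  have h1 := (h.comp_injective hinj).sigma
  have h2 : Summable fun n : ℕ => A⁻¹ * (n : ℝ)⁻¹ := by
    refine Summable.of_nonneg_of_le (fun n => by positivity) (fun n => ?_) h1
    rw [tsum_fintype]
    have key : ∀ i : Fin n, A⁻¹ * ((n : ℝ) ^ 2)⁻¹ ≤ normPow 1 (⟨(n : ℤ), ((i : ℕ) : ℤ)⟩ : OE D) := by
      intro i
      have hi : ((i : ℕ) : ℝ) ≤ n := Nat.cast_le.2 i.2.le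
      have hi0 : (0 : ℝ) ≤ ((i : ℕ) : ℝ) := Nat.cast_nonneg _
      have hn : (1 : ℝ) ≤ n := Nat.one_le_cast.2 (by have := i.2; omega)
      have hne : (⟨(n : ℤ), ((i : ℕ) : ℤ)⟩ : OE D) ≠ 0 := fun h0 => by
        have : (n : ℤ) = 0 := congrArg QuadraticAlgebra.re h0
        have : (n : ℝ) = 0 := by exact_mod_cast this
        linarith
      rw [normPow_one_eq, ← mul_inv]
      refine inv_anti₀ ?_ ?_
      · exact_mod_cast one_le_norm_OE hne
      · rw [QuadraticAlgebra.norm_def]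
        push_cast
        have h3 : (cB D : ℝ) * n * (i : ℕ) ≤ |(cB D : ℝ)| * n ^ 2 := by
          calc (cB D : ℝ) * n * (i : ℕ) ≤ |(cB D : ℝ)| * n * (i : ℕ) := by
                gcongr
                exact le_abs_self _
            _ ≤ |(cB D : ℝ)| * n * n := by gcongr
            _ = _ := by ring
        have h4 : -((cA D : ℝ) * (i : ℕ) * (i : ℕ)) ≤ |(cA D : ℝ)| * n ^ 2 := by
          calc -((cA D : ℝ) * (i : ℕ) * (i : ℕ)) = (-(cA D : ℝ)) * ((i : ℕ) * (i : ℕ)) := by ring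
            _ ≤ |(cA D : ℝ)| * ((i : ℕ) * (i : ℕ)) := by
                gcongr
                exact neg_le_abs _
            _ ≤ |(cA D : ℝ)| * (n * n) := by gcongr
            _ = _ := by ring
        rw [hA]
        nlinarith
    calc A⁻¹ * (n : ℝ)⁻¹ = ∑ _i : Fin n, A⁻¹ * ((n : ℝ) ^ 2)⁻¹ := by
          rw [Finset.sum_const, Finset.card_univ, Fintype.card_fin, nsmul_eq_mul]
          by_cases hn : (n : ℝ) = 0
          · rw [hn]; simp
          · field_simp
      _ ≤ _ := Finset.sum_le_sum fun i _ => key i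
  exact Real.not_summable_natCast_inv ((summable_mul_left_iff (inv_pos.2 hA0).ne').1 h2)

/-- A bound on `(1, 2]` would pass to finite partial sums at `s = 1` by continuity. The zero element
is removed since its summand is not given by a continuous formula. -/
theorem latZ_unbounded (M : ℝ) : ∃ s ∈ Set.Ioc (1 : ℝ) 2, M < latZ D s := by
  by_contra! hcon
  refine not_summable_normPow_one (D := D) ?_
  refine summable_of_sum_le (fun x => normPow_nonneg 1 x) (c := M) fun T => ?_
  have hcont : Filter.Tendsto (fun s : ℝ => ∑ x ∈ T.filter (· ≠ 0), normPow s x)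
      (nhdsWithin 1 (Set.Ioi 1)) (nhds (∑ x ∈ T.filter (· ≠ 0), normPow 1 x)) := by
    refine tendsto_finsetSum _ fun x hx => ?_
    have hx0 := (Finset.mem_filter.1 hx).2
    have h1 : (0 : ℝ) < ((x.norm : ℤ) : ℝ) := by exact_mod_cast one_le_norm_OE hx0
    have hc : Continuous fun s : ℝ => ((x.norm : ℤ) : ℝ) ^ (-s) :=
      Real.continuous_const_rpow h1.ne' |>.comp continuous_neg
    exact (hc.tendsto 1).mono_left nhdsWithin_le_nhds
  have e : ∑ x ∈ T, normPow 1 x = ∑ x ∈ T.filter (· ≠ 0), normPow 1 x := by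
    rw [Finset.sum_filter]
    refine Finset.sum_congr rfl fun x _ => ?_
    split_ifs with h
    · rfl
    · rw [not_not.1 h, normPow_zero one_pos]
  rw [e]
  refine le_of_tendsto hcont ?_
  filter_upwards [Ioc_mem_nhdsGT (one_lt_two : (1 : ℝ) < 2)] with s hs
  exact ((summable_normPow hs.1).sum_le_tsum _ fun x _ => normPow_nonneg s x).trans (hcon s hs)

theorem tsum_idPow_unbounded (M : ℝ) : ∃ s ∈ Set.Ioc (1 : ℝ) 2,
    M < ∑' I : Ideal (OE D), idPow s I := by
  obtain ⟨C, hC⟩ := exists_abs_clsZ_sub_le (1 : ClD D)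
  set w : ℝ := ((Nat.card (OE D)ˣ : ℕ) : ℝ) with hw
  have hw0 : 0 < w := Nat.cast_pos.2 Nat.card_pos
  obtain ⟨s, hs, h⟩ := latZ_unbounded (D := D) (w * M + C)
  refine ⟨s, hs, ?_⟩
  have h1 := (abs_le.1 (hC s hs)).1
  have h2 : clsZ s (1 : ClD D) ≤ ∑' I : Ideal (OE D), idPow s I :=
    tsum_comp_le_tsum_of_inj (summable_idPow hs.1) (fun I => idPow_nonneg s I)
      Subtype.val_injective
  have h3 : w * M < w * clsZ s (1 : ClD D) := by linarith
  exact (lt_of_mul_lt_mul_left h3 hw0.le).trans_le h2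

end idealSums

/-! ### The Euler product as a sieve -/

section sieve

variable {R : Type*} [CommRing R] [IsDedekindDomain R] (f : Ideal R →*₀ ℂ)
  (hf : Summable fun I => ‖f I‖)

include hf

-- Removing the multiples of one more prime `P` multiplies the sum by `1 - f(P)`, by complete
-- multiplicativity.
open Classical in
theorem tsum_sieve (S : Finset (HeightOneSpectrum R)) :
    ∑' I, (if ∀ P ∈ S, ¬ P.asIdeal ∣ I then f I else 0) =
      (∏ P ∈ S, (1 - f P.asIdeal)) * ∑' I, f I := by
  have hsum : ∀ (p : Ideal R → Prop) [DecidablePred p], Summable fun I => if p I then f I else 0 := fun p _ =>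
    Summable.of_norm_bounded hf fun I => by
      split_ifs
      · exact le_rfl
      · rw [norm_zero]; exact norm_nonneg _
  induction S using Finset.induction_on with
  | empty => simp
  | insert P S hP ih =>
    have hPp := P.prime
    have hinj : Function.Injective fun I : Ideal R => P.asIdeal * I := fun I J e =>
      mul_left_cancel₀ hPp.ne_zero e
    have h1 : ∀ I, (if ∀ Q ∈ S, ¬ Q.asIdeal ∣ I then f I else 0) -
        (if ∀ Q ∈ insert P S, ¬ Q.asIdeal ∣ I then f I else 0) =
        if (∀ Q ∈ S, ¬ Q.asIdeal ∣ I) ∧ P.asIdeal ∣ I then f I else 0 := by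
      intro I
      simp only [Finset.forall_mem_insert]
      by_cases hS : ∀ Q ∈ S, ¬ Q.asIdeal ∣ I <;> by_cases hd : P.asIdeal ∣ I
      · rw [if_pos hS, if_neg fun h => h.1 hd, if_pos ⟨hS, hd⟩, sub_zero]
      · rw [if_pos hS, if_pos ⟨hd, hS⟩, if_neg fun h => hd h.2, sub_self]
      · rw [if_neg hS, if_neg fun h => h.1 hd, if_neg fun h => hS h.1, sub_zero]
      · rw [if_neg hS, if_neg fun h => hS h.2, if_neg fun h => hS h.1, sub_zero]
    have h2 : ∀ I, (∀ Q ∈ S, ¬ Q.asIdeal ∣ P.asIdeal * I) ↔ ∀ Q ∈ S, ¬ Q.asIdeal ∣ I := by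
      intro I
      refine forall₂_congr fun Q hQ => not_congr ?_
      constructor
      · intro h
        refine (Q.prime.dvd_or_dvd h).resolve_left fun hQP => hP ?_
        have : Q = P := by
          have h3 := Q.prime.dvd_prime_iff_associated hPp |>.1 hQP
          exact HeightOneSpectrum.ext (associated_iff_eq.1 h3)
        rwa [← this]
      · exact fun h => h.mul_left _
    have h3 : ∑' I, (if (∀ Q ∈ S, ¬ Q.asIdeal ∣ I) ∧ P.asIdeal ∣ I then f I else 0) =
        f P.asIdeal * ∑' I, (if ∀ Q ∈ S, ¬ Q.asIdeal ∣ I then f I else 0) := by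
      rw [← hinj.tsum_eq, ← tsum_mul_left]
      · refine tsum_congr fun I => ?_
        rw [mul_ite, mul_zero, ← map_mul]
        exact if_congr ⟨fun h => (h2 I).1 h.1, fun h => ⟨(h2 I).2 h, dvd_mul_right _ _⟩⟩ rfl rfl
      · intro I hI
        by_contra hn
        refine hI (if_neg ?_)
        rintro ⟨-, J, rfl⟩
        exact hn ⟨J, rfl⟩
    have h4 := (hsum fun I => ∀ Q ∈ S, ¬ Q.asIdeal ∣ I).tsum_sub
      (hsum fun I => ∀ Q ∈ insert P S, ¬ Q.asIdeal ∣ I)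
    simp only [h1] at h4
    rw [h3, ih] at h4
    rw [Finset.prod_insert hP]
    linear_combination h4

-- Every proper nonzero ideal is eventually sieved out, so only the unit ideal remains, by dominated
-- convergence.
open Classical in
theorem tendsto_prod_one_sub :
    Filter.Tendsto (fun S : Finset (HeightOneSpectrum R) =>
      (∏ P ∈ S, (1 - f P.asIdeal)) * ∑' I, f I) Filter.atTop (nhds 1) := by
  have h1 : ∑' I : Ideal R, (if I = 1 then (1 : ℂ) else 0) = 1 := by
    rw [tsum_ite_eq]
  rw [funext fun S => (tsum_sieve f hf S).symm]
  refine h1 ▸ tendsto_tsum_of_dominated_convergence hf (fun I => ?_)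
    (Filter.Eventually.of_forall fun S I => ?_)
  · refine tendsto_const_nhds.congr' ?_
    by_cases hI : I = 1
    · refine Filter.Eventually.of_forall fun S => ?_
      beta_reduce
      rw [if_pos hI, if_pos, hI, map_one]
      intro P _ h
      rw [hI] at h
      exact P.prime.not_isUnit (isUnit_of_dvd_one h)
    by_cases hI0 : I = 0
    · refine Filter.Eventually.of_forall fun S => ?_
      beta_reduce
      rw [if_neg hI, hI0, map_zero, ite_self]
    · obtain ⟨M, hM, hIM⟩ := Ideal.exists_le_maximal I (by rwa [← Ideal.one_eq_top])
      have hM0 : M ≠ ⊥ := by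
        rintro rfl
        exact hI0 (le_bot_iff.1 hIM)
      filter_upwards [Filter.eventually_ge_atTop {(⟨M, hM.isPrime, hM0⟩ : HeightOneSpectrum R)}]
        with S hS
      beta_reduce
      rw [if_neg hI, if_neg fun h => h _ (hS (Finset.mem_singleton_self _)) (Ideal.dvd_iff_le.2 hIM)]
  · split_ifs
    · exact le_rfl
    · rw [norm_zero]; exact norm_nonneg _

end sieve

/-! ### Sums over primes and a one-sided density argument -/

section primeSums

/-- Half the logarithm of `|1 - x|² = 1 - 2 Re x + |x|²`, bounded by `log u ≤ u - 1`. -/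
theorem log_norm_one_sub_le {x : ℂ} (hx : ‖x‖ < 1) :
    Real.log ‖1 - x‖ ≤ -x.re + ‖x‖ ^ 2 / 2 := by
  have hne : 0 < ‖1 - x‖ := norm_pos_iff.2 fun h => by
    rw [← sub_eq_zero.1 h, norm_one] at hx
    exact lt_irrefl _ hx
  have h1 : ‖1 - x‖ ^ 2 = 1 - 2 * x.re + ‖x‖ ^ 2 := by
    rw [← Complex.normSq_eq_norm_sq, ← Complex.normSq_eq_norm_sq, Complex.normSq_apply,
      Complex.normSq_apply]
    simp only [Complex.sub_re, Complex.sub_im, Complex.one_re, Complex.one_im]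
    ring
  have h2 := Real.log_le_sub_one_of_pos (pow_pos hne 2)
  rw [Real.log_pow, h1] at h2
  push_cast at h2
  linarith

theorem neg_log_one_sub_le {x : ℝ} (h0 : 0 ≤ x) (h : x ≤ 1 / 2) : -Real.log (1 - x) ≤ 2 * x := by
  have h1 : 0 < 1 - x := by linarith
  have h2 := Real.log_le_sub_one_of_pos (inv_pos.2 h1)
  rw [Real.log_inv] at h2
  refine h2.trans ?_
  rw [sub_le_iff_le_add, inv_le_iff_one_le_mul₀ h1]
  nlinarith

section dedekind

variable {R : Type*} [CommRing R] [IsDedekindDomain R] (f : Ideal R →*₀ ℂ)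
  (hf : Summable fun I => ‖f I‖) (hlt : ∀ P : HeightOneSpectrum R, ‖f P.asIdeal‖ ≤ 1 / 2)

theorem asIdeal_injective : Function.Injective (asIdeal : HeightOneSpectrum R → Ideal R) :=
  fun _ _ h => HeightOneSpectrum.ext h

include hf hlt

theorem tsum_ne_zero_of_summable : 0 < ‖∑' I, f I‖ := by
  refine norm_pos_iff.2 fun h => ?_
  have := tendsto_prod_one_sub f hf
  rw [h] at this
  simp only [mul_zero] at this
  exact zero_ne_one (tendsto_nhds_unique tendsto_const_nhds this)

theorem summable_re_prime : Summable fun P : HeightOneSpectrum R => (f P.asIdeal).re :=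
  Summable.of_norm_bounded (hf.comp_injective asIdeal_injective) fun _ => Complex.abs_re_le_norm _

/-- Logarithm of the sieved product, which eventually exceeds `1/2` in absolute value. Only this
direction is needed for nontrivial characters: boundedness of the `L`-series gives it without
nonvanishing at `s = 1`. -/
theorem tsum_re_prime_le : ∑' P : HeightOneSpectrum R, (f P.asIdeal).re ≤
    Real.log 2 + Real.log ‖∑' I, f I‖ + ∑' P : HeightOneSpectrum R, ‖f P.asIdeal‖ ^ 2 / 2 := by
  have hF := tsum_ne_zero_of_summable f hf hlt
  have hpos : ∀ P : HeightOneSpectrum R, 0 < ‖1 - f P.asIdeal‖ := fun P => by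
    refine norm_pos_iff.2 fun h => ?_
    have := hlt P
    rw [← sub_eq_zero.1 h, norm_one] at this
    norm_num at this
  have hsq : Summable fun P : HeightOneSpectrum R => ‖f P.asIdeal‖ ^ 2 / 2 :=
    Summable.of_nonneg_of_le (fun P => by positivity) (fun P => by
      have := hlt P
      have := norm_nonneg (f P.asIdeal)
      change _ ≤ ‖f P.asIdeal‖
      nlinarith) (hf.comp_injective asIdeal_injective)
  have hre := summable_re_prime f hf hlt
  have ht := (tendsto_prod_one_sub f hf).norm
  rw [norm_one] at ht
  refine le_of_tendsto hre.hasSum ?_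
  filter_upwards [ht.eventually (lt_mem_nhds (by norm_num : (1 / 2 : ℝ) < 1))] with S hS
  rw [norm_mul, norm_prod] at hS
  have h1 := Real.log_lt_log (by norm_num) hS
  rw [Real.log_mul (Finset.prod_ne_zero_iff.2 fun P _ => (hpos P).ne') hF.ne',
    Real.log_prod fun P _ => (hpos P).ne', one_div, Real.log_inv] at h1
  have h2 : ∑ P ∈ S, Real.log ‖1 - f P.asIdeal‖ ≤
      ∑ P ∈ S, (-(f P.asIdeal).re + ‖f P.asIdeal‖ ^ 2 / 2) :=
    Finset.sum_le_sum fun P _ => log_norm_one_sub_le ((hlt P).trans_lt (by norm_num))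
  rw [Finset.sum_add_distrib, Finset.sum_neg_distrib] at h2
  have h3 := hsq.sum_le_tsum S fun P _ => by positivity
  linarith

/-- The reverse direction, from a sieved product below `2`; it transfers unboundedness of the zeta
sum to the primes. -/
theorem log_norm_tsum_le : Real.log ‖∑' I, f I‖ ≤
    Real.log 2 + ∑' P : HeightOneSpectrum R, 2 * ‖f P.asIdeal‖ := by
  have hF := tsum_ne_zero_of_summable f hf hlt
  have hpos : ∀ P : HeightOneSpectrum R, 0 < 1 - ‖f P.asIdeal‖ := fun P => by
    have := hlt P
    linarith
  have hle : ∀ P : HeightOneSpectrum R, 1 - ‖f P.asIdeal‖ ≤ ‖1 - f P.asIdeal‖ := fun P => by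
    have := norm_sub_norm_le 1 (f P.asIdeal)
    rwa [norm_one] at this
  have ht := (tendsto_prod_one_sub f hf).norm
  rw [norm_one] at ht
  obtain ⟨S, hS⟩ := (ht.eventually (gt_mem_nhds (by norm_num : (1 : ℝ) < 2))).exists
  rw [norm_mul, norm_prod] at hS
  have h0 : (∏ P ∈ S, (1 - ‖f P.asIdeal‖)) * ‖∑' I, f I‖ ≤ 2 :=
    (mul_le_mul_of_nonneg_right (Finset.prod_le_prod (fun P _ => (hpos P).le) fun P _ => hle P)
      hF.le).trans hS.le
  have h1 := Real.log_le_log (mul_pos (Finset.prod_pos fun P _ => hpos P) hF) h0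
  rw [Real.log_mul (Finset.prod_ne_zero_iff.2 fun P _ => (hpos P).ne') hF.ne',
    Real.log_prod fun P _ => (hpos P).ne'] at h1
  have h2 : ∑ P ∈ S, -Real.log (1 - ‖f P.asIdeal‖) ≤ ∑ P ∈ S, 2 * ‖f P.asIdeal‖ :=
    Finset.sum_le_sum fun P _ => neg_log_one_sub_le (norm_nonneg _) (hlt P)
  rw [Finset.sum_neg_distrib] at h2
  have h3 := ((hf.comp_injective asIdeal_injective).mul_left 2).sum_le_tsum S fun P _ =>
    mul_nonneg zero_le_two (norm_nonneg _)
  have h4 : ∑ P ∈ S, 2 * ‖f P.asIdeal‖ ≤ ∑' P : HeightOneSpectrum R, 2 * ‖f P.asIdeal‖ := h3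
  linarith

end dedekind

variable {D : ℤ} [ImagDisc D]

/-- The sum of `Re ψ(P) N(P)⁻ˢ` over the nonzero primes. -/
def primeSum (ψ : ClDual D) (s : ℝ) : ℝ :=
  ∑' P : HeightOneSpectrum (OE D), (ev ψ (idCls P.asIdeal)).re * idPow s P.asIdeal

theorem two_le_absNorm (P : HeightOneSpectrum (OE D)) : 2 ≤ Ideal.absNorm P.asIdeal := by
  have h0 := absNorm_pos P.ne_bot
  have h1 : Ideal.absNorm P.asIdeal ≠ 1 := fun h => P.isPrime.ne_top (Ideal.absNorm_eq_one_iff.1 h)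
  omega

theorem idPow_prime_le {s : ℝ} (hs : 1 < s) (P : HeightOneSpectrum (OE D)) :
    idPow s P.asIdeal ≤ 1 / 2 := by
  have h2 : (2 : ℝ) ≤ Ideal.absNorm P.asIdeal := by exact_mod_cast two_le_absNorm P
  calc idPow s P.asIdeal ≤ (Ideal.absNorm P.asIdeal : ℝ) ^ (-1 : ℝ) :=
        Real.rpow_le_rpow_of_exponent_le (by linarith) (by linarith)
    _ = (Ideal.absNorm P.asIdeal : ℝ)⁻¹ := Real.rpow_neg_one _
    _ ≤ 1 / 2 := by rw [one_div]; exact inv_anti₀ two_pos h2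

theorem summable_idPow_prime {s : ℝ} (hs : 1 < s) :
    Summable fun P : HeightOneSpectrum (OE D) => idPow s P.asIdeal :=
  (summable_idPow hs).comp_injective asIdeal_injective

theorem summable_norm_idChar (ψ : ClDual D) {s : ℝ} (hs : 1 < s) (hs0 : 0 < s) :
    Summable fun I => ‖idChar ψ hs0 I‖ := by
  simp only [norm_idChar]
  exact summable_idPow hs

theorem re_idChar (ψ : ClDual D) {s : ℝ} (hs : 0 < s) (I : Ideal (OE D)) :
    (idChar ψ hs I).re = (ev ψ (idCls I)).re * idPow s I := by
  rw [idChar_apply, Complex.re_mul_ofReal]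

theorem summable_primeSum (ψ : ClDual D) {s : ℝ} (hs : 1 < s) :
    Summable fun P : HeightOneSpectrum (OE D) =>
      (ev ψ (idCls P.asIdeal)).re * idPow s P.asIdeal := by
  have hs0 : 0 < s := by linarith
  have := summable_re_prime (idChar ψ hs0) (summable_norm_idChar ψ hs hs0) fun P => by
    rw [norm_idChar]; exact idPow_prime_le hs P
  simpa only [re_idChar] using this

theorem exists_primeSum_le {ψ : ClDual D} (hψ : ψ ≠ 1) : ∃ C : ℝ, ∀ s ∈ Set.Ioc (1 : ℝ) 2,
    primeSum ψ s ≤ C := by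
  obtain ⟨C, hC⟩ := exists_norm_tsum_idChar_le hψ
  have hsum2 : Summable fun P : HeightOneSpectrum (OE D) => idPow 2 P.asIdeal :=
    summable_idPow_prime one_lt_two
  refine ⟨Real.log 2 + Real.log C + ∑' P : HeightOneSpectrum (OE D), idPow 2 P.asIdeal,
    fun s hs => ?_⟩
  have hs0 : 0 < s := by linarith [hs.1]
  have hlt : ∀ P : HeightOneSpectrum (OE D), ‖idChar ψ hs0 P.asIdeal‖ ≤ 1 / 2 := fun P => by
    rw [norm_idChar]; exact idPow_prime_le hs.1 P
  have hsum := summable_norm_idChar ψ hs.1 hs0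
  have h1 := tsum_re_prime_le (idChar ψ hs0) hsum hlt
  simp only [re_idChar, norm_idChar] at h1
  have h2 : Real.log ‖∑' I, idChar ψ hs0 I‖ ≤ Real.log C :=
    Real.log_le_log (tsum_ne_zero_of_summable _ hsum hlt) (hC s hs hs0)
  have hsq : ∀ P : HeightOneSpectrum (OE D), idPow s P.asIdeal ^ 2 / 2 ≤ idPow 2 P.asIdeal := by
    intro P
    have hN : (1 : ℝ) ≤ Ideal.absNorm P.asIdeal := by
      exact_mod_cast (one_le_two.trans (two_le_absNorm P))
    have h3 : idPow s P.asIdeal ^ 2 ≤ idPow 2 P.asIdeal := by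
      rw [idPow, ← Real.rpow_natCast, ← Real.rpow_mul (by linarith)]
      refine Real.rpow_le_rpow_of_exponent_le hN ?_
      push_cast
      linarith [hs.1]
    have := idPow_nonneg 2 P.asIdeal
    linarith
  have h4 : ∑' P : HeightOneSpectrum (OE D), idPow s P.asIdeal ^ 2 / 2 ≤
      ∑' P : HeightOneSpectrum (OE D), idPow 2 P.asIdeal :=
    Summable.tsum_le_tsum hsq
      (Summable.of_nonneg_of_le (fun P => by positivity) hsq hsum2) hsum2
  rw [primeSum]
  linarith

theorem primeSum_one (s : ℝ) : primeSum (1 : ClDual D) s =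
    ∑' P : HeightOneSpectrum (OE D), idPow s P.asIdeal :=
  tsum_congr fun P => by rw [ev_one_char, Complex.one_re, one_mul]

theorem primeSum_one_unbounded (M : ℝ) : ∃ s ∈ Set.Ioc (1 : ℝ) 2, M < primeSum (1 : ClDual D) s := by
  obtain ⟨s, hs, h⟩ := tsum_idPow_unbounded (D := D) (Real.exp (Real.log 2 + 2 * M))
  refine ⟨s, hs, ?_⟩
  have hs0 : 0 < s := by linarith [hs.1]
  have hlt : ∀ P : HeightOneSpectrum (OE D), ‖idChar (1 : ClDual D) hs0 P.asIdeal‖ ≤ 1 / 2 :=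
    fun P => by rw [norm_idChar]; exact idPow_prime_le hs.1 P
  have h1 := log_norm_tsum_le (idChar (1 : ClDual D) hs0)
    (summable_norm_idChar (1 : ClDual D) hs.1 hs0) hlt
  have e : ∑' I, idChar (1 : ClDual D) hs0 I = ((∑' I : Ideal (OE D), idPow s I : ℝ) : ℂ) := by
    rw [Complex.ofReal_tsum]
    exact tsum_congr fun I => by rw [idChar_apply, ev_one_char, one_mul]
  have hpos : 0 < ∑' I : Ideal (OE D), idPow s I := (Real.exp_pos _).trans h
  rw [e, Complex.norm_real, Real.norm_of_nonneg hpos.le] at h1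
  have h2 := Real.log_lt_log (Real.exp_pos _) h
  rw [Real.log_exp] at h2
  simp only [norm_idChar] at h1
  rw [tsum_mul_left, ← primeSum_one] at h1
  linarith

/-- A family of characters cannot satisfy a pointwise inequality whose average fails. -/
theorem not_forall_prime_le {ι : Type*} (T : Finset ι) (ψ : ι → ClDual D) (a : ι → ℝ)
    (ha : ∀ i ∈ T, 0 ≤ a i) (hψ : ∀ i ∈ T, ψ i ≠ 1) {c : ℝ} (hc : 0 < c)
    (B : Set (HeightOneSpectrum (OE D))) (hB : B.Finite)
    (h : ∀ P ∉ B, c ≤ ∑ i ∈ T, a i * (ev (ψ i) (idCls P.asIdeal)).re) : False := by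
  classical
  choose! C hC using fun i (hi : i ∈ T) => exists_primeSum_le (hψ i hi)
  -- At an exceptional prime the combination is at least `-∑ a_i`, so `A` compensates the defect.
  set A : ℝ := c + ∑ i ∈ T, a i with hA
  obtain ⟨s, hs, hM⟩ := primeSum_one_unbounded (D := D)
    ((∑ i ∈ T, a i * C i + ∑ _P ∈ hB.toFinset, A) / c)
  have hle : ∀ P : HeightOneSpectrum (OE D), c * idPow s P.asIdeal ≤
      ∑ i ∈ T, a i * ((ev (ψ i) (idCls P.asIdeal)).re * idPow s P.asIdeal) +
        if P ∈ hB.toFinset then A else 0 := by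
    intro P
    have hp0 := idPow_nonneg s P.asIdeal
    have hp1 := idPow_prime_le hs.1 P
    have e : ∑ i ∈ T, a i * ((ev (ψ i) (idCls P.asIdeal)).re * idPow s P.asIdeal) =
        (∑ i ∈ T, a i * (ev (ψ i) (idCls P.asIdeal)).re) * idPow s P.asIdeal := by
      rw [Finset.sum_mul]
      exact Finset.sum_congr rfl fun i _ => by ring
    rw [e]
    by_cases hP : P ∈ B
    · rw [if_pos (hB.mem_toFinset.2 hP)]
      have h1 : -∑ i ∈ T, a i ≤ ∑ i ∈ T, a i * (ev (ψ i) (idCls P.asIdeal)).re := by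
        rw [← Finset.sum_neg_distrib]
        refine Finset.sum_le_sum fun i hi => ?_
        have h2 := Complex.abs_re_le_norm (ev (ψ i) (idCls P.asIdeal))
        rw [norm_ev] at h2
        have := (abs_le.1 h2).1
        nlinarith [ha i hi]
      have h3 : 0 ≤ ∑ i ∈ T, a i := Finset.sum_nonneg ha
      rw [hA]
      nlinarith
    · rw [if_neg fun h' => hP (hB.mem_toFinset.1 h'), add_zero]
      exact mul_le_mul_of_nonneg_right (h P hP) hp0
  have hs1 : ∀ i ∈ T, Summable fun P : HeightOneSpectrum (OE D) =>
      a i * ((ev (ψ i) (idCls P.asIdeal)).re * idPow s P.asIdeal) := fun i _ =>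
    (summable_primeSum (ψ i) hs.1).mul_left _
  have hs2 : Summable fun P : HeightOneSpectrum (OE D) => if P ∈ hB.toFinset then A else 0 :=
    summable_of_ne_finset_zero (s := hB.toFinset) fun P hP => if_neg hP
  have h5 := Summable.tsum_le_tsum hle ((summable_idPow_prime hs.1).mul_left c)
    ((summable_sum hs1).add hs2)
  rw [tsum_mul_left, ← primeSum_one, (summable_sum hs1).tsum_add hs2, Summable.tsum_finsetSum hs1]
    at h5
  have h6 : ∑ i ∈ T, ∑' P : HeightOneSpectrum (OE D),
      a i * ((ev (ψ i) (idCls P.asIdeal)).re * idPow s P.asIdeal) ≤ ∑ i ∈ T, a i * C i := by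
    refine Finset.sum_le_sum fun i hi => ?_
    rw [tsum_mul_left]
    exact mul_le_mul_of_nonneg_left (hC i hi s hs) (ha i hi)
  have h7 : ∑' P : HeightOneSpectrum (OE D), (if P ∈ hB.toFinset then A else 0) =
      ∑ _P ∈ hB.toFinset, A := by
    rw [tsum_eq_sum (s := hB.toFinset) fun P hP => if_neg hP]
    exact Finset.sum_congr rfl fun P hP => if_pos hP
  rw [h7] at h5
  rw [div_lt_iff₀ hc] at hM
  linarith

end primeSums

/-! ### Norm forms and characters of order two -/

section genus

/-- Pigeonhole: with `n = pql` there are `nd` residue classes, while the box of side lengths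
`√(nd)`, `√n`, `√d` contains more than `nd` points. The solution is a difference of two of them. -/
theorem exists_small_congruence_solution {p q l d : ℕ} (hp : 0 < p) (hq : 0 < q) (hl : 0 < l)
    (hd : 0 < d) (s t u w : ℤ) : ∃ x y z : ℤ, ¬ (x = 0 ∧ y = 0 ∧ z = 0) ∧
      x ^ 2 ≤ (p * q * l : ℕ) * d ∧ y ^ 2 ≤ (p * q * l : ℕ) ∧ z ^ 2 ≤ d ∧
      (p : ℤ) ∣ x - s * y ∧ (q : ℤ) ∣ x - t * y ∧ (l : ℤ) ∣ x - u * y ∧ (d : ℤ) ∣ x - w * z := by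
  set n : ℕ := p * q * l with hn
  have hn0 : 0 < n := by positivity
  have : NeZero p := ⟨hp.ne'⟩
  have : NeZero q := ⟨hq.ne'⟩
  have : NeZero l := ⟨hl.ne'⟩
  have : NeZero d := ⟨hd.ne'⟩
  let f : ℕ × ℕ × ℕ → ZMod p × ZMod q × ZMod l × ZMod d := fun i =>
    (((i.1 - s * i.2.1 : ℤ) : ZMod p), ((i.1 - t * i.2.1 : ℤ) : ZMod q),
      ((i.1 - u * i.2.1 : ℤ) : ZMod l), ((i.1 - w * i.2.2 : ℤ) : ZMod d))
  let S : Finset (ℕ × ℕ × ℕ) := Finset.range (Nat.sqrt (n * d) + 1) ×ˢ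
    Finset.range (Nat.sqrt n + 1) ×ˢ Finset.range (Nat.sqrt d + 1)
  have hcard : (Finset.univ : Finset (ZMod p × ZMod q × ZMod l × ZMod d)).card < S.card := by
    simp only [S, Finset.card_univ, Fintype.card_prod, ZMod.card, Finset.card_product,
      Finset.card_range]
    have h1 := Nat.lt_succ_sqrt (n * d)
    have h2 := Nat.lt_succ_sqrt n
    have h3 := Nat.lt_succ_sqrt d
    have h4 := Nat.mul_lt_mul_of_lt_of_le h1 (Nat.mul_le_mul h2.le h3.le) (by positivity)
    refine Nat.mul_self_lt_mul_self_iff.1 (lt_of_eq_of_lt ?_ (h4.trans_eq ?_))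
    · rw [hn]; ring
    · simp only [Nat.succ_eq_add_one]; ring
  obtain ⟨i, hi, j, hj, hij, hf⟩ := Finset.exists_ne_map_eq_of_card_lt_of_maps_to hcard
    (f := f) fun a _ => Finset.mem_univ _
  obtain ⟨i1, i2, i3⟩ := i
  obtain ⟨j1, j2, j3⟩ := j
  simp only [S, Finset.mem_product, Finset.mem_range, Nat.lt_succ_iff] at hi hj
  simp only [f, Prod.mk.injEq, ZMod.intCast_eq_intCast_iff_dvd_sub] at hf
  have sq_le : ∀ {m x y : ℕ}, x ≤ Nat.sqrt m → y ≤ Nat.sqrt m → ((y : ℤ) - x) ^ 2 ≤ m := by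
    intro m x y hx hy
    have hx' : x * x ≤ m := Nat.le_sqrt.1 hx
    have hy' : y * y ≤ m := Nat.le_sqrt.1 hy
    zify at hx' hy'
    rcases le_total x y with h | h
    · have := mul_le_mul_of_nonneg_left (Int.ofNat_le.2 h) (Int.natCast_nonneg x)
      nlinarith
    · have := mul_le_mul_of_nonneg_left (Int.ofNat_le.2 h) (Int.natCast_nonneg y)
      nlinarith
  refine ⟨j1 - i1, j2 - i2, j3 - i3, ?_, by exact_mod_cast sq_le hi.1 hj.1,
    sq_le hi.2.1 hj.2.1, sq_le hi.2.2 hj.2.2, ?_, ?_, ?_, ?_⟩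
  · rintro ⟨e1, e2, e3⟩
    refine hij ?_
    rw [Prod.mk.injEq, Prod.mk.injEq]
    omega
  · exact hf.1.trans (dvd_of_eq (by ring))
  · exact hf.2.1.trans (dvd_of_eq (by ring))
  · exact hf.2.2.1.trans (dvd_of_eq (by ring))
  · exact hf.2.2.2.trans (dvd_of_eq (by ring))

theorem isCoprime_of_prime_ne {p q : ℕ} (hp : p.Prime) (hq : q.Prime) (h : p ≠ q) :
    IsCoprime (p : ℤ) q :=
  Nat.isCoprime_iff_coprime.2 ((Nat.coprime_primes hp hq).2 h)

/-- A norm form takes the values of the ternary form up to the factor `p q l`. -/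
theorem exists_norm_form_eq {D : ℤ} {d : ℕ} (hd : D = -(d : ℤ)) (hd2 : 2 ≤ d) {p q l : ℕ}
    (hp : p.Prime) (hq : q.Prime) (hl : l.Prime) (hpq : p ≠ q) (hpl : p ≠ l) (hql : q ≠ l)
    (hpD : IsCoprime (p : ℤ) D) (hqD : IsCoprime (q : ℤ) D) (hlD : IsCoprime (l : ℤ) D)
    (h : D ∣ p * q - l) {s t u : ℤ}
    (hs : (p : ℤ) ∣ s ^ 2 - D) (ht : (q : ℤ) ∣ t ^ 2 - D) (hu : (l : ℤ) ∣ u ^ 2 - D) :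
    ∃ x y z w : ℤ, x ^ 2 - D * y ^ 2 = (p * q * l : ℤ) * (z ^ 2 - D * w ^ 2) ∧
      0 < z ^ 2 - D * w ^ 2 := by
  obtain ⟨X, Y, Z, hne, hX, hY, hZ, f1, f2, f3, f4⟩ := exists_small_congruence_solution hp.pos
    hq.pos hl.pos (by omega : 0 < d) s t u (p * q)
  have hnZ : ((p * q * l : ℕ) : ℤ) = p * q * l := by push_cast; ring
  rw [hnZ] at hX hY
  have hp0 : (0 : ℤ) < p := by exact_mod_cast hp.pos
  have hq0 : (0 : ℤ) < q := by exact_mod_cast hq.pos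
  have hl0 : (0 : ℤ) < l := by exact_mod_cast hl.pos
  have hdiv : (p * q * l : ℤ) * D ∣ X ^ 2 - D * Y ^ 2 - (p * q * l : ℤ) * Z ^ 2 := by
    -- Modulo each of the three primes `X ≡ sY` with `s² ≡ D`, so `X² - DY²` vanishes.
    have key : ∀ {m s : ℤ}, m ∣ X - s * Y → m ∣ s ^ 2 - D → m ∣ p * q * l →
        m ∣ X ^ 2 - D * Y ^ 2 - (p * q * l : ℤ) * Z ^ 2 := by
      intro m s h1 h2 h3
      have e : X ^ 2 - D * Y ^ 2 - (p * q * l : ℤ) * Z ^ 2 =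
          (X - s * Y) * (X + s * Y) + (s ^ 2 - D) * Y ^ 2 - p * q * l * Z ^ 2 := by ring
      rw [e]
      exact dvd_sub (dvd_add (h1.mul_right _) (h2.mul_right _)) (h3.mul_right _)
    refine IsCoprime.mul_dvd ((hpD.mul_left hqD).mul_left hlD) ?_ ?_
    · exact IsCoprime.mul_dvd ((isCoprime_of_prime_ne hp hl hpl).mul_left
        (isCoprime_of_prime_ne hq hl hql))
        (IsCoprime.mul_dvd (isCoprime_of_prime_ne hp hq hpq) (key f1 hs ⟨q * l, by ring⟩)
          (key f2 ht ⟨p * l, by ring⟩)) (key f3 hu ⟨p * q, by ring⟩)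
    -- Modulo `D` one has `X ≡ pqZ` and `pq ≡ l`, so `X² ≡ pql Z²`.
    · have e : X ^ 2 - D * Y ^ 2 - (p * q * l : ℤ) * Z ^ 2 = (X - p * q * Z) * (X + p * q * Z) -
          D * Y ^ 2 + (p * q - l) * (p * q * Z ^ 2) := by ring
      rw [e]
      refine dvd_add (dvd_sub (Dvd.dvd.mul_right ?_ _) (dvd_mul_right _ _)) (h.mul_right _)
      rw [hd, neg_dvd]
      exact f4
  obtain ⟨n, hn⟩ : ∃ n : ℤ, n = p * q * l := ⟨_, rfl⟩
  rw [← hn] at hX hY hdiv ⊢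
  obtain ⟨k, hk⟩ := hdiv
  have hn0 : 0 < n := by rw [hn]; positivity
  have hd0 : (2 : ℤ) ≤ d := by exact_mod_cast hd2
  have hm : 0 < n * d := by positivity
  have hk' : X ^ 2 + d * Y ^ 2 - n * Z ^ 2 = -k * (n * d) := by
    rw [hd] at hk
    linear_combination hk
  have hdY : (d : ℤ) * Y ^ 2 ≤ n * d := by nlinarith only [hY, hd0]
  have hnZ2 : n * Z ^ 2 ≤ n * d := mul_le_mul_of_nonneg_left hZ hn0.le
  have hdY0 : 0 ≤ (d : ℤ) * Y ^ 2 := by positivity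
  have hnZ0 : 0 ≤ n * Z ^ 2 := by positivity
  have hX0 := sq_nonneg X
  have hk1 : k ≤ 1 := by
    by_contra hc
    have : 2 ≤ k := by omega
    nlinarith only [this, hm, hk', hX0, hdY0, hnZ2]
  have hk2 : -2 ≤ k := by
    by_contra hc
    have : k ≤ -3 := by omega
    nlinarith only [this, hm, hk', hX, hdY, hnZ0]
  -- With `X² + dY² - nZ² = -k n d`, the size bounds leave `k` from `-2` to `1`. The extreme values
  -- force equality in the bounds: `k = -2` gives `Y² = n`, impossible for three distinct primes,
  -- and `k = 1` gives `X = Y = 0`, `Z² = d`, impossible as `D ∣ Z`. The values `-1` and `0` give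
  -- the solutions with `w = 1` and `w = 0`.
  interval_cases k
  · exfalso
    have e : (d : ℤ) * (Y ^ 2 - n) = 0 := by linarith
    have e1 : Y ^ 2 = n := by
      rcases mul_eq_zero.1 e with e | e <;> omega
    obtain ⟨y, hy⟩ : (p : ℤ) ∣ Y := (Nat.prime_iff_prime_int.1 hp).dvd_of_dvd_pow (n := 2) (by
      rw [e1, hn]
      exact ⟨q * l, by ring⟩)
    have e3 : (p : ℤ) ∣ q * l := by
      refine ⟨y ^ 2, mul_left_cancel₀ hp0.ne' ?_⟩
      rw [hy, hn] at e1
      linear_combination -e1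
    rcases (Nat.prime_iff_prime_int.1 hp).dvd_or_dvd e3 with e4 | e4
    · exact hpq ((Nat.prime_dvd_prime_iff_eq hp hq).1 (Int.natCast_dvd_natCast.1 e4))
    · exact hpl ((Nat.prime_dvd_prime_iff_eq hp hl).1 (Int.natCast_dvd_natCast.1 e4))
  · refine ⟨X, Y, Z, 1, ?_, ?_⟩
    · rw [hd]
      linear_combination hk'
    · have := sq_nonneg Z
      rw [hd]
      linarith
  · refine ⟨X, Y, Z, 0, ?_, ?_⟩
    · rw [hd]
      linear_combination hk'
    · have : Z ≠ 0 := by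
        intro hZ0
        rw [hZ0] at hk'
        have e1 : X ^ 2 = 0 := by linarith
        have e2 : (d : ℤ) * Y ^ 2 = 0 := by linarith
        refine hne ⟨pow_eq_zero_iff two_ne_zero |>.1 e1, ?_, hZ0⟩
        rcases mul_eq_zero.1 e2 with e | e
        · omega
        · exact pow_eq_zero_iff two_ne_zero |>.1 e
      have : 0 < Z ^ 2 := by positivity
      linarith
  · exfalso
    have e1 : X ^ 2 = 0 := by linarith
    have e2 : n * (d - Z ^ 2) = 0 := by linarith
    have e3 : Z ^ 2 = d := by
      rcases mul_eq_zero.1 e2 with e | e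
      · exact absurd e hn0.ne'
      · linarith
    have e4 : X = 0 := pow_eq_zero_iff two_ne_zero |>.1 e1
    have e5 : D ∣ p * q * Z := by
      rw [e4, zero_sub, dvd_neg] at f4
      rwa [hd, neg_dvd]
    have e7 : D ∣ Z := (hpD.mul_left hqD).symm.dvd_of_dvd_mul_left e5
    have e8 : D * D ∣ d := by
      rw [← e3, sq]
      exact mul_dvd_mul e7 e7
    have := Int.le_of_dvd (by omega) e8
    rw [hd] at this
    nlinarith only [this, hd0]

variable {D : ℤ} [ImagDisc D]

theorem ev_mul_self_of_sq {γ : ClDual D} (hγ : γ ^ 2 = 1) (c : ClD D) : ev γ c * ev γ c = 1 := by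
  rw [← ev_mul_char, ← hom_sq, hγ, ev_one_char]

theorem ev_inv_of_sq {γ : ClDual D} (hγ : γ ^ 2 = 1) (c : ClD D) : (ev γ c)⁻¹ = ev γ c :=
  inv_eq_of_mul_eq_one_left (ev_mul_self_of_sq hγ c)

theorem ev_locCls_piU_eq {γ : ClDual D} (hγ : γ ^ 2 = 1) {v : Pl} {r r' : ℤ} (hr : IsRootAt D v r)
    (hr' : IsRootAt D v r') :
    ev γ (locCls v (piU D r (Qv v))) = ev γ (locCls v (piU D r' (Qv v))) := by
  rw [← idCls_ker_redAt hr']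
  rcases eq_ker_redAt hr (ker_redAt_isMaximal hr').isPrime (comap_ker_redAt hr') with e | e
  · rw [e, idCls_ker_redAt]
  · rw [e, idCls_ker_redAt, locCls_piU_conj, ev_inv, ev_inv_of_sq hγ]

open Classical in
/-- The value of a character of order two on the primes of norm `p`. -/
def genusVal (γ : ClDual D) (p : ℕ) : ℂ :=
  if h : ∃ (v : Pl) (r : ℤ), IsRootAt D v r ∧ resChar v = p then
    ev γ (locCls h.choose (piU D h.choose_spec.choose (Qv h.choose))) else 1

theorem genusVal_resChar {γ : ClDual D} (hγ : γ ^ 2 = 1) {v : Pl} {r : ℤ} (hr : IsRootAt D v r) :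
    genusVal γ (resChar v) = ev γ (locCls v (piU D r (Qv v))) := by
  have h : ∃ (w : Pl) (r : ℤ), IsRootAt D w r ∧ resChar w = resChar v := ⟨v, r, hr, rfl⟩
  rw [genusVal, dif_pos h]
  have h1 := h.choose_spec.choose_spec
  revert h1
  generalize h.choose_spec.choose = r'
  generalize h.choose = w
  rintro ⟨hr', hw⟩
  obtain rfl := resChar_injective hw
  exact ev_locCls_piU_eq hγ hr' hr

theorem genusVal_mul_self {γ : ClDual D} (hγ : γ ^ 2 = 1) (p : ℕ) :
    genusVal γ p * genusVal γ p = 1 := by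
  rw [genusVal]
  split_ifs
  · exact ev_mul_self_of_sq hγ _
  · exact one_mul 1

/-- The completely multiplicative extension of `genusVal`. -/
def genusFun (γ : ClDual D) (n : ℕ) : ℂ := n.factorization.prod fun p k => genusVal γ p ^ k

theorem genusFun_mul (γ : ClDual D) {m n : ℕ} (hm : m ≠ 0) (hn : n ≠ 0) :
    genusFun γ (m * n) = genusFun γ m * genusFun γ n := by
  rw [genusFun, Nat.factorization_mul hm hn]
  exact Finsupp.prod_add_index' (fun _ => pow_zero _) fun _ _ _ => pow_add _ _ _

theorem genusFun_prime (γ : ClDual D) {p : ℕ} (hp : p.Prime) : genusFun γ p = genusVal γ p := by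
  rw [genusFun, hp.factorization]
  exact (Finsupp.prod_single_index (h := fun p k => genusVal γ p ^ k) (pow_zero _)).trans
    (pow_one (genusVal γ p))

theorem absNorm_ker_redAt {v : Pl} {r : ℤ} (hr : IsRootAt D v r) :
    Ideal.absNorm (RingHom.ker (redAt hr)) = resChar v := by
  rw [Ideal.absNorm_apply, Submodule.cardQuot_apply]
  exact card_quot_ker_redAt hr

theorem absNorm_ker_redInert (v : Pl) :
    Ideal.absNorm (RingHom.ker (redInert D v)) = resChar v ^ 2 := by
  rw [Ideal.absNorm_apply, Submodule.cardQuot_apply]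
  exact card_quot_ker_redInert

/-- Both sides are multiplicative, so it suffices to treat primes. Split and ramified primes have
norm `p`, and conjugate primes share the value; inert primes have trivial class and norm `p²`, where
the value squares to `1`. -/
theorem genusFun_absNorm {γ : ClDual D} (hγ : γ ^ 2 = 1) {I : Ideal (OE D)} (hI : I ≠ ⊥) :
    genusFun γ (Ideal.absNorm I) = ev γ (idCls I) := by
  induction I using UniqueFactorizationMonoid.induction_on_prime with
  | h₁ => exact absurd rfl hI
  | h₂ I h =>
    rw [Ideal.isUnit_iff.1 h, idCls_top, ev_one, Ideal.absNorm_top, genusFun,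
      Nat.factorization_one, Finsupp.prod_zero_index]
  | h₃ I P hI0 hP ih =>
    have hI1 : I ≠ ⊥ := hI0
    have hP1 : P ≠ ⊥ := hP.ne_zero
    rw [map_mul, genusFun_mul γ (absNorm_pos hP1).ne' (absNorm_pos hI1).ne', ih hI1,
      idCls_mul hP1 hI1, ev_mul]
    congr 1
    rcases isPrime_cases (Ideal.isPrime_of_prime hP) hP1 with ⟨v, r, hr, rfl⟩ | ⟨v, -, rfl⟩
    · rw [absNorm_ker_redAt, genusFun_prime γ (resChar_prime v), genusVal_resChar hγ hr,
        idCls_ker_redAt]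
    · rw [absNorm_ker_redInert, sq, genusFun_mul γ (resChar_prime v).ne_zero
        (resChar_prime v).ne_zero, genusFun_prime γ (resChar_prime v), genusVal_mul_self hγ,
        idCls_ker_redInert, ev_one]

/-- The values of a character of order two only depend on the norm. -/
theorem ev_idCls_eq_of_absNorm_eq {γ : ClDual D} (hγ : γ ^ 2 = 1) {I J : Ideal (OE D)} (hI : I ≠ ⊥)
    (hJ : J ≠ ⊥) (h : Ideal.absNorm I = Ideal.absNorm J) : ev γ (idCls I) = ev γ (idCls J) := by
  rw [← genusFun_absNorm hγ hI, h, genusFun_absNorm hγ hJ]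

end genus

/-! ### Primes at which two characters are nontrivial -/

section separation

variable {D : ℤ} [ImagDisc D]

theorem norm_sqD (x y : ℤ) :
    QuadraticAlgebra.norm (⟨x - cB D * y, 2 * y⟩ : OE D) = x ^ 2 - D * y ^ 2 := by
  rw [QuadraticAlgebra.norm_def]
  simp only [Int.cast_id]
  linear_combination -(y ^ 2) * cB_sq D

theorem ker_redAt_ne_bot {v : Pl} {r : ℤ} (hr : IsRootAt D v r) : RingHom.ker (redAt hr) ≠ ⊥ :=
  ne_bot_of_comap (comap_ker_redAt hr)

theorem dvd_sq_sub {v : Pl} {r : ℤ} (hr : IsRootAt D v r) :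
    (resChar v : ℤ) ∣ (2 * r - cB D) ^ 2 - D := by
  rw [← four_mul_nf]
  exact hr.1.mul_left 4

theorem not_dvd_of_not_dvd_disc {v : Pl} {r : ℤ} (hr : IsRootAt D v r)
    (hD : ¬ (resChar v : ℤ) ∣ D) : ¬ (resChar v : ℤ) ∣ 2 * r - cB D := fun h => hD (by
  rw [disc_eq_sq_sub D r]
  exact dvd_sub (dvd_pow h two_ne_zero) (hr.1.mul_left 4))

theorem kron_resChar {v : Pl} {r : ℤ} (hr : IsRootAt D v r) (hD : ¬ (resChar v : ℤ) ∣ D) :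
    kron D (resChar v) = 1 := by
  rw [kron_eq_kronAtPrime (ImagDisc.neg) (ImagDisc.isFundDisc (D := D)).mod_four (resChar_prime v),
    kronAtPrime_split hr.1 (not_dvd_of_not_dvd_disc hr hD)]

theorem exists_isRootAt_of_kron {v : Pl} (h : kron D (resChar v) = 1) : ∃ r, IsRootAt D v r := by
  rw [kron_eq_kronAtPrime (ImagDisc.neg) (ImagDisc.isFundDisc (D := D)).mod_four
    (resChar_prime v)] at h
  rcases exists_tor_part_cases (D := D) v with ⟨r, hr, -⟩ | ⟨r, hr, -⟩ | hin
  · exact ⟨r, hr⟩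
  · exact ⟨r, hr⟩
  · rw [kronAtPrime_inert hin] at h
    norm_num at h

theorem isCoprime_disc {v : Pl} (hD : ¬ (resChar v : ℤ) ∣ D) : IsCoprime (resChar v : ℤ) D :=
  (Nat.prime_iff_prime_int.1 (resChar_prime v)).coprime_iff_not_dvd.2 hD

/-- Characters of order two satisfy a reciprocity relation. -/
theorem exists_place_mul_eq_one {v w : Pl} {r s : ℤ} (hr : IsRootAt D v r) (hs : IsRootAt D w s)
    (hvw : v ≠ w) (hv : ¬ (resChar v : ℤ) ∣ D) (hw : ¬ (resChar w : ℤ) ∣ D) :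
    ∃ (u : Pl) (t : ℤ) (ht : IsRootAt D u t), ∀ γ : ClDual D, γ ^ 2 = 1 →
      ev γ (idCls (RingHom.ker (redAt hr))) * ev γ (idCls (RingHom.ker (redAt hs))) *
        ev γ (idCls (RingHom.ker (redAt ht))) = 1 := by
  have hneg : D < 0 := ImagDisc.neg
  have h4 := (ImagDisc.isFundDisc (D := D)).mod_four
  have : NeZero D.natAbs := ⟨by omega⟩
  have hcop : ∀ {v : Pl}, ¬ (resChar v : ℤ) ∣ D → (resChar v).Coprime D.natAbs := fun h =>
    Int.isCoprime_iff_gcd_eq_one.1 (isCoprime_disc h)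
  have hu : IsUnit ((resChar v * resChar w : ℕ) : ZMod D.natAbs) :=
    (ZMod.isUnit_iff_coprime _ _).2 ((hcop hv).mul_left (hcop hw))
  -- Dirichlet's theorem: a prime congruent to the product modulo `|D|`, taken large so as to differ
  -- from both primes and not to divide `D`. Multiplicativity of the Kronecker symbol then makes it
  -- split.
  obtain ⟨l, hlt, hl, hmod⟩ := Nat.forall_exists_prime_gt_and_eq_mod hu
    (resChar v + resChar w + D.natAbs)
  obtain ⟨u, rfl⟩ := exists_place hl
  have hmod' := (ZMod.natCast_eq_natCast_iff' _ _ _).1 hmod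
  have hk : kron D (resChar u) = 1 := by
    rw [← kron_mod, hmod', kron_mod, kron_mul, kron_resChar hr hv, kron_resChar hs hw, one_mul]
  obtain ⟨t, ht⟩ := exists_isRootAt_of_kron hk
  have hdvd : D ∣ (resChar v : ℤ) * resChar w - resChar u := by
    rw [← Int.natAbs_dvd]
    have := (ZMod.natCast_eq_natCast_iff _ _ _).1 hmod
    have := Nat.modEq_iff_dvd.1 this
    push_cast at this ⊢
    exact this
  have huD : ¬ (resChar u : ℤ) ∣ D := fun h => by
    have := Nat.le_of_dvd (by omega) (Int.natCast_dvd.1 h)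
    omega
  have hd : D = -((D.natAbs : ℕ) : ℤ) := by omega
  obtain ⟨x, y, z, z', hxy, hz⟩ := exists_norm_form_eq hd (by omega) (resChar_prime v)
    (resChar_prime w) hl (fun h => hvw (resChar_injective h)) (by omega) (by omega)
    (isCoprime_disc hv) (isCoprime_disc hw) (isCoprime_disc huD) hdvd (dvd_sq_sub hr)
    (dvd_sq_sub hs) (dvd_sq_sub ht)
  refine ⟨u, t, ht, fun γ hγ => ?_⟩
  set a : OE D := ⟨x - cB D * y, 2 * y⟩ with ha
  set b : OE D := ⟨z - cB D * z', 2 * z'⟩ with hb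
  have hna : a.norm = (resChar v * resChar w * resChar u : ℤ) * b.norm := by
    rw [ha, hb, norm_sqD, norm_sqD, hxy]
  have hb0 : b ≠ 0 := fun h => by
    have := norm_sqD (D := D) z z'
    rw [← hb, h, QuadraticAlgebra.norm_zero] at this
    omega
  have ha0 : a ≠ 0 := fun h => by
    rw [h, QuadraticAlgebra.norm_zero] at hna
    have h1 := (resChar_prime v).ne_zero
    have h2 := (resChar_prime w).ne_zero
    have h3 := (resChar_prime u).ne_zero
    have h4 := norm_OE_ne_zero hb0
    have : (resChar v * resChar w * resChar u : ℤ) * b.norm ≠ 0 := by positivity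
    exact this hna.symm
  have hI := ideal_mul_ne_bot (ideal_mul_ne_bot (ker_redAt_ne_bot hr) (ker_redAt_ne_bot hs))
    (ker_redAt_ne_bot ht)
  have hB := span_singleton_ne_bot hb0
  -- The principal ideal `(a)` has the same norm as the product of the three primes with `(b)`, and
  -- principal ideals have trivial class.
  have := ev_idCls_eq_of_absNorm_eq hγ (span_singleton_ne_bot ha0) (ideal_mul_ne_bot hI hB) (by
    rw [map_mul, map_mul, map_mul, absNorm_ker_redAt, absNorm_ker_redAt, absNorm_ker_redAt]
    zify
    rw [absNorm_span_OE, absNorm_span_OE, hna])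
  rw [idCls_span ha0, idCls_mul hI hB, idCls_span hb0, cls_mul_one,
    idCls_mul (ideal_mul_ne_bot (ker_redAt_ne_bot hr) (ker_redAt_ne_bot hs)) (ker_redAt_ne_bot ht),
    idCls_mul (ker_redAt_ne_bot hr) (ker_redAt_ne_bot hs), ev_one, ev_mul, ev_mul] at this
  exact this.symm

theorem re_mul_self (z : ℂ) (hz : ‖z‖ = 1) : (z * z).re = 2 * z.re ^ 2 - 1 := by
  have h : z.re * z.re + z.im * z.im = 1 := by
    rw [← Complex.normSq_apply, Complex.normSq_eq_norm_sq, hz, one_pow]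
  rw [Complex.mul_re]
  linarith

/-- If at each prime `α` or `β` were trivial, the combination `4/9 Re α + 2/9 Re α² + 1/2 Re β`
would be at least `1/6` everywhere. When `α = 1` this is `4/9 + 2/9 - 1/2`; when `β = 1` it is the
minimum of a quadratic in `Re α`, attained at `-1/2`. -/
theorem exists_prime_of_sq_ne_one {α β : ClDual D} (hα : α ^ 2 ≠ 1) (hβ : β ≠ 1) :
    ∃ P : HeightOneSpectrum (OE D), ev α (idCls P.asIdeal) ≠ 1 ∧ ev β (idCls P.asIdeal) ≠ 1 := by
  by_contra! hc
  have hα1 : α ≠ 1 := fun h => hα (by rw [hom_sq, h]; exact one_mul (1 : ClDual D))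
  refine not_forall_prime_le (Finset.univ : Finset (Fin 3)) ![α, α * α, β]
    ![(4 / 9 : ℝ), 2 / 9, 1 / 2] (fun i _ => ?_) (fun i _ => ?_) (c := 1 / 6) (by norm_num) ∅
    Set.finite_empty fun P _ => ?_
  · fin_cases i <;> norm_num
  · fin_cases i
    · exact hα1
    · exact (hom_sq α) ▸ hα
    · exact hβ
  · rw [Fin.sum_univ_three]
    change (1 / 6 : ℝ) ≤ 4 / 9 * (ev α (idCls P.asIdeal)).re +
      2 / 9 * (ev (α * α) (idCls P.asIdeal)).re + 1 / 2 * (ev β (idCls P.asIdeal)).re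
    rw [ev_mul_char, re_mul_self _ (norm_ev _ _)]
    have hb := Complex.abs_re_le_norm (ev β (idCls P.asIdeal))
    rw [norm_ev] at hb
    have hb' := (abs_le.1 hb).1
    by_cases h : ev α (idCls P.asIdeal) = 1
    · rw [h, Complex.one_re]
      linarith
    · rw [hc P h, Complex.one_re]
      nlinarith [sq_nonneg ((ev α (idCls P.asIdeal)).re + 1 / 2)]

/-- Inert primes have trivial class, so a nontrivial value can only occur at the listed primes; the
finitely many divisors of `D` may be discarded in the density argument. -/
theorem exists_place_ev_ne_one {γ : ClDual D} (h1 : γ ≠ 1) :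
    ∃ (v : Pl) (r : ℤ) (hr : IsRootAt D v r), ¬ (resChar v : ℤ) ∣ D ∧
      ev γ (idCls (RingHom.ker (redAt hr))) ≠ 1 := by
  by_contra! hc
  have hD0 : (D : OE D) ≠ 0 := fun h => ImagDisc.ne_zero D (by
    have := congrArg QuadraticAlgebra.re h
    rwa [QuadraticAlgebra.re_intCast, QuadraticAlgebra.re_zero] at this)
  refine not_forall_prime_le {()} (fun _ => γ) (fun _ => 1) (fun _ _ => zero_le_one)
    (fun _ _ => h1) one_pos {P | P.asIdeal ∣ Ideal.span {(D : OE D)}}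
    (Ideal.finite_factors (span_singleton_ne_bot hD0)) fun P hP => ?_
  rw [Finset.sum_singleton, one_mul]
  rcases isPrime_cases P.isPrime P.ne_bot with ⟨v, r, hr, e⟩ | ⟨v, -, e⟩
  · rw [e, hc v r hr, Complex.one_re]
    intro hd
    refine hP ?_
    rw [Set.mem_ofPred_eq, Ideal.dvd_span_singleton, e, mem_ker_redAt, QuadraticAlgebra.re_intCast,
      QuadraticAlgebra.im_intCast, mul_zero, add_zero]
    exact hd
  · rw [e, idCls_ker_redInert, ev_one, Complex.one_re]

/-- Two nontrivial characters of the class group are simultaneously nontrivial on some prime. -/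
theorem exists_prime_ev_ne_one {α β : ClDual D} (hα : α ≠ 1) (hβ : β ≠ 1) :
    ∃ P : HeightOneSpectrum (OE D), ev α (idCls P.asIdeal) ≠ 1 ∧ ev β (idCls P.asIdeal) ≠ 1 := by
  by_cases hα2 : α ^ 2 = 1
  swap
  · exact exists_prime_of_sq_ne_one hα2 hβ
  by_cases hβ2 : β ^ 2 = 1
  swap
  · obtain ⟨P, h1, h2⟩ := exists_prime_of_sq_ne_one hβ2 hα
    exact ⟨P, h2, h1⟩
  by_contra! hc
  have hc' : ∀ {v : Pl} {r : ℤ} (hr : IsRootAt D v r),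
      ev α (idCls (RingHom.ker (redAt hr))) ≠ 1 → ev β (idCls (RingHom.ker (redAt hr))) = 1 :=
    fun hr => hc ⟨_, (ker_redAt_isMaximal hr).isPrime, ker_redAt_ne_bot hr⟩
  obtain ⟨v, r, hr, hv, h1⟩ := exists_place_ev_ne_one hα
  obtain ⟨w, s, hs, hw, h2⟩ := exists_place_ev_ne_one hβ
  have h1' := hc' hr h1
  have h2' : ev α (idCls (RingHom.ker (redAt hs))) = 1 := by
    by_contra h
    exact h2 (hc' hs h)
  have hvw : v ≠ w := by
    rintro rfl
    rw [idCls_ker_redAt, ev_locCls_piU_eq hα2 hr hs, ← idCls_ker_redAt hs] at h1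
    exact h1 h2'
  -- Each character is trivial at the prime chosen for the other one. Reciprocity makes both of them
  -- nontrivial at the third prime.
  obtain ⟨u, t, ht, h⟩ := exists_place_mul_eq_one hr hs hvw hv hw
  have h3 := h α hα2
  have h4 := h β hβ2
  rw [h2', mul_one] at h3
  rw [h1', one_mul] at h4
  refine h2 ?_
  rw [hc' ht, mul_one] at h4
  · exact h4
  · intro h5
    rw [h5, mul_one] at h3
    exact h1 h3

end separation

/-! ### Separation of eigenvectors and the classification of submodules -/

section multiplicityOne

/-- A nonzero combination of simultaneous eigenvectors which are separated by their eigenvalues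
generates one of the eigenvectors. -/
theorem exists_mem_of_separating {ι V : Type*} [AddCommGroup V] [Module ℂ V] (W : Submodule ℂ V)
    (x : ι → V) (hsep : ∀ i j, i ≠ j → ∃ (T : V →ₗ[ℂ] V) (l : ι → ℂ), (∀ w ∈ W, T w ∈ W) ∧
      (∀ k, T (x k) = l k • x k) ∧ l i ≠ l j) (S : Finset ι) :
    ∀ a : ι → ℂ, S.Nonempty → (∀ i ∈ S, a i ≠ 0) → ∑ i ∈ S, a i • x i ∈ W → ∃ i ∈ S, x i ∈ W := by
  classical
  induction S using Finset.strongInduction with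
  | H S ih =>
    intro a hS ha hmem
    obtain ⟨i, hi⟩ := hS
    by_cases h1 : ∃ j ∈ S, j ≠ i
    · obtain ⟨j, hj, hji⟩ := h1
      obtain ⟨T, l, hT, hl, hne⟩ := hsep j i hji
      -- The operator `T - l i` preserves `W`, kills the term of `i` and keeps that of `j`, so a
      -- shorter nonzero combination lies in `W`.
      have hsub : S.filter (fun k => l k ≠ l i) ⊂ S :=
        (Finset.filter_ssubset).2 ⟨i, hi, fun h => h rfl⟩
      obtain ⟨k, hk, hkW⟩ := ih _ hsub (fun k => a k * (l k - l i))
        ⟨j, Finset.mem_filter.2 ⟨hj, hne⟩⟩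
        (fun k hk => mul_ne_zero (ha k (Finset.mem_filter.1 hk).1)
          (sub_ne_zero.2 (Finset.mem_filter.1 hk).2)) (by
          have h2 := W.sub_mem (hT _ hmem) (W.smul_mem (l i) hmem)
          rw [map_sum, Finset.smul_sum, ← Finset.sum_sub_distrib] at h2
          rw [Finset.sum_filter]
          convert h2 using 2 with k hk
          rw [map_smul, hl]
          split_ifs with h
          · module
          · rw [not_not.1 h, smul_comm, sub_self])
      exact ⟨k, (Finset.mem_filter.1 hk).1, hkW⟩
    · push Not at h1
      have hS' : S = {i} := Finset.eq_singleton_iff_unique_mem.2 ⟨hi, h1⟩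
      rw [hS', Finset.sum_singleton] at hmem
      exact ⟨i, hi, (W.smul_mem_iff (ha i hi)).1 hmem⟩

variable {D : ℤ} [ImagDisc D]

/-- Equality of `z + z⁻¹` for the two characters at `P` means that `χψ⁻¹` or `χψ` is trivial there;
both are nontrivial characters, so some prime avoids this. -/
theorem exists_place_add_inv_ne {χ ψ : ClDual D} (h1 : ψ ≠ χ) (h2 : ψ ≠ χ⁻¹) :
    ∃ (v : Pl) (t : (QA D (Qv v))ˣ), ev χ (locCls v t) + (ev χ (locCls v t))⁻¹ ≠
      ev ψ (locCls v t) + (ev ψ (locCls v t))⁻¹ := by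
  obtain ⟨P, hα, hβ⟩ := exists_prime_ev_ne_one (D := D) (fun h => h1 (hom_eq_of_mul_inv h))
    (fun h => h2 (hom_eq_inv h))
  rcases isPrime_cases P.isPrime P.ne_bot with ⟨v, r, hr, e⟩ | ⟨v, -, e⟩
  · refine ⟨v, piU D r (Qv v), fun h => ?_⟩
    rw [e, idCls_ker_redAt] at hα hβ
    rw [ev_mul_char, ev_inv_char] at hα
    rw [ev_mul_char] at hβ
    have hne := ev_ne_zero ψ (locCls v (piU D r (Qv v)))
    rcases (add_inv_eq_iff (ev_ne_zero _ _) hne).1 h with h | h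
    · exact hα (by rw [h, mul_inv_cancel₀ hne])
    · exact hβ (by rw [h, inv_mul_cancel₀ hne])
  · rw [e, idCls_ker_redInert, ev_one] at hα
    exact absurd rfl hα

/-- A spherical vector expands in the basis `f_χ`. The local operators given by a translate plus its
inverse preserve `W` and separate the basis vectors, so one of them lies in `W`. -/
theorem exists_fChi_mem {W : Submodule ℂ (GA D → ℂ)} (hW : IsStable W) (hV : W ≤ autV D)
    (h : fixK W ≠ ⊥) : ∃ χ : ClDual D, fChi χ ∈ W := by
  obtain ⟨f, hf, hf0⟩ := Submodule.exists_mem_ne_zero_of_ne_bot h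
  obtain ⟨B, hB⟩ := exists_basis (D := D)
  have hBo : ∀ q : ClDualGal D, (B q : GA D → ℂ) = fChi q.out := fun q => by
    rw [← hB, Quotient.out_eq]
  set y : fixK (autV D) := ⟨f, hV hf.1, hf.2⟩ with hy
  have hsum : ∑ q ∈ (B.repr y).support, B.repr y q • fChi (Quotient.out q) = f := by
    have h1 := congrArg (Submodule.subtype _) (B.linearCombination_repr y)
    rw [Finsupp.linearCombination_apply, Finsupp.sum, map_sum] at h1
    rw [show f = Submodule.subtype _ y from rfl, ← h1]
    exact Finset.sum_congr rfl fun q _ => by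
      rw [map_smul, Submodule.subtype_apply, hBo]
  have hne : (B.repr y).support.Nonempty := by
    rw [Finsupp.support_nonempty_iff]
    intro h0
    refine hf0 ?_
    rw [← hsum, h0]
    exact Finset.sum_empty
  obtain ⟨q, -, hq⟩ := exists_mem_of_separating W (fun q : ClDualGal D => fChi q.out) (fun i j hij => by
    have hg : ¬ (j.out = i.out ∨ j.out = i.out⁻¹) := fun h => hij (by
      rw [← Quotient.out_eq i, ← Quotient.out_eq j]
      exact gal_iff.2 h)
    rw [not_or] at hg
    obtain ⟨v, t, ht⟩ := exists_place_add_inv_ne hg.1 hg.2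
    exact ⟨rTrans (tor (locIdele v t)) + rTrans (tor (locIdele v t))⁻¹, _,
      fun w hw => W.add_mem (hW _ _ hw) (hW _ _ hw),
      fun k => rTrans_add_rTrans_inv_fChi k.out t, ht⟩) _ _ hne
    (fun q hq => Finsupp.mem_support_iff.1 hq) (hsum.symm ▸ hf.1)
  exact ⟨_, hq⟩

theorem genU_congr {χ ψ : ClDual D} (h : fChi χ = fChi ψ) : genU χ = genU ψ := by
  rw [genU, genU, h]

theorem fixK_genU_ne_bot (χ : ClDual D) : fixK (genU χ) ≠ ⊥ := fun h => fChi_ne_zero χ (by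
  have := fChi_mem_fixK_genU χ
  rwa [h, Submodule.mem_bot] at this)

theorem fChi_eq_of_genU_eq {χ ψ : ClDual D} (h : genU χ = genU ψ) : fChi χ = fChi ψ := by
  have h1 := fChi_mem_fixK_genU χ
  rw [h, fixK_genU, Submodule.mem_span_singleton] at h1
  obtain ⟨a, ha⟩ := h1
  have h2 := congrFun ha (1, tor 1)
  rw [Pi.smul_apply, fChi_apply, fChi_apply, cls_tor] at h2
  have h3 : a * symF ψ 1 = symF χ 1 := h2
  rw [symF_one, symF_one, mul_one] at h3
  rw [← ha, h3, one_smul]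

theorem exists_equiv_sphIrred (hirr : ∀ χ : ClDual D, IsIrred (genU χ)) :
    ∃ e : ClDualGal D ≃ SphIrred D,
      ∀ χ : ClDual D, (e (Quotient.mk (galSetoid D) χ)).1 = genU χ := by
  let F : ClDualGal D → SphIrred D := fun q =>
    ⟨genU q.out, genU_le_autV _, hirr _, fixK_genU_ne_bot _⟩
  refine ⟨Equiv.ofBijective F ⟨fun q q' h => ?_, fun W => ?_⟩, fun χ => genU_congr (fChi_out χ)⟩
  · have h1 := fChi_eq_iff.1 (fChi_eq_of_genU_eq (congrArg Subtype.val h))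
    rw [← Quotient.out_eq q, ← Quotient.out_eq q']
    exact gal_iff.2 h1
  · obtain ⟨W, hV, hW, hne⟩ := W
    obtain ⟨χ, hχ⟩ := exists_fChi_mem hW.1 hV hne
    refine ⟨Quotient.mk (galSetoid D) χ, Subtype.ext ?_⟩
    change genU (Quotient.mk (galSetoid D) χ).out = W
    rw [genU_congr (fChi_out χ)]
    exact (hW.2.2 _ (isStable_genU χ) (genU_le_of_mem hW.1 hχ)).resolve_left
      (hirr χ).2.1

end multiplicityOne

end OTwo

end

theorem lemma2p7 (D : ℤ) (hD : IsFundDisc D) (hneg : D < 0)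
    (μR : Measure (GD D ℝ)) [μR.IsHaarMeasure] [IsProbabilityMeasure μR]
    (μf : Measure (GD D Af)) [μf.IsHaarMeasure] (hμf : μf (finKs D) = 1) :
    -- `f_χ` is well defined and lies in the space of `K`-invariant automorphic functions
    (∀ h : GD D Af, ∃ t, HasTorusPart h t) ∧
    (∀ (χ : ClDual D) (h : GA D) (t : (AE D)ˣ), HasTorusPart h.2 t →
      fChi χ h = (1 / 2 : ℂ) * (chi χ t + chi χ (conjIdele D t))) ∧
    (∀ χ : ClDual D, fChi χ ∈ fixK (autV D)) ∧
    -- it is a joint Hecke eigenfunction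
    (∀ χ : ClDual D, ∀ φ ∈ heckeSet D, ∃ c : ℂ, heckeAct μf φ (fChi χ) = c • fChi χ) ∧
    -- basis
    (∃ B : Module.Basis (ClDualGal D) ℂ (fixK (autV D)),
      ∀ χ : ClDual D, (B (Quotient.mk (galSetoid D) χ) : GA D → ℂ) = fChi χ) ∧
    -- orthogonality and norms in `L²(G(ℚ) \ G(𝔸))`
    (∃ F : Set (GA D), IsFundamentalDomain (ratPts D) F (μR.prod μf)) ∧
    (∀ F : Set (GA D), IsFundamentalDomain (ratPts D) F (μR.prod μf) →
      (∀ χ ψ : ClDual D,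
        Quotient.mk (galSetoid D) χ ≠ Quotient.mk (galSetoid D) ψ →
          ∫ h in F, fChi χ h * conj (fChi ψ h) ∂(μR.prod μf) = 0) ∧
      (∀ χ : ClDual D,
        (χ ^ 2 = 1 → ∫ h in F, ‖fChi χ h‖ ^ 2 ∂(μR.prod μf) =
          (classNo hD hneg : ℝ) / (2 * unitNo D) * (1 + 1)) ∧
        (χ ^ 2 ≠ 1 → ∫ h in F, ‖fChi χ h‖ ^ 2 ∂(μR.prod μf) =
          (classNo hD hneg : ℝ) / (2 * unitNo D)))) ∧
    -- the generated submodules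
    (∀ χ : ClDual D, genU χ ≤ autV D ∧ IsIrred (genU χ) ∧
      fixK (genU χ) = Submodule.span ℂ {fChi χ}) ∧
    (∃ e : ClDualGal D ≃ SphIrred D,
      ∀ χ : ClDual D, (e (Quotient.mk (galSetoid D) χ)).1 = genU χ) ∧
    -- their `L`-functions
    (∀ (χ : ClDual D) (v : Pl) (s : ℂ), locL (genU χ) v s = locAI χ v s) ∧
    (∀ (χ : ClDual D) (s : ℂ), 1 < s.re →
      Multipliable (fun v => locL (genU χ) v s) ∧
      eulerProd (locL (genU χ)) s = eulerProd (locAI χ) s) ∧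
    (∀ (χ : ClDual D) (L : ℂ → ℂ), IsLFunction (locL (genU χ)) L ↔ IsLFunction (locAI χ) L) ∧
    (∃ η : DirichletCharacter ℂ D.natAbs,
      (∀ p : ℕ, p.Prime → η p = kronAtPrime D p) ∧
      IsLFunction (locL (genU (1 : ClDual D)))
        (fun s => riemannZeta s *
          @DirichletCharacter.LFunction D.natAbs ⟨Int.natAbs_ne_zero.2 hneg.ne⟩ η s)) := by
  have : ImagDisc D := ⟨hD, hneg⟩
  have hμ : μf (finKs D) ≠ ⊤ := by rw [hμf]; exact ENNReal.one_ne_top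
  have hcl : classNo hD hneg = Nat.card (ClD D) := card_classGroup
  have hL : ∀ χ : ClDual D, locL (genU χ) = locAI χ := fun χ =>
    funext fun v => funext fun s => locL_genU χ v s
  refine ⟨exists_hasTorusPart, fChi_of_hasTorusPart, fChi_mem, fun χ φ hφ => heckeAct_fChi μf χ hφ,
    exists_basis D, exists_fundamentalDomain _, fun F hF => ⟨fun χ ψ h => ?_, fun χ => ⟨fun h => ?_,
    fun h => ?_⟩⟩, fun χ => ⟨genU_le_autV χ, isIrred_genU μf hμ χ, fixK_genU χ⟩,
    exists_equiv_sphIrred (isIrred_genU μf hμ), locL_genU, fun χ s hs => ?_, fun χ L => ?_, ?_⟩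
  · rw [Ne, gal_iff, not_or] at h
    exact setIntegral_fChi_mul_conj μR μf hμf hF h.1 h.2
  · rw [setIntegral_norm_fChi μR μf hμf hF, if_pos h, hcl]
  · rw [setIntegral_norm_fChi μR μf hμf hF, if_neg h, hcl, add_zero, mul_one]
  · rw [hL]
    exact ⟨multipliable_locAI χ hs, rfl⟩
  · rw [hL]
  · obtain ⟨η, hη⟩ := exists_kronecker_character hneg
    have hη' : ∀ p : ℕ, p.Prime → η p = kronAtPrime D p := fun p hp => by
      rw [hη, kron_eq_kronAtPrime hneg hD.mod_four hp]
    have : NeZero D.natAbs := ⟨Int.natAbs_ne_zero.2 hneg.ne⟩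
    refine ⟨η, hη', ?_⟩
    rw [hL]
    exact isLFunction_locAI_one η hη'
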